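/- Let $(M,g)$ be a three-dimensional spacetime: a connected (Hausdorff) smooth three-manifold with a smooth Lorentzian metric $g$ of signature $(+,+,-)$ and a time orientation given by a smooth timelike vector field. Let $C^+\subset TM$ be the bundle of future null vectors (nonzero $v$ with $g(v,v)=0$ in the future hemicone), and let $\pi:\mathcal PC\to M$ be the smooth circle bundle of null lines: a point of the four-manifold $\mathcal PC$ is a pair $(x,l)$ with $l\subset T_xM$ a null line. Let $\mathcal D_{(x,l)}=(T_{(x,l)}\pi)^{-1}(l)$ be the Engel structure of the Lorentz prolongation, $\mathcal E=[\mathcal D,\mathcal D]$ the distribution spanned by the sections of $\mathcal D$ and their Lie brackets, and $\mathcal W\subset\mathcal E$ the Engel kernel, i.e. the distribution spanned by the local sections $X$ of $\mathcal E$ such that $[X,\mathcal E]\subseteq\mathcal E$. Let $$\mathcal N=\{\gamma(I) : \gamma:I\to M\ \text{a maximal geodesic with}\ \dot\gamma\in C^+\}$$ be the space of null geodesics, with the quotient topology from the map that sends $v\in C^+$ to the null geodesic tangent to $v$, and let $\mathcal PC/\mathcal W$ be the space of leaves of $\mathcal W$ with the quotient topology. Then: 1. $\mathcal W$ is tangent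 to the projectivized geodesic spray: for every future null geodesic $\gamma:I\to M$, the curve $t\mapsto(\gamma(t),\langle\dot\gamma(t)\rangle)$ in $\mathcal PC$ is differentiable and its velocity spans $\mathcal W$ at each of its points. 2. $\mathcal N\cong\mathcal PC/\mathcal W$: there is a homeomorphism $\mathcal PC/\mathcal W\to\mathcal N$ that sends the leaf through $(x,l)$ to the null geodesic through $x$ tangent to $l$. 3. Let $p:\mathcal PC\to\mathcal PC/\mathcal W\cong\mathcal N$ be the resulting projection. Suppose that $\mathcal N$ is a manifold (it carries a smooth three-manifold structure compatible with its topology) and $p$ is a submersion. Then the canonical contact structure $\mathcal H$ of $\mathcal N$ is well defined and $\mathcal H=p_*\mathcal E$, that is, $\mathcal H_{p(u)}=T_up(\mathcal E_u)$ for every $u\in\mathcal PC$. Here $\mathcal H$ is the distribution on $\mathcal N$ with $$\mathcal H_\gamma=T_\gamma\mathfrak S_x\oplus T_\gamma\mathfrak S_y$$ for any two points $x,y\in\gamma$ that are not conjugate along $\gamma$ (no nonzero Jacobi field along $\gamma$ vanishes at both); every null geodesic $\gamma$ carries such a pair of points. The sky $\mathfrak S_x$ is the set of null geodesics through $x$,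 i.e. the image under $p$ of the fibre $\mathcal PC_x$, and $T_\gamma\mathfrak S_x=T_up(\ker T_u\pi)$, where $u=(x,l)$ and $l$ is the tangent line of $\gamma$ at $x$. -/

import Mathlib

open Set Bundle Manifold
open scoped ContDiff Topology

noncomputable section

namespace LorentzEngel

/-- The model space of a three-dimensional manifold. -/
abbrev E3 : Type := EuclideanSpace ℝ (Fin 3)

section Metric

variable (M : Type*) [TopologicalSpace M] [ChartedSpace E3 M] [IsManifold 𝓘(ℝ, E3) ∞ M]

/-- A smooth Lorentzian metric (signature `(+,+,-)`) on a three-manifold. -/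
structure LorentzMetric where
  val : ∀ x : M, TangentSpace 𝓘(ℝ, E3) x →L[ℝ] TangentSpace 𝓘(ℝ, E3) x →L[ℝ] ℝ
  symm : ∀ (x : M) (v w : TangentSpace 𝓘(ℝ, E3) x), val x v w = val x w v
  signature : ∀ x : M, ∃ V Y T : TangentSpace 𝓘(ℝ, E3) x,
    val x V V = 1 ∧ val x Y Y = 1 ∧ val x T T = -1 ∧
      val x V Y = 0 ∧ val x V T = 0 ∧ val x Y T = 0
  contMDiff : ContMDiff 𝓘(ℝ, E3) (𝓘(ℝ, E3).prod 𝓘(ℝ, E3 →L[ℝ] E3 →L[ℝ] ℝ)) ∞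
    (fun x => TotalSpace.mk' (E3 →L[ℝ] E3 →L[ℝ] ℝ)
      (E := fun x : M => TangentSpace 𝓘(ℝ, E3) x →L[ℝ] TangentSpace 𝓘(ℝ, E3) x →L[ℝ] ℝ)
      x (val x))

end Metric

variable {M : Type*} [TopologicalSpace M] [ChartedSpace E3 M] [IsManifold 𝓘(ℝ, E3) ∞ M]

/-- `X` is a smooth vector field on the set `U`. -/
def SmoothFieldOn (X : ∀ x : M, TangentSpace 𝓘(ℝ, E3) x) (U : Set M) : Prop :=
  ContMDiffOn 𝓘(ℝ, E3) 𝓘(ℝ, E3).tangent ∞ (fun x => (⟨x, X x⟩ : TangentBundle 𝓘(ℝ, E3) M)) U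

/-- A smooth orthonormal frame `(V, Y, T)` over an open set, `V` and `Y` spacelike, `T` timelike. -/
structure Frame (g : LorentzMetric M) where
  dom : Set M
  V : ∀ x : M, TangentSpace 𝓘(ℝ, E3) x
  Y : ∀ x : M, TangentSpace 𝓘(ℝ, E3) x
  T : ∀ x : M, TangentSpace 𝓘(ℝ, E3) x
  isOpen_dom : IsOpen dom
  smooth_V : SmoothFieldOn V dom
  smooth_Y : SmoothFieldOn Y dom
  smooth_T : SmoothFieldOn T dom
  VV : ∀ x ∈ dom, g.val x (V x) (V x) = 1
  YY : ∀ x ∈ dom, g.val x (Y x) (Y x) = 1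
  TT : ∀ x ∈ dom, g.val x (T x) (T x) = -1
  VY : ∀ x ∈ dom, g.val x (V x) (Y x) = 0
  VT : ∀ x ∈ dom, g.val x (V x) (T x) = 0
  YT : ∀ x ∈ dom, g.val x (Y x) (T x) = 0

namespace LorentzMetric

variable (g : LorentzMetric M)

lemma smooth_apply {X Z : ∀ x : M, TangentSpace 𝓘(ℝ, E3) x} {U : Set M}
    (hX : SmoothFieldOn X U) (hZ : SmoothFieldOn Z U) :
    ContMDiffOn 𝓘(ℝ, E3) 𝓘(ℝ, ℝ) ∞ (fun x => g.val x (X x) (Z x)) U := by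
  intro x hx
  have h : ContMDiffWithinAt 𝓘(ℝ, E3) (𝓘(ℝ, E3).prod 𝓘(ℝ, ℝ)) ∞
      (fun m ↦ TotalSpace.mk' ℝ (E := Bundle.Trivial M ℝ) m (g.val m (X m) (Z m))) U x := by
    apply ContMDiffWithinAt.clm_bundle_apply₂ (F₁ := E3) (F₂ := E3) (b := id)
    · exact g.contMDiff.contMDiffAt.contMDiffWithinAt
    · exact hX x hx
    · exact hZ x hx
  simp only [contMDiffWithinAt_totalSpace] at h
  exact h.2

/-- Expansion of a vector in an orthonormal basis. -/
lemma expand (x : M) {V Y T : TangentSpace 𝓘(ℝ, E3) x}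
    (hVV : g.val x V V = 1) (hYY : g.val x Y Y = 1) (hTT : g.val x T T = -1)
    (hVY : g.val x V Y = 0) (hVT : g.val x V T = 0) (hYT : g.val x Y T = 0)
    (v : TangentSpace 𝓘(ℝ, E3) x) :
    v = g.val x v V • V + g.val x v Y • Y - g.val x v T • T := by
  have hYV := (g.symm x Y V).trans hVY
  have hTV := (g.symm x T V).trans hVT
  have hTY := (g.symm x T Y).trans hYT
  have key : ∀ a b c : ℝ, g.val x (a • V + b • Y + c • T) V = a ∧
      g.val x (a • V + b • Y + c • T) Y = b ∧ g.val x (a • V + b • Y + c • T) T = -c := by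
    intro a b c
    simp [hVV, hYY, hTT, hVY, hVT, hYT, hYV, hTV, hTY]
  let B : Fin 3 → TangentSpace 𝓘(ℝ, E3) x := ![V, Y, T]
  have hli : LinearIndependent ℝ B := by
    rw [Fintype.linearIndependent_iff]
    intro c hc
    have h0 : c 0 • V + c 1 • Y + c 2 • T = 0 := by
      simpa [B, Fin.sum_univ_three] using hc
    have h1 := key (c 0) (c 1) (c 2)
    rw [h0] at h1
    simp only [map_zero, zero_apply] at h1
    intro i
    fin_cases i
    · exact h1.1.symm
    · exact h1.2.1.symm
    · simpa using h1.2.2.symm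
  have hcard : Fintype.card (Fin 3) = Module.finrank ℝ (TangentSpace 𝓘(ℝ, E3) x) := by
    show _ = Module.finrank ℝ E3
    simp
  have : FiniteDimensional ℝ (TangentSpace 𝓘(ℝ, E3) x) :=
    inferInstanceAs (FiniteDimensional ℝ E3)
  have hspan := hli.span_eq_top_of_card_eq_finrank' hcard
  have hv : v ∈ Submodule.span ℝ (Set.range B) := hspan ▸ Submodule.mem_top
  rw [Submodule.mem_span_range_iff_exists_fun] at hv
  obtain ⟨c, hc⟩ := hv
  have h0 : c 0 • V + c 1 • Y + c 2 • T = v := by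
    simpa [B, Fin.sum_univ_three] using hc
  obtain ⟨k1, k2, k3⟩ := key (c 0) (c 1) (c 2)
  rw [h0] at k1 k2 k3
  rw [k1, k2, k3, ← h0]
  module

end LorentzMetric

lemma SmoothFieldOn.mono {X : ∀ x : M, TangentSpace 𝓘(ℝ, E3) x} {U U' : Set M}
    (h : SmoothFieldOn X U) (hU : U' ⊆ U) : SmoothFieldOn X U' := ContMDiffOn.mono h hU

lemma SmoothFieldOn.add {X Z : ∀ x : M, TangentSpace 𝓘(ℝ, E3) x} {U : Set M}
    (hX : SmoothFieldOn X U) (hZ : SmoothFieldOn Z U) :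
    SmoothFieldOn (fun x => X x + Z x) U := ContMDiffOn.add_section hX hZ

lemma SmoothFieldOn.smul {X : ∀ x : M, TangentSpace 𝓘(ℝ, E3) x} {U : Set M} {f : M → ℝ}
    (hf : ContMDiffOn 𝓘(ℝ, E3) 𝓘(ℝ, ℝ) ∞ f U) (hX : SmoothFieldOn X U) :
    SmoothFieldOn (fun x => f x • X x) U := ContMDiffOn.smul_section hf hX

/-- Normalising a smooth field `X` with `ε g(X, X) > 0`. -/
lemma exists_normalize (g : LorentzMetric M) (ε : ℝ) (hε : ε * ε = 1)
    {X : ∀ x : M, TangentSpace 𝓘(ℝ, E3) x} {U : Set M} (hU : IsOpen U)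
    (hX : SmoothFieldOn X U) {x₀ : M} (hx₀ : x₀ ∈ U)
    (h1 : g.val x₀ (X x₀) (X x₀) = ε) :
    ∃ (U' : Set M) (f : M → ℝ), IsOpen U' ∧ U' ⊆ U ∧ x₀ ∈ U' ∧ f x₀ = 1 ∧
      SmoothFieldOn (fun x => f x • X x) U' ∧
      ∀ x ∈ U', g.val x (f x • X x) (f x • X x) = ε := by
  have hs := g.smooth_apply hX hX
  let q : M → ℝ := fun x => ε * g.val x (X x) (X x)
  have hq : ContMDiffOn 𝓘(ℝ, E3) 𝓘(ℝ, ℝ) ∞ q U :=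
    ContMDiffOn.mul contMDiffOn_const hs
  have hq0 : q x₀ = 1 := by simp only [q]; rw [h1, hε]
  let U' := U ∩ q ⁻¹' (Ioi 0)
  refine ⟨U', fun x => (Real.sqrt (q x))⁻¹, hq.continuousOn.isOpen_inter_preimage hU isOpen_Ioi,
    inter_subset_left, ⟨hx₀, by simp [hq0]⟩, by simp [hq0], ?_, ?_⟩
  · refine SmoothFieldOn.smul ?_ (hX.mono inter_subset_left)
    intro x hx
    have h3 : ContDiffAt ℝ ∞ (fun y : ℝ => (Real.sqrt y)⁻¹) (q x) := by
      have hpos : 0 < q x := hx.2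
      exact (Real.contDiffAt_sqrt hpos.ne').inv (Real.sqrt_pos.2 hpos).ne'
    exact h3.contMDiffAt.comp_contMDiffWithinAt x ((hq x hx.1).mono inter_subset_left)
  · intro x hx
    have hpos : 0 < q x := hx.2
    simp only [map_smul, smul_apply, smul_eq_mul]
    have h2 : Real.sqrt (q x) * Real.sqrt (q x) = q x := Real.mul_self_sqrt hpos.le
    have h3 : (Real.sqrt (q x))⁻¹ * (Real.sqrt (q x))⁻¹ * q x = 1 := by
      rw [← mul_inv, h2, inv_mul_cancel₀ hpos.ne']
    have h4 : g.val x (X x) (X x) = ε * q x := by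
      simp only [q]; rw [← mul_assoc, hε, one_mul]
    rw [h4]
    linear_combination ε * h3

/-- Every point lies in the domain of a frame (Gram–Schmidt). -/
lemma exists_frame (g : LorentzMetric M) (x₀ : M) : ∃ F : Frame g, x₀ ∈ F.dom := by
  obtain ⟨V₀, Y₀, T₀, hVV, hYY, hTT, hVY, hVT, hYT⟩ := g.signature x₀
  have hYV := (g.symm x₀ Y₀ V₀).trans hVY
  have hTV := (g.symm x₀ T₀ V₀).trans hVT
  have hTY := (g.symm x₀ T₀ Y₀).trans hYT
  have ext : ∀ v : TangentSpace 𝓘(ℝ, E3) x₀, ∃ (U : Set M)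
      (X : ∀ x : M, TangentSpace 𝓘(ℝ, E3) x), IsOpen U ∧ x₀ ∈ U ∧ X x₀ = v ∧
        SmoothFieldOn X U := by
    intro v
    obtain ⟨s, hs, h⟩ := FiberBundle.exists_contMDiffOn_extend (k := ∞) 𝓘(ℝ, E3) E3 v
    obtain ⟨U, hUs, hU, hx⟩ := mem_nhds_iff.1 hs
    exact ⟨U, _, hU, hx, FiberBundle.extend_apply_self E3 v, ContMDiffOn.mono h hUs⟩
  obtain ⟨U1, X1, hU1, hx1, e1, s1⟩ := ext T₀
  obtain ⟨U2, X2, hU2, hx2, e2, s2⟩ := ext V₀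
  obtain ⟨U3, X3, hU3, hx3, e3, s3⟩ := ext Y₀
  obtain ⟨A, f, hA, hAU, hxA, hf, sT, nT⟩ := exists_normalize g (-1) (by norm_num) hU1 s1 hx1
    (by rw [e1, hTT])
  set T : ∀ x : M, TangentSpace 𝓘(ℝ, E3) x := fun x => f x • X1 x with hT
  have eT : T x₀ = T₀ := by simp [hT, hf, e1]
  have s2' : SmoothFieldOn (fun x => X2 x + g.val x (X2 x) (T x) • T x) (A ∩ U2) :=
    (s2.mono inter_subset_right).add ((sT.mono inter_subset_left).smul
      (g.smooth_apply (s2.mono inter_subset_right) (sT.mono inter_subset_left)))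
  obtain ⟨B, k, hB, hBU, hxB, hk, sV, nV⟩ := exists_normalize g 1 (by norm_num) (hA.inter hU2) s2'
    ⟨hxA, hx2⟩ (by simp [eT, e2, hVT, hVV])
  set V : ∀ x : M, TangentSpace 𝓘(ℝ, E3) x :=
    fun x => k x • (X2 x + g.val x (X2 x) (T x) • T x) with hV
  have eV : V x₀ = V₀ := by simp [hV, hk, e2, eT, hVT]
  have oVT : ∀ x ∈ B, g.val x (V x) (T x) = 0 := by
    intro x hx
    have h1 := nT x (hBU hx).1
    simp only [hV, map_smul, map_add, add_apply, smul_apply, smul_eq_mul]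
    rw [show g.val x (T x) (T x) = -1 from h1]
    ring
  have sTB : SmoothFieldOn T (B ∩ U3) := sT.mono fun x hx => (hBU hx.1).1
  have sVB : SmoothFieldOn V (B ∩ U3) := sV.mono inter_subset_left
  have s3B : SmoothFieldOn X3 (B ∩ U3) := s3.mono inter_subset_right
  have s3' : SmoothFieldOn (fun x => X3 x + g.val x (X3 x) (T x) • T x
      + (-1 * g.val x (X3 x) (V x)) • V x) (B ∩ U3) :=
    (s3B.add (sTB.smul (g.smooth_apply s3B sTB))).add
      (sVB.smul (contMDiffOn_const.mul (g.smooth_apply s3B sVB)))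
  obtain ⟨C, m, hC, hCU, hxC, hm, sY, nY⟩ := exists_normalize g 1 (by norm_num) (hB.inter hU3) s3'
    ⟨hxB, hx3⟩ (by simp [eT, eV, e3, hYT, hYV, hYY])
  set Y : ∀ x : M, TangentSpace 𝓘(ℝ, E3) x :=
    fun x => m x • (X3 x + g.val x (X3 x) (T x) • T x
      + (-1 * g.val x (X3 x) (V x)) • V x) with hY
  refine ⟨⟨C, V, Y, T, hC, sV.mono fun x hx => (hCU hx).1, sY,
    sT.mono fun x hx => (hBU (hCU hx).1).1, fun x hx => nV x (hCU hx).1, nY,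
    fun x hx => nT x (hBU (hCU hx).1).1, ?_, fun x hx => oVT x (hCU hx).1, ?_⟩, hxC⟩
  · intro x hx
    have h1 := nV x (hCU hx).1
    have h2 := oVT x (hCU hx).1
    simp only [hY, map_smul, map_add, smul_eq_mul]
    rw [show g.val x (V x) (V x) = 1 from h1, h2, g.symm x (V x) (X3 x)]
    ring
  · intro x hx
    have h1 := nT x (hBU (hCU hx).1).1
    have h2 := oVT x (hCU hx).1
    simp only [hY, map_smul, map_add, smul_apply, add_apply, smul_eq_mul]
    rw [h2, show g.val x (T x) (T x) = -1 from h1]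
    ring


/-- The projectivized null cone bundle `PC`: null lines in the tangent spaces of `M`. -/
structure PC (g : LorentzMetric M) where
  pt : M
  line : Projectivization ℝ (TangentSpace 𝓘(ℝ, E3) pt)
  null : ∀ v ∈ line.submodule, g.val pt v v = 0

variable {g : LorentzMetric M}

/-- The null line spanned by a nonzero null vector. -/
def PC.of (g : LorentzMetric M) (x : M) (v : TangentSpace 𝓘(ℝ, E3) x) (hv : v ≠ 0)
    (hnull : g.val x v v = 0) : PC g where
  pt := x
  line := Projectivization.mk ℝ v hv
  null := by
    intro w hw
    rw [Projectivization.submodule_mk, Submodule.mem_span_singleton] at hw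
    obtain ⟨a, rfl⟩ := hw
    simp [hnull]

lemma PC.of_congr {x : M} {v w : TangentSpace 𝓘(ℝ, E3) x} (hv : v ≠ 0) (hw : w ≠ 0)
    (hvn : g.val x v v = 0) (hwn : g.val x w w = 0) (a : ℝ) (h : a • w = v) :
    PC.of g x v hv hvn = PC.of g x w hw hwn := by
  unfold PC.of
  congr 1
  rw [Projectivization.mk_eq_mk_iff']
  exact ⟨a, h⟩

lemma PC.exists_of (u : PC g) : ∃ (x : M) (v : TangentSpace 𝓘(ℝ, E3) x) (hv : v ≠ 0)
    (hn : g.val x v v = 0), u = PC.of g x v hv hn := by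
  obtain ⟨x, l, hl⟩ := u
  refine ⟨x, l.rep, l.rep_nonzero, hl _ ?_, ?_⟩
  · rw [Projectivization.submodule_eq]
    exact Submodule.mem_span_singleton_self _
  · unfold PC.of
    congr 1
    exact (Projectivization.mk_rep l).symm

namespace Frame

variable (F : Frame g)

/-- Numerator and denominator of the affine fibre coordinate of a vector. -/
def num (x : M) (v : TangentSpace 𝓘(ℝ, E3) x) : ℝ := g.val x v (F.Y x)

def den (x : M) (v : TangentSpace 𝓘(ℝ, E3) x) : ℝ := g.val x v (F.V x) - g.val x v (F.T x)

/-- The affine coordinate on the circle of null lines: `tan (θ / 2)` at the line spanned by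
`cos θ V + sin θ Y + T`. -/
def coord (u : PC g) : ℝ := F.num u.pt u.line.rep / F.den u.pt u.line.rep

/-- The null vector with affine coordinate `s`, a positive multiple of `cos θ V + sin θ Y + T`
for `s = tan (θ / 2)`. -/
def vec (x : M) (s : ℝ) : TangentSpace 𝓘(ℝ, E3) x :=
  (1 - s ^ 2) • F.V x + (2 * s) • F.Y x + (1 + s ^ 2) • F.T x

lemma pair_vec (x : M) (s : ℝ) (w : TangentSpace 𝓘(ℝ, E3) x) :
    g.val x (F.vec x s) w = (1 - s ^ 2) * g.val x (F.V x) w + (2 * s) * g.val x (F.Y x) w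
      + (1 + s ^ 2) * g.val x (F.T x) w := by
  simp [vec]

lemma vec_null {x : M} (hx : x ∈ F.dom) (s : ℝ) : g.val x (F.vec x s) (F.vec x s) = 0 := by
  have e (w) : g.val x w (F.vec x s) = g.val x (F.vec x s) w := g.symm _ _ _
  rw [pair_vec, e, e, e, pair_vec, pair_vec, pair_vec, F.VV x hx, F.YY x hx, F.TT x hx, F.VT x hx,
    F.VY x hx, F.YT x hx, g.symm x (F.T x) (F.V x), g.symm x (F.T x) (F.Y x),
    g.symm x (F.Y x) (F.V x), F.VT x hx, F.VY x hx, F.YT x hx]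
  ring

lemma num_vec {x : M} (hx : x ∈ F.dom) (s : ℝ) : F.num x (F.vec x s) = 2 * s := by
  rw [num, pair_vec, F.YY x hx, F.VY x hx, g.symm x (F.T x) (F.Y x), F.YT x hx]
  ring

lemma den_vec {x : M} (hx : x ∈ F.dom) (s : ℝ) : F.den x (F.vec x s) = 2 := by
  rw [den, pair_vec, pair_vec, F.VV x hx, F.TT x hx, F.VT x hx, F.YT x hx,
    g.symm x (F.T x) (F.V x), g.symm x (F.Y x) (F.V x), F.VT x hx, F.VY x hx]
  ring

lemma vec_ne_zero {x : M} (hx : x ∈ F.dom) (s : ℝ) : F.vec x s ≠ 0 := by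
  intro h
  have := F.den_vec hx s
  rw [h] at this
  simp [den] at this

/-- The null line with affine coordinate `s` over `x`. -/
def lineAt (x : M) (hx : x ∈ F.dom) (s : ℝ) : PC g :=
  PC.of g x (F.vec x s) (F.vec_ne_zero hx s) (F.vec_null hx s)

lemma rep_of {x : M} {v : TangentSpace 𝓘(ℝ, E3) x} (hv : v ≠ 0) (hn : g.val x v v = 0) :
    ∃ a : ℝ, a ≠ 0 ∧ (PC.of g x v hv hn).line.rep = a • v := by
  obtain ⟨a, ha⟩ := Projectivization.exists_smul_eq_mk_rep ℝ v hv
  exact ⟨a, a.ne_zero, ha.symm⟩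

lemma coord_of {x : M} {v : TangentSpace 𝓘(ℝ, E3) x} (hv : v ≠ 0) (hn : g.val x v v = 0) :
    F.coord (PC.of g x v hv hn) = F.num x v / F.den x v := by
  obtain ⟨a, ha, h⟩ := rep_of hv hn
  show F.num x (PC.of g x v hv hn).line.rep / F.den x (PC.of g x v hv hn).line.rep = _
  rw [h]
  simp only [num, den, map_smul, smul_apply, smul_eq_mul, ← mul_sub]
  rw [mul_div_mul_left _ _ ha]

lemma den_of {x : M} {v : TangentSpace 𝓘(ℝ, E3) x} (hv : v ≠ 0) (hn : g.val x v v = 0) :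
    F.den (PC.of g x v hv hn).pt (PC.of g x v hv hn).line.rep ≠ 0 ↔ F.den x v ≠ 0 := by
  obtain ⟨a, ha, h⟩ := rep_of hv hn
  show F.den x (PC.of g x v hv hn).line.rep ≠ 0 ↔ _
  rw [h]
  simp only [den, map_smul, smul_apply, smul_eq_mul, ← mul_sub]
  simp [ha]

lemma lineAt_coord {x : M} (hx : x ∈ F.dom) {v : TangentSpace 𝓘(ℝ, E3) x} (hv : v ≠ 0)
    (hn : g.val x v v = 0) (hd : F.den x v ≠ 0) :
    F.lineAt x hx (F.num x v / F.den x v) = PC.of g x v hv hn := by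
  have hexp := g.expand x (F.VV x hx) (F.YY x hx) (F.TT x hx) (F.VY x hx) (F.VT x hx)
    (F.YT x hx) v
  have hq : g.val x v (F.V x) ^ 2 + g.val x v (F.Y x) ^ 2 = g.val x v (F.T x) ^ 2 := by
    have h2 : g.val x v v = g.val x v (g.val x v (F.V x) • F.V x + g.val x v (F.Y x) • F.Y x
      - g.val x v (F.T x) • F.T x) := by rw [← hexp]
    rw [hn] at h2
    simp only [map_sub, map_add, map_smul, smul_eq_mul] at h2
    linear_combination -h2
  refine PC.of_congr _ _ _ _ (2 / F.den x v) ?_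
  refine Eq.trans (congrArg (fun w => (2 / F.den x v) • w) hexp) ?_
  unfold vec num
  have hd' : F.den x v = g.val x v (F.V x) - g.val x v (F.T x) := rfl
  set a := g.val x v (F.V x)
  set b := g.val x v (F.Y x)
  set c := g.val x v (F.T x)
  set d := F.den x v
  have e1 : 2 / d * a = 1 - (b / d) ^ 2 := by
    field_simp
    rw [hd']
    linear_combination hq
  have e2 : 2 / d * b = 2 * (b / d) := by ring
  have e3 : 2 / d * (-c) = 1 + (b / d) ^ 2 := by
    field_simp
    rw [hd']
    linear_combination -hq
  rw [← e1, ← e2, ← e3]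
  module

/-- The chart of `PC` attached to a frame and to the chart of `M` at the base point of `u₀`. -/
def chart (u₀ : PC g) : PartialEquiv (PC g) (E3 × ℝ) where
  toFun u := (chartAt E3 u₀.pt u.pt, F.coord u)
  invFun q := by
    classical
    exact if h : (chartAt E3 u₀.pt).symm q.1 ∈ F.dom then F.lineAt _ h q.2 else u₀
  source := {u | u.pt ∈ (chartAt E3 u₀.pt).source ∧ u.pt ∈ F.dom ∧ F.den u.pt u.line.rep ≠ 0}
  target := {q | q.1 ∈ (chartAt E3 u₀.pt).target ∧ (chartAt E3 u₀.pt).symm q.1 ∈ F.dom}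
  map_source' u hu := by
    refine ⟨(chartAt E3 u₀.pt).map_source hu.1, ?_⟩
    show (chartAt E3 u₀.pt).symm (chartAt E3 u₀.pt u.pt) ∈ F.dom
    rw [(chartAt E3 u₀.pt).left_inv hu.1]
    exact hu.2.1
  map_target' q hq := by
    simp only [hq.2, dif_pos]
    refine ⟨(chartAt E3 u₀.pt).map_target hq.1, hq.2, ?_⟩
    unfold lineAt
    rw [den_of, den_vec _ hq.2]
    norm_num
  left_inv' u hu := by
    classical
    obtain ⟨x, v, hv, hn, rfl⟩ := u.exists_of
    have hx : (chartAt E3 u₀.pt).symm (chartAt E3 u₀.pt x) = x := (chartAt E3 u₀.pt).left_inv hu.1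
    have hd := (F.den_of hv hn).1 hu.2.2
    have hxd : x ∈ F.dom := hu.2.1
    have gen : ∀ (y : M) (hy : y = x) (hyd : y ∈ F.dom),
        F.lineAt y hyd (F.coord (PC.of g x v hv hn)) = PC.of g x v hv hn := by
      rintro y rfl hyd
      rw [coord_of]
      exact F.lineAt_coord hyd hv hn hd
    have hd2 : (chartAt E3 u₀.pt).symm (chartAt E3 u₀.pt x) ∈ F.dom := hx.symm ▸ hxd
    show dite _ _ _ = _
    rw [dif_pos (show (chartAt E3 u₀.pt).symm (chartAt E3 u₀.pt (PC.of g x v hv hn).pt) ∈ F.dom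
      from hd2)]
    exact gen _ hx _
  right_inv' q hq := by
    simp only [hq.2, dif_pos]
    refine Prod.ext ((chartAt E3 u₀.pt).right_inv hq.1) ?_
    show F.coord (F.lineAt _ hq.2 q.2) = q.2
    unfold lineAt
    rw [coord_of, num_vec _ hq.2, den_vec _ hq.2]
    ring

lemma chart_symm_apply (u₀ : PC g) {q : E3 × ℝ} (h : (chartAt E3 u₀.pt).symm q.1 ∈ F.dom) :
    (F.chart u₀).symm q = F.lineAt _ h q.2 := dif_pos h

/-- The frame with the sign of `V` reversed. -/
def flip : Frame g where
  dom := F.dom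
  V x := -F.V x
  Y := F.Y
  T := F.T
  isOpen_dom := F.isOpen_dom
  smooth_V := ContMDiffOn.neg_section F.smooth_V
  smooth_Y := F.smooth_Y
  smooth_T := F.smooth_T
  VV x hx := by simpa using F.VV x hx
  YY := F.YY
  TT := F.TT
  VY x hx := by simpa using F.VY x hx
  VT x hx := by simpa using F.VT x hx
  YT := F.YT

end Frame

lemma exists_chart (u : PC g) : ∃ F : Frame g, u ∈ (F.chart u).source := by
  obtain ⟨F, hF⟩ := exists_frame g u.pt
  by_cases h : F.den u.pt u.line.rep = 0
  · refine ⟨F.flip, mem_chart_source E3 u.pt, hF, fun h' => ?_⟩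
    set v := u.line.rep
    simp only [Frame.den, Frame.flip, map_neg] at h h'
    have hn : g.val u.pt v v = 0 := u.null v (by
      rw [Projectivization.submodule_eq]
      exact Submodule.mem_span_singleton_self _)
    have hexp := g.expand u.pt (F.VV _ hF) (F.YY _ hF) (F.TT _ hF) (F.VY _ hF) (F.VT _ hF)
      (F.YT _ hF) v
    have h1 : g.val u.pt v (F.V u.pt) = 0 := by linarith
    have h2 : g.val u.pt v (F.T u.pt) = 0 := by linarith
    rw [h1, h2] at hexp
    simp only [zero_smul, zero_add, sub_zero] at hexp
    have h3 : g.val u.pt v v = g.val u.pt v (g.val u.pt v (F.Y u.pt) • F.Y u.pt) := by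
      rw [← hexp]
    rw [hn, map_smul, smul_eq_mul] at h3
    have h4 : g.val u.pt v (F.Y u.pt) = 0 := by
      simpa using h3.symm
    rw [h4, zero_smul] at hexp
    exact u.line.rep_nonzero hexp
  · exact ⟨F, mem_chart_source E3 u.pt, hF, h⟩

lemma SmoothFieldOn.contDiffOn_pair (g : LorentzMetric M) {X Z : ∀ x : M, TangentSpace 𝓘(ℝ, E3) x}
    {U : Set M} (hX : SmoothFieldOn X U) (hZ : SmoothFieldOn Z U) (x₀ : M) :
    ContDiffOn ℝ ∞ (fun q : E3 × ℝ => g.val ((chartAt E3 x₀).symm q.1)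
      (X ((chartAt E3 x₀).symm q.1)) (Z ((chartAt E3 x₀).symm q.1)))
      {q | q.1 ∈ (chartAt E3 x₀).target ∧ (chartAt E3 x₀).symm q.1 ∈ U} := by
  have h1 : ContMDiffOn 𝓘(ℝ, E3) 𝓘(ℝ, ℝ) ∞ (fun y : E3 => g.val ((chartAt E3 x₀).symm y)
      (X ((chartAt E3 x₀).symm y)) (Z ((chartAt E3 x₀).symm y)))
      {y | y ∈ (chartAt E3 x₀).target ∧ (chartAt E3 x₀).symm y ∈ U} :=
    (g.smooth_apply hX hZ).comp ((contMDiffOn_chart_symm (I := 𝓘(ℝ, E3))).mono fun y hy => hy.1)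
      fun y hy => hy.2
  exact (contMDiffOn_iff_contDiffOn.1 h1).comp contDiff_fst.contDiffOn fun q hq => hq

section Transition

variable (F F' : Frame g) (u u' : PC g)

/-- The denominator of the second coordinate of a change of charts. -/
def transDen (q : E3 × ℝ) : ℝ :=
  F'.den ((chartAt E3 u.pt).symm q.1) (F.vec ((chartAt E3 u.pt).symm q.1) q.2)

def transNum (q : E3 × ℝ) : ℝ :=
  F'.num ((chartAt E3 u.pt).symm q.1) (F.vec ((chartAt E3 u.pt).symm q.1) q.2)

/-- The set of `q` over which both frames and both charts of `M` are defined. -/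
def transDom : Set (E3 × ℝ) :=
  {q | q.1 ∈ (chartAt E3 u.pt).target ∧
    (chartAt E3 u.pt).symm q.1 ∈ F.dom ∩ F'.dom ∩ (chartAt E3 u'.pt).source}

lemma isOpen_transDom : IsOpen (transDom F F' u u') := by
  have h : IsOpen ((chartAt E3 u.pt).target ∩
      (chartAt E3 u.pt).symm ⁻¹' (F.dom ∩ F'.dom ∩ (chartAt E3 u'.pt).source)) :=
    (chartAt E3 u.pt).isOpen_inter_preimage_symm
      ((F.isOpen_dom.inter F'.isOpen_dom).inter (chartAt E3 u'.pt).open_source)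
  exact h.preimage continuous_fst

lemma trans_source : ((F.chart u).symm.trans (F'.chart u')).source =
    transDom F F' u u' ∩ transDen F F' u ⁻¹' {0}ᶜ := by
  ext q
  rw [PartialEquiv.trans_source]
  constructor
  · rintro ⟨⟨h1, h2⟩, h3⟩
    rw [mem_preimage, F.chart_symm_apply u h2] at h3
    obtain ⟨h4, h5, h6⟩ := h3
    exact ⟨⟨h1, ⟨h2, h5⟩, h4⟩, (F'.den_of _ _).1 h6⟩
  · rintro ⟨⟨h1, ⟨h2, h5⟩, h4⟩, h6⟩
    refine ⟨⟨h1, h2⟩, ?_⟩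
    rw [mem_preimage, F.chart_symm_apply u h2]
    exact ⟨h4, h5, (F'.den_of _ _).2 h6⟩

lemma contDiffOn_pair_vec {X : ∀ x : M, TangentSpace 𝓘(ℝ, E3) x} (hX : SmoothFieldOn X F'.dom) :
    ContDiffOn ℝ ∞ (fun q : E3 × ℝ => g.val ((chartAt E3 u.pt).symm q.1)
      (F.vec ((chartAt E3 u.pt).symm q.1) q.2) (X ((chartAt E3 u.pt).symm q.1)))
      (transDom F F' u u') := by
  have key {Z : ∀ x : M, TangentSpace 𝓘(ℝ, E3) x} (hZ : SmoothFieldOn Z F.dom) :=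
    (SmoothFieldOn.contDiffOn_pair g (hZ.mono (inter_subset_left (t := F'.dom)))
      (hX.mono inter_subset_right) u.pt).mono
      (fun q (hq : q ∈ transDom F F' u u') => ⟨hq.1, hq.2.1⟩)
  have hs : ContDiffOn ℝ ∞ (fun q : E3 × ℝ => q.2) (transDom F F' u u') :=
    contDiff_snd.contDiffOn
  simp only [Frame.pair_vec]
  exact (((contDiffOn_const.sub (hs.pow 2)).mul (key F.smooth_V)).add
    ((contDiffOn_const.mul hs).mul (key F.smooth_Y))).add
    ((contDiffOn_const.add (hs.pow 2)).mul (key F.smooth_T))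

lemma contDiffOn_transDen : ContDiffOn ℝ ∞ (transDen F F' u) (transDom F F' u u') :=
  (contDiffOn_pair_vec F F' u u' F'.smooth_V).sub (contDiffOn_pair_vec F F' u u' F'.smooth_T)

lemma contDiffOn_transNum : ContDiffOn ℝ ∞ (transNum F F' u) (transDom F F' u u') :=
  contDiffOn_pair_vec F F' u u' F'.smooth_Y

lemma contDiffOn_trans : ContDiffOn ℝ ∞ ((F.chart u).symm.trans (F'.chart u'))
    ((F.chart u).symm.trans (F'.chart u')).source := by
  rw [trans_source]
  have h1 : ContDiffOn ℝ ∞ (fun q : E3 × ℝ => chartAt E3 u'.pt ((chartAt E3 u.pt).symm q.1))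
      (transDom F F' u u' ∩ transDen F F' u ⁻¹' {0}ᶜ) := by
    have h2 : ContMDiffOn 𝓘(ℝ, E3) 𝓘(ℝ, E3) ∞
        (fun y : E3 => chartAt E3 u'.pt ((chartAt E3 u.pt).symm y))
        ((chartAt E3 u.pt).target ∩ (chartAt E3 u.pt).symm ⁻¹' (chartAt E3 u'.pt).source) :=
      (contMDiffOn_chart (I := 𝓘(ℝ, E3))).comp
        ((contMDiffOn_chart_symm (I := 𝓘(ℝ, E3))).mono inter_subset_left) fun y hy => hy.2
    exact (contMDiffOn_iff_contDiffOn.1 h2).comp contDiff_fst.contDiffOn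
      fun q hq => ⟨hq.1.1, hq.1.2.2⟩
  have h3 : ContDiffOn ℝ ∞ (fun q => transNum F F' u q / transDen F F' u q)
      (transDom F F' u u' ∩ transDen F F' u ⁻¹' {0}ᶜ) :=
    ((contDiffOn_transNum F F' u u').mono inter_subset_left).div
      ((contDiffOn_transDen F F' u u').mono inter_subset_left) fun q hq => hq.2
  refine (h1.prodMk h3).congr fun q hq => ?_
  show F'.chart u' ((F.chart u).symm q) = _
  rw [F.chart_symm_apply u hq.1.2.1.1]
  exact Prod.ext rfl (F'.coord_of _ _)

lemma isOpen_trans_source : IsOpen ((F.chart u).symm.trans (F'.chart u')).source := by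
  rw [trans_source]
  exact (contDiffOn_transDen F F' u u').continuousOn.isOpen_inter_preimage
    (isOpen_transDom F F' u u') isOpen_compl_singleton

end Transition

/-- The smooth atlas of `PC`. -/
def PC.core (g : LorentzMetric M) : ChartedSpaceCore (E3 × ℝ) (PC g) where
  atlas := {e | ∃ (F : Frame g) (u : PC g), e = F.chart u}
  chartAt u := (exists_chart u).choose.chart u
  mem_chart_source u := (exists_chart u).choose_spec
  chart_mem_atlas u := ⟨_, _, rfl⟩
  open_source := by
    rintro _ _ ⟨F, u, rfl⟩ ⟨F', u', rfl⟩
    exact isOpen_trans_source F F' u u'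
  continuousOn_toFun := by
    rintro _ _ ⟨F, u, rfl⟩ ⟨F', u', rfl⟩
    exact (contDiffOn_trans F F' u u').continuousOn

instance (g : LorentzMetric M) : TopologicalSpace (PC g) := (PC.core g).toTopologicalSpace

instance (g : LorentzMetric M) : ChartedSpace (E3 × ℝ) (PC g) := (PC.core g).toChartedSpace

instance (g : LorentzMetric M) : IsManifold 𝓘(ℝ, E3 × ℝ) ∞ (PC g) := by
  refine isManifold_of_contDiffOn _ _ _ ?_
  rintro e e' he he'
  obtain ⟨c, hc, h⟩ : ∃ (c : PartialEquiv (PC g) (E3 × ℝ)) (hc : c ∈ (PC.core g).atlas),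
      e = (PC.core g).openPartialHomeomorph c hc := by
    simpa [atlas, ChartedSpace.atlas, ChartedSpaceCore.toChartedSpace] using he
  obtain ⟨c', hc', h'⟩ : ∃ (c : PartialEquiv (PC g) (E3 × ℝ)) (hc : c ∈ (PC.core g).atlas),
      e' = (PC.core g).openPartialHomeomorph c hc := by
    simpa [atlas, ChartedSpace.atlas, ChartedSpaceCore.toChartedSpace] using he'
  subst h h'
  obtain ⟨F, u, rfl⟩ := hc
  obtain ⟨F', u', rfl⟩ := hc'
  have h := contDiffOn_trans F F' u u'
  simp only [modelWithCornersSelf_coe, modelWithCornersSelf_coe_symm, range_id, inter_univ,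
    preimage_id, Function.id_comp, Function.comp_id]
  exact h

section Distributions

variable (F : Type*) [NormedAddCommGroup F] [NormedSpace ℝ F]
  (Q : Type*) [TopologicalSpace Q] [ChartedSpace F Q]

/-- A field of tangent subspaces on `Q`. -/
abbrev TangentDistribution : Type _ := ∀ q : Q, Submodule ℝ (TangentSpace 𝓘(ℝ, F) q)

variable {F Q} [IsManifold 𝓘(ℝ, F) ∞ Q]

/-- `X` is a smooth section of the distribution `D` over the open set `U`. -/
structure IsLocalSection (D : TangentDistribution F Q) (U : Set Q)
    (X : ∀ q : Q, TangentSpace 𝓘(ℝ, F) q) : Prop where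
  isOpen : IsOpen U
  smooth : ContMDiffOn 𝓘(ℝ, F) 𝓘(ℝ, F).tangent ∞
    (fun q => (⟨q, X q⟩ : TangentBundle 𝓘(ℝ, F) Q)) U
  mem : ∀ q ∈ U, X q ∈ D q

/-- The distribution `[D, D]` spanned by the sections of `D` and their Lie brackets. -/
def bracket (D : TangentDistribution F Q) : TangentDistribution F Q := fun q =>
  D q ⊔ Submodule.span ℝ {w | ∃ (U : Set Q) (X Y : ∀ q : Q, TangentSpace 𝓘(ℝ, F) q),
    IsLocalSection D U X ∧ IsLocalSection D U Y ∧ q ∈ U ∧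
      VectorField.mlieBracket 𝓘(ℝ, F) X Y q = w}

/-- `X` is a smooth section of `E` over `U` with `[X, E] ⊆ E`. -/
def IsCharacteristicSection (E : TangentDistribution F Q) (U : Set Q)
    (X : ∀ q : Q, TangentSpace 𝓘(ℝ, F) q) : Prop :=
  IsLocalSection E U X ∧ ∀ (U' : Set Q) (Y : ∀ q : Q, TangentSpace 𝓘(ℝ, F) q),
    IsLocalSection E U' Y → ∀ q ∈ U ∩ U', VectorField.mlieBracket 𝓘(ℝ, F) X Y q ∈ E q

/-- The distribution spanned by the sections `X` of `E` with `[X, E] ⊆ E`, i.e. the largest `W`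
spanned by smooth sections with `W ⊆ E` and `[W, E] ⊆ E`. -/
def characteristic (E : TangentDistribution F Q) : TangentDistribution F Q := fun q =>
  Submodule.span ℝ {w | ∃ (U : Set Q) (X : ∀ q : Q, TangentSpace 𝓘(ℝ, F) q),
    IsCharacteristicSection E U X ∧ q ∈ U ∧ X q = w}

/-- The kernel of an Engel structure `D`: the characteristic line field of `[D, D]`. -/
def engelKernel (D : TangentDistribution F Q) : TangentDistribution F Q := characteristic (bracket D)

/-- Two points are joined by a smooth curve tangent to `W`. -/
def JoinedAlong (W : TangentDistribution F Q) (u v : Q) : Prop :=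
  ∃ c : ℝ → Q, ContMDiff 𝓘(ℝ, ℝ) 𝓘(ℝ, F) ∞ c ∧
    (∀ t, mfderiv 𝓘(ℝ, ℝ) 𝓘(ℝ, F) c t (1 : ℝ) ∈ W (c t)) ∧ c 0 = u ∧ c 1 = v

/-- The leaf space `Q / W` with the quotient topology: two points are in the same leaf when they
are joined by a finite chain of smooth curves tangent to `W`. -/
abbrev LeafSpace (W : TangentDistribution F Q) : Type _ := Quot (JoinedAlong W)

end Distributions

/-- The distribution `D` of the Lorentz prolongation: `D_(x,l)` is the preimage of the line `l`
under the differential of the projection `PC → M`. -/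
def prolongation (g : LorentzMetric M) : TangentDistribution (E3 × ℝ) (PC g) := fun u =>
  u.line.submodule.comap (mfderiv 𝓘(ℝ, E3 × ℝ) 𝓘(ℝ, E3) (PC.pt : PC g → M) u).toLinearMap

section LeviCivita

/-- The metric in the chart of `M` at `x₀`. -/
def chartMetric (g : LorentzMetric M) (x₀ : M) (y : E3) : E3 →L[ℝ] E3 →L[ℝ] ℝ :=
  let A : E3 →L[ℝ] E3 := mfderiv 𝓘(ℝ, E3) 𝓘(ℝ, E3) (extChartAt 𝓘(ℝ, E3) x₀).symm y
  let G : E3 →L[ℝ] E3 →L[ℝ] ℝ := g.val ((extChartAt 𝓘(ℝ, E3) x₀).symm y)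
  G.bilinearComp A A

variable (G : E3 → E3 →L[ℝ] E3 →L[ℝ] ℝ)

/-- The Christoffel map `Γ_y(u, v)` of the metric `G` in coordinates, determined by
`2 G(Γ(u, v), w) = ∂_u G(v, w) + ∂_v G(u, w) - ∂_w G(u, v)`. -/
def christoffel (y u v : E3) : E3 :=
  (G y).inverse ((1 / 2 : ℝ) • (fderiv ℝ (fun z => G z v) y u + fderiv ℝ (fun z => G z u) y v
    - fderiv ℝ (fun z => G z u v) y))

/-- The curvature `R(a, b)c = ∇_a ∇_b c - ∇_b ∇_a c` for constant fields `a`, `b`, `c`. -/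
def curvature (y a b c : E3) : E3 :=
  fderiv ℝ (fun z => christoffel G z b c) y a - fderiv ℝ (fun z => christoffel G z a c) y b
    + christoffel G y a (christoffel G y b c) - christoffel G y b (christoffel G y a c)

/-- The covariant derivative of the field `W` along the curve `c`, in coordinates. -/
def covDeriv (c W : ℝ → E3) (t : ℝ) : E3 := deriv W t + christoffel G (c t) (deriv c t) (W t)

end LeviCivita

section Geodesics

/-- The velocity of a curve. -/
def velocity (γ : ℝ → M) (t : ℝ) : TangentSpace 𝓘(ℝ, E3) (γ t) :=
  mfderiv 𝓘(ℝ, ℝ) 𝓘(ℝ, E3) γ t (1 : ℝ)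

/-- The coordinate expression of a curve in the chart at `x₀`. -/
def coordCurve (x₀ : M) (γ : ℝ → M) (t : ℝ) : E3 := extChartAt 𝓘(ℝ, E3) x₀ (γ t)

/-- The coordinate expression, in the chart at `x₀`, of a vector field along a curve. -/
def coordField (x₀ : M) (γ : ℝ → M) (J : ∀ t, TangentSpace 𝓘(ℝ, E3) (γ t)) (t : ℝ) : E3 :=
  mfderiv 𝓘(ℝ, E3) 𝓘(ℝ, E3) (extChartAt 𝓘(ℝ, E3) x₀) (γ t) (J t)

variable (g) in
/-- `γ` is a geodesic on the open interval `I`. -/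
structure IsGeodesic (γ : ℝ → M) (I : Set ℝ) : Prop where
  isOpen : IsOpen I
  isConnected : IsConnected I
  smooth : ContMDiffOn 𝓘(ℝ, ℝ) 𝓘(ℝ, E3) ∞ γ I
  equation : ∀ (x₀ : M), ∀ t ∈ I, γ t ∈ (chartAt E3 x₀).source →
    covDeriv (chartMetric g x₀) (coordCurve x₀ γ) (deriv (coordCurve x₀ γ)) t = 0

variable (g) in
/-- A Jacobi field along `γ` on `I`: a smooth field with `D_t D_t J + R(J, γ')γ' = 0`. -/
def IsJacobiField (γ : ℝ → M) (I : Set ℝ) (J : ∀ t, TangentSpace 𝓘(ℝ, E3) (γ t)) : Prop :=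
  ∀ (x₀ : M), ∀ t ∈ I, γ t ∈ (chartAt E3 x₀).source →
    ContDiffAt ℝ ∞ (coordField x₀ γ J) t ∧
    covDeriv (chartMetric g x₀) (coordCurve x₀ γ)
        (covDeriv (chartMetric g x₀) (coordCurve x₀ γ) (coordField x₀ γ J)) t
      + curvature (chartMetric g x₀) (coordCurve x₀ γ t) (coordField x₀ γ J t)
          (deriv (coordCurve x₀ γ) t) (deriv (coordCurve x₀ γ) t) = 0

variable (g) in
/-- The points `γ a` and `γ b` are conjugate along the geodesic `γ`, i.e. joined, to first order,
by a one-parameter family of geodesics. -/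
def Conjugate (γ : ℝ → M) (I : Set ℝ) (a b : ℝ) : Prop :=
  ∃ J : ∀ t, TangentSpace 𝓘(ℝ, E3) (γ t),
    IsJacobiField g γ I J ∧ (∃ t ∈ I, J t ≠ 0) ∧ J a = 0 ∧ J b = 0

/-- A time orientation, given by a smooth timelike vector field. -/
structure TimeOrientation (g : LorentzMetric M) where
  field : ∀ x : M, TangentSpace 𝓘(ℝ, E3) x
  smooth : SmoothFieldOn field univ
  timelike : ∀ x, g.val x (field x) (field x) < 0

variable (o : TimeOrientation g)

/-- The future null vectors, i.e. the elements of the hemicone bundle `C⁺`. -/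
structure IsFutureNull {x : M} (v : TangentSpace 𝓘(ℝ, E3) x) : Prop where
  ne_zero : v ≠ 0
  null : g.val x v v = 0
  future : g.val x v (o.field x) < 0

/-- A future null geodesic on the open interval `I`. -/
structure IsNullGeodesic (γ : ℝ → M) (I : Set ℝ) : Prop extends IsGeodesic g γ I where
  futureNull : ∀ t ∈ I, IsFutureNull o (velocity γ t)

/-- A future null geodesic that cannot be extended to a geodesic on a larger open interval. -/
structure IsMaximalNullGeodesic (γ : ℝ → M) (I : Set ℝ) : Prop extends IsNullGeodesic o γ I where
  maximal : ∀ (γ' : ℝ → M) (I' : Set ℝ), IsGeodesic g γ' I' → I ⊆ I' → EqOn γ γ' I → I' = I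

/-- The null line `[γ'(t)]` in `PC`. -/
def IsNullGeodesic.direction {o : TimeOrientation g} {γ : ℝ → M} {I : Set ℝ}
    (h : IsNullGeodesic o γ I) {t : ℝ} (ht : t ∈ I) : PC g :=
  PC.of g (γ t) (velocity γ t) (h.futureNull t ht).ne_zero (h.futureNull t ht).null

/-- The space `N` of null geodesics: the images `γ(I)` of the maximal future null geodesics. -/
@[ext]
structure NullGeodesic where
  carrier : Set M
  isNull : ∃ (γ : ℝ → M) (I : Set ℝ), IsMaximalNullGeodesic o γ I ∧ γ '' I = carrier

/-- A null geodesic together with one of its future tangent vectors. Forgetting the geodesic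
identifies these pairs with `C⁺`. -/
structure TangentPair where
  vec : TangentBundle 𝓘(ℝ, E3) M
  curve : NullGeodesic o
  tangent : ∃ (γ : ℝ → M) (I : Set ℝ) (t : ℝ), IsMaximalNullGeodesic o γ I ∧
    γ '' I = curve.carrier ∧ t ∈ I ∧ (⟨γ t, velocity γ t⟩ : TangentBundle 𝓘(ℝ, E3) M) = vec

/-- The topology of `N` as the quotient of `C⁺ ⊆ TM` by the geodesic spray and the Euler field:
the finest one for which the map from a vector `v` in `C⁺` to the null geodesic tangent to `v` is
continuous. -/
instance : TopologicalSpace (NullGeodesic o) :=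
  TopologicalSpace.coinduced TangentPair.curve
    (TopologicalSpace.induced (TangentPair.vec (o := o)) inferInstance)

end Geodesics

section Contact

variable {o : TimeOrientation g} [ChartedSpace E3 (NullGeodesic o)]

/-- A smooth map with surjective differential. -/
def IsSmoothSubmersion (p : PC g → NullGeodesic o) : Prop :=
  ContMDiff 𝓘(ℝ, E3 × ℝ) 𝓘(ℝ, E3) ∞ p ∧
    ∀ u, Function.Surjective (mfderiv 𝓘(ℝ, E3 × ℝ) 𝓘(ℝ, E3) p u)

/-- The tangent space at `A = p u` to the sky of `x = π u`, the sky being the image under `p` of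
the fibre `PC_x` of the projection `π : PC → M`. (If `A` passes through `x` in several directions,
this is the tangent space to the branch of the sky given by the direction `u`.) -/
def skyTangent (p : PC g → NullGeodesic o) (A : NullGeodesic o) (u : PC g) (h : p u = A) :
    Submodule ℝ (TangentSpace 𝓘(ℝ, E3) A) :=
  h ▸ (LinearMap.ker (mfderiv 𝓘(ℝ, E3 × ℝ) 𝓘(ℝ, E3) (PC.pt : PC g → M) u).toLinearMap).map
    (mfderiv 𝓘(ℝ, E3 × ℝ) 𝓘(ℝ, E3) p u).toLinearMap

/-- `H` is the canonical contact structure of the space of null geodesics (where `p` maps a null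
line to the null geodesic tangent to it): at a null geodesic `A`, it is the direct sum
of the tangent spaces of the skies of any two points that are not conjugate along `A`, and every
`A` carries two such points. -/
structure IsCanonicalContactStructure (p : PC g → NullGeodesic o)
    (H : TangentDistribution E3 (NullGeodesic o)) : Prop where
  exists_nonconjugate : ∀ A : NullGeodesic o, ∃ (γ : ℝ → M) (I : Set ℝ) (a b : ℝ),
    IsMaximalNullGeodesic o γ I ∧ γ '' I = A.carrier ∧ a ∈ I ∧ b ∈ I ∧ ¬ Conjugate g γ I a b
  eq_sum : ∀ (A : NullGeodesic o) (γ : ℝ → M) (I : Set ℝ) (hγ : IsMaximalNullGeodesic o γ I)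
    (a b : ℝ) (ha : a ∈ I) (hb : b ∈ I), γ '' I = A.carrier → ¬ Conjugate g γ I a b →
    ∃ (hu : p (hγ.direction ha) = A) (hv : p (hγ.direction hb) = A),
      Disjoint (skyTangent p A _ hu) (skyTangent p A _ hv) ∧
      H A = skyTangent p A _ hu ⊔ skyTangent p A _ hv

end Contact

end LorentzEngel

end

open LorentzEngel

noncomputable section

set_option maxSynthPendingDepth 3
set_option synthInstance.maxHeartbeats 200000

/-! Everything is computed in coordinates `(y, s)` on the bundle of null lines, where `y` is a chart
of M and the line is spanned by `xi (y, s) = (1 - s²) V + 2 s Y + (1 + s²) T` for an orthonormal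
frame. Write `rho` for the derivative of `xi` in `s`; it is spacelike and, with `xi`, spans the
orthogonal complement of `xi`. The plane D consists of the vectors whose base part is a multiple of
`xi`. The bracket of the vertical field with `(xi, 0)` is `(rho, 0)`, so [D, D] is the kernel of the
form `G(·, xi)` (`PC.mem_eSub_iff`). Since the Levi-Civita connection is metric and torsion-free,
this form takes on the bracket of two sections X, Z of its kernel the value `G(X, ∇_Z xi) - G(Z, ∇_X
xi)` (`FramedMetric.G_lieBracket`). Testing against `(rho, 0)` and the vertical field leaves as
kernel exactly the line of `spray = (xi, slope)`, where `slope` is the fibre speed that makes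
`∇_spray xi` a multiple of `xi` (`PC.mem_wSub_iff`). This is the geodesic equation up to
parametrisation, so lifts of null geodesics are integral curves of the kernel, which is the first
claim (`IsLift.wSub_eq_span`).

For the homeomorphism, a curve tangent to the kernel is locally a reparametrised lift, by uniqueness
for ordinary differential equations, so the geodesic tangent to a line is constant on leaves
(`tangentGeodesic_of_joinedAlong`). Conversely, null geodesics are point sets, and two of them with
equal images could a priori have different lifts. The set of coincidence parameters is uncountable,
hence has an accumulation point in itself, and there the two velocities must be parallel
(`exists_parallel`); from that common null line one moves along both lifts. Continuity in both
directions comes from choosing continuously a future vector on a null line, and the line of a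
vector.

For the contact structure, the differential of p has the Engel kernel as its kernel, by dimension. A
tangent vector ζ at a null geodesic therefore has, along the lift, a unique preimage whose base part
is orthogonal to the time orientation. This gauged lift solves the linearised spray equation
(`IsTangentSubmersion.isSprayField`), and its base part J solves the Jacobi equation up to a
multiple of the velocity. That multiple is removed by subtracting `H γ'` with H vanishing at two
prescribed parameters (`exists_isJacobiField_sub`); hence a nonzero ζ tangent to two skies makes the
two points conjugate (`IsTangentSubmersion.conjugate`). On the other hand `g(J, γ')` is constant
along γ, and its vanishing says that ζ lies in the image of [D, D]; so this image depends only on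
the null geodesic (`IsTangentSubmersion.pushE_eq`). The image has dimension at most two and contains
the nonzero tangent spaces of all skies through the geodesic, so at nonconjugate points two of these
are complementary in it. Nearby points are never conjugate, which makes the structure exist and be
unique. -/

namespace LorentzEngel

/-! ### The Christoffel map of a metric in coordinates and its transformation law. -/

section Christoffel

variable {E : Type*} [NormedAddCommGroup E] [NormedSpace ℝ E] {G : E → E →L[ℝ] E →L[ℝ] ℝ} {y : E}

/-- The Christoffel map as a continuous bilinear map. -/
def christoffelCLM (G : E → E →L[ℝ] E →L[ℝ] ℝ) (y : E) : E →L[ℝ] E →L[ℝ] E :=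
  (ContinuousLinearMap.compL ℝ E (E →L[ℝ] ℝ) E (G y).inverse) ∘L
    ((1 / 2 : ℝ) • (fderiv ℝ G y + (fderiv ℝ G y).flip -
      (ContinuousLinearMap.flipₗᵢ ℝ E E ℝ :
        (E →L[ℝ] E →L[ℝ] ℝ) →L[ℝ] (E →L[ℝ] E →L[ℝ] ℝ)) ∘L (fderiv ℝ G y).flip))

lemma contDiffOn_christoffelCLM [CompleteSpace E] {O : Set E} (hO : IsOpen O) (hG : ContDiffOn ℝ ∞ G O)
    (hinv : ∀ y ∈ O, (G y).IsInvertible) : ContDiffOn ℝ ∞ (christoffelCLM G) O := by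
  have hD : ContDiffOn ℝ ∞ (fderiv ℝ G) O := hG.fderiv_of_isOpen hO (by simp)
  have hI : ContDiffOn ℝ ∞ (fun y => (G y).inverse) O := by
    intro y hy
    exact (hinv y hy).contDiffAt_map_inverse.comp_contDiffWithinAt y (hG y hy)
  have hF : ContDiffOn ℝ ∞ (fun y => (fderiv ℝ G y).flip) O :=
    (ContinuousLinearMap.flipₗᵢ ℝ E E (E →L[ℝ] ℝ)).toContinuousLinearEquiv.contDiff.comp_contDiffOn hD
  exact ((ContinuousLinearMap.compL ℝ E (E →L[ℝ] ℝ) E).contDiff.comp_contDiffOn hI).clm_comp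
    (((hD.add hF).sub (contDiffOn_const.clm_comp hF)).const_smul _)

/-- The Koszul formula. All later identities are derived from it by linear arithmetic, so that the
inverse of the metric is never expanded. -/
lemma christoffel_spec (hinv : (G y).IsInvertible) (u v w : E) :
    2 * G y (christoffelCLM G y u v) w =
      fderiv ℝ G y u v w + fderiv ℝ G y v u w - fderiv ℝ G y w u v := by
  have : G y (christoffelCLM G y u v) = (1 / 2 : ℝ) • (fderiv ℝ G y u v + fderiv ℝ G y v u -
      ((fderiv ℝ G y).flip u).flip v) := by
    unfold christoffelCLM
    simp only [ContinuousLinearMap.comp_apply, ContinuousLinearMap.compL_apply]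
    rw [hinv.self_apply_inverse]
    rfl
  rw [this]
  simp

lemma fderiv_symm {O : Set E} (hO : IsOpen O) (hG : DifferentiableOn ℝ G O)
    (hs : ∀ y ∈ O, ∀ u v, G y u v = G y v u) (hy : y ∈ O) (u v w : E) :
    fderiv ℝ G y u v w = fderiv ℝ G y u w v := by
  have hGy := (hG y hy).differentiableAt (hO.mem_nhds hy)
  have h1 : ∀ a b : E, fderiv ℝ (fun z => G z a b) y u = fderiv ℝ G y u a b := by
    intro a b
    rw [fderiv_clm_apply (hGy.clm_apply (differentiableAt_const a)) (differentiableAt_const b),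
      fderiv_clm_apply hGy (differentiableAt_const a)]
    simp
  rw [← h1, ← h1]
  congr 1
  apply Filter.EventuallyEq.fderiv_eq
  filter_upwards [hO.mem_nhds hy] with z hz using hs z hz v w

lemma christoffel_symm {O : Set E} (hO : IsOpen O) (hG : DifferentiableOn ℝ G O)
    (hs : ∀ y ∈ O, ∀ u v, G y u v = G y v u) (hinv : ∀ y ∈ O, (G y).IsInvertible) (hy : y ∈ O)
    (u v : E) : christoffelCLM G y u v = christoffelCLM G y v u := by
  have h1 := hinv y hy
  apply h1.injective
  ext w
  have e1 := christoffel_spec h1 u v w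
  have e2 := christoffel_spec h1 v u w
  have e3 := fderiv_symm hO hG hs hy w u v
  linarith

end Christoffel

section Covariance

variable {E : Type*} [NormedAddCommGroup E] [NormedSpace ℝ E] {G₁ G₂ : E → E →L[ℝ] E →L[ℝ] ℝ} {φ : E → E}

/-- Transformation law of the Christoffel map under an isometric change of coordinates. -/
lemma christoffel_covariant {y : E} (hφ : ContDiffAt ℝ ∞ φ y)
    (hA : Function.Surjective (fderiv ℝ φ y))
    (hG : ∀ᶠ z in 𝓝 y, ∀ u v, G₁ z u v = G₂ (φ z) (fderiv ℝ φ z u) (fderiv ℝ φ z v))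
    (h1 : DifferentiableAt ℝ G₁ y) (h2 : DifferentiableAt ℝ G₂ (φ y))
    (hs : ∀ u v, G₂ (φ y) u v = G₂ (φ y) v u)
    (i1 : (G₁ y).IsInvertible) (i2 : (G₂ (φ y)).IsInvertible) (u v : E) :
    fderiv ℝ φ y (christoffelCLM G₁ y u v) =
      christoffelCLM G₂ (φ y) (fderiv ℝ φ y u) (fderiv ℝ φ y v) + fderiv ℝ (fderiv ℝ φ) y u v := by
  set A := fderiv ℝ φ y with hAdef
  set B := fderiv ℝ (fderiv ℝ φ) y with hB
  have hφd : DifferentiableAt ℝ φ y := hφ.differentiableAt (by simp)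
  have hφ' : DifferentiableAt ℝ (fderiv ℝ φ) y :=
    (hφ.fderiv_right (m := 1) (by norm_cast)).differentiableAt (by simp)
  have hBs : ∀ a b, B a b = B b a := fun a b =>
    (hφ.isSymmSndFDerivAt (by simp; norm_cast)) a b
  -- The isometry relation `hG` differentiated in the direction `a`.
  have d1 : ∀ a b c, fderiv ℝ G₁ y a b c =
      fderiv ℝ G₂ (φ y) (A a) (A b) (A c) + G₂ (φ y) (B a b) (A c) + G₂ (φ y) (A b) (B a c) := by
    intro a b c
    have e1 : HasFDerivAt (fun z => G₁ z b c) _ y :=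
      (h1.hasFDerivAt.clm_apply (hasFDerivAt_const b y)).clm_apply (hasFDerivAt_const c y)
    have e2 : HasFDerivAt (fun z => G₂ (φ z) (fderiv ℝ φ z b) (fderiv ℝ φ z c)) _ y :=
      ((h2.hasFDerivAt.comp y hφd.hasFDerivAt).clm_apply
        (hφ'.hasFDerivAt.clm_apply (hasFDerivAt_const b y))).clm_apply
        (hφ'.hasFDerivAt.clm_apply (hasFDerivAt_const c y))
    have e3 := e1.unique (e2.congr_of_eventuallyEq (hG.mono fun z hz => hz b c))
    have e4 := congrArg (fun L => L a) e3
    simp at e4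
    rw [e4]
    simp only [← hAdef, ← hB]
    ring
  -- The inverse metrics are avoided by pairing both sides, through `G₂`, with test vectors. As the
  -- differential of `φ` is onto, test vectors `A w` suffice, and these are the ones that both
  -- Koszul formulas control.
  apply i2.injective
  ext w
  obtain ⟨w, rfl⟩ := hA w
  have s1 := christoffel_spec i1 u v w
  have s2 := christoffel_spec i2 (A u) (A v) (A w)
  have s3 := hG.self_of_nhds (christoffelCLM G₁ y u v) w
  rw [d1, d1, d1] at s1
  rw [hBs v u, hBs w u, hBs w v, hs (B u w) (A v), hs _ (B v w)] at s1
  simp only [map_add, add_apply]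
  linarith

end Covariance

/-- Links the pointwise `christoffel` of the definitions, built from derivatives of evaluations of
`G`, to the bundled bilinear map, whose smoothness in `y` is accessible. -/
lemma christoffel_eq {G : E3 → E3 →L[ℝ] E3 →L[ℝ] ℝ} {y : E3} (hG : DifferentiableAt ℝ G y) (u v : E3) :
    christoffel G y u v = christoffelCLM G y u v := by
  have h1 : ∀ a b : E3, fderiv ℝ (fun z => G z a) y b = fderiv ℝ G y b a := by
    intro a b
    rw [fderiv_clm_apply hG (differentiableAt_const a)]
    simp
  have h2 : fderiv ℝ (fun z => G z u v) y = ((fderiv ℝ G y).flip u).flip v := by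
    ext b
    rw [fderiv_clm_apply (hG.clm_apply (differentiableAt_const u)) (differentiableAt_const v)]
    simp [h1]
  unfold christoffel christoffelCLM
  rw [h1, h1, h2]
  simp

/-! ### The geodesic operator and its linearisation in coordinates. -/

section Operators

variable {E : Type*} [NormedAddCommGroup E] [NormedSpace ℝ E]

/-- The geodesic operator `y'' + Γ(y', y')`. -/
def geodOp (Γ : E → E →L[ℝ] E →L[ℝ] E) (y : ℝ → E) (t : ℝ) : E :=
  deriv (deriv y) t + Γ (y t) (deriv y t) (deriv y t)

/-- The linearisation of the geodesic operator at `y` in the direction of `J`. -/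
def jacobiOp (Γ : E → E →L[ℝ] E →L[ℝ] E) (y J : ℝ → E) (t : ℝ) : E :=
  deriv (deriv J) t + fderiv ℝ Γ (y t) (J t) (deriv y t) (deriv y t) +
    (2 : ℝ) • Γ (y t) (deriv y t) (deriv J t)

lemma contDiffAt_deriv {F : Type*} [NormedAddCommGroup F] [NormedSpace ℝ F]
    {f : ℝ → F} {t : ℝ} (h : ContDiffAt ℝ ∞ f t) : ContDiffAt ℝ ∞ (deriv f) t := by
  have h1 : ContDiffAt ℝ ∞ (fun s => fderiv ℝ f s 1) t :=
    (h.fderiv_right (m := ∞) (by norm_cast)).clm_apply contDiffAt_const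
  exact h1.congr_of_eventuallyEq (Filter.Eventually.of_forall fun s => by
    simp)

lemma eventually_differentiableAt {F F' : Type*} [NormedAddCommGroup F] [NormedSpace ℝ F]
    [NormedAddCommGroup F'] [NormedSpace ℝ F']
    {f : F' → F} {t : F'} (h : ContDiffAt ℝ ∞ f t) : ∀ᶠ s in 𝓝 t, DifferentiableAt ℝ f s := by
  filter_upwards [(h.of_le (m := 1) (by norm_cast)).eventually (by simp)] with s hs
  exact hs.differentiableAt (by simp)

variable {Γ Γ₁ Γ₂ : E → E →L[ℝ] E →L[ℝ] E} {φ : E → E} {y J : ℝ → E} {t : ℝ}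

lemma contDiffAt_fderiv {F F' : Type*} [NormedAddCommGroup F] [NormedSpace ℝ F]
    [NormedAddCommGroup F'] [NormedSpace ℝ F'] {f : F' → F} {x : F'}
    (h : ContDiffAt ℝ ∞ f x) : ContDiffAt ℝ ∞ (fderiv ℝ f) x :=
  h.fderiv_right (by norm_cast)

lemma deriv_comp_eventually (hφ : ContDiffAt ℝ ∞ φ (y t)) (hy : ContDiffAt ℝ ∞ y t) :
    deriv (φ ∘ y) =ᶠ[𝓝 t] fun s => fderiv ℝ φ (y s) (deriv y s) := by
  filter_upwards [eventually_differentiableAt hy,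
    hy.continuousAt.eventually (eventually_differentiableAt hφ)] with s h1 h2
  exact fderiv_comp_deriv s h2 h1

lemma hasDerivAt_fderiv_apply (hφ : ContDiffAt ℝ ∞ φ (y t)) (hy : ContDiffAt ℝ ∞ y t)
    (hJ : ContDiffAt ℝ ∞ J t) : HasDerivAt (fun s => fderiv ℝ φ (y s) (J s))
      (fderiv ℝ (fderiv ℝ φ) (y t) (deriv y t) (J t) + fderiv ℝ φ (y t) (deriv J t)) t := by
  have h1 := ((contDiffAt_fderiv hφ).differentiableAt (by simp)).hasFDerivAt.comp_hasDerivAt t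
    (hy.differentiableAt (by simp)).hasDerivAt
  exact h1.clm_apply (hJ.differentiableAt (by simp)).hasDerivAt

/-- The second derivative of `φ ∘ y` contains the Hessian of `φ` on `(y', y')`, which is exactly the
inhomogeneous term in the transformation law of `Γ`. -/
lemma geodOp_comp (hφ : ContDiffAt ℝ ∞ φ (y t)) (hy : ContDiffAt ℝ ∞ y t)
    (hΓ : ∀ u v, fderiv ℝ φ (y t) (Γ₁ (y t) u v) = Γ₂ (φ (y t)) (fderiv ℝ φ (y t) u)
      (fderiv ℝ φ (y t) v) + fderiv ℝ (fderiv ℝ φ) (y t) u v) :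
    geodOp Γ₂ (φ ∘ y) t = fderiv ℝ φ (y t) (geodOp Γ₁ y t) := by
  have h1 := deriv_comp_eventually hφ hy
  unfold geodOp
  rw [h1.deriv_eq, (hasDerivAt_fderiv_apply hφ hy (contDiffAt_deriv hy)).deriv, h1.self_of_nhds,
    map_add, hΓ]
  simp only [Function.comp]
  abel

lemma hasFDerivAt_apply_const₂ {F G₁ G₂ : Type*} [NormedAddCommGroup F] [NormedSpace ℝ F]
    [NormedAddCommGroup G₁] [NormedSpace ℝ G₁] [NormedAddCommGroup G₂] [NormedSpace ℝ G₂]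
    {Γ : F → G₁ →L[ℝ] G₁ →L[ℝ] G₂} {x : F} (h : DifferentiableAt ℝ Γ x) (u v : G₁) (w : F) :
    DifferentiableAt ℝ (fun z => Γ z u v) x ∧
    fderiv ℝ (fun z => Γ z u v) x w = fderiv ℝ Γ x w u v := by
  have h1 := (h.hasFDerivAt.clm_apply (hasFDerivAt_const u x)).clm_apply (hasFDerivAt_const v x)
  refine ⟨h1.differentiableAt, ?_⟩
  rw [h1.fderiv]
  simp

/-- The linearised geodesic operator is covariant along geodesics. -/
lemma jacobiOp_comp (hφ : ContDiffAt ℝ ∞ φ (y t)) (hy : ContDiffAt ℝ ∞ y t)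
    (hJ : ContDiffAt ℝ ∞ J t)
    (hΓ : ∀ᶠ z in 𝓝 (y t), ∀ u v, fderiv ℝ φ z (Γ₁ z u v) = Γ₂ (φ z) (fderiv ℝ φ z u)
      (fderiv ℝ φ z v) + fderiv ℝ (fderiv ℝ φ) z u v)
    (h1 : DifferentiableAt ℝ Γ₁ (y t)) (h2 : DifferentiableAt ℝ Γ₂ (φ (y t)))
    (hs : ∀ u v, Γ₂ (φ (y t)) u v = Γ₂ (φ (y t)) v u)
    (hgeo : geodOp Γ₁ y t = 0) :
    jacobiOp Γ₂ (φ ∘ y) (fun s => fderiv ℝ φ (y s) (J s)) t =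
      fderiv ℝ φ (y t) (jacobiOp Γ₁ y J t) := by
  have hφ1 := contDiffAt_fderiv hφ
  have hφ2 := contDiffAt_fderiv hφ1
  have dφ : DifferentiableAt ℝ φ (y t) := hφ.differentiableAt (by simp)
  have dφ1 : DifferentiableAt ℝ (fderiv ℝ φ) (y t) := hφ1.differentiableAt (by simp)
  have dφ2 : DifferentiableAt ℝ (fderiv ℝ (fderiv ℝ φ)) (y t) := hφ2.differentiableAt (by simp)
  have dy : HasDerivAt y (deriv y t) t := (hy.differentiableAt (by simp)).hasDerivAt
  have dJ : HasDerivAt J (deriv J t) t := (hJ.differentiableAt (by simp)).hasDerivAt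
  have dy1 : HasDerivAt (deriv y) (deriv (deriv y) t) t :=
    ((contDiffAt_deriv hy).differentiableAt (by simp)).hasDerivAt
  have dJ1 : HasDerivAt (deriv J) (deriv (deriv J) t) t :=
    ((contDiffAt_deriv hJ).differentiableAt (by simp)).hasDerivAt
  set A := fderiv ℝ φ (y t) with hA
  set B := fderiv ℝ (fderiv ℝ φ) (y t) with hB
  set C := fderiv ℝ (fderiv ℝ (fderiv ℝ φ)) (y t) with hC
  have Bs : ∀ a b, B a b = B b a := fun a b => (hφ.isSymmSndFDerivAt (by simp; norm_cast)) a b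
  have Cs1 : ∀ a b, C a b = C b a := fun a b => (hφ1.isSymmSndFDerivAt (by simp; norm_cast)) a b
  have Cs2 : ∀ a b c, C a b c = C a c b := by
    intro a b c
    rw [← (hasFDerivAt_apply_const₂ dφ2 b c a).2, ← (hasFDerivAt_apply_const₂ dφ2 c b a).2]
    congr 1
    apply Filter.EventuallyEq.fderiv_eq
    filter_upwards [(hφ.of_le (m := 2) (by norm_cast)).eventually (by simp)] with z hz
    exact (hz.isSymmSndFDerivAt (by simp)) b c
  -- the derivative of the transformation law
  have key : ∀ w u v, B w (Γ₁ (y t) u v) + A (fderiv ℝ Γ₁ (y t) w u v) =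
      fderiv ℝ Γ₂ (φ (y t)) (A w) (A u) (A v) + Γ₂ (φ (y t)) (B w u) (A v) +
        Γ₂ (φ (y t)) (A u) (B w v) + C w u v := by
    intro w u v
    have e0 : HasFDerivAt (fun z => Γ₁ z u v) _ (y t) :=
      (h1.hasFDerivAt.clm_apply (hasFDerivAt_const u _)).clm_apply (hasFDerivAt_const v _)
    have e1 : HasFDerivAt (fun z => fderiv ℝ φ z (Γ₁ z u v)) _ (y t) :=
      dφ1.hasFDerivAt.clm_apply e0
    have e2 : HasFDerivAt (fun z => Γ₂ (φ z) (fderiv ℝ φ z u) (fderiv ℝ φ z v) +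
        fderiv ℝ (fderiv ℝ φ) z u v) _ (y t) :=
      (((h2.hasFDerivAt.comp (y t) dφ.hasFDerivAt).clm_apply
        (dφ1.hasFDerivAt.clm_apply (hasFDerivAt_const u _))).clm_apply
        (dφ1.hasFDerivAt.clm_apply (hasFDerivAt_const v _))).add
        ((dφ2.hasFDerivAt.clm_apply (hasFDerivAt_const u _)).clm_apply (hasFDerivAt_const v _))
    have e3 := e1.unique (e2.congr_of_eventuallyEq (hΓ.mono fun z hz => hz u v))
    have e4 := congrArg (fun L => L w) e3
    simp at e4
    simp only [← hA, ← hB, ← hC] at e4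
    rw [add_comm] at e4
    rw [e4]
    abel
  have hd1 : deriv (fun s => fderiv ℝ φ (y s) (J s)) =ᶠ[𝓝 t] fun s =>
      fderiv ℝ (fderiv ℝ φ) (y s) (deriv y s) (J s) + fderiv ℝ φ (y s) (deriv J s) := by
    filter_upwards [eventually_differentiableAt hy, eventually_differentiableAt hJ,
      hy.continuousAt.eventually (eventually_differentiableAt hφ1)] with s p1 p2 p3
    exact ((p3.hasFDerivAt.comp_hasDerivAt s p1.hasDerivAt).clm_apply p2.hasDerivAt).deriv
  have hd2 : HasDerivAt (fun s =>
      fderiv ℝ (fderiv ℝ φ) (y s) (deriv y s) (J s) + fderiv ℝ φ (y s) (deriv J s)) _ t :=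
    (((dφ2.hasFDerivAt.comp_hasDerivAt t dy).clm_apply dy1).clm_apply dJ).add
      ((dφ1.hasFDerivAt.comp_hasDerivAt t dy).clm_apply dJ1)
  have hd3 := (deriv_comp_eventually hφ hy).self_of_nhds
  unfold jacobiOp
  rw [hd1.deriv_eq, hd2.deriv, hd1.self_of_nhds, hd3]
  simp only [Function.comp, map_add, map_smul, ← hA, ← hB, ← hC, add_apply]
  have k := key (J t) (deriv y t) (deriv y t)
  -- Linearising `geodOp_comp` leaves an extra term, the Hessian of `φ` on `J` and the geodesic
  -- operator of `y`. It disappears because `y` is a geodesic at `t`.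
  have g1 : deriv (deriv y) t = - Γ₁ (y t) (deriv y t) (deriv y t) :=
    eq_neg_of_add_eq_zero_left hgeo
  rw [g1, hΓ.self_of_nhds]
  simp only [map_neg, ← hA, ← hB]
  rw [Bs (J t) (Γ₁ _ _ _), hs (B (J t) _) (A _), Bs (J t) (deriv y t), Cs1 (J t), Cs2 (deriv y t) (J t)] at k
  have k' := eq_sub_of_add_eq' k
  rw [k']
  simp only [neg_apply]
  module

/-- The velocity of a geodesic is itself a Jacobi field, and its covariant derivative vanishes, so
by the product rule the operator sends `H y'` to `H'' y'`. A tangential error in the Jacobi equation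
can thus be removed by integrating twice. -/
lemma jacobiOp_sub_smul_velocity {H : ℝ → ℝ} (hy : ContDiffAt ℝ ∞ y t)
    (hJ : ContDiffAt ℝ ∞ J t) (hH : ContDiffAt ℝ ∞ H t)
    (h1 : DifferentiableAt ℝ Γ (y t)) (hs : ∀ u v, Γ (y t) u v = Γ (y t) v u)
    (hgeo : ∀ᶠ s in 𝓝 t, geodOp Γ y s = 0) :
    jacobiOp Γ y (fun s => J s - H s • deriv y s) t =
      jacobiOp Γ y J t - deriv (deriv H) t • deriv y t := by
  have hy1 := contDiffAt_deriv hy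
  have dy : HasDerivAt y (deriv y t) t := (hy.differentiableAt (by simp)).hasDerivAt
  have dy1 : HasDerivAt (deriv y) (deriv (deriv y) t) t :=
    (hy1.differentiableAt (by simp)).hasDerivAt
  have dJ1 : HasDerivAt (deriv J) (deriv (deriv J) t) t :=
    ((contDiffAt_deriv hJ).differentiableAt (by simp)).hasDerivAt
  have dH : HasDerivAt H (deriv H t) t := (hH.differentiableAt (by simp)).hasDerivAt
  have dH1 : HasDerivAt (deriv H) (deriv (deriv H) t) t :=
    ((contDiffAt_deriv hH).differentiableAt (by simp)).hasDerivAt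
  have g1 : deriv (deriv y) =ᶠ[𝓝 t] fun s => - Γ (y s) (deriv y s) (deriv y s) := by
    filter_upwards [hgeo] with s hs using eq_neg_of_add_eq_zero_left hs
  have g2 : HasDerivAt (fun s => - Γ (y s) (deriv y s) (deriv y s)) _ t :=
    (((h1.hasFDerivAt.comp_hasDerivAt t dy).clm_apply dy1).clm_apply dy1).neg
  have g3 := g2.congr_of_eventuallyEq g1
  have d1 : deriv (fun s => J s - H s • deriv y s) =ᶠ[𝓝 t] fun s =>
      deriv J s - (H s • deriv (deriv y) s + deriv H s • deriv y s) := by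
    filter_upwards [eventually_differentiableAt hy1, eventually_differentiableAt hJ,
      eventually_differentiableAt hH] with s p1 p2 p3
    exact (p2.hasDerivAt.sub (p3.hasDerivAt.smul p1.hasDerivAt)).deriv
  have d2 : HasDerivAt (fun s =>
      deriv J s - (H s • deriv (deriv y) s + deriv H s • deriv y s)) _ t :=
    dJ1.sub ((dH.smul g3).add (dH1.smul dy1))
  unfold jacobiOp
  rw [d1.deriv_eq, d2.deriv, d1.self_of_nhds, g1.self_of_nhds]
  simp only [map_sub, map_smul, map_add, map_neg, sub_apply, smul_apply, add_apply, neg_apply,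
    Function.comp_apply]
  rw [show deriv (deriv y) t = _ from g1.self_of_nhds,
    hs (Γ (y t) (deriv y t) (deriv y t)) (deriv y t)]
  simp only [map_neg]
  module

end Operators

/-! ### Uniqueness, smoothness and local existence for ordinary differential equations. -/

section ODE

variable {E : Type*} [NormedAddCommGroup E] [NormedSpace ℝ E]

/-- Local uniqueness for `α' = h(t) f(α)`. -/
lemma ode_unique_scaled {f : E → E} {h : ℝ → ℝ} {α β : ℝ → E} {t₀ : ℝ}
    (hf : ContDiffAt ℝ 1 f (α t₀)) (hh : ContinuousAt h t₀)
    (hα : ∀ᶠ t in 𝓝 t₀, HasDerivAt α (h t • f (α t)) t)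
    (hβ : ∀ᶠ t in 𝓝 t₀, HasDerivAt β (h t • f (β t)) t) (h0 : α t₀ = β t₀) : α =ᶠ[𝓝 t₀] β := by
  obtain ⟨K, s, hs, hK⟩ := hf.exists_lipschitzOnWith
  -- Only an upper bound on `h` enters. It may vanish, as it does for curves tangent to the Engel
  -- kernel that stop or turn back.
  have hb : ∀ᶠ t in 𝓝 t₀, ‖h t‖₊ < ‖h t₀‖₊ + 1 :=
    hh.nnnorm.eventually_lt continuousAt_const (by simp)
  refine ODE_solution_unique_of_eventually (v := fun t x => h t • f x) (s := fun _ => s)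
    (K := (‖h t₀‖₊ + 1) * K) ?_ ?_ ?_ h0
  · filter_upwards [hb] with t ht
    refine LipschitzOnWith.of_dist_le_mul fun x hx y hy => ?_
    rw [dist_smul₀]
    have h1 := hK.dist_le_mul x hx y hy
    have h2 : ‖h t‖ ≤ ‖h t₀‖ + 1 := by exact_mod_cast ht.le
    push_cast
    rw [mul_assoc]
    gcongr
  · filter_upwards [hα, hα.self_of_nhds.continuousAt.eventually hs] with t h1 h2 using ⟨h1, h2⟩
  · filter_upwards [hβ, hβ.self_of_nhds.continuousAt.eventually (h0 ▸ hs)] with t h1 h2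
      using ⟨h1, h2⟩

lemma ode_unique {f : E → E} {α β : ℝ → E} {t₀ : ℝ}
    (hf : ContDiffAt ℝ 1 f (α t₀))
    (hα : ∀ᶠ t in 𝓝 t₀, HasDerivAt α (f (α t)) t)
    (hβ : ∀ᶠ t in 𝓝 t₀, HasDerivAt β (f (β t)) t) (h0 : α t₀ = β t₀) : α =ᶠ[𝓝 t₀] β :=
  ode_unique_scaled (h := fun _ => 1) hf continuousAt_const (by simpa using hα)
    (by simpa using hβ) h0

/-- A solution of a linear equation that vanishes at a point vanishes near it. -/
lemma linear_ode_eq_zero {L : ℝ → E →L[ℝ] E} {α : ℝ → E} {t₀ : ℝ} (hL : ContinuousAt L t₀)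
    (hα : ∀ᶠ t in 𝓝 t₀, HasDerivAt α (L t (α t)) t) (h0 : α t₀ = 0) : ∀ᶠ t in 𝓝 t₀, α t = 0 := by
  have hb : ∀ᶠ t in 𝓝 t₀, ‖L t‖₊ < ‖L t₀‖₊ + 1 :=
    hL.nnnorm.eventually_lt continuousAt_const (by simp)
  refine ODE_solution_unique_of_eventually (v := fun t x => L t x) (s := fun _ => univ)
    (K := ‖L t₀‖₊ + 1) (g := fun _ => 0) ?_ ?_ ?_ h0
  · filter_upwards [hb] with t ht
    exact ((L t).lipschitz.weaken ht.le).lipschitzOnWith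
  · filter_upwards [hα] with t h1 using ⟨h1, mem_univ _⟩
  · filter_upwards with t
    simpa using hasDerivAt_const t (0 : E)

/-- Solutions of smooth autonomous equations are smooth. -/
lemma contDiffOn_of_ode {f : E → E} {Ω : Set E} {α : ℝ → E} {I : Set ℝ} (hI : IsOpen I)
    (hf : ContDiffOn ℝ ∞ f Ω) (hΩ : MapsTo α I Ω) (hα : ∀ t ∈ I, HasDerivAt α (f (α t)) t) :
    ContDiffOn ℝ ∞ α I := by
  rw [contDiffOn_infty]
  intro n
  induction n with
  | zero => exact contDiffOn_zero.2 fun t ht => (hα t ht).continuousAt.continuousWithinAt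
  | succ n ih =>
    push_cast
    rw [contDiffOn_succ_iff_deriv_of_isOpen hI]
    refine ⟨fun t ht => (hα t ht).differentiableAt.differentiableWithinAt, by simp, ?_⟩
    exact ((hf.of_le (by exact_mod_cast le_top)).comp ih hΩ).congr fun t ht => (hα t ht).deriv

/-- Local existence of geodesics in coordinates. -/
lemma exists_geodOp_eq_zero [CompleteSpace E] {Γ : E → E →L[ℝ] E →L[ℝ] E} {O : Set E}
    (hO : IsOpen O)
    (hΓ : ContDiffOn ℝ ∞ Γ O) {y₀ : E} (hy₀ : y₀ ∈ O) (v₀ : E) :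
    ∃ (y : ℝ → E) (ε : ℝ), 0 < ε ∧ ContDiffOn ℝ ∞ y (Ioo (-ε) ε) ∧ MapsTo y (Ioo (-ε) ε) O ∧
      (∀ t ∈ Ioo (-ε) ε, geodOp Γ y t = 0) ∧ y 0 = y₀ ∧ deriv y 0 = v₀ := by
  let f : E × E → E × E := fun p => (p.2, -Γ p.1 p.2 p.2)
  have hf : ContDiffOn ℝ ∞ f (O ×ˢ univ) := by
    have h1 : ContDiffOn ℝ ∞ (fun p : E × E => Γ p.1) (O ×ˢ univ) :=
      hΓ.comp contDiff_fst.contDiffOn fun p hp => hp.1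
    have h2 : ContDiffOn ℝ ∞ (fun p : E × E => p.2) (O ×ˢ univ) := contDiff_snd.contDiffOn
    exact h2.prodMk ((h1.clm_apply h2).clm_apply h2).neg
  have hΩ : IsOpen (O ×ˢ (univ : Set E)) := hO.prod isOpen_univ
  have hf0 : ContDiffAt ℝ 1 f (y₀, v₀) :=
    ((hf _ ⟨hy₀, mem_univ _⟩).contDiffAt (hΩ.mem_nhds ⟨hy₀, mem_univ _⟩)).of_le
      (by norm_cast)
  obtain ⟨α, h0, ε, hε, hα⟩ := hf0.exists_forall_mem_closedBall_exists_eq_forall_mem_Ioo_hasDerivAt₀ 0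
  simp only [zero_sub, zero_add] at hα
  have hc : ContinuousAt α 0 := (hα 0 ⟨by linarith, hε⟩).continuousAt
  have hm : ∀ᶠ t in 𝓝 (0 : ℝ), α t ∈ O ×ˢ (univ : Set E) :=
    hc.eventually (hΩ.mem_nhds (by rw [h0]; exact ⟨hy₀, mem_univ _⟩))
  obtain ⟨δ, hδ, hδm⟩ := Metric.eventually_nhds_iff_ball.1 hm
  have hsub : Ioo (-(min ε δ)) (min ε δ) ⊆ Ioo (-ε) ε :=
    Ioo_subset_Ioo (neg_le_neg (min_le_left _ _)) (min_le_left _ _)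
  have hmaps : MapsTo α (Ioo (-(min ε δ)) (min ε δ)) (O ×ˢ (univ : Set E)) := by
    intro t ht
    apply hδm
    rw [Real.ball_eq_Ioo]
    exact ⟨by linarith [ht.1, min_le_right ε δ], by linarith [ht.2, min_le_right ε δ]⟩
  have hs := contDiffOn_of_ode isOpen_Ioo hf hmaps fun t ht => hα t (hsub ht)
  have hfst : ∀ t ∈ Ioo (-(min ε δ)) (min ε δ), HasDerivAt (fun t => (α t).1) (α t).2 t :=
    fun t ht => (hα t (hsub ht)).fst
  have hsnd : ∀ t ∈ Ioo (-(min ε δ)) (min ε δ),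
      HasDerivAt (fun t => (α t).2) (-Γ (α t).1 (α t).2 (α t).2) t :=
    fun t ht => (hα t (hsub ht)).snd
  refine ⟨fun t => (α t).1, min ε δ, lt_min hε hδ, contDiff_fst.comp_contDiffOn hs,
    fun t ht => (hmaps ht).1, fun t ht => ?_, by simp [h0], ?_⟩
  · have e : deriv (fun t => (α t).1) =ᶠ[𝓝 t] fun t => (α t).2 := by
      filter_upwards [isOpen_Ioo.mem_nhds ht] with s hs using (hfst s hs).deriv
    unfold geodOp
    rw [e.deriv_eq, (hsnd t ht).deriv, e.self_of_nhds]
    simp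
  · rw [(hfst 0 (by simp [hε, hδ])).deriv, h0]

/-- Local uniqueness of geodesics in coordinates. -/
lemma geodOp_unique {Γ : E → E →L[ℝ] E →L[ℝ] E} {O : Set E} (hO : IsOpen O)
    (hΓ : ContDiffOn ℝ ∞ Γ O) {y z : ℝ → E} {t₀ : ℝ} (hyO : y t₀ ∈ O)
    (hy : ∀ᶠ t in 𝓝 t₀, ContDiffAt ℝ ∞ y t) (hz : ∀ᶠ t in 𝓝 t₀, ContDiffAt ℝ ∞ z t)
    (gy : ∀ᶠ t in 𝓝 t₀, geodOp Γ y t = 0) (gz : ∀ᶠ t in 𝓝 t₀, geodOp Γ z t = 0)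
    (h0 : y t₀ = z t₀) (h1 : deriv y t₀ = deriv z t₀) : y =ᶠ[𝓝 t₀] z := by
  let f : E × E → E × E := fun p => (p.2, -Γ p.1 p.2 p.2)
  have hf : ContDiffAt ℝ 1 f (y t₀, deriv y t₀) := by
    have h1 : ContDiffAt ℝ ∞ (fun p : E × E => Γ p.1) (y t₀, deriv y t₀) :=
      ((hΓ _ hyO).contDiffAt (hO.mem_nhds hyO)).comp (y t₀, deriv y t₀) contDiffAt_fst
    have h2 : ContDiffAt ℝ ∞ (fun p : E × E => p.2) (y t₀, deriv y t₀) := contDiffAt_snd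
    exact (h2.prodMk ((h1.clm_apply h2).clm_apply h2).neg).of_le (by norm_cast)
  have key : ∀ x : ℝ → E, (∀ᶠ t in 𝓝 t₀, ContDiffAt ℝ ∞ x t) →
      (∀ᶠ t in 𝓝 t₀, geodOp Γ x t = 0) →
      ∀ᶠ t in 𝓝 t₀, HasDerivAt (fun t => (x t, deriv x t)) (f (x t, deriv x t)) t := by
    intro x h1 h2
    filter_upwards [h1, h2] with t h1 h2
    have h3 : deriv (deriv x) t = -Γ (x t) (deriv x t) (deriv x t) :=
      eq_neg_of_add_eq_zero_left h2
    have h4 := ((contDiffAt_deriv h1).differentiableAt (by simp)).hasDerivAt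
    rw [h3] at h4
    exact (h1.differentiableAt (by simp)).hasDerivAt.prodMk h4
  have := ode_unique (α := fun t => (y t, deriv y t)) (β := fun t => (z t, deriv z t)) hf
    (key y hy gy) (key z hz gz) (Prod.ext h0 h1)
  filter_upwards [this] with t ht using (Prod.ext_iff.1 ht).1

end ODE

/-! ### Differentials, velocities, vector fields and Lie brackets in charts, with tangent spaces
read as the model space. -/

section Charts

variable {F : Type*} [NormedAddCommGroup F] [NormedSpace ℝ F]
  {Q : Type*} [TopologicalSpace Q] [ChartedSpace F Q]

/-- The differential of the chart at `q₀`, at the point `q`. -/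
def chartD (q₀ q : Q) : F →L[ℝ] F := mfderiv 𝓘(ℝ, F) 𝓘(ℝ, F) (extChartAt 𝓘(ℝ, F) q₀) q

/-- The differential of the inverse of the chart at `q₀`. -/
def chartDSymm (q₀ : Q) (y : F) : F →L[ℝ] F :=
  mfderiv 𝓘(ℝ, F) 𝓘(ℝ, F) (extChartAt 𝓘(ℝ, F) q₀).symm y

/-- The change of charts. -/
def transition (q₀ q₁ : Q) (y : F) : F := extChartAt 𝓘(ℝ, F) q₁ ((extChartAt 𝓘(ℝ, F) q₀).symm y)

lemma transition_extChartAt {q₀ q₁ q : Q} (h0 : q ∈ (extChartAt 𝓘(ℝ, F) q₀).source) :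
    transition q₀ q₁ (extChartAt 𝓘(ℝ, F) q₀ q) = extChartAt 𝓘(ℝ, F) q₁ q := by
  unfold transition
  rw [(extChartAt 𝓘(ℝ, F) q₀).left_inv h0]

/-- The differential of a map, as a map of the model spaces. -/
def mfd {F' : Type*} [NormedAddCommGroup F'] [NormedSpace ℝ F']
    {Q' : Type*} [TopologicalSpace Q'] [ChartedSpace F' Q'] (f : Q → Q') (q : Q) : F →L[ℝ] F' :=
  mfderiv 𝓘(ℝ, F) 𝓘(ℝ, F') f q

/-- The velocity of a curve, as a vector of the model space. -/
def vel (γ : ℝ → Q) (t : ℝ) : F := mfderiv 𝓘(ℝ, ℝ) 𝓘(ℝ, F) γ t (1 : ℝ)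

variable [IsManifold 𝓘(ℝ, F) ∞ Q]

lemma chartD_chartDSymm {q₀ : Q} {y : F} (hy : y ∈ (extChartAt 𝓘(ℝ, F) q₀).target) (w : F) :
    chartD q₀ ((extChartAt 𝓘(ℝ, F) q₀).symm y) (chartDSymm q₀ y w) = w := by
  have h := mfderiv_extChartAt_comp_mfderivWithin_extChartAt_symm (I := 𝓘(ℝ, F)) hy
  rw [modelWithCornersSelf_coe, range_id, mfderivWithin_univ] at h
  exact congrArg (fun L : F →L[ℝ] F => L w) h

lemma chartDSymm_chartD {q₀ q : Q} (hq : q ∈ (extChartAt 𝓘(ℝ, F) q₀).source) (w : F) :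
    chartDSymm q₀ (extChartAt 𝓘(ℝ, F) q₀ q) (chartD q₀ q w) = w := by
  have h := mfderivWithin_extChartAt_symm_comp_mfderiv_extChartAt' (I := 𝓘(ℝ, F)) hq
  rw [modelWithCornersSelf_coe, range_id, mfderivWithin_univ] at h
  exact congrArg (fun L : F →L[ℝ] F => L w) h

lemma chartD_chartDSymm' {q₀ q : Q} (hq : q ∈ (extChartAt 𝓘(ℝ, F) q₀).source) (w : F) :
    chartD q₀ q (chartDSymm q₀ (extChartAt 𝓘(ℝ, F) q₀ q) w) = w := by
  have h := mfderiv_extChartAt_comp_mfderivWithin_extChartAt_symm' (I := 𝓘(ℝ, F)) hq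
  rw [modelWithCornersSelf_coe, range_id, mfderivWithin_univ] at h
  exact congrArg (fun L : F →L[ℝ] F => L w) h

lemma chartD_self (q : Q) (w : F) : chartD q q w = w :=
  congrArg (fun L : F →L[ℝ] F => L w) (mfderiv_extChartAt_self (I := 𝓘(ℝ, F)) (x := q))

lemma contMDiffAt_extChartAt_symm {q₀ : Q} {y : F} (hy : y ∈ (extChartAt 𝓘(ℝ, F) q₀).target) :
    ContMDiffAt 𝓘(ℝ, F) 𝓘(ℝ, F) ∞ (extChartAt 𝓘(ℝ, F) q₀).symm y :=
  (contMDiffOn_extChartAt_symm q₀ y hy).contMDiffAt ((isOpen_extChartAt_target q₀).mem_nhds hy)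

lemma contMDiffAt_extChartAt_of_mem {q₀ q : Q} (hq : q ∈ (extChartAt 𝓘(ℝ, F) q₀).source) :
    ContMDiffAt 𝓘(ℝ, F) 𝓘(ℝ, F) ∞ (extChartAt 𝓘(ℝ, F) q₀) q :=
  contMDiffAt_extChartAt' (by rwa [extChartAt_source] at hq)

section Maps

variable {F' : Type*} [NormedAddCommGroup F'] [NormedSpace ℝ F']
  {Q' : Type*} [TopologicalSpace Q'] [ChartedSpace F' Q'] [IsManifold 𝓘(ℝ, F') ∞ Q']

/-- The coordinate expression of the differential of a map. -/
lemma fderiv_coord_map {f : Q → Q'} {q₀ q : Q} {r₀ : Q'}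
    (hf : MDifferentiableAt 𝓘(ℝ, F) 𝓘(ℝ, F') f q)
    (hq : q ∈ (extChartAt 𝓘(ℝ, F) q₀).source) (hr : f q ∈ (extChartAt 𝓘(ℝ, F') r₀).source) (w : F) :
    DifferentiableAt ℝ (fun y => extChartAt 𝓘(ℝ, F') r₀ (f ((extChartAt 𝓘(ℝ, F) q₀).symm y)))
      (extChartAt 𝓘(ℝ, F) q₀ q) ∧
    fderiv ℝ (fun y => extChartAt 𝓘(ℝ, F') r₀ (f ((extChartAt 𝓘(ℝ, F) q₀).symm y)))
      (extChartAt 𝓘(ℝ, F) q₀ q) (chartD q₀ q w) =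
      chartD r₀ (f q) (mfd f q w) := by
  have hy := (extChartAt 𝓘(ℝ, F) q₀).map_source hq
  have hx := (extChartAt 𝓘(ℝ, F) q₀).left_inv hq
  have h1 : MDifferentiableAt 𝓘(ℝ, F) 𝓘(ℝ, F) (extChartAt 𝓘(ℝ, F) q₀).symm
      (extChartAt 𝓘(ℝ, F) q₀ q) := (contMDiffAt_extChartAt_symm hy).mdifferentiableAt (by simp)
  have h2 : MDifferentiableAt 𝓘(ℝ, F) 𝓘(ℝ, F') f
    ((extChartAt 𝓘(ℝ, F) q₀).symm (extChartAt 𝓘(ℝ, F) q₀ q)) := by rwa [hx]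
  have h3 : MDifferentiableAt 𝓘(ℝ, F') 𝓘(ℝ, F') (extChartAt 𝓘(ℝ, F') r₀)
    (f ((extChartAt 𝓘(ℝ, F) q₀).symm (extChartAt 𝓘(ℝ, F) q₀ q))) := by
    rw [hx]; exact (contMDiffAt_extChartAt_of_mem hr).mdifferentiableAt (by simp)
  let L : F →L[ℝ] F' :=
    (chartD r₀ (f ((extChartAt 𝓘(ℝ, F) q₀).symm (extChartAt 𝓘(ℝ, F) q₀ q)))) ∘L
        ((mfd f ((extChartAt 𝓘(ℝ, F) q₀).symm (extChartAt 𝓘(ℝ, F) q₀ q))) ∘L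
          (chartDSymm q₀ (extChartAt 𝓘(ℝ, F) q₀ q)))
  have h5 : HasFDerivAt (fun y => extChartAt 𝓘(ℝ, F') r₀ (f ((extChartAt 𝓘(ℝ, F) q₀).symm y)))
      L (extChartAt 𝓘(ℝ, F) q₀ q) := hasMFDerivAt_iff_hasFDerivAt.1
    (h3.hasMFDerivAt.comp (extChartAt 𝓘(ℝ, F) q₀ q)
      (h2.hasMFDerivAt.comp (extChartAt 𝓘(ℝ, F) q₀ q) h1.hasMFDerivAt))
  refine ⟨h5.differentiableAt, ?_⟩
  rw [h5.fderiv]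
  simp only [L, ContinuousLinearMap.comp_apply]
  rw [chartDSymm_chartD hq, hx]

/-- Smoothness of a map in charts. -/
lemma contDiffAt_coord_map {f : Q → Q'} {q₀ q : Q} {r₀ : Q'}
    (hf : ContMDiffAt 𝓘(ℝ, F) 𝓘(ℝ, F') ∞ f q)
    (hq : q ∈ (extChartAt 𝓘(ℝ, F) q₀).source) (hr : f q ∈ (extChartAt 𝓘(ℝ, F') r₀).source) :
    ContDiffAt ℝ ∞ (fun y => extChartAt 𝓘(ℝ, F') r₀ (f ((extChartAt 𝓘(ℝ, F) q₀).symm y)))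
      (extChartAt 𝓘(ℝ, F) q₀ q) := by
  have hy := (extChartAt 𝓘(ℝ, F) q₀).map_source hq
  have hx := (extChartAt 𝓘(ℝ, F) q₀).left_inv hq
  rw [← contMDiffAt_iff_contDiffAt]
  have h1 := contMDiffAt_extChartAt_symm hy
  refine ContMDiffAt.comp _ (g := fun z => extChartAt 𝓘(ℝ, F') r₀ (f z)) ?_ h1
  rw [hx]
  exact (contMDiffAt_extChartAt_of_mem hr).comp q hf

end Maps

lemma contDiffAt_transition {q₀ q₁ q : Q} (h0 : q ∈ (extChartAt 𝓘(ℝ, F) q₀).source)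
    (h1 : q ∈ (extChartAt 𝓘(ℝ, F) q₁).source) :
    ContDiffAt ℝ ∞ (transition q₀ q₁) (extChartAt 𝓘(ℝ, F) q₀ q) :=
  contDiffAt_coord_map (f := id) contMDiffAt_id h0 h1

lemma fderiv_transition {q₀ q₁ q : Q} (h0 : q ∈ (extChartAt 𝓘(ℝ, F) q₀).source)
    (h1 : q ∈ (extChartAt 𝓘(ℝ, F) q₁).source) (w : F) :
    fderiv ℝ (transition q₀ q₁) (extChartAt 𝓘(ℝ, F) q₀ q) (chartD q₀ q w) = chartD q₁ q w := by
  have := (fderiv_coord_map (f := id) mdifferentiableAt_id h0 h1 w).2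
  unfold mfd at this
  rwa [mfderiv_id] at this

lemma chartD_injective {q₀ q : Q} (hq : q ∈ (extChartAt 𝓘(ℝ, F) q₀).source) :
    Function.Injective (chartD q₀ q : F →L[ℝ] F) := fun a b h => by
  rw [← chartDSymm_chartD hq a, ← chartDSymm_chartD hq b, h]

section Curves

/-- The velocity of a curve in a chart. -/
lemma hasDerivAt_coord_curve {γ : ℝ → Q} {t : ℝ} {q₀ : Q}
    (hγ : MDifferentiableAt 𝓘(ℝ, ℝ) 𝓘(ℝ, F) γ t)
    (h : γ t ∈ (extChartAt 𝓘(ℝ, F) q₀).source) :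
    HasDerivAt (fun s => extChartAt 𝓘(ℝ, F) q₀ (γ s))
      (chartD q₀ (γ t) (vel γ t)) t := by
  have h3 := ((contMDiffAt_extChartAt_of_mem h).mdifferentiableAt (by simp)).hasMFDerivAt
  let L : ℝ →L[ℝ] F := (chartD q₀ (γ t)) ∘L (mfderiv 𝓘(ℝ, ℝ) 𝓘(ℝ, F) γ t : ℝ →L[ℝ] F)
  have h4 : HasFDerivAt (fun s => extChartAt 𝓘(ℝ, F) q₀ (γ s)) L t :=
    hasMFDerivAt_iff_hasFDerivAt.1 (h3.comp t hγ.hasMFDerivAt)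
  exact h4.hasDerivAt

lemma contDiffAt_coord_curve {γ : ℝ → Q} {t : ℝ} {q₀ : Q}
    (hγ : ContMDiffAt 𝓘(ℝ, ℝ) 𝓘(ℝ, F) ∞ γ t)
    (h : γ t ∈ (extChartAt 𝓘(ℝ, F) q₀).source) :
    ContDiffAt ℝ ∞ (fun s => extChartAt 𝓘(ℝ, F) q₀ (γ s)) t := by
  rw [← contMDiffAt_iff_contDiffAt]
  exact (contMDiffAt_extChartAt_of_mem h).comp t hγ

/-- A curve that is smooth in a chart is smooth. -/
lemma contMDiffAt_of_coord_curve {γ : ℝ → Q} {t : ℝ} {q₀ : Q} {y : ℝ → F}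
    (hy : ContDiffAt ℝ ∞ y t) (hyt : y t ∈ (extChartAt 𝓘(ℝ, F) q₀).target)
    (h : γ =ᶠ[𝓝 t] fun s => (extChartAt 𝓘(ℝ, F) q₀).symm (y s)) :
    ContMDiffAt 𝓘(ℝ, ℝ) 𝓘(ℝ, F) ∞ γ t :=
  ((contMDiffAt_extChartAt_symm hyt).comp t hy.contMDiffAt).congr_of_eventuallyEq h

end Curves

section Fields

/-- Smoothness and continuity in the tangent bundle are tested in its trivialisations, while all
computations use differentials of charts. This identifies the two. -/
lemma chartD_eq_trivialization {q₀ q : Q} (hq : q ∈ (extChartAt 𝓘(ℝ, F) q₀).source)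
    (w : F) :
    chartD q₀ q w = (trivializationAt F (TangentSpace 𝓘(ℝ, F)) q₀ ⟨q, w⟩).2 := by
  have h3 : q ∈ (chartAt F q₀).source := by rwa [← extChartAt_source 𝓘(ℝ, F)]
  have h4 := TangentBundle.continuousLinearMapAt_trivializationAt (I := 𝓘(ℝ, F)) h3
  have h5 := congrArg (fun L : TangentSpace 𝓘(ℝ, F) q →L[ℝ] F => L w) h4
  have h6 : ∀ v : TangentSpace 𝓘(ℝ, F) q,
      (trivializationAt F (TangentSpace 𝓘(ℝ, F)) q₀).continuousLinearMapAt ℝ q v =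
        (trivializationAt F (TangentSpace 𝓘(ℝ, F)) q₀ ⟨q, v⟩).2 := by
    intro v
    rw [Trivialization.continuousLinearMapAt_apply, Trivialization.linearMapAt_apply,
      if_pos (by rwa [TangentBundle.trivializationAt_baseSet])]
  exact h5.symm.trans (h6 w)

/-- A vector field in the chart at `q₀`. -/
def coordVectorField (q₀ : Q) (X : ∀ q : Q, TangentSpace 𝓘(ℝ, F) q) (y : F) : F :=
  chartD q₀ ((extChartAt 𝓘(ℝ, F) q₀).symm y) (X ((extChartAt 𝓘(ℝ, F) q₀).symm y))

lemma contDiffOn_coordVectorField {X : ∀ q : Q, TangentSpace 𝓘(ℝ, F) q} {U : Set Q} (hU : IsOpen U)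
    (hX : ContMDiffOn 𝓘(ℝ, F) 𝓘(ℝ, F).tangent ∞
      (fun q => (⟨q, X q⟩ : TangentBundle 𝓘(ℝ, F) Q)) U) (q₀ : Q) :
    ContDiffOn ℝ ∞ (coordVectorField q₀ X)
      {y | y ∈ (extChartAt 𝓘(ℝ, F) q₀).target ∧ (extChartAt 𝓘(ℝ, F) q₀).symm y ∈ U} := by
  rw [← contMDiffOn_iff_contDiffOn]
  have h0 : IsOpen ((chartAt F q₀).source ∩ U) := (chartAt F q₀).open_source.inter hU
  have h1 := ((trivializationAt F (TangentSpace 𝓘(ℝ, F)) q₀).contMDiffOn_section_iff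
    (IB := 𝓘(ℝ, F)) (n := ∞) (s := X) h0 (by
      rw [TangentBundle.trivializationAt_baseSet]; exact inter_subset_left)).1
    (ContMDiffOn.mono hX inter_subset_right)
  have h5 : ContMDiffOn 𝓘(ℝ, F) 𝓘(ℝ, F) ∞ (extChartAt 𝓘(ℝ, F) q₀).symm
      {y | y ∈ (extChartAt 𝓘(ℝ, F) q₀).target ∧ (extChartAt 𝓘(ℝ, F) q₀).symm y ∈ U} :=
    (contMDiffOn_extChartAt_symm q₀).mono fun y hy => hy.1
  have h2 := h1.comp h5 (fun y hy => ⟨by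
      rw [← extChartAt_source 𝓘(ℝ, F)]
      exact (extChartAt 𝓘(ℝ, F) q₀).map_target hy.1, hy.2⟩)
  refine h2.congr fun y hy => ?_
  exact chartD_eq_trivialization ((extChartAt 𝓘(ℝ, F) q₀).map_target hy.1) _

/-- The vector field with given coordinates in the chart at `q₀`. -/
def fieldOfCoord (q₀ : Q) (X : F → F) (q : Q) : TangentSpace 𝓘(ℝ, F) q :=
  chartDSymm q₀ (extChartAt 𝓘(ℝ, F) q₀ q) (X (extChartAt 𝓘(ℝ, F) q₀ q))

lemma contMDiffOn_fieldOfCoord {X : F → F} {q₀ : Q} {Ω : Set F} (hΩ : IsOpen Ω)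
    (hX : ContDiffOn ℝ ∞ X Ω) :
    ContMDiffOn 𝓘(ℝ, F) 𝓘(ℝ, F).tangent ∞
      (fun q => (⟨q, fieldOfCoord q₀ X q⟩ : TangentBundle 𝓘(ℝ, F) Q))
      ((extChartAt 𝓘(ℝ, F) q₀).source ∩ extChartAt 𝓘(ℝ, F) q₀ ⁻¹' Ω) := by
  have h0 : IsOpen ((extChartAt 𝓘(ℝ, F) q₀).source ∩ extChartAt 𝓘(ℝ, F) q₀ ⁻¹' Ω) :=
    isOpen_extChartAt_preimage' q₀ hΩ
  refine ((trivializationAt F (TangentSpace 𝓘(ℝ, F)) q₀).contMDiffOn_section_iff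
    (IB := 𝓘(ℝ, F)) (n := ∞) (s := fieldOfCoord q₀ X) h0 (by
      rw [TangentBundle.trivializationAt_baseSet, extChartAt_source]; exact inter_subset_left)).2 ?_
  have h1 : ContMDiffOn 𝓘(ℝ, F) 𝓘(ℝ, F) ∞ (fun q : Q => X (extChartAt 𝓘(ℝ, F) q₀ q))
      ((extChartAt 𝓘(ℝ, F) q₀).source ∩ extChartAt 𝓘(ℝ, F) q₀ ⁻¹' Ω) :=
    (contMDiffOn_iff_contDiffOn.2 hX).comp ((contMDiffOn_extChartAt (n := ∞) (x := q₀)).mono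
      (by rw [extChartAt_source]; exact inter_subset_left)) fun q hq => hq.2
  refine h1.congr fun q hq => ?_
  refine Eq.trans (chartD_eq_trivialization hq.1 _).symm ?_
  exact chartD_chartDSymm' hq.1 (X (extChartAt 𝓘(ℝ, F) q₀ q))

/-- The Lie bracket of vector fields in the chart at `q₀`. -/
lemma chartD_mlieBracket [CompleteSpace F] {X Y : ∀ q : Q, TangentSpace 𝓘(ℝ, F) q} {q₀ q : Q}
    (hq : q ∈ (extChartAt 𝓘(ℝ, F) q₀).source)
    (hX : ContMDiffAt 𝓘(ℝ, F) 𝓘(ℝ, F).tangent ∞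
      (fun q => (⟨q, X q⟩ : TangentBundle 𝓘(ℝ, F) Q)) q)
    (hY : ContMDiffAt 𝓘(ℝ, F) 𝓘(ℝ, F).tangent ∞
      (fun q => (⟨q, Y q⟩ : TangentBundle 𝓘(ℝ, F) Q)) q) :
    chartD q₀ q (show F from VectorField.mlieBracket 𝓘(ℝ, F) X Y q) =
      VectorField.lieBracket ℝ (coordVectorField q₀ X) (coordVectorField q₀ Y)
        (extChartAt 𝓘(ℝ, F) q₀ q) := by
  have hy := (extChartAt 𝓘(ℝ, F) q₀).map_source hq
  have hx := (extChartAt 𝓘(ℝ, F) q₀).left_inv hq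
  -- Pulling a field back by the inverse chart uses the inverse of the differential of that map.
  -- Identifying it with the differential of the chart makes the pullback the coordinate expression,
  -- and brackets commute with pullbacks.
  have inv : ∀ y ∈ (extChartAt 𝓘(ℝ, F) q₀).target, ∀ w,
      ContinuousLinearMap.inverse (chartDSymm q₀ y) w =
        chartD q₀ ((extChartAt 𝓘(ℝ, F) q₀).symm y) w := by
    intro y hy w
    have e1 : (chartDSymm q₀ y) ∘L (chartD q₀ ((extChartAt 𝓘(ℝ, F) q₀).symm y)) =
        ContinuousLinearMap.id ℝ F := by
      ext v
      have := chartDSymm_chartD (q₀ := q₀) ((extChartAt 𝓘(ℝ, F) q₀).map_target hy) v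
      rwa [(extChartAt 𝓘(ℝ, F) q₀).right_inv hy] at this
    have e2 : (chartD q₀ ((extChartAt 𝓘(ℝ, F) q₀).symm y)) ∘L (chartDSymm q₀ y) =
        ContinuousLinearMap.id ℝ F := by
      ext v
      exact chartD_chartDSymm hy v
    rw [ContinuousLinearMap.inverse_eq e1 e2]
  have pull : ∀ Z : ∀ q : Q, TangentSpace 𝓘(ℝ, F) q,
      VectorField.mpullback 𝓘(ℝ, F) 𝓘(ℝ, F) (extChartAt 𝓘(ℝ, F) q₀).symm Z =ᶠ[
        𝓝 (extChartAt 𝓘(ℝ, F) q₀ q)] coordVectorField q₀ Z := by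
    intro Z
    filter_upwards [(isOpen_extChartAt_target q₀).mem_nhds hy] with y hy
    exact inv y hy _
  have : IsManifold 𝓘(ℝ, F) (minSmoothness ℝ 2) Q := by
    rw [minSmoothness_of_isRCLikeNormedField]
    exact IsManifold.of_le (n := ∞) (by norm_cast)
  have h1 := VectorField.mpullback_mlieBracket (n := ∞) (I := 𝓘(ℝ, F)) (I' := 𝓘(ℝ, F))
    (f := (extChartAt 𝓘(ℝ, F) q₀).symm) (x₀ := extChartAt 𝓘(ℝ, F) q₀ q) (V := X) (W := Y)
    (by rw [hx]; exact hX.mdifferentiableAt (by simp))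
    (by rw [hx]; exact hY.mdifferentiableAt (by simp)) (contMDiffAt_extChartAt_symm hy)
    (by rw [minSmoothness_of_isRCLikeNormedField]; norm_cast)
  have h2 := h1.trans (Filter.EventuallyEq.mlieBracket_vectorField_eq (pull X) (pull Y))
  have h3 := congrFun (VectorField.mlieBracketWithin_eq_lieBracketWithin (𝕜 := ℝ) (s := univ)
    (V := coordVectorField q₀ X) (W := coordVectorField q₀ Y)) (extChartAt 𝓘(ℝ, F) q₀ q)
  have h5 : VectorField.lieBracketWithin ℝ (coordVectorField q₀ X) (coordVectorField q₀ Y) univ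
      (extChartAt 𝓘(ℝ, F) q₀ q) = VectorField.lieBracket ℝ (coordVectorField q₀ X)
        (coordVectorField q₀ Y) (extChartAt 𝓘(ℝ, F) q₀ q) := by
    rw [VectorField.lieBracketWithin_univ]
  have h4 := h2.trans ((congrFun VectorField.mlieBracketWithin_univ _).symm.trans (h3.trans h5))
  refine Eq.trans ?_ h4
  refine Eq.trans ?_ (inv _ hy _).symm
  rw [hx]

end Fields

end Charts

/-! ### The metric, the geodesic equation and the Jacobi equation in charts of M. -/

section

variable {M : Type*} [TopologicalSpace M] [ChartedSpace E3 M] [IsManifold 𝓘(ℝ, E3) ∞ M]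

section ChartMetric

/-- The metric as a bilinear form on the model space. -/
def LorentzMetric.form (g : LorentzMetric M) (x : M) : E3 →L[ℝ] E3 →L[ℝ] ℝ := g.val x

variable (g : LorentzMetric M)

lemma LorentzMetric.form_symm (x : M) (u v : E3) : g.form x u v = g.form x v u := g.symm x u v

lemma LorentzMetric.form_nondegenerate (x : M) {u : E3} (h : ∀ v, g.form x u v = 0) : u = 0 := by
  obtain ⟨V, Y, T, hVV, hYY, hTT, hVY, hVT, hYT⟩ := g.signature x
  have h1 : (u : TangentSpace 𝓘(ℝ, E3) x) = _ := g.expand x hVV hYY hTT hVY hVT hYT u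
  have e : ∀ W : TangentSpace 𝓘(ℝ, E3) x, g.val x u W = 0 := fun W => h W
  rw [e, e, e] at h1
  refine h1.trans ?_
  simp
  rfl

lemma chartMetric_apply (x₀ : M) (y u v : E3) : chartMetric g x₀ y u v =
    g.form ((extChartAt 𝓘(ℝ, E3) x₀).symm y) (chartDSymm x₀ y u) (chartDSymm x₀ y v) := rfl

lemma chartMetric_chartD {x₀ x : M} (hx : x ∈ (extChartAt 𝓘(ℝ, E3) x₀).source) (u v : E3) :
    chartMetric g x₀ (extChartAt 𝓘(ℝ, E3) x₀ x) (chartD x₀ x u) (chartD x₀ x v) =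
      g.form x u v := by
  rw [chartMetric_apply, chartDSymm_chartD hx, chartDSymm_chartD hx,
    (extChartAt 𝓘(ℝ, E3) x₀).left_inv hx]

lemma chartMetric_symm (x₀ : M) (y u v : E3) :
    chartMetric g x₀ y u v = chartMetric g x₀ y v u := by
  rw [chartMetric_apply, chartMetric_apply, g.form_symm]

lemma contDiffOn_chartMetric (x₀ : M) :
    ContDiffOn ℝ ∞ (chartMetric g x₀) (extChartAt 𝓘(ℝ, E3) x₀).target := by
  rw [contDiffOn_clm_apply]
  intro u
  rw [contDiffOn_clm_apply]
  intro v
  have h1 : ∀ u : E3, SmoothFieldOn (fieldOfCoord x₀ fun _ => u)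
      (extChartAt 𝓘(ℝ, E3) x₀).source := by
    intro u
    have := contMDiffOn_fieldOfCoord (q₀ := x₀) isOpen_univ
      (contDiffOn_const (c := u) (s := univ) (n := ∞))
    simp only [preimage_univ, inter_univ] at this
    exact this
  have h2 := (g.smooth_apply (h1 u) (h1 v)).comp (contMDiffOn_extChartAt_symm (I := 𝓘(ℝ, E3)) x₀)
    fun y hy => (extChartAt 𝓘(ℝ, E3) x₀).map_target hy
  refine (contMDiffOn_iff_contDiffOn.1 h2).congr fun y hy => ?_
  have h3 : ∀ w : E3, fieldOfCoord x₀ (fun _ => w) ((extChartAt 𝓘(ℝ, E3) x₀).symm y) =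
      chartDSymm x₀ y w := by
    intro w
    unfold fieldOfCoord
    rw [(extChartAt 𝓘(ℝ, E3) x₀).right_inv hy]
  refine (chartMetric_apply g x₀ y u v).trans ?_
  rw [← h3, ← h3]
  rfl

lemma isInvertible_of_nondegenerate {B : E3 →L[ℝ] E3 →L[ℝ] ℝ}
    (h : ∀ u, (∀ v, B u v = 0) → u = 0) : B.IsInvertible := by
  have hinj : Function.Injective (B : E3 →ₗ[ℝ] E3 →L[ℝ] ℝ) := by
    rw [injective_iff_map_eq_zero]
    intro u hu
    exact h u fun v => by
      have : B u = 0 := hu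
      rw [this]; simp
  have hrank : Module.finrank ℝ E3 = Module.finrank ℝ (E3 →L[ℝ] ℝ) := by
    rw [← (LinearMap.toContinuousLinearMap (𝕜 := ℝ) (E := E3) (F' := ℝ)).finrank_eq,
      Module.finrank_linearMap]
    simp
  refine ⟨(LinearEquiv.ofInjectiveOfFinrankEq _ hinj hrank).toContinuousLinearEquiv, ?_⟩
  ext u v
  rfl

lemma chartMetric_isInvertible (x₀ : M) {y : E3} (hy : y ∈ (extChartAt 𝓘(ℝ, E3) x₀).target) :
    (chartMetric g x₀ y).IsInvertible := by
  refine isInvertible_of_nondegenerate fun u hu => ?_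
  have h1 : chartDSymm x₀ y u = 0 := by
    refine g.form_nondegenerate ((extChartAt 𝓘(ℝ, E3) x₀).symm y) fun v => ?_
    have h2 := hu (chartD x₀ ((extChartAt 𝓘(ℝ, E3) x₀).symm y) v)
    rw [chartMetric_apply] at h2
    have h3 := chartDSymm_chartD ((extChartAt 𝓘(ℝ, E3) x₀).map_target hy) v
    rw [(extChartAt 𝓘(ℝ, E3) x₀).right_inv hy] at h3
    rwa [h3] at h2
  rw [← chartD_chartDSymm hy u, h1, map_zero]

/-- The Christoffel map in the chart at `x₀`. -/
def chartGamma (x₀ : M) : E3 → E3 →L[ℝ] E3 →L[ℝ] E3 := christoffelCLM (chartMetric g x₀)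

lemma contDiffOn_chartGamma (x₀ : M) :
    ContDiffOn ℝ ∞ (chartGamma g x₀) (extChartAt 𝓘(ℝ, E3) x₀).target :=
  contDiffOn_christoffelCLM (isOpen_extChartAt_target x₀) (contDiffOn_chartMetric g x₀)
    fun _ hy => chartMetric_isInvertible g x₀ hy

lemma contDiffAt_chartMetric (x₀ : M) {y : E3} (hy : y ∈ (extChartAt 𝓘(ℝ, E3) x₀).target) :
    ContDiffAt ℝ ∞ (chartMetric g x₀) y :=
  (contDiffOn_chartMetric g x₀ y hy).contDiffAt ((isOpen_extChartAt_target x₀).mem_nhds hy)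

lemma contDiffAt_chartGamma (x₀ : M) {y : E3} (hy : y ∈ (extChartAt 𝓘(ℝ, E3) x₀).target) :
    ContDiffAt ℝ ∞ (chartGamma g x₀) y :=
  (contDiffOn_chartGamma g x₀ y hy).contDiffAt ((isOpen_extChartAt_target x₀).mem_nhds hy)

lemma chartGamma_symm (x₀ : M) {y : E3} (hy : y ∈ (extChartAt 𝓘(ℝ, E3) x₀).target) (u v : E3) :
    chartGamma g x₀ y u v = chartGamma g x₀ y v u :=
  christoffel_symm (isOpen_extChartAt_target x₀)
    ((contDiffOn_chartMetric g x₀).differentiableOn (by simp))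
    (fun y _ u v => chartMetric_symm g x₀ y u v)
    (fun _ hy => chartMetric_isInvertible g x₀ hy) hy u v

lemma christoffel_chartMetric (x₀ : M) {y : E3} (hy : y ∈ (extChartAt 𝓘(ℝ, E3) x₀).target)
    (u v : E3) : christoffel (chartMetric g x₀) y u v = chartGamma g x₀ y u v :=
  christoffel_eq ((contDiffAt_chartMetric g x₀ hy).differentiableAt (by simp)) u v

lemma extChartAt_eventually {x₀ x₁ x : M} (h0 : x ∈ (extChartAt 𝓘(ℝ, E3) x₀).source)
    (h1 : x ∈ (extChartAt 𝓘(ℝ, E3) x₁).source) :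
    ∀ᶠ z in 𝓝 (extChartAt 𝓘(ℝ, E3) x₀ x), ∃ x', x' ∈ (extChartAt 𝓘(ℝ, E3) x₀).source ∧
      x' ∈ (extChartAt 𝓘(ℝ, E3) x₁).source ∧ extChartAt 𝓘(ℝ, E3) x₀ x' = z := by
  have hy := (extChartAt 𝓘(ℝ, E3) x₀).map_source h0
  have hc : ContinuousAt (extChartAt 𝓘(ℝ, E3) x₀).symm (extChartAt 𝓘(ℝ, E3) x₀ x) :=
    (contMDiffAt_extChartAt_symm hy).continuousAt
  have h2 : (extChartAt 𝓘(ℝ, E3) x₁).source ∈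
      𝓝 ((extChartAt 𝓘(ℝ, E3) x₀).symm (extChartAt 𝓘(ℝ, E3) x₀ x)) := by
    rw [(extChartAt 𝓘(ℝ, E3) x₀).left_inv h0]
    exact (isOpen_extChartAt_source x₁).mem_nhds h1
  filter_upwards [(isOpen_extChartAt_target x₀).mem_nhds hy, hc.eventually h2] with z h3 h4
  exact ⟨_, (extChartAt 𝓘(ℝ, E3) x₀).map_target h3, h4, (extChartAt 𝓘(ℝ, E3) x₀).right_inv h3⟩

/-- Both coordinate metrics come from the same `g`, so the change of charts is an isometry between
them and `christoffel_covariant` applies. -/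
lemma chartGamma_transition {x₀ x₁ x : M} (h0 : x ∈ (extChartAt 𝓘(ℝ, E3) x₀).source)
    (h1 : x ∈ (extChartAt 𝓘(ℝ, E3) x₁).source) (u v : E3) :
    fderiv ℝ (transition x₀ x₁) (extChartAt 𝓘(ℝ, E3) x₀ x)
        (chartGamma g x₀ (extChartAt 𝓘(ℝ, E3) x₀ x) u v) =
      chartGamma g x₁ (transition x₀ x₁ (extChartAt 𝓘(ℝ, E3) x₀ x))
        (fderiv ℝ (transition x₀ x₁) (extChartAt 𝓘(ℝ, E3) x₀ x) u)
        (fderiv ℝ (transition x₀ x₁) (extChartAt 𝓘(ℝ, E3) x₀ x) v) +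
      fderiv ℝ (fderiv ℝ (transition x₀ x₁)) (extChartAt 𝓘(ℝ, E3) x₀ x) u v := by
  have hy0 := (extChartAt 𝓘(ℝ, E3) x₀).map_source h0
  have hy1 := (extChartAt 𝓘(ℝ, E3) x₁).map_source h1
  have ht : transition x₀ x₁ (extChartAt 𝓘(ℝ, E3) x₀ x) ∈ (extChartAt 𝓘(ℝ, E3) x₁).target := by
    rwa [transition_extChartAt h0]
  refine christoffel_covariant (contDiffAt_transition h0 h1) ?_ ?_
    ((contDiffAt_chartMetric g x₀ hy0).differentiableAt (by simp))
    ((contDiffAt_chartMetric g x₁ ht).differentiableAt (by simp))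
    (fun u v => chartMetric_symm g x₁ _ u v) (chartMetric_isInvertible g x₀ hy0)
    (chartMetric_isInvertible g x₁ ht) u v
  · intro w
    refine ⟨chartD x₀ x (chartDSymm x₁ (extChartAt 𝓘(ℝ, E3) x₁ x) w), ?_⟩
    rw [fderiv_transition h0 h1, chartD_chartDSymm' h1]
  · filter_upwards [extChartAt_eventually h0 h1] with z hz u v
    obtain ⟨x', h0', h1', rfl⟩ := hz
    rw [← chartD_chartDSymm' h0' u, ← chartD_chartDSymm' h0' v, fderiv_transition h0' h1',
      fderiv_transition h0' h1', transition_extChartAt h0', chartMetric_chartD g h0',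
      chartMetric_chartD g h1']

end ChartMetric

section CurvesInCharts

variable {g : LorentzMetric M} {γ : ℝ → M} {t : ℝ} {x₀ x₁ : M}

lemma contDiffAt_coordCurve (hγ : ContMDiffAt 𝓘(ℝ, ℝ) 𝓘(ℝ, E3) ∞ γ t)
    (h : γ t ∈ (extChartAt 𝓘(ℝ, E3) x₀).source) : ContDiffAt ℝ ∞ (coordCurve x₀ γ) t :=
  contDiffAt_coord_curve hγ h

lemma deriv_coordCurve (hγ : ContMDiffAt 𝓘(ℝ, ℝ) 𝓘(ℝ, E3) ∞ γ t)
    (h : γ t ∈ (extChartAt 𝓘(ℝ, E3) x₀).source) :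
    deriv (coordCurve x₀ γ) t = chartD x₀ (γ t) (vel γ t) :=
  (hasDerivAt_coord_curve (hγ.mdifferentiableAt (by simp)) h).deriv

omit [IsManifold 𝓘(ℝ, E3) ∞ M] in
lemma eventually_mem_chart (hγ : ContMDiffAt 𝓘(ℝ, ℝ) 𝓘(ℝ, E3) ∞ γ t)
    (h : γ t ∈ (extChartAt 𝓘(ℝ, E3) x₀).source) :
    ∀ᶠ s in 𝓝 t, γ s ∈ (extChartAt 𝓘(ℝ, E3) x₀).source :=
  hγ.continuousAt.eventually ((isOpen_extChartAt_source x₀).mem_nhds h)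

omit [IsManifold 𝓘(ℝ, E3) ∞ M] in
lemma coordCurve_transition (hγ : ContMDiffAt 𝓘(ℝ, ℝ) 𝓘(ℝ, E3) ∞ γ t)
    (h0 : γ t ∈ (extChartAt 𝓘(ℝ, E3) x₀).source) :
    coordCurve x₁ γ =ᶠ[𝓝 t] transition x₀ x₁ ∘ coordCurve x₀ γ := by
  filter_upwards [eventually_mem_chart hγ h0] with s hs
  exact (transition_extChartAt hs).symm

lemma geodOp_congr {Γ : E3 → E3 →L[ℝ] E3 →L[ℝ] E3} {y z : ℝ → E3} (h : y =ᶠ[𝓝 t] z) :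
    geodOp Γ y t = geodOp Γ z t := by
  unfold geodOp
  rw [h.deriv.deriv_eq, h.deriv_eq, h.self_of_nhds]

lemma jacobiOp_congr {Γ : E3 → E3 →L[ℝ] E3 →L[ℝ] E3} {y z J K : ℝ → E3} (h : y =ᶠ[𝓝 t] z)
    (hJ : J =ᶠ[𝓝 t] K) : jacobiOp Γ y J t = jacobiOp Γ z K t := by
  unfold jacobiOp
  rw [hJ.deriv.deriv_eq, hJ.deriv_eq, h.deriv_eq, h.self_of_nhds, hJ.self_of_nhds]

/-- The geodesic operator is independent of the chart. -/
lemma geodOp_chart (hγ : ContMDiffAt 𝓘(ℝ, ℝ) 𝓘(ℝ, E3) ∞ γ t)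
    (h0 : γ t ∈ (extChartAt 𝓘(ℝ, E3) x₀).source) (h1 : γ t ∈ (extChartAt 𝓘(ℝ, E3) x₁).source) :
    geodOp (chartGamma g x₁) (coordCurve x₁ γ) t =
      fderiv ℝ (transition x₀ x₁) (coordCurve x₀ γ t)
        (geodOp (chartGamma g x₀) (coordCurve x₀ γ) t) := by
  rw [geodOp_congr (coordCurve_transition hγ h0)]
  exact geodOp_comp (contDiffAt_transition h0 h1) (contDiffAt_coordCurve hγ h0)
    (chartGamma_transition g h0 h1)

lemma covDeriv_velocity (h0 : γ t ∈ (extChartAt 𝓘(ℝ, E3) x₀).source) :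
    covDeriv (chartMetric g x₀) (coordCurve x₀ γ) (deriv (coordCurve x₀ γ)) t =
      geodOp (chartGamma g x₀) (coordCurve x₀ γ) t := by
  have hy : coordCurve x₀ γ t ∈ (extChartAt 𝓘(ℝ, E3) x₀).target :=
    (extChartAt 𝓘(ℝ, E3) x₀).map_source h0
  unfold covDeriv geodOp
  rw [christoffel_chartMetric g x₀ hy]

/-- The field along a curve in the chart at `x₀`. -/
lemma coordField_transition (hγ : ContMDiffAt 𝓘(ℝ, ℝ) 𝓘(ℝ, E3) ∞ γ t)
    (h0 : γ t ∈ (extChartAt 𝓘(ℝ, E3) x₀).source) (h1 : γ t ∈ (extChartAt 𝓘(ℝ, E3) x₁).source)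
    (J : ∀ t, TangentSpace 𝓘(ℝ, E3) (γ t)) :
    coordField x₁ γ J =ᶠ[𝓝 t] fun s => fderiv ℝ (transition x₀ x₁) (coordCurve x₀ γ s)
      (coordField x₀ γ J s) := by
  filter_upwards [eventually_mem_chart hγ h0, eventually_mem_chart hγ h1] with s hs0 hs1
  exact (fderiv_transition hs0 hs1 (show E3 from J s)).symm

lemma contDiffAt_coordField_chart (hγ : ContMDiffAt 𝓘(ℝ, ℝ) 𝓘(ℝ, E3) ∞ γ t)
    (h0 : γ t ∈ (extChartAt 𝓘(ℝ, E3) x₀).source) (h1 : γ t ∈ (extChartAt 𝓘(ℝ, E3) x₁).source)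
    {J : ∀ t, TangentSpace 𝓘(ℝ, E3) (γ t)} (hJ : ContDiffAt ℝ ∞ (coordField x₀ γ J) t) :
    ContDiffAt ℝ ∞ (coordField x₁ γ J) t := by
  refine ContDiffAt.congr_of_eventuallyEq ?_ (coordField_transition hγ h0 h1 J)
  exact ((contDiffAt_fderiv (contDiffAt_transition h0 h1)).comp t
    (contDiffAt_coordCurve hγ h0)).clm_apply hJ

/-- The Jacobi operator is independent of the chart. -/
lemma jacobiOp_chart (hγ : ContMDiffAt 𝓘(ℝ, ℝ) 𝓘(ℝ, E3) ∞ γ t)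
    (h0 : γ t ∈ (extChartAt 𝓘(ℝ, E3) x₀).source) (h1 : γ t ∈ (extChartAt 𝓘(ℝ, E3) x₁).source)
    {J : ∀ t, TangentSpace 𝓘(ℝ, E3) (γ t)} (hJ : ContDiffAt ℝ ∞ (coordField x₀ γ J) t)
    (hgeo : geodOp (chartGamma g x₀) (coordCurve x₀ γ) t = 0) :
    jacobiOp (chartGamma g x₁) (coordCurve x₁ γ) (coordField x₁ γ J) t =
      fderiv ℝ (transition x₀ x₁) (coordCurve x₀ γ t)
        (jacobiOp (chartGamma g x₀) (coordCurve x₀ γ) (coordField x₀ γ J) t) := by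
  have hy0 := (extChartAt 𝓘(ℝ, E3) x₀).map_source h0
  have ht : transition x₀ x₁ (extChartAt 𝓘(ℝ, E3) x₀ (γ t)) ∈
      (extChartAt 𝓘(ℝ, E3) x₁).target := by
    rw [transition_extChartAt h0]
    exact (extChartAt 𝓘(ℝ, E3) x₁).map_source h1
  rw [jacobiOp_congr (coordCurve_transition hγ h0) (coordField_transition hγ h0 h1 J)]
  refine jacobiOp_comp (contDiffAt_transition h0 h1) (contDiffAt_coordCurve hγ h0) hJ ?_
    ((contDiffAt_chartGamma g x₀ hy0).differentiableAt (by simp))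
    ((contDiffAt_chartGamma g x₁ ht).differentiableAt (by simp))
    (chartGamma_symm g x₁ ht) hgeo
  filter_upwards [extChartAt_eventually h0 h1] with z hz u v
  obtain ⟨x', h0', h1', rfl⟩ := hz
  exact chartGamma_transition g h0' h1' u v

/-- The Jacobi equation in terms of the linearised geodesic operator. -/
lemma jacobi_eq_jacobiOp (hγ : ContMDiffAt 𝓘(ℝ, ℝ) 𝓘(ℝ, E3) ∞ γ t)
    (h0 : γ t ∈ (extChartAt 𝓘(ℝ, E3) x₀).source) {K : ℝ → E3} (hK : ContDiffAt ℝ ∞ K t)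
    (hgeo : geodOp (chartGamma g x₀) (coordCurve x₀ γ) t = 0) :
    covDeriv (chartMetric g x₀) (coordCurve x₀ γ)
        (covDeriv (chartMetric g x₀) (coordCurve x₀ γ) K) t
      + curvature (chartMetric g x₀) (coordCurve x₀ γ t) (K t)
          (deriv (coordCurve x₀ γ) t) (deriv (coordCurve x₀ γ) t) =
      jacobiOp (chartGamma g x₀) (coordCurve x₀ γ) K t := by
  have hO := isOpen_extChartAt_target (I := 𝓘(ℝ, E3)) x₀
  have hy0 : coordCurve x₀ γ t ∈ (extChartAt 𝓘(ℝ, E3) x₀).target :=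
    (extChartAt 𝓘(ℝ, E3) x₀).map_source h0
  have dΓ := (contDiffAt_chartGamma g x₀ hy0).differentiableAt (by simp)
  have hy := contDiffAt_coordCurve hγ h0
  have chr := christoffel_chartMetric g x₀ hy0
  have dchr : ∀ u v w : E3, fderiv ℝ (fun z => christoffel (chartMetric g x₀) z u v)
      (coordCurve x₀ γ t) w = fderiv ℝ (chartGamma g x₀) (coordCurve x₀ γ t) w u v := by
    intro u v w
    rw [← (hasFDerivAt_apply_const₂ dΓ u v w).2]
    congr 1
    apply Filter.EventuallyEq.fderiv_eq
    filter_upwards [hO.mem_nhds hy0] with z hz using christoffel_chartMetric g x₀ hz u v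
  have dsΓ : ∀ u v w : E3, fderiv ℝ (chartGamma g x₀) (coordCurve x₀ γ t) w u v =
      fderiv ℝ (chartGamma g x₀) (coordCurve x₀ γ t) w v u := by
    intro u v w
    rw [← (hasFDerivAt_apply_const₂ dΓ u v w).2, ← (hasFDerivAt_apply_const₂ dΓ v u w).2]
    congr 1
    apply Filter.EventuallyEq.fderiv_eq
    filter_upwards [hO.mem_nhds hy0] with z hz using chartGamma_symm g x₀ hz u v
  have hc : covDeriv (chartMetric g x₀) (coordCurve x₀ γ) K =ᶠ[𝓝 t] fun s =>
      deriv K s + chartGamma g x₀ (coordCurve x₀ γ s) (deriv (coordCurve x₀ γ) s) (K s) := by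
    filter_upwards [eventually_mem_chart hγ h0] with s hs
    have hy : coordCurve x₀ γ s ∈ (extChartAt 𝓘(ℝ, E3) x₀).target :=
      (extChartAt 𝓘(ℝ, E3) x₀).map_source hs
    show deriv K s + christoffel _ _ _ _ = _
    rw [christoffel_chartMetric g x₀ hy]
  set y := coordCurve x₀ γ
  set Γ := chartGamma g x₀
  have dy := (hy.differentiableAt (by simp)).hasDerivAt
  have dy1 := ((contDiffAt_deriv hy).differentiableAt (by simp)).hasDerivAt
  have dK := (hK.differentiableAt (by simp)).hasDerivAt
  have dK1 := ((contDiffAt_deriv hK).differentiableAt (by simp)).hasDerivAt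
  have hd : HasDerivAt (fun s => deriv K s + Γ (y s) (deriv y s) (K s)) _ t :=
    dK1.add (((dΓ.hasFDerivAt.comp_hasDerivAt t dy).clm_apply dy1).clm_apply dK)
  -- With this substitution the terms quadratic in `Γ` cancel. The curvature contributes the
  -- derivative of `Γ` along `K` and removes the derivative along `y'` produced by differentiating
  -- twice; what remains is the linearised operator.
  have g1 : deriv (deriv y) t = - Γ (y t) (deriv y t) (deriv y t) :=
    eq_neg_of_add_eq_zero_left hgeo
  have sΓ : ∀ u v, Γ (y t) u v = Γ (y t) v u := chartGamma_symm g x₀ hy0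
  unfold curvature jacobiOp
  rw [covDeriv, hc.deriv_eq, hd.deriv, hc.self_of_nhds]
  simp only [dchr, chr, Function.comp_apply, map_add, add_apply, g1, map_neg, neg_apply]
  rw [sΓ (Γ (y t) _ _) (K t), sΓ (K t) (deriv y t), dsΓ (deriv y t) (K t)]
  module

lemma chartD_eq_zero_iff {x : M} (hx : x ∈ (extChartAt 𝓘(ℝ, E3) x₀).source) (w : E3) :
    chartD x₀ x w = 0 ↔ w = 0 := by
  constructor
  · intro h
    rw [← chartDSymm_chartD hx w, h, map_zero]
  · rintro rfl
    exact map_zero _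

end CurvesInCharts

lemma chartMetric_coordVector {M : Type*} [TopologicalSpace M] [ChartedSpace E3 M]
    [IsManifold 𝓘(ℝ, E3) ∞ M] (g : LorentzMetric M) {x₀ : M} {y : E3}
    (hy : y ∈ (extChartAt 𝓘(ℝ, E3) x₀).target) (u v : E3) :
    chartMetric g x₀ y (chartD x₀ ((extChartAt 𝓘(ℝ, E3) x₀).symm y) u)
      (chartD x₀ ((extChartAt 𝓘(ℝ, E3) x₀).symm y) v) =
        g.form ((extChartAt 𝓘(ℝ, E3) x₀).symm y) u v := by
  have h := chartMetric_chartD g ((extChartAt 𝓘(ℝ, E3) x₀).map_target hy) u v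
  rwa [(extChartAt 𝓘(ℝ, E3) x₀).right_inv hy] at h

end

/-! ### The null cone, its connection and the projectivized spray in framed coordinates. -/

/-- A Lorentzian metric on an open subset of a vector space, with an orthonormal frame. -/
structure FramedMetric (E : Type*) [NormedAddCommGroup E] [NormedSpace ℝ E] where
  dom : Set E
  G : E → E →L[ℝ] E →L[ℝ] ℝ
  V : E → E
  Y : E → E
  T : E → E
  isOpen_dom : IsOpen dom
  smooth_G : ContDiffOn ℝ ∞ G dom
  smooth_V : ContDiffOn ℝ ∞ V dom
  smooth_Y : ContDiffOn ℝ ∞ Y dom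
  smooth_T : ContDiffOn ℝ ∞ T dom
  symm : ∀ y ∈ dom, ∀ u v, G y u v = G y v u
  invertible : ∀ y ∈ dom, (G y).IsInvertible
  VV : ∀ y ∈ dom, G y (V y) (V y) = 1
  YY : ∀ y ∈ dom, G y (Y y) (Y y) = 1
  TT : ∀ y ∈ dom, G y (T y) (T y) = -1
  VY : ∀ y ∈ dom, G y (V y) (Y y) = 0
  VT : ∀ y ∈ dom, G y (V y) (T y) = 0
  YT : ∀ y ∈ dom, G y (Y y) (T y) = 0
  expand : ∀ y ∈ dom, ∀ w, w = G y w (V y) • V y + G y w (Y y) • Y y - G y w (T y) • T y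

namespace FramedMetric

open VectorField

variable {E : Type*} [NormedAddCommGroup E] [NormedSpace ℝ E] (N : FramedMetric E)

/-- The parametrisation of the null cone. -/
def xi (q : E × ℝ) : E :=
  (1 - q.2 ^ 2) • N.V q.1 + (2 * q.2) • N.Y q.1 + (1 + q.2 ^ 2) • N.T q.1

/-- The derivative of `xi` in the direction of the fibre. -/
def rho (q : E × ℝ) : E := (-2 * q.2) • N.V q.1 + (2 : ℝ) • N.Y q.1 + (2 * q.2) • N.T q.1

/-- The domain of the coordinates on the bundle of null lines. -/
def lineDom : Set (E × ℝ) := {q | q.1 ∈ N.dom}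

lemma isOpen_lineDom : IsOpen N.lineDom := N.isOpen_dom.preimage continuous_fst

/-- The component of a null-orthogonal vector along `xi`. -/
def coeff (y w : E) : ℝ := (N.G y w (N.V y) - N.G y w (N.T y)) / 2

/-- The Christoffel map. -/
def Γ : E → E →L[ℝ] E →L[ℝ] E := christoffelCLM N.G

/-- The covariant derivative of `xi` in the direction `Z`. -/
def nabla (q Z : E × ℝ) : E := fderiv ℝ N.xi q Z + N.Γ q.1 Z.1 (N.xi q)

/-- The covariant acceleration of `xi`. -/
def acc (q : E × ℝ) : E := N.nabla q (N.xi q, 0)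

/-- The fibre component of the geodesic spray. -/
def slope (q : E × ℝ) : ℝ := -N.G q.1 (N.acc q) (N.rho q) / 4

/-- The projectivized geodesic spray. -/
def spray (q : E × ℝ) : E × ℝ := (N.xi q, N.slope q)

/-- The deviation of the projectivized spray from being affinely parametrised. -/
def nonaffinity (q : E × ℝ) : ℝ := N.coeff q.1 (N.acc q)

variable {N} {q : E × ℝ}

section Pointwise

variable (hq : q ∈ N.lineDom)
include hq

lemma G_YV : N.G q.1 (N.Y q.1) (N.V q.1) = 0 := (N.symm _ hq _ _).trans (N.VY _ hq)
lemma G_TV : N.G q.1 (N.T q.1) (N.V q.1) = 0 := (N.symm _ hq _ _).trans (N.VT _ hq)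
lemma G_TY : N.G q.1 (N.T q.1) (N.Y q.1) = 0 := (N.symm _ hq _ _).trans (N.YT _ hq)

lemma G_xi_xi : N.G q.1 (N.xi q) (N.xi q) = 0 := by
  simp [xi, N.VV _ hq, N.YY _ hq, N.TT _ hq, N.VY _ hq, N.VT _ hq, N.YT _ hq, G_YV hq, G_TV hq,
    G_TY hq]
  ring

lemma G_xi_rho : N.G q.1 (N.xi q) (N.rho q) = 0 := by
  simp [xi, rho, N.VV _ hq, N.YY _ hq, N.TT _ hq, N.VY _ hq, N.VT _ hq, N.YT _ hq, G_YV hq, G_TV hq,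
    G_TY hq]
  ring

lemma G_rho_rho : N.G q.1 (N.rho q) (N.rho q) = 4 := by
  simp [rho, N.VV _ hq, N.YY _ hq, N.TT _ hq, N.VY _ hq, N.VT _ hq, N.YT _ hq, G_YV hq, G_TV hq,
    G_TY hq]
  ring

lemma coeff_xi : N.coeff q.1 (N.xi q) = 1 := by
  simp [coeff, xi, N.VV _ hq, N.TT _ hq, N.VT _ hq, N.YT _ hq, G_YV hq, G_TV hq]
  ring

lemma coeff_rho : N.coeff q.1 (N.rho q) = 0 := by
  simp [coeff, rho, N.VV _ hq, N.TT _ hq, N.VT _ hq, N.YT _ hq, G_YV hq, G_TV hq]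

omit hq in
lemma coeff_add (y a b : E) : N.coeff y (a + b) = N.coeff y a + N.coeff y b := by
  simp [coeff]; ring

omit hq in
lemma coeff_smul (y : E) (r : ℝ) (a : E) : N.coeff y (r • a) = r * N.coeff y a := by
  simp [coeff]; ring

lemma xi_ne_zero : N.xi q ≠ 0 := fun h => by
  have := coeff_xi hq
  rw [h] at this
  simp [coeff] at this

/-- The orthogonal complement of the null vector `xi` is spanned by `xi` and `rho`. Pairing with
`rho`, which has square 4 and is orthogonal to `xi`, gives one coefficient; the linear form `coeff`,
equal to 1 on `xi` and 0 on `rho`, gives the other. -/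
lemma decompose {w : E} (hw : N.G q.1 w (N.xi q) = 0) :
    w = N.coeff q.1 w • N.xi q + (N.G q.1 w (N.rho q) / 4) • N.rho q := by
  have h := N.expand _ hq w
  unfold coeff
  simp only [xi, rho, map_add, map_smul, smul_eq_mul] at hw ⊢
  set a := N.G q.1 w (N.V q.1)
  set b := N.G q.1 w (N.Y q.1)
  set c := N.G q.1 w (N.T q.1)
  set s := q.2
  have e1 : (a - c) / 2 * (1 - s ^ 2) + ((-2 * s) * a + 2 * b + (2 * s) * c) / 4 * (-2 * s) = a := by
    linear_combination (-1 / 2) * hw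
  have e2 : (a - c) / 2 * (2 * s) + ((-2 * s) * a + 2 * b + (2 * s) * c) / 4 * 2 = b := by
    ring
  have e3 : (a - c) / 2 * (1 + s ^ 2) + ((-2 * s) * a + 2 * b + (2 * s) * c) / 4 * (2 * s) = -c := by
    linear_combination (1 / 2) * hw
  refine h.trans ?_
  rw [sub_eq_add_neg, ← neg_smul, ← e3]
  nth_rw 1 [← e1, ← e2]
  module

/-- The null vectors `w` with `coeff w ≠ 0`. -/
lemma eq_smul_xi_of_null {w : E} (hw : N.G q.1 w w = 0) (hs : N.coeff q.1 w ≠ 0)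
    (h : N.G q.1 w (N.Y q.1) = 2 * N.coeff q.1 w * q.2) : w = N.coeff q.1 w • N.xi q := by
  have h1 := N.expand _ hq w
  have h2 : N.G q.1 w w = N.G q.1 w (N.V q.1) ^ 2 + N.G q.1 w (N.Y q.1) ^ 2
      - N.G q.1 w (N.T q.1) ^ 2 := by
    have h3 := congrArg (N.G q.1 w) h1
    simp only [map_add, map_sub, map_smul, smul_eq_mul] at h3
    rw [h3]
    ring
  rw [hw, h] at h2
  refine h1.trans ?_
  unfold xi
  rw [h]
  have hs' : N.coeff q.1 w = (N.G q.1 w (N.V q.1) - N.G q.1 w (N.T q.1)) / 2 := rfl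
  set a := N.G q.1 w (N.V q.1)
  set c := N.G q.1 w (N.T q.1)
  set k := N.coeff q.1 w
  -- With `2 k = a - c`, the null condition is `2 k` times this expression; the factor `k` can be
  -- cancelled because the line lies in the affine part of the fibre.
  have hk : a + c + 2 * k * q.2 ^ 2 = 0 := by
    have : k * (a + c + 2 * k * q.2 ^ 2) = 0 := by
      linear_combination (a + c) * hs' - h2 / 2
    exact (mul_eq_zero.1 this).resolve_left hs
  have ea : a = k * (1 - q.2 ^ 2) := by linear_combination (-1) * hs' + hk / 2
  have ec : c = -(k * (1 + q.2 ^ 2)) := by linear_combination hs' + hk / 2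
  rw [ea, ec]
  module

end Pointwise

section Smooth

variable (hq : q ∈ N.lineDom)
include hq

lemma contDiffAt_comp_fst {F : Type*} [NormedAddCommGroup F] [NormedSpace ℝ F] {f : E → F}
    (hf : ContDiffOn ℝ ∞ f N.dom) : ContDiffAt ℝ ∞ (fun q : E × ℝ => f q.1) q :=
  ((hf q.1 hq).contDiffAt (N.isOpen_dom.mem_nhds hq)).comp q contDiffAt_fst

lemma contDiffAt_xi : ContDiffAt ℝ ∞ N.xi q :=
  (((contDiffAt_const.sub (contDiffAt_snd.pow 2)).smul (contDiffAt_comp_fst hq N.smooth_V)).add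
    ((contDiffAt_const.mul contDiffAt_snd).smul (contDiffAt_comp_fst hq N.smooth_Y))).add
    ((contDiffAt_const.add (contDiffAt_snd.pow 2)).smul (contDiffAt_comp_fst hq N.smooth_T))

lemma contDiffAt_rho : ContDiffAt ℝ ∞ N.rho q :=
  (((contDiffAt_const.mul contDiffAt_snd).smul (contDiffAt_comp_fst hq N.smooth_V)).add
    (contDiffAt_const.smul (contDiffAt_comp_fst hq N.smooth_Y))).add
    ((contDiffAt_const.mul contDiffAt_snd).smul (contDiffAt_comp_fst hq N.smooth_T))

lemma fderiv_xi_snd : fderiv ℝ N.xi q (0, 1) = N.rho q := by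
  have h1 : HasDerivAt (fun s : ℝ => N.xi (q.1, s)) (N.rho q) q.2 := by
    have hs := hasDerivAt_id q.2
    have := (((hs.pow 2).const_sub 1).smul_const (N.V q.1)).add
      (((hs.const_mul 2).smul_const (N.Y q.1)).add (((hs.pow 2).const_add 1).smul_const (N.T q.1)))
    convert this using 1
    · ext s; simp [xi, add_assoc]
    · simp [rho, add_assoc]
  have h2 : HasDerivAt (fun s : ℝ => N.xi (q.1, s)) (fderiv ℝ N.xi q (0, 1)) q.2 :=
    HasFDerivAt.comp_hasDerivAt (f := fun s : ℝ => (q.1, s)) q.2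
      ((contDiffAt_xi hq).differentiableAt (by simp)).hasFDerivAt
      ((hasDerivAt_const q.2 q.1).prodMk (hasDerivAt_id q.2))
  exact h2.unique h1

lemma nabla_snd : N.nabla q (0, 1) = N.rho q := by
  simp [nabla, fderiv_xi_snd hq]

omit hq in
lemma nabla_add (Z W : E × ℝ) : N.nabla q (Z + W) = N.nabla q Z + N.nabla q W := by
  simp [nabla]; abel

omit hq in
lemma nabla_smul (r : ℝ) (Z : E × ℝ) : N.nabla q (r • Z) = r • N.nabla q Z := by
  simp [nabla]

/-- `xi` is null everywhere, and the connection is metric: differentiate `G(xi, xi) = 0`. -/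
lemma G_nabla_xi (Z : E × ℝ) : N.G q.1 (N.nabla q Z) (N.xi q) = 0 := by
  have hG := (contDiffAt_comp_fst hq N.smooth_G).differentiableAt (by simp)
  have hGy : DifferentiableAt ℝ N.G q.1 := ((N.smooth_G q.1 hq).contDiffAt
    (N.isOpen_dom.mem_nhds hq)).differentiableAt (by simp)
  have hx := ((contDiffAt_xi hq).differentiableAt (by simp)).hasFDerivAt
  have h1 := ((hGy.hasFDerivAt.comp q hasFDerivAt_fst).clm_apply hx).clm_apply hx
  have h2 : fderiv ℝ (fun q : E × ℝ => N.G q.1 (N.xi q) (N.xi q)) q = 0 := by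
    have : (fun q : E × ℝ => N.G q.1 (N.xi q) (N.xi q)) =ᶠ[𝓝 q] fun _ => 0 := by
      filter_upwards [N.isOpen_lineDom.mem_nhds hq] with z hz using G_xi_xi hz
    rw [this.fderiv_eq]
    simp
  have h3 := congrArg (fun L : E × ℝ →L[ℝ] ℝ => L Z) (h1.fderiv.symm.trans h2)
  simp at h3
  have h4 := christoffel_spec (N.invertible _ hq) Z.1 (N.xi q) (N.xi q)
  have h5 := N.symm _ hq (N.xi q) (fderiv ℝ N.xi q Z)
  unfold nabla Γ
  simp only [map_add, add_apply]
  linarith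

/-- Lie brackets of fields orthogonal to `xi`. -/
lemma G_lieBracket {X Z : E × ℝ → E × ℝ} (hX : DifferentiableAt ℝ X q) (hZ : DifferentiableAt ℝ Z q)
    (eX : ∀ᶠ z in 𝓝 q, N.G z.1 (X z).1 (N.xi z) = 0)
    (eZ : ∀ᶠ z in 𝓝 q, N.G z.1 (Z z).1 (N.xi z) = 0) :
    N.G q.1 (lieBracket ℝ X Z q).1 (N.xi q) =
      N.G q.1 (X q).1 (N.nabla q (Z q)) - N.G q.1 (Z q).1 (N.nabla q (X q)) := by
  have hGy : DifferentiableAt ℝ N.G q.1 := ((N.smooth_G q.1 hq).contDiffAt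
    (N.isOpen_dom.mem_nhds hq)).differentiableAt (by simp)
  have hx := ((contDiffAt_xi hq).differentiableAt (by simp)).hasFDerivAt
  -- Differentiating the orthogonality relation trades the derivative of a field, which appears in
  -- the bracket, for derivatives of `G` and `xi`. The Koszul formulas then turn the derivatives of
  -- `G` into Christoffel terms.
  have key : ∀ {X : E × ℝ → E × ℝ}, DifferentiableAt ℝ X q →
      (∀ᶠ z in 𝓝 q, N.G z.1 (X z).1 (N.xi z) = 0) → ∀ W : E × ℝ,
      fderiv ℝ N.G q.1 W.1 (X q).1 (N.xi q) + N.G q.1 (fderiv ℝ X q W).1 (N.xi q) +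
        N.G q.1 (X q).1 (fderiv ℝ N.xi q W) = 0 := by
    intro X hX eX W
    have h1 := ((hGy.hasFDerivAt.comp q hasFDerivAt_fst).clm_apply hX.hasFDerivAt.fst).clm_apply hx
    have h2 : fderiv ℝ (fun q : E × ℝ => N.G q.1 (X q).1 (N.xi q)) q = 0 := by
      have : (fun q : E × ℝ => N.G q.1 (X q).1 (N.xi q)) =ᶠ[𝓝 q] fun _ => 0 := eX
      rw [this.fderiv_eq]
      simp
    have h3 := congrArg (fun L : E × ℝ →L[ℝ] ℝ => L W) (h1.fderiv.symm.trans h2)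
    simp at h3
    linarith
  have k1 := key hX eX (Z q)
  have k2 := key hZ eZ (X q)
  have c1 := christoffel_spec (N.invertible _ hq) (Z q).1 (N.xi q) (X q).1
  have c2 := christoffel_spec (N.invertible _ hq) (X q).1 (N.xi q) (Z q).1
  have s1 := fderiv_symm N.isOpen_dom (N.smooth_G.differentiableOn (by simp)) N.symm hq
  rw [s1 (N.xi q) (Z q).1 (X q).1, s1 (Z q).1 (N.xi q) (X q).1] at c1
  rw [s1 (X q).1 (N.xi q) (Z q).1] at c2
  have s2 := N.symm _ hq (X q).1 (christoffelCLM N.G q.1 (Z q).1 (N.xi q))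
  have s3 := N.symm _ hq (Z q).1 (christoffelCLM N.G q.1 (X q).1 (N.xi q))
  unfold nabla Γ lieBracket
  simp only [map_add, map_sub, sub_apply, Prod.fst_sub]
  rw [s2, s3]
  linarith [s1 (N.xi q) (Z q).1 (X q).1, s1 (Z q).1 (N.xi q) (X q).1, s1 (X q).1 (N.xi q) (Z q).1]

lemma acc_eq : N.acc q = N.nonaffinity q • N.xi q - N.slope q • N.rho q := by
  refine (decompose hq (G_nabla_xi hq (N.xi q, 0))).trans ?_
  unfold nonaffinity slope acc
  module

/-- The reason for the choice of `slope`. Moving in the fibre with speed `slope` adds `slope • rho`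
to the covariant acceleration of `xi` and cancels its `rho` component, so that only the geodesic
equation up to parametrisation remains. -/
lemma nabla_spray : N.nabla q (N.spray q) = N.nonaffinity q • N.xi q := by
  have : N.spray q = (N.xi q, 0) + N.slope q • ((0 : E), (1 : ℝ)) := by simp [spray]
  rw [this, nabla_add, nabla_smul, nabla_snd hq, ← acc, acc_eq hq]
  module

section Spray

variable [CompleteSpace E]

lemma contDiffAt_Γ : ContDiffAt ℝ ∞ (fun q : E × ℝ => N.Γ q.1) q :=
  contDiffAt_comp_fst hq (contDiffOn_christoffelCLM N.isOpen_dom N.smooth_G N.invertible)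

lemma contDiffAt_acc : ContDiffAt ℝ ∞ N.acc q :=
  ((contDiffAt_fderiv (contDiffAt_xi hq)).clm_apply
    ((contDiffAt_xi hq).prodMk contDiffAt_const)).add
    (((contDiffAt_Γ hq).clm_apply (contDiffAt_xi hq)).clm_apply (contDiffAt_xi hq))

lemma contDiffAt_slope : ContDiffAt ℝ ∞ N.slope q :=
  ((((contDiffAt_comp_fst hq N.smooth_G).clm_apply (contDiffAt_acc hq)).clm_apply
    (contDiffAt_rho hq)).neg).div_const 4

omit [CompleteSpace E] in
lemma contDiffAt_coeff {w : E × ℝ → E} (hw : ContDiffAt ℝ ∞ w q) :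
    ContDiffAt ℝ ∞ (fun q => N.coeff q.1 (w q)) q := by
  have hG := (contDiffAt_comp_fst hq N.smooth_G).clm_apply hw
  exact ((hG.clm_apply (contDiffAt_comp_fst hq N.smooth_V)).sub
    (hG.clm_apply (contDiffAt_comp_fst hq N.smooth_T))).div_const 2

lemma contDiffAt_nonaffinity : ContDiffAt ℝ ∞ N.nonaffinity q :=
  contDiffAt_coeff hq (contDiffAt_acc hq)

lemma contDiffAt_spray : ContDiffAt ℝ ∞ N.spray q :=
  (contDiffAt_xi hq).prodMk (contDiffAt_slope hq)

end Spray

end Smooth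

/-- A null geodesic lifts to an integral curve of the spray. -/
lemma hasDerivAt_lift [CompleteSpace E] {y : ℝ → E} {h s : ℝ → ℝ} {t : ℝ} (hy : y t ∈ N.dom)
    (cy : ContDiffAt ℝ ∞ y t)
    (ch : ContDiffAt ℝ ∞ h t) (cs : ContDiffAt ℝ ∞ s t) (hh : h t ≠ 0)
    (e : ∀ᶠ r in 𝓝 t, deriv y r = h r • N.xi (y r, s r)) (hgeo : geodOp N.Γ y t = 0) :
    HasDerivAt (fun r => (y r, s r)) (h t • N.spray (y t, s t)) t ∧
      HasDerivAt h (-(h t ^ 2 * N.nonaffinity (y t, s t))) t := by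
  have hq : (y t, s t) ∈ N.lineDom := hy
  have dy := (cy.differentiableAt (by simp)).hasDerivAt
  have ds := (cs.differentiableAt (by simp)).hasDerivAt
  have dh := (ch.differentiableAt (by simp)).hasDerivAt
  have e0 := e.self_of_nhds
  have dx : HasDerivAt (fun r => N.xi (y r, s r)) (fderiv ℝ N.xi (y t, s t) (deriv y t, deriv s t)) t :=
    HasFDerivAt.comp_hasDerivAt (f := fun r => (y r, s r)) t
      ((contDiffAt_xi hq).differentiableAt (by simp)).hasFDerivAt (dy.prodMk ds)
  have h1 : deriv (deriv y) t = h t • fderiv ℝ N.xi (y t, s t) (deriv y t, deriv s t) +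
      deriv h t • N.xi (y t, s t) := by
    have e' : deriv y =ᶠ[𝓝 t] fun r => h r • N.xi (y r, s r) := e
    rw [e'.deriv_eq]
    exact (dh.smul dx).deriv
  -- The geodesic equation after inserting `y' = h xi`. Its pairing with `rho` yields `s' = h slope`
  -- (here `h ≠ 0` is needed), and its `coeff` yields the equation for `h`.
  have h2 : h t • N.nabla (y t, s t) (deriv y t, deriv s t) + deriv h t • N.xi (y t, s t) = 0 := by
    have : geodOp N.Γ y t = h t • N.nabla (y t, s t) (deriv y t, deriv s t) +
        deriv h t • N.xi (y t, s t) := by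
      unfold geodOp nabla
      have h5 : N.Γ (y t) (deriv y t) (deriv y t) = h t • N.Γ (y t) (deriv y t) (N.xi (y t, s t)) :=
        (congrArg _ e0).trans (map_smul _ _ _)
      rw [h1, h5, smul_add]
      abel
    rw [← this, hgeo]
  have h3 : (deriv y t, deriv s t) =
      h t • N.spray (y t, s t) + (deriv s t - h t * N.slope (y t, s t)) • ((0 : E), (1 : ℝ)) := by
    rw [e0]
    ext <;> simp [spray]
  rw [h3, nabla_add, nabla_smul, nabla_smul, nabla_snd hq, nabla_spray hq] at h2
  have h4 := congrArg (N.coeff (y t)) h2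
  have h5 := congrArg (fun w => N.G (y t) w (N.rho (y t, s t))) h2
  have hx1 := coeff_xi hq
  have hx2 := coeff_rho hq
  have hx3 := G_xi_rho hq
  have hx4 := G_rho_rho hq
  simp only at hx1 hx2 hx3 hx4
  simp only [coeff_add, coeff_smul, hx1, hx2, mul_one, mul_zero, add_zero] at h4
  simp only [map_add, map_smul, smul_add, add_apply, smul_apply, smul_eq_mul, hx3, hx4, mul_zero,
    add_zero, zero_add, map_zero, zero_apply] at h5
  have z : N.coeff (y t) 0 = 0 := by simp [coeff]
  rw [z] at h4
  have hs : deriv s t = h t * N.slope (y t, s t) := by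
    have : h t * 4 * (deriv s t - h t * N.slope (y t, s t)) = 0 := by linear_combination h5
    have := (mul_eq_zero.1 this).resolve_left (mul_ne_zero hh four_ne_zero)
    linarith
  constructor
  · have := dy.prodMk ds
    rw [e0, hs] at this
    simpa [spray] using this
  · have : deriv h t = -(h t ^ 2 * N.nonaffinity (y t, s t)) := by linear_combination h4
    rw [← this]
    exact dh

end FramedMetric

/-! ### Metric compatibility; local existence and uniqueness of geodesics on M. -/

section

lemma metric_compatible {E : Type*} [NormedAddCommGroup E] [NormedSpace ℝ E]
    {G : E → E →L[ℝ] E →L[ℝ] ℝ} {O : Set E} (hO : IsOpen O) (hG : DifferentiableOn ℝ G O)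
    (hs : ∀ y ∈ O, ∀ u v, G y u v = G y v u) {y : E} (hy : y ∈ O) (hinv : (G y).IsInvertible)
    (u a b : E) :
    fderiv ℝ G y u a b = G y (christoffelCLM G y u a) b + G y a (christoffelCLM G y u b) := by
  have c1 := christoffel_spec hinv u a b
  have c2 := christoffel_spec hinv u b a
  have s1 := fderiv_symm hO hG hs hy
  rw [hs y hy a]
  linarith [s1 u a b, s1 b u a, s1 a u b]

lemma hasDerivAt_metric_apply {E : Type*} [NormedAddCommGroup E] [NormedSpace ℝ E]
    {G : E → E →L[ℝ] E →L[ℝ] ℝ} {O : Set E} (hO : IsOpen O) (hG : DifferentiableOn ℝ G O)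
    (hs : ∀ y ∈ O, ∀ u v, G y u v = G y v u) (hinv : ∀ y ∈ O, (G y).IsInvertible)
    {y a b : ℝ → E} {y' a' b' : E} {t : ℝ} (hy : y t ∈ O) (dy : HasDerivAt y y' t)
    (da : HasDerivAt a a' t) (db : HasDerivAt b b' t) :
    HasDerivAt (fun s => G (y s) (a s) (b s))
      (G (y t) (a' + christoffelCLM G (y t) y' (a t)) (b t) +
        G (y t) (a t) (b' + christoffelCLM G (y t) y' (b t))) t := by
  have h1 := (((hG _ hy).differentiableAt (hO.mem_nhds hy)).hasFDerivAt.comp_hasDerivAt t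
    dy).clm_apply da |>.clm_apply db
  have h2 := metric_compatible hO hG hs hy (hinv _ hy) y' (a t) (b t)
  refine h1.congr_deriv ?_
  simp only [map_add, add_apply, Function.comp_apply]
  linarith

variable {M : Type*} [TopologicalSpace M] [ChartedSpace E3 M] [IsManifold 𝓘(ℝ, E3) ∞ M]
  {g : LorentzMetric M}

section LocalTheory

variable {γ γ₁ γ₂ : ℝ → M} {I I₁ I₂ : Set ℝ} {t : ℝ} {x₀ : M}

lemma IsGeodesic.contMDiffAt (h : IsGeodesic g γ I) (ht : t ∈ I) :
    ContMDiffAt 𝓘(ℝ, ℝ) 𝓘(ℝ, E3) ∞ γ t :=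
  (h.smooth t ht).contMDiffAt (h.isOpen.mem_nhds ht)

lemma IsGeodesic.geodOp_eq_zero (h : IsGeodesic g γ I) (ht : t ∈ I)
    (hx : γ t ∈ (extChartAt 𝓘(ℝ, E3) x₀).source) :
    geodOp (chartGamma g x₀) (coordCurve x₀ γ) t = 0 := by
  rw [← covDeriv_velocity hx]
  exact h.equation x₀ t ht (by rwa [extChartAt_source] at hx)

/-- The definition asks for the equation in every chart around each point; by covariance one chart
per point is enough. -/
lemma isGeodesic_of_chart (hI : IsOpen I) (hc : IsConnected I)
    (hγ : ∀ t ∈ I, ContMDiffAt 𝓘(ℝ, ℝ) 𝓘(ℝ, E3) ∞ γ t)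
    (h : ∀ t ∈ I, ∃ x₀, γ t ∈ (extChartAt 𝓘(ℝ, E3) x₀).source ∧
      geodOp (chartGamma g x₀) (coordCurve x₀ γ) t = 0) : IsGeodesic g γ I := by
  refine ⟨hI, hc, fun t ht => (hγ t ht).contMDiffWithinAt, fun x₁ t ht hx₁ => ?_⟩
  obtain ⟨x₀, h0, h1⟩ := h t ht
  rw [← extChartAt_source 𝓘(ℝ, E3)] at hx₁
  rw [covDeriv_velocity hx₁, geodOp_chart (hγ t ht) h0 hx₁, h1, map_zero]

omit [IsManifold 𝓘(ℝ, E3) ∞ M] in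
lemma coordCurve_congr (h : γ₁ =ᶠ[𝓝 t] γ₂) : coordCurve x₀ γ₁ =ᶠ[𝓝 t] coordCurve x₀ γ₂ :=
  h.mono fun s hs => by unfold coordCurve; rw [hs]

omit [IsManifold 𝓘(ℝ, E3) ∞ M] in
lemma vel_congr (h : γ₁ =ᶠ[𝓝 t] γ₂) : (vel γ₁ t : E3) = vel γ₂ t := by
  unfold vel
  have : (mfderiv 𝓘(ℝ, ℝ) 𝓘(ℝ, E3) γ₁ t : ℝ →L[ℝ] E3) = mfderiv 𝓘(ℝ, ℝ) 𝓘(ℝ, E3) γ₂ t :=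
    h.mfderiv_eq
  exact congrArg (fun L : ℝ →L[ℝ] E3 => L 1) this

lemma isGeodesic_congr_local (hI : IsOpen I) (hc : IsConnected I)
    (h : ∀ t ∈ I, ∃ (γ' : ℝ → M) (I' : Set ℝ), IsGeodesic g γ' I' ∧ t ∈ I' ∧ γ =ᶠ[𝓝 t] γ') :
    IsGeodesic g γ I := by
  refine isGeodesic_of_chart hI hc (fun t ht => ?_) fun t ht => ?_
  · obtain ⟨γ', I', h1, h2, h3⟩ := h t ht
    exact (h1.contMDiffAt h2).congr_of_eventuallyEq h3
  · obtain ⟨γ', I', h1, h2, h3⟩ := h t ht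
    refine ⟨γ t, mem_extChartAt_source _, ?_⟩
    rw [geodOp_congr (coordCurve_congr h3)]
    refine h1.geodOp_eq_zero h2 ?_
    rw [← h3.self_of_nhds]
    exact mem_extChartAt_source _

variable (g) in
/-- Local existence of geodesics. -/
lemma exists_isGeodesic (x : M) (v : E3) (t₀ : ℝ) : ∃ (γ : ℝ → M) (I : Set ℝ), IsGeodesic g γ I ∧
    t₀ ∈ I ∧ γ t₀ = x ∧ vel γ t₀ = v := by
  obtain ⟨y, ε, hε, cy, mO, gy, y0, dy0⟩ := exists_geodOp_eq_zero
    (isOpen_extChartAt_target (I := 𝓘(ℝ, E3)) x) (contDiffOn_chartGamma g x)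
    (mem_extChartAt_target (I := 𝓘(ℝ, E3)) x) v
  let z : ℝ → E3 := fun t => y (t - t₀)
  let γ : ℝ → M := fun t => (extChartAt 𝓘(ℝ, E3) x).symm (z t)
  have hI : ∀ t ∈ Ioo (t₀ - ε) (t₀ + ε), t - t₀ ∈ Ioo (-ε) ε := fun t ht =>
    ⟨by linarith [ht.1], by linarith [ht.2]⟩
  have hz : ∀ t ∈ Ioo (t₀ - ε) (t₀ + ε), z t ∈ (extChartAt 𝓘(ℝ, E3) x).target := fun t ht =>
    mO (hI t ht)
  have cz : ∀ t ∈ Ioo (t₀ - ε) (t₀ + ε), ContDiffAt ℝ ∞ z t := fun t ht =>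
    ((cy _ (hI t ht)).contDiffAt (isOpen_Ioo.mem_nhds (hI t ht))).comp t
      (contDiffAt_id.sub contDiffAt_const)
  have cγ : ∀ t ∈ Ioo (t₀ - ε) (t₀ + ε), ContMDiffAt 𝓘(ℝ, ℝ) 𝓘(ℝ, E3) ∞ γ t := fun t ht =>
    contMDiffAt_of_coord_curve (cz t ht) (hz t ht) Filter.EventuallyEq.rfl
  have ht₀ : t₀ ∈ Ioo (t₀ - ε) (t₀ + ε) := ⟨by linarith, by linarith⟩
  have hcc : ∀ t ∈ Ioo (t₀ - ε) (t₀ + ε), coordCurve x γ =ᶠ[𝓝 t] z := fun t ht => by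
    filter_upwards [isOpen_Ioo.mem_nhds ht] with s hs
    exact (extChartAt 𝓘(ℝ, E3) x).right_inv (hz s hs)
  have hsrc : ∀ t ∈ Ioo (t₀ - ε) (t₀ + ε), γ t ∈ (extChartAt 𝓘(ℝ, E3) x).source := fun t ht =>
    (extChartAt 𝓘(ℝ, E3) x).map_target (hz t ht)
  have hγ0 : γ t₀ = x := by
    show (extChartAt 𝓘(ℝ, E3) x).symm (y (t₀ - t₀)) = x
    rw [sub_self, y0]
    exact extChartAt_to_inv x
  refine ⟨γ, Ioo (t₀ - ε) (t₀ + ε), isGeodesic_of_chart isOpen_Ioo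
    (isConnected_Ioo (by linarith)) cγ fun t ht => ⟨x, hsrc t ht, ?_⟩, ht₀, hγ0, ?_⟩
  · rw [geodOp_congr (hcc t ht)]
    have h1 : deriv z = fun s => deriv y (s - t₀) := by
      funext s
      exact deriv_comp_sub_const y t₀ s
    have h2 : deriv (deriv z) t = deriv (deriv y) (t - t₀) := by
      rw [h1, deriv_comp_sub_const (deriv y) t₀ t]
    have := gy _ (hI t ht)
    unfold geodOp at this ⊢
    rw [h2, h1]
    exact this
  · have h1 := deriv_coordCurve (cγ t₀ ht₀) (hsrc t₀ ht₀)
    rw [(hcc t₀ ht₀).deriv_eq, deriv_comp_sub_const, sub_self, dy0] at h1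
    have h2 : chartD x (γ t₀) (vel γ t₀) = (vel γ t₀ : E3) := by
      rw [hγ0]
      exact chartD_self x _
    rw [h1, h2]

/-- Local uniqueness of geodesics. -/
lemma IsGeodesic.eventuallyEq (h₁ : IsGeodesic g γ₁ I₁) (h₂ : IsGeodesic g γ₂ I₂) (ht₁ : t ∈ I₁)
    (ht₂ : t ∈ I₂) (h : γ₁ t = γ₂ t) (hv : (vel γ₁ t : E3) = vel γ₂ t) : γ₁ =ᶠ[𝓝 t] γ₂ := by
  have m1 : γ₁ t ∈ (extChartAt 𝓘(ℝ, E3) (γ₁ t)).source := mem_extChartAt_source _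
  have m2 : γ₂ t ∈ (extChartAt 𝓘(ℝ, E3) (γ₁ t)).source := by rw [← h]; exact m1
  have key : coordCurve (γ₁ t) γ₁ =ᶠ[𝓝 t] coordCurve (γ₁ t) γ₂ := by
    refine geodOp_unique (isOpen_extChartAt_target (γ₁ t)) (contDiffOn_chartGamma g (γ₁ t))
      ((extChartAt 𝓘(ℝ, E3) (γ₁ t)).map_source m1) ?_ ?_ ?_ ?_ ?_ ?_
    · filter_upwards [h₁.isOpen.mem_nhds ht₁, eventually_mem_chart (h₁.contMDiffAt ht₁) m1]
        with s hs hs' using contDiffAt_coordCurve (h₁.contMDiffAt hs) hs'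
    · filter_upwards [h₂.isOpen.mem_nhds ht₂, eventually_mem_chart (h₂.contMDiffAt ht₂) m2]
        with s hs hs' using contDiffAt_coordCurve (h₂.contMDiffAt hs) hs'
    · filter_upwards [h₁.isOpen.mem_nhds ht₁, eventually_mem_chart (h₁.contMDiffAt ht₁) m1]
        with s hs hs' using h₁.geodOp_eq_zero hs hs'
    · filter_upwards [h₂.isOpen.mem_nhds ht₂, eventually_mem_chart (h₂.contMDiffAt ht₂) m2]
        with s hs hs' using h₂.geodOp_eq_zero hs hs'
    · unfold coordCurve; rw [h]
    · rw [deriv_coordCurve (h₁.contMDiffAt ht₁) m1, deriv_coordCurve (h₂.contMDiffAt ht₂) m2, hv, h]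
  filter_upwards [key, eventually_mem_chart (h₁.contMDiffAt ht₁) m1,
    eventually_mem_chart (h₂.contMDiffAt ht₂) m2] with s hs hs1 hs2
  exact (extChartAt 𝓘(ℝ, E3) (γ₁ t)).injOn hs1 hs2 hs

/-- Uniqueness of geodesics. -/
lemma IsGeodesic.eqOn [T2Space M] (h₁ : IsGeodesic g γ₁ I₁) (h₂ : IsGeodesic g γ₂ I₂)
    (ht₁ : t ∈ I₁) (ht₂ : t ∈ I₂) (h : γ₁ t = γ₂ t) (hv : (vel γ₁ t : E3) = vel γ₂ t) :
    EqOn γ₁ γ₂ (I₁ ∩ I₂) := by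
  have hpre : IsPreconnected (I₁ ∩ I₂) :=
    (h₁.isConnected.isPreconnected.ordConnected.inter
      h₂.isConnected.isPreconnected.ordConnected).isPreconnected
  -- The parameters at which the germs agree form an open set. It is closed in the interval `I₁ ∩
  -- I₂`: positions and coordinate velocities agree at limit points, because M is Hausdorff, and
  -- local uniqueness extends the agreement.
  have key : I₁ ∩ I₂ ⊆ {s | γ₁ =ᶠ[𝓝 s] γ₂} := by
    refine hpre.subset_of_closure_inter_subset (isOpen_setOfPred_eventually_nhds (p := fun s => γ₁ s = γ₂ s))
      ⟨t, ⟨ht₁, ht₂⟩, h₁.eventuallyEq h₂ ht₁ ht₂ h hv⟩ ?_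
    rintro s ⟨hs, hs1, hs2⟩
    have c1 := (h₁.contMDiffAt hs1).continuousAt
    have c2 := (h₂.contMDiffAt hs2).continuousAt
    have hne : Filter.NeBot (nhdsWithin s {s : ℝ | γ₁ =ᶠ[𝓝 s] γ₂}) :=
      mem_closure_iff_nhdsWithin_neBot.1 hs
    have e : γ₁ s = γ₂ s := by
      refine tendsto_nhds_unique (c1.mono_left (nhdsWithin_le_nhds (s := {s : ℝ | γ₁ =ᶠ[𝓝 s] γ₂})))
        ((c2.mono_left nhdsWithin_le_nhds).congr' ?_)
      filter_upwards [self_mem_nhdsWithin] with r hr using hr.self_of_nhds.symm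
    have m1 : γ₁ s ∈ (extChartAt 𝓘(ℝ, E3) (γ₁ s)).source := mem_extChartAt_source _
    have m2 : γ₂ s ∈ (extChartAt 𝓘(ℝ, E3) (γ₁ s)).source := by rw [← e]; exact m1
    refine h₁.eventuallyEq h₂ hs1 hs2 e (chartD_injective m1 ?_)
    have d1 := (contDiffAt_deriv (contDiffAt_coordCurve (h₁.contMDiffAt hs1) m1)).continuousAt
    have d2 := (contDiffAt_deriv (contDiffAt_coordCurve (h₂.contMDiffAt hs2) m2)).continuousAt
    have e2 : deriv (coordCurve (γ₁ s) γ₁) s = deriv (coordCurve (γ₁ s) γ₂) s := by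
      refine tendsto_nhds_unique (d1.mono_left (nhdsWithin_le_nhds (s := {s : ℝ | γ₁ =ᶠ[𝓝 s] γ₂})))
        ((d2.mono_left nhdsWithin_le_nhds).congr' ?_)
      filter_upwards [self_mem_nhdsWithin] with r hr
      exact (coordCurve_congr (x₀ := γ₁ s) (show γ₁ =ᶠ[𝓝 r] γ₂ from hr)).deriv_eq.symm
    rw [deriv_coordCurve (h₁.contMDiffAt hs1) m1, deriv_coordCurve (h₂.contMDiffAt hs2) m2] at e2
    rw [e2, ← e]
  exact fun s hs => (key hs).self_of_nhds

end LocalTheory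

/-! ### Null vectors, time orientation, and propagation of the causal character along geodesics. -/

section Causal

/-- The future null vectors, as vectors of the model space. -/
def FutureNullAt (o : TimeOrientation g) (x : M) (v : E3) : Prop :=
  IsFutureNull o (show TangentSpace 𝓘(ℝ, E3) x from v)

lemma LorentzMetric.exists_form_expand (g : LorentzMetric M) (x : M) : ∃ V Y T : E3,
    ∀ w : E3, w = g.form x w V • V + g.form x w Y • Y - g.form x w T • T := by
  obtain ⟨V, Y, T, hVV, hYY, hTT, hVY, hVT, hYT⟩ := g.signature x
  exact ⟨V, Y, T, fun w => g.expand x hVV hYY hTT hVY hVT hYT w⟩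

/-- The orthogonal complement of a timelike vector is positive definite. In the proof this takes the
form of the identity of Lagrange in an orthonormal basis. -/
lemma lorentz_ne_zero {x : M} {T v : E3} (hT : g.form x T T < 0) (hv : g.form x v v = 0)
    (h : g.form x v T = 0) : v = 0 := by
  obtain ⟨V, Y, T₀, ev⟩ := g.exists_form_expand x
  have key : ∀ w z : E3, g.form x w z = g.form x w V * g.form x z V + g.form x w Y * g.form x z Y
      - g.form x w T₀ * g.form x z T₀ := by
    intro w z
    have := congrArg (g.form x w) (ev z)
    simp only [map_add, map_sub, map_smul, smul_eq_mul] at this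
    rw [this]; ring
  rw [key] at hT hv h
  have e := ev v
  set a := g.form x v V
  set b := g.form x v Y
  set c := g.form x v T₀
  set p := g.form x T V
  set q := g.form x T Y
  set r := g.form x T T₀
  have hc : c = 0 := by
    by_contra hc
    have hc2 : 0 < c ^ 2 := by positivity
    -- The identity of Lagrange for the spacelike parts, with `a² + b² = c²` and `a p + b q = c r`.
    -- The right side is negative when `c ≠ 0`.
    have h1 : (a * q - b * p) ^ 2 = c ^ 2 * (p * p + q * q - r * r) := by
      linear_combination (p ^ 2 + q ^ 2) * hv - (a * p + b * q + c * r) * h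
    nlinarith [sq_nonneg (a * q - b * p), mul_pos hc2 (neg_pos.2 hT)]
  rw [hc] at hv e
  have ha : a = 0 := by nlinarith [sq_nonneg a, sq_nonneg b]
  have hb : b = 0 := by nlinarith [sq_nonneg a, sq_nonneg b]
  rw [e, ha, hb]
  simp

variable {o : TimeOrientation g} {γ : ℝ → M} {I : Set ℝ}

lemma futureNullAt_iff {x : M} {v : E3} : FutureNullAt o x v ↔
    v ≠ 0 ∧ g.form x v v = 0 ∧ g.form x v (o.field x) < 0 :=
  ⟨fun h => ⟨h.ne_zero, h.null, h.future⟩, fun h => ⟨h.1, h.2.1, h.2.2⟩⟩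

lemma futureNullAt_or_neg {x : M} {v : E3} (h0 : v ≠ 0) (h : g.form x v v = 0) :
    FutureNullAt o x v ∨ FutureNullAt o x (-v) := by
  have h1 : g.form x v (o.field x) ≠ 0 := fun h2 => h0 (lorentz_ne_zero (o.timelike x) h h2)
  rcases lt_or_gt_of_ne h1 with h2 | h2
  · exact Or.inl (futureNullAt_iff.2 ⟨h0, h, h2⟩)
  · refine Or.inr (futureNullAt_iff.2 ⟨neg_ne_zero.2 h0, by simpa using h, ?_⟩)
    have h3 : g.form x (-v) (o.field x) = -g.form x v (o.field x) :=
      congrArg (fun L : E3 →L[ℝ] ℝ => L (o.field x)) (map_neg (g.form x) v)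
    rw [h3]
    exact neg_neg_of_pos h2

lemma hasDerivAt_form {x₀ : M} {t : ℝ} (hγ : ContMDiffAt 𝓘(ℝ, ℝ) 𝓘(ℝ, E3) ∞ γ t)
    (h : γ t ∈ (extChartAt 𝓘(ℝ, E3) x₀).source) {a b : ℝ → E3} {a' b' : E3}
    (da : HasDerivAt (fun s => chartD x₀ (γ s) (a s)) a' t)
    (db : HasDerivAt (fun s => chartD x₀ (γ s) (b s)) b' t) :
    HasDerivAt (fun s => g.form (γ s) (a s) (b s))
      (chartMetric g x₀ (coordCurve x₀ γ t)
          (a' + chartGamma g x₀ (coordCurve x₀ γ t) (deriv (coordCurve x₀ γ) t)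
            (chartD x₀ (γ t) (a t))) (chartD x₀ (γ t) (b t)) +
        chartMetric g x₀ (coordCurve x₀ γ t) (chartD x₀ (γ t) (a t))
          (b' + chartGamma g x₀ (coordCurve x₀ γ t) (deriv (coordCurve x₀ γ) t)
            (chartD x₀ (γ t) (b t)))) t := by
  have h1 := hasDerivAt_metric_apply (isOpen_extChartAt_target x₀)
    ((contDiffOn_chartMetric g x₀).differentiableOn (by simp))
    (fun y _ u v => chartMetric_symm g x₀ y u v)
    (fun _ hy => chartMetric_isInvertible g x₀ hy)
    ((extChartAt 𝓘(ℝ, E3) x₀).map_source h)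
    ((contDiffAt_coordCurve hγ h).differentiableAt (by simp)).hasDerivAt da db
  refine h1.congr_of_eventuallyEq ?_
  filter_upwards [eventually_mem_chart hγ h] with s hs
  exact (chartMetric_chartD g hs _ _).symm

lemma IsGeodesic.hasDerivAt_velocity {x₀ : M} {t : ℝ} (h : IsGeodesic g γ I) (ht : t ∈ I)
    (hx : γ t ∈ (extChartAt 𝓘(ℝ, E3) x₀).source) :
    HasDerivAt (fun s => chartD x₀ (γ s) (vel γ s))
      (-chartGamma g x₀ (coordCurve x₀ γ t) (deriv (coordCurve x₀ γ) t)
        (deriv (coordCurve x₀ γ) t)) t := by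
  have h1 := ((contDiffAt_deriv (contDiffAt_coordCurve (h.contMDiffAt ht) hx)).differentiableAt
    (by simp)).hasDerivAt
  rw [eq_neg_of_add_eq_zero_left (h.geodOp_eq_zero ht hx)] at h1
  refine h1.congr_of_eventuallyEq ?_
  filter_upwards [h.isOpen.mem_nhds ht, eventually_mem_chart (h.contMDiffAt ht) hx] with s hs hs'
  exact (deriv_coordCurve (h.contMDiffAt hs) hs').symm

lemma IsGeodesic.continuousAt_form {t : ℝ} (h : IsGeodesic g γ I) (ht : t ∈ I) {X : M → E3}
    (hX : SmoothFieldOn X univ) : ContinuousAt (fun s => g.form (γ s) (vel γ s) (X (γ s))) t := by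
  have hx : γ t ∈ (extChartAt 𝓘(ℝ, E3) (γ t)).source := mem_extChartAt_source _
  have h1 := contDiffOn_coordVectorField isOpen_univ hX (γ t)
  have h2 : ContDiffAt ℝ ∞ (coordVectorField (γ t) X) (coordCurve (γ t) γ t) := by
    refine (h1 _ ⟨(extChartAt 𝓘(ℝ, E3) (γ t)).map_source hx, mem_univ _⟩).contDiffAt ?_
    filter_upwards [(isOpen_extChartAt_target (I := 𝓘(ℝ, E3)) (γ t)).mem_nhds
      ((extChartAt 𝓘(ℝ, E3) (γ t)).map_source hx)] with y hy using ⟨hy, mem_univ _⟩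
  have h3 : HasDerivAt (fun s => chartD (γ t) (γ s) (X (γ s)))
      (deriv (coordVectorField (γ t) X ∘ coordCurve (γ t) γ) t) t := by
    refine ((h2.comp t (contDiffAt_coordCurve (h.contMDiffAt ht) hx)).differentiableAt
      (by simp)).hasDerivAt.congr_of_eventuallyEq ?_
    filter_upwards [eventually_mem_chart (h.contMDiffAt ht) hx] with s hs
    show _ = coordVectorField (γ t) X (extChartAt 𝓘(ℝ, E3) (γ t) (γ s))
    unfold coordVectorField
    rw [(extChartAt 𝓘(ℝ, E3) (γ t)).left_inv hs]
  exact (hasDerivAt_form (h.contMDiffAt ht) hx (h.hasDerivAt_velocity ht hx) h3).continuousAt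

lemma IsGeodesic.form_const (h : IsGeodesic g γ I) {s t : ℝ} (hs : s ∈ I) (ht : t ∈ I) :
    g.form (γ t) (vel γ t) (vel γ t) = g.form (γ s) (vel γ s) (vel γ s) := by
  have hd : ∀ r ∈ I, HasDerivAt (fun s => g.form (γ s) (vel γ s) (vel γ s)) 0 r := by
    intro r hr
    have hx : γ r ∈ (extChartAt 𝓘(ℝ, E3) (γ r)).source := mem_extChartAt_source _
    have hv := h.hasDerivAt_velocity hr hx
    have := hasDerivAt_form (g := g) (h.contMDiffAt hr) hx hv hv
    rw [deriv_coordCurve (h.contMDiffAt hr) hx] at this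
    simpa using this
  exact (h.isOpen.is_const_of_deriv_eq_zero h.isConnected.isPreconnected
    (fun r hr => (hd r hr).differentiableAt.differentiableWithinAt)
    (fun r hr => (hd r hr).deriv) ht hs)

lemma isGeodesic_const (x : M) : IsGeodesic g (fun _ => x) univ := by
  refine isGeodesic_of_chart isOpen_univ isConnected_univ (fun t _ => contMDiffAt_const)
    fun t _ => ⟨x, mem_extChartAt_source _, ?_⟩
  have : coordCurve x (fun _ => x) = fun _ => extChartAt 𝓘(ℝ, E3) x x := rfl
  unfold geodOp
  rw [this]
  simp

omit [IsManifold 𝓘(ℝ, E3) ∞ M] in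
lemma vel_const (x : M) (t : ℝ) : (vel (fun _ => x) t : E3) = 0 := by
  unfold vel
  have : (mfderiv 𝓘(ℝ, ℝ) 𝓘(ℝ, E3) (fun _ : ℝ => x) t : ℝ →L[ℝ] E3) = 0 := mfderiv_const
  exact congrArg (fun L : ℝ →L[ℝ] E3 => L 1) this

/-- A geodesic whose velocity vanishes once agrees to first order with a constant geodesic, hence is
constant. -/
lemma IsGeodesic.vel_ne_zero [T2Space M] (h : IsGeodesic g γ I) {s t : ℝ} (hs : s ∈ I) (ht : t ∈ I)
    (h0 : (vel γ s : E3) ≠ 0) : (vel γ t : E3) ≠ 0 := by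
  intro h1
  have h2 := h.eqOn (isGeodesic_const (γ t)) ht (mem_univ t) rfl (by rw [h1, vel_const])
  refine h0 ?_
  rw [vel_congr (γ₂ := fun _ => γ t), vel_const]
  filter_upwards [h.isOpen.mem_nhds hs] with r hr using h2 ⟨hr, mem_univ _⟩

/-- A geodesic that is future null at one point is future null. -/
lemma IsGeodesic.isNullGeodesic [T2Space M] (h : IsGeodesic g γ I) {s : ℝ} (hs : s ∈ I)
    (h0 : FutureNullAt o (γ s) (vel γ s)) : IsNullGeodesic o γ I := by
  refine ⟨h, fun t ht => ?_⟩
  show FutureNullAt o (γ t) (vel γ t)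
  rw [futureNullAt_iff] at h0 ⊢
  have hn : ∀ t ∈ I, g.form (γ t) (vel γ t) (vel γ t) = 0 := fun t ht => by
    rw [h.form_const hs ht]; exact h0.2.1
  refine ⟨h.vel_ne_zero hs ht h0.1, hn t ht, ?_⟩
  -- If the geodesic left the future hemicone, its pairing with the time orientation would vanish
  -- somewhere by the intermediate value theorem, which is impossible for a nonzero null vector.
  by_contra hle
  have hc : ContinuousOn (fun s => g.form (γ s) (vel γ s) (o.field (γ s))) I := fun r hr =>
    (h.continuousAt_form hr o.smooth).continuousWithinAt
  obtain ⟨r, hr, hr0⟩ := h.isConnected.isPreconnected.intermediate_value hs ht hc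
    ⟨h0.2.2.le, not_lt.1 hle⟩
  exact h.vel_ne_zero hs hr h0.1 (lorentz_ne_zero (o.timelike _) (hn r hr) hr0)

end Causal

end

/-! ### Affine reparametrisation and maximal geodesics. -/

section

variable {M : Type*} [TopologicalSpace M] [ChartedSpace E3 M] [IsManifold 𝓘(ℝ, E3) ∞ M]
  {g : LorentzMetric M} {o : TimeOrientation g} {γ γ₁ γ₂ : ℝ → M} {I I₁ I₂ : Set ℝ} {t t₁ t₂ : ℝ}

section Affine

omit [IsManifold 𝓘(ℝ, E3) ∞ M] in
lemma contMDiffAt_comp_affine (a b : ℝ) (h : ContMDiffAt 𝓘(ℝ, ℝ) 𝓘(ℝ, E3) ∞ γ (a * t + b)) :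
    ContMDiffAt 𝓘(ℝ, ℝ) 𝓘(ℝ, E3) ∞ (fun s => γ (a * s + b)) t := by
  have h1 : ContDiffAt ℝ ∞ (fun s : ℝ => a * s + b) t :=
    (contDiffAt_const.mul contDiffAt_id).add contDiffAt_const
  exact ContMDiffAt.comp t h h1.contMDiffAt

lemma vel_comp_affine (a b : ℝ) (h : ContMDiffAt 𝓘(ℝ, ℝ) 𝓘(ℝ, E3) ∞ γ (a * t + b)) :
    (vel (fun s => γ (a * s + b)) t : E3) = a • vel γ (a * t + b) := by
  set x := γ (a * t + b)
  have hx : γ (a * t + b) ∈ (extChartAt 𝓘(ℝ, E3) x).source := mem_extChartAt_source _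
  refine chartD_injective hx ?_
  have h1 := deriv_coordCurve (x₀ := x) (contMDiffAt_comp_affine a b h) hx
  have h2 := ((contDiffAt_coordCurve h hx).differentiableAt (by simp)).hasDerivAt
  rw [deriv_coordCurve h hx] at h2
  have h3 : HasDerivAt (coordCurve x (fun s => γ (a * s + b))) (a • chartD x x (vel γ (a * t + b))) t := by
    have h4 : HasDerivAt (fun s : ℝ => a * s + b) a t := by
      simpa using ((hasDerivAt_id t).const_mul a).add_const b
    exact HasDerivAt.scomp t h2 h4
  rw [h3.deriv] at h1
  rw [map_smul]
  exact h1.symm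

lemma IsGeodesic.comp_affine (h : IsGeodesic g γ I) {a : ℝ} (ha : a ≠ 0) (b : ℝ) :
    IsGeodesic g (fun s => γ (a * s + b)) ((fun s => a * s + b) ⁻¹' I) := by
  refine isGeodesic_of_chart (h.isOpen.preimage (by fun_prop))
    ((affineHomeomorph a b ha).isConnected_preimage.2 h.isConnected)
    (fun t ht => contMDiffAt_comp_affine a b (h.contMDiffAt ht)) fun t ht => ?_
  set x := γ (a * t + b)
  have hx : γ (a * t + b) ∈ (extChartAt 𝓘(ℝ, E3) x).source := mem_extChartAt_source _
  refine ⟨x, hx, ?_⟩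
  have hy := contDiffAt_coordCurve (h.contMDiffAt ht) hx
  have h4 : ∀ s, HasDerivAt (fun s : ℝ => a * s + b) a s := fun s => by
    simpa using ((hasDerivAt_id s).const_mul a).add_const b
  have hc : ContinuousAt (fun s : ℝ => a * s + b) t := by fun_prop
  have e1 : deriv (coordCurve x (fun s => γ (a * s + b))) =ᶠ[𝓝 t]
      fun s => a • deriv (coordCurve x γ) (a * s + b) := by
    filter_upwards [hc.eventually (eventually_differentiableAt hy)] with s hs
    exact (HasDerivAt.scomp s hs.hasDerivAt (h4 s)).deriv
  have e2 : deriv (fun s => a • deriv (coordCurve x γ) (a * s + b)) t =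
      a • a • deriv (deriv (coordCurve x γ)) (a * t + b) :=
    ((HasDerivAt.scomp t ((contDiffAt_deriv hy).differentiableAt (by simp)).hasDerivAt
      (h4 t)).const_smul a).deriv
  have e3 := h.geodOp_eq_zero ht hx
  unfold geodOp at e3 ⊢
  rw [e1.deriv_eq, e1.self_of_nhds, e2]
  have e4 : coordCurve x (fun s => γ (a * s + b)) t = coordCurve x γ (a * t + b) := rfl
  rw [e4]
  simp only [map_smul, smul_apply]
  rw [← smul_add, ← smul_add, e3, smul_zero, smul_zero]

end Affine

section Maximal

variable [T2Space M]

variable (g) in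
/-- The maximal geodesic with given initial values. -/
lemma exists_maximal_geodesic (x : M) (v : E3) (t₀ : ℝ) : ∃ (γ : ℝ → M) (I : Set ℝ),
    IsGeodesic g γ I ∧ t₀ ∈ I ∧ γ t₀ = x ∧ vel γ t₀ = v ∧
      ∀ (γ' : ℝ → M) (I' : Set ℝ), IsGeodesic g γ' I' → t₀ ∈ I' → γ' t₀ = x →
        (vel γ' t₀ : E3) = v → I' ⊆ I ∧ EqOn γ γ' I' := by
  -- All geodesics with the given initial values. Any two agree on their common interval, so they
  -- glue to a geodesic on the union; the value off the union is irrelevant.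
  let S : (ℝ → M) × Set ℝ → Prop := fun p =>
    IsGeodesic g p.1 p.2 ∧ t₀ ∈ p.2 ∧ p.1 t₀ = x ∧ (vel p.1 t₀ : E3) = v
  let I : Set ℝ := {t | ∃ p, S p ∧ t ∈ p.2}
  classical
  let γ : ℝ → M := fun t => if h : ∃ p, S p ∧ t ∈ p.2 then h.choose.1 t else x
  have hγ : ∀ p, S p → EqOn γ p.1 p.2 := by
    intro p hp t ht
    have h : ∃ p, S p ∧ t ∈ p.2 := ⟨p, hp, ht⟩
    have h1 := h.choose_spec
    have : γ t = h.choose.1 t := dif_pos h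
    rw [this]
    exact h1.1.1.eqOn hp.1 h1.1.2.1 hp.2.1 (h1.1.2.2.1.trans hp.2.2.1.symm)
      (h1.1.2.2.2.trans hp.2.2.2.symm) ⟨h1.2, ht⟩
  have hev : ∀ p, S p → ∀ t ∈ p.2, γ =ᶠ[𝓝 t] p.1 := fun p hp t ht => by
    filter_upwards [hp.1.isOpen.mem_nhds ht] with s hs using hγ p hp hs
  obtain ⟨γ₀, I₀, h0⟩ := exists_isGeodesic g x v t₀
  have hS0 : S (γ₀, I₀) := h0
  have hopen : IsOpen I := by
    have : I = ⋃ p : {p // S p}, p.1.2 := by ext t; simp [I]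
    rw [this]
    exact isOpen_iUnion fun p => p.2.1.isOpen
  have hIc : IsConnected I := by
    have : I = ⋃ p : {p // S p}, p.1.2 := by ext t; simp [I]
    refine ⟨⟨t₀, (γ₀, I₀), hS0, hS0.2.1⟩, ?_⟩
    rw [this]
    exact isPreconnected_iUnion ⟨t₀, mem_iInter.2 fun p => p.2.2.1⟩
      fun p => p.2.1.isConnected.isPreconnected
  refine ⟨γ, I, isGeodesic_congr_local hopen hIc ?_, ⟨_, hS0, hS0.2.1⟩, ?_, ?_, ?_⟩
  · rintro t ⟨p, hp, ht⟩
    exact ⟨p.1, p.2, hp.1, ht, hev p hp t ht⟩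
  · rw [hγ _ hS0 hS0.2.1]; exact hS0.2.2.1
  · rw [vel_congr (hev _ hS0 t₀ hS0.2.1)]; exact hS0.2.2.2
  · intro γ' I' h1 h2 h3 h4
    have hp : S (γ', I') := ⟨h1, h2, h3, h4⟩
    exact ⟨fun t ht => ⟨_, hp, ht⟩, hγ _ hp⟩

/-- Any geodesic that agrees with a maximal one to first order is contained in it. -/
lemma IsMaximalNullGeodesic.contains (h : IsMaximalNullGeodesic o γ₁ I₁)
    (h' : IsGeodesic g γ₂ I₂) (ht₁ : t ∈ I₁) (ht₂ : t ∈ I₂) (e : γ₁ t = γ₂ t)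
    (ev : (vel γ₁ t : E3) = vel γ₂ t) : I₂ ⊆ I₁ ∧ EqOn γ₁ γ₂ I₂ := by
  obtain ⟨δ, K, hδ, htK, -, -, hmax⟩ := exists_maximal_geodesic g (γ₁ t) (vel γ₁ t) t
  obtain ⟨s1, e1⟩ := hmax γ₁ I₁ h.toIsGeodesic ht₁ rfl rfl
  obtain ⟨s2, e2⟩ := hmax γ₂ I₂ h' ht₂ e.symm ev.symm
  have hK := h.maximal δ K hδ s1 e1.symm
  rw [hK] at s2
  exact ⟨s2, fun s hs => (e1 (s2 hs)).symm.trans (e2 hs)⟩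

variable (o) in
lemma exists_isMaximalNullGeodesic {x : M} {v : E3} (hv : FutureNullAt o x v) (t₀ : ℝ) :
    ∃ (γ : ℝ → M) (I : Set ℝ), IsMaximalNullGeodesic o γ I ∧ t₀ ∈ I ∧ γ t₀ = x ∧ vel γ t₀ = v := by
  obtain ⟨γ, I, hγ, ht, hx, hv', hmax⟩ := exists_maximal_geodesic g x v t₀
  subst hx hv'
  refine ⟨γ, I, ⟨hγ.isNullGeodesic ht hv, fun γ' I' h' hI e => ?_⟩, ht, rfl, rfl⟩
  have e' : γ =ᶠ[𝓝 t₀] γ' := by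
    filter_upwards [hγ.isOpen.mem_nhds ht] with s hs using e hs
  exact ((hmax γ' I' h' (hI ht) e'.self_of_nhds.symm (vel_congr e').symm).1).antisymm hI

omit [T2Space M] in
lemma IsNullGeodesic.futureNullAt (h : IsNullGeodesic o γ I) (ht : t ∈ I) :
    FutureNullAt o (γ t) (vel γ t) := h.futureNull t ht

/-- Maximal null geodesics with parallel velocities at a common point have the same image. -/
lemma IsMaximalNullGeodesic.eq_comp_affine (h₁ : IsMaximalNullGeodesic o γ₁ I₁)
    (h₂ : IsMaximalNullGeodesic o γ₂ I₂) (ht₁ : t₁ ∈ I₁) (ht₂ : t₂ ∈ I₂) (e : γ₁ t₁ = γ₂ t₂)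
    {k : ℝ} (hk : k ≠ 0) (ev : (vel γ₁ t₁ : E3) = k • vel γ₂ t₂) {s : ℝ} (hs : s ∈ I₁) :
    k * s + (t₂ - k * t₁) ∈ I₂ ∧ γ₁ s = γ₂ (k * s + (t₂ - k * t₁)) := by
  have hk' := inv_ne_zero hk
  -- The affine change of parameter moves `t₁` to `t₂` and rescales the velocity by `k⁻¹`, after
  -- which both curves have the same initial values and maximality of `γ₂` applies.
  have h3 := h₁.toIsGeodesic.comp_affine hk' (t₁ - k⁻¹ * t₂)
  have e1 : k⁻¹ * t₂ + (t₁ - k⁻¹ * t₂) = t₁ := by ring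
  obtain ⟨s1, s2⟩ := h₂.contains h3 ht₂ (by rw [mem_preimage, e1]; exact ht₁)
    (by rw [e1]; exact e.symm)
    (by
      rw [vel_comp_affine, e1, ev, smul_smul, inv_mul_cancel₀ hk, one_smul]
      rw [e1]
      exact h₁.toIsGeodesic.contMDiffAt ht₁)
  have e2 : k⁻¹ * (k * s + (t₂ - k * t₁)) + (t₁ - k⁻¹ * t₂) = s := by
    field_simp; ring
  have h4 : k * s + (t₂ - k * t₁) ∈ (fun s => k⁻¹ * s + (t₁ - k⁻¹ * t₂)) ⁻¹' I₁ := by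
    rw [mem_preimage, e2]; exact hs
  refine ⟨s1 h4, ?_⟩
  rw [s2 h4]
  exact (congrArg γ₁ e2).symm

lemma IsMaximalNullGeodesic.image_eq (h₁ : IsMaximalNullGeodesic o γ₁ I₁)
    (h₂ : IsMaximalNullGeodesic o γ₂ I₂) (ht₁ : t₁ ∈ I₁) (ht₂ : t₂ ∈ I₂) (e : γ₁ t₁ = γ₂ t₂)
    {k : ℝ} (hk : k ≠ 0) (ev : (vel γ₁ t₁ : E3) = k • vel γ₂ t₂) : γ₁ '' I₁ = γ₂ '' I₂ := by
  apply Subset.antisymm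
  · rintro _ ⟨s, hs, rfl⟩
    obtain ⟨a, b⟩ := h₁.eq_comp_affine h₂ ht₁ ht₂ e hk ev hs
    exact ⟨_, a, b.symm⟩
  · rintro _ ⟨s, hs, rfl⟩
    have ev' : (vel γ₂ t₂ : E3) = k⁻¹ • vel γ₁ t₁ := by
      rw [ev, smul_smul, inv_mul_cancel₀ hk, one_smul]
    obtain ⟨a, b⟩ := h₂.eq_comp_affine h₁ ht₂ ht₁ e.symm (inv_ne_zero hk) ev' hs
    exact ⟨_, a, b.symm⟩

end Maximal

end

/-! ### Charts of the bundle of null lines and the framed coordinates they define. -/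

section

open VectorField

variable {M : Type*} [TopologicalSpace M] [ChartedSpace E3 M] [IsManifold 𝓘(ℝ, E3) ∞ M]
  {g : LorentzMetric M}

section Frames

omit [IsManifold 𝓘(ℝ, E3) ∞ M] in
lemma isOpen_extChartAt_symm_preimage {x₀ : M} {U : Set M} (hU : IsOpen U) :
    IsOpen {y | y ∈ (extChartAt 𝓘(ℝ, E3) x₀).target ∧ (extChartAt 𝓘(ℝ, E3) x₀).symm y ∈ U} :=
  (continuousOn_extChartAt_symm (I := 𝓘(ℝ, E3)) x₀).isOpen_inter_preimage
    (isOpen_extChartAt_target x₀) hU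

/-- A frame in the chart of `M` at `x₀`. -/
def Frame.model (F : Frame g) (x₀ : M) : FramedMetric E3 where
  dom := {y | y ∈ (extChartAt 𝓘(ℝ, E3) x₀).target ∧ (extChartAt 𝓘(ℝ, E3) x₀).symm y ∈ F.dom}
  G := chartMetric g x₀
  V := coordVectorField x₀ F.V
  Y := coordVectorField x₀ F.Y
  T := coordVectorField x₀ F.T
  isOpen_dom := isOpen_extChartAt_symm_preimage F.isOpen_dom
  smooth_G := (contDiffOn_chartMetric g x₀).mono fun y hy => hy.1
  smooth_V := contDiffOn_coordVectorField F.isOpen_dom F.smooth_V x₀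
  smooth_Y := contDiffOn_coordVectorField F.isOpen_dom F.smooth_Y x₀
  smooth_T := contDiffOn_coordVectorField F.isOpen_dom F.smooth_T x₀
  symm y _ u v := chartMetric_symm g x₀ y u v
  invertible y hy := chartMetric_isInvertible g x₀ hy.1
  VV y hy := (chartMetric_coordVector g hy.1 _ _).trans (F.VV _ hy.2)
  YY y hy := (chartMetric_coordVector g hy.1 _ _).trans (F.YY _ hy.2)
  TT y hy := (chartMetric_coordVector g hy.1 _ _).trans (F.TT _ hy.2)
  VY y hy := (chartMetric_coordVector g hy.1 _ _).trans (F.VY _ hy.2)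
  VT y hy := (chartMetric_coordVector g hy.1 _ _).trans (F.VT _ hy.2)
  YT y hy := (chartMetric_coordVector g hy.1 _ _).trans (F.YT _ hy.2)
  expand y hy w := by
    have h1 : ∀ v : E3, v = _ := fun v => g.expand _ (F.VV _ hy.2) (F.YY _ hy.2) (F.TT _ hy.2)
      (F.VY _ hy.2) (F.VT _ hy.2) (F.YT _ hy.2) v
    have h2 := congrArg (chartD x₀ ((extChartAt 𝓘(ℝ, E3) x₀).symm y)) (h1 (chartDSymm x₀ y w))
    rw [chartD_chartDSymm hy.1] at h2
    have e : ∀ X : ∀ x : M, TangentSpace 𝓘(ℝ, E3) x, chartMetric g x₀ y w (coordVectorField x₀ X y) =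
        g.form ((extChartAt 𝓘(ℝ, E3) x₀).symm y) (chartDSymm x₀ y w)
          (X ((extChartAt 𝓘(ℝ, E3) x₀).symm y)) := by
      intro X
      conv_lhs => rw [← chartD_chartDSymm hy.1 w]
      exact chartMetric_coordVector g hy.1 _ _
    rw [e, e, e]
    refine h2.trans ((map_sub _ _ _).trans ?_)
    congr 1
    · refine (map_add _ _ _).trans ?_
      congr 1 <;> exact map_smul _ _ _
    · exact map_smul _ _ _

end Frames

namespace PC

/-- The frame used for the preferred chart at `u₀`. -/
def frame (u₀ : PC g) : Frame g := (exists_chart u₀).choose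

/-- The geometry of `M` in the preferred chart at `u₀`. -/
def model (u₀ : PC g) : FramedMetric E3 := u₀.frame.model u₀.pt

variable {u₀ u : PC g}

lemma extChartAt_apply (u₀ u : PC g) : extChartAt 𝓘(ℝ, E3 × ℝ) u₀ u =
    (extChartAt 𝓘(ℝ, E3) u₀.pt u.pt, u₀.frame.coord u) := rfl

lemma extChartAt_source_iff : u ∈ (extChartAt 𝓘(ℝ, E3 × ℝ) u₀).source ↔
    u.pt ∈ (extChartAt 𝓘(ℝ, E3) u₀.pt).source ∧ u.pt ∈ u₀.frame.dom ∧
      u₀.frame.den u.pt u.line.rep ≠ 0 := by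
  rw [extChartAt_source, extChartAt_source]
  rfl

lemma extChartAt_target_eq :
    (extChartAt 𝓘(ℝ, E3 × ℝ) u₀).target = u₀.model.lineDom := by
  ext q
  rw [extChartAt_target]
  unfold FramedMetric.lineDom
  simp only [modelWithCornersSelf_coe_symm, range_id, inter_univ, modelWithCornersSelf_coe]
  show _ ↔ q.1 ∈ (extChartAt 𝓘(ℝ, E3) u₀.pt).target ∧ _
  rw [extChartAt_target]
  simp only [modelWithCornersSelf_coe_symm, range_id, inter_univ, modelWithCornersSelf_coe]
  rfl

lemma pt_mem (hu : u ∈ (extChartAt 𝓘(ℝ, E3 × ℝ) u₀).source) :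
    u.pt ∈ (extChartAt 𝓘(ℝ, E3) u₀.pt).source := (extChartAt_source_iff.1 hu).1

lemma mem_lineDom (hu : u ∈ (extChartAt 𝓘(ℝ, E3 × ℝ) u₀).source) :
    extChartAt 𝓘(ℝ, E3 × ℝ) u₀ u ∈ u₀.model.lineDom := by
  rw [← extChartAt_target_eq]
  exact (extChartAt 𝓘(ℝ, E3 × ℝ) u₀).map_source hu

lemma pt_symm {q : E3 × ℝ} (hq : q ∈ u₀.model.lineDom) :
    ((extChartAt 𝓘(ℝ, E3 × ℝ) u₀).symm q).pt = (extChartAt 𝓘(ℝ, E3) u₀.pt).symm q.1 := by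
  have h : (chartAt E3 u₀.pt).symm q.1 ∈ u₀.frame.dom := hq.2
  exact congrArg PC.pt (u₀.frame.chart_symm_apply u₀ h)

variable (g) in
lemma contMDiff_pt : ContMDiff 𝓘(ℝ, E3 × ℝ) 𝓘(ℝ, E3) ∞ (PC.pt : PC g → M) := by
  intro u
  have h1 : ContMDiffAt 𝓘(ℝ, E3 × ℝ) 𝓘(ℝ, E3) ∞ (fun u' : PC g =>
      (extChartAt 𝓘(ℝ, E3) u.pt).symm (extChartAt 𝓘(ℝ, E3 × ℝ) u u').1) u := by
    have h2 : ContMDiffAt 𝓘(ℝ, E3 × ℝ) 𝓘(ℝ, E3) ∞ (fun u' : PC g =>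
        (extChartAt 𝓘(ℝ, E3 × ℝ) u u').1) u :=
      ContMDiffAt.comp u (contDiffAt_fst (𝕜 := ℝ) (E := E3) (F := ℝ)).contMDiffAt
        (contMDiffAt_extChartAt (I := 𝓘(ℝ, E3 × ℝ)))
    exact (contMDiffAt_extChartAt_symm (mem_extChartAt_target (I := 𝓘(ℝ, E3)) u.pt)).comp u h2
  refine h1.congr_of_eventuallyEq ?_
  filter_upwards [extChartAt_source_mem_nhds (I := 𝓘(ℝ, E3 × ℝ)) u] with u' hu'
  exact ((extChartAt 𝓘(ℝ, E3) u.pt).left_inv (pt_mem hu')).symm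

/-- The differential of the projection in charts. -/
lemma chartD_mfd_pt (hu : u ∈ (extChartAt 𝓘(ℝ, E3 × ℝ) u₀).source) (w : E3 × ℝ) :
    chartD u₀.pt u.pt (mfd (PC.pt : PC g → M) u w) = (chartD u₀ u w).1 := by
  have h1 := (fderiv_coord_map (f := (PC.pt : PC g → M))
    ((contMDiff_pt g u).mdifferentiableAt (by simp)) hu (pt_mem hu) w).2
  rw [← h1]
  have h2 : (fun y => extChartAt 𝓘(ℝ, E3) u₀.pt ((extChartAt 𝓘(ℝ, E3 × ℝ) u₀).symm y).pt)
      =ᶠ[𝓝 (extChartAt 𝓘(ℝ, E3 × ℝ) u₀ u)] Prod.fst := by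
    filter_upwards [u₀.model.isOpen_lineDom.mem_nhds (mem_lineDom hu)] with z hz
    rw [pt_symm hz]
    exact (extChartAt 𝓘(ℝ, E3) u₀.pt).right_inv hz.1
  rw [h2.fderiv_eq, fderiv_fst]
  rfl

lemma chartD_vec (F : Frame g) {x₀ x : M} (hx : x ∈ (extChartAt 𝓘(ℝ, E3) x₀).source) (s : ℝ) :
    (chartD x₀ x : E3 →L[ℝ] E3) (F.vec x s) = (F.model x₀).xi (extChartAt 𝓘(ℝ, E3) x₀ x, s) := by
  have e : ∀ X : ∀ x : M, TangentSpace 𝓘(ℝ, E3) x,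
      (chartD x₀ x : E3 →L[ℝ] E3) (X x) = coordVectorField x₀ X (extChartAt 𝓘(ℝ, E3) x₀ x) := by
    intro X
    unfold coordVectorField
    rw [(extChartAt 𝓘(ℝ, E3) x₀).left_inv hx]
  unfold FramedMetric.xi
  show (chartD x₀ x : E3 →L[ℝ] E3) (F.vec x s) = (1 - s ^ 2) • coordVectorField x₀ F.V _ + (2 * s) •
    coordVectorField x₀ F.Y _ + (1 + s ^ 2) • coordVectorField x₀ F.T _
  rw [← e, ← e, ← e]
  refine (map_add _ _ _).trans ?_
  congr 1
  · refine (map_add _ _ _).trans ?_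
    congr 1 <;> exact map_smul _ _ _
  · exact map_smul _ _ _

/-- The null vectors on the line `u`, as a subspace of the model space. -/
def lineSub (u : PC g) : Submodule ℝ E3 := u.line.submodule

lemma mem_lineSub_of (x : M) (v : E3) (hv : v ≠ 0) (hn : g.val x v v = 0) (w : E3) :
    w ∈ (PC.of g x v hv hn).lineSub ↔ ∃ r : ℝ, w = r • v := by
  have h : (PC.of g x v hv hn).lineSub = Submodule.span ℝ {v} :=
    Projectivization.submodule_mk (K := ℝ) (V := E3) v hv
  rw [h, Submodule.mem_span_singleton]
  exact ⟨fun ⟨r, h⟩ => ⟨r, h.symm⟩, fun ⟨r, h⟩ => ⟨r, h.symm⟩⟩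

/-- The fibre coordinate of `u` was defined so that `Frame.vec` at this coordinate spans the line,
and `xi` is this vector in the chart. -/
lemma mem_lineSub_iff (hu : u ∈ (extChartAt 𝓘(ℝ, E3 × ℝ) u₀).source) (w : E3) :
    w ∈ u.lineSub ↔
      ∃ r : ℝ, chartD u₀.pt u.pt w = r • u₀.model.xi (extChartAt 𝓘(ℝ, E3 × ℝ) u₀ u) := by
  obtain ⟨x, v, hv, hn, rfl⟩ := u.exists_of
  obtain ⟨h1, h2, h3⟩ := extChartAt_source_iff.1 hu
  have hd := (u₀.frame.den_of hv hn).1 h3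
  have h4 := u₀.frame.lineAt_coord h2 hv hn hd
  have h5 : extChartAt 𝓘(ℝ, E3 × ℝ) u₀ (PC.of g x v hv hn) =
      (extChartAt 𝓘(ℝ, E3) u₀.pt x, u₀.frame.num x v / u₀.frame.den x v) := by
    rw [extChartAt_apply, u₀.frame.coord_of]
    rfl
  rw [h5]
  have h6 := mem_lineSub_of x (u₀.frame.vec x (u₀.frame.num x v / u₀.frame.den x v))
    (u₀.frame.vec_ne_zero h2 _) (u₀.frame.vec_null h2 _) w
  have h7 : PC.of g x v hv hn = PC.of g x (u₀.frame.vec x (u₀.frame.num x v / u₀.frame.den x v))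
    (u₀.frame.vec_ne_zero h2 _) (u₀.frame.vec_null h2 _) := h4.symm
  have h8 : w ∈ (PC.of g x v hv hn).lineSub ↔
      ∃ r : ℝ, w = r • (u₀.frame.vec x (u₀.frame.num x v / u₀.frame.den x v) : E3) := by
    rw [h7]; exact h6
  rw [h8]
  have h9 := chartD_vec u₀.frame h1 (u₀.frame.num x v / u₀.frame.den x v)
  have key : ∀ V X : E3, chartD u₀.pt x V = X →
      ((∃ r : ℝ, w = r • V) ↔ ∃ r : ℝ, chartD u₀.pt x w = r • X) := by
    rintro V X rfl
    refine exists_congr fun r => ?_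
    rw [← map_smul]
    exact (chartD_injective h1).eq_iff.symm
  exact key _ _ h9

end PC

end

/-! ### The distribution D, its derived distribution and the Engel kernel in coordinates. -/

section

open VectorField

variable {M : Type*} [TopologicalSpace M] [ChartedSpace E3 M] [IsManifold 𝓘(ℝ, E3) ∞ M]
  {g : LorentzMetric M} {u₀ u : PC g}

namespace PC

/-- The differential of the preferred chart at `u₀`. -/
abbrev dChart (u₀ u : PC g) : E3 × ℝ →L[ℝ] E3 × ℝ := chartD u₀ u

/-- The plane `D u`, as a subspace of the model space. -/
def dSub (u : PC g) : Submodule ℝ (E3 × ℝ) := prolongation g u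

/-- The space `[D, D] u`, as a subspace of the model space. -/
def eSub (u : PC g) : Submodule ℝ (E3 × ℝ) := bracket (prolongation g) u

/-- The kernel line, as a subspace of the model space. -/
def wSub (u : PC g) : Submodule ℝ (E3 × ℝ) := engelKernel (prolongation g) u

lemma mem_dSub_iff (hu : u ∈ (extChartAt 𝓘(ℝ, E3 × ℝ) u₀).source) (w : E3 × ℝ) :
    w ∈ u.dSub ↔
      ∃ r : ℝ, (dChart u₀ u w).1 = r • u₀.model.xi (extChartAt 𝓘(ℝ, E3 × ℝ) u₀ u) := by
  rw [← chartD_mfd_pt hu, ← mem_lineSub_iff hu]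
  rfl

section Coordinates

variable {U : Set (PC g)} {X : ∀ u : PC g, TangentSpace 𝓘(ℝ, E3 × ℝ) u}

/-- A field in coordinates near a point of its domain. -/
lemma coordVectorField_eventually (hU : IsOpen U) (hu : u ∈ (extChartAt 𝓘(ℝ, E3 × ℝ) u₀).source)
    (huU : u ∈ U) {P : PC g → Prop} (h : ∀ u ∈ U, P u) :
    ∀ᶠ z in 𝓝 (extChartAt 𝓘(ℝ, E3 × ℝ) u₀ u), ∃ u', u' ∈ (extChartAt 𝓘(ℝ, E3 × ℝ) u₀).source ∧
      P u' ∧ z = extChartAt 𝓘(ℝ, E3 × ℝ) u₀ u' ∧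
        coordVectorField u₀ X z = dChart u₀ u' (X u') := by
  have hy := (extChartAt 𝓘(ℝ, E3 × ℝ) u₀).map_source hu
  have hc : ContinuousAt (extChartAt 𝓘(ℝ, E3 × ℝ) u₀).symm (extChartAt 𝓘(ℝ, E3 × ℝ) u₀ u) :=
    (contMDiffAt_extChartAt_symm hy).continuousAt
  have h2 : U ∈ 𝓝 ((extChartAt 𝓘(ℝ, E3 × ℝ) u₀).symm (extChartAt 𝓘(ℝ, E3 × ℝ) u₀ u)) := by
    rw [(extChartAt 𝓘(ℝ, E3 × ℝ) u₀).left_inv hu]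
    exact hU.mem_nhds huU
  filter_upwards [(isOpen_extChartAt_target u₀).mem_nhds hy, hc.eventually h2] with z h3 h4
  exact ⟨_, (extChartAt 𝓘(ℝ, E3 × ℝ) u₀).map_target h3, h _ h4,
    ((extChartAt 𝓘(ℝ, E3 × ℝ) u₀).right_inv h3).symm, rfl⟩

lemma contDiffAt_coordVectorField (hU : IsOpen U) (hu : u ∈ (extChartAt 𝓘(ℝ, E3 × ℝ) u₀).source)
    (huU : u ∈ U) (hX : ContMDiffOn 𝓘(ℝ, E3 × ℝ) 𝓘(ℝ, E3 × ℝ).tangent ∞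
      (fun q => (⟨q, X q⟩ : TangentBundle 𝓘(ℝ, E3 × ℝ) (PC g))) U) :
    ContDiffAt ℝ ∞ (coordVectorField u₀ X) (extChartAt 𝓘(ℝ, E3 × ℝ) u₀ u) := by
  have hy := (extChartAt 𝓘(ℝ, E3 × ℝ) u₀).map_source hu
  refine (contDiffOn_coordVectorField hU hX u₀ _ ⟨hy, ?_⟩).contDiffAt ?_
  · rwa [(extChartAt 𝓘(ℝ, E3 × ℝ) u₀).left_inv hu]
  · refine ((continuousOn_extChartAt_symm (I := 𝓘(ℝ, E3 × ℝ)) u₀).isOpen_inter_preimage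
      (isOpen_extChartAt_target u₀) hU).mem_nhds ⟨hy, ?_⟩
    rw [mem_preimage, (extChartAt 𝓘(ℝ, E3 × ℝ) u₀).left_inv hu]
    exact huU

/-- The bracket of two sections of `[D, D]` in coordinates. -/
lemma G_mlieBracket {D : TangentDistribution (E3 × ℝ) (PC g)}
    (hD : ∀ u' ∈ (extChartAt 𝓘(ℝ, E3 × ℝ) u₀).source, ∀ w : E3 × ℝ, w ∈ D u' →
      u₀.model.G (extChartAt 𝓘(ℝ, E3 × ℝ) u₀ u').1 (dChart u₀ u' w).1
        (u₀.model.xi (extChartAt 𝓘(ℝ, E3 × ℝ) u₀ u')) = 0)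
    {U U' : Set (PC g)} {X Z : ∀ u : PC g, TangentSpace 𝓘(ℝ, E3 × ℝ) u}
    (hX : IsLocalSection D U X) (hZ : IsLocalSection D U' Z)
    (hu : u ∈ (extChartAt 𝓘(ℝ, E3 × ℝ) u₀).source) (hU : u ∈ U) (hU' : u ∈ U') :
    u₀.model.G (extChartAt 𝓘(ℝ, E3 × ℝ) u₀ u).1
        (dChart u₀ u (mlieBracket 𝓘(ℝ, E3 × ℝ) X Z u)).1
        (u₀.model.xi (extChartAt 𝓘(ℝ, E3 × ℝ) u₀ u)) =
      u₀.model.G (extChartAt 𝓘(ℝ, E3 × ℝ) u₀ u).1 (dChart u₀ u (X u)).1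
        (u₀.model.nabla (extChartAt 𝓘(ℝ, E3 × ℝ) u₀ u) (dChart u₀ u (Z u))) -
      u₀.model.G (extChartAt 𝓘(ℝ, E3 × ℝ) u₀ u).1 (dChart u₀ u (Z u)).1
        (u₀.model.nabla (extChartAt 𝓘(ℝ, E3 × ℝ) u₀ u) (dChart u₀ u (X u))) := by
  have key : ∀ {U : Set (PC g)} {X : ∀ u : PC g, TangentSpace 𝓘(ℝ, E3 × ℝ) u},
      IsLocalSection D U X → u ∈ U →
      DifferentiableAt ℝ (coordVectorField u₀ X) (extChartAt 𝓘(ℝ, E3 × ℝ) u₀ u) ∧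
      (∀ᶠ z in 𝓝 (extChartAt 𝓘(ℝ, E3 × ℝ) u₀ u),
        u₀.model.G z.1 (coordVectorField u₀ X z).1 (u₀.model.xi z) = 0) ∧
      coordVectorField u₀ X (extChartAt 𝓘(ℝ, E3 × ℝ) u₀ u) = dChart u₀ u (X u) := by
    intro U X hX hU
    refine ⟨(contDiffAt_coordVectorField hX.isOpen hu hU hX.smooth).differentiableAt (by simp),
      ?_, ?_⟩
    · filter_upwards [coordVectorField_eventually (X := X) hX.isOpen hu hU hX.mem] with z hz
      obtain ⟨u', h1, h2, h3, h4⟩ := hz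
      rw [h4, h3]
      exact hD u' h1 _ h2
    · unfold coordVectorField
      rw [(extChartAt 𝓘(ℝ, E3 × ℝ) u₀).left_inv hu]
  obtain ⟨dX, oX, eX⟩ := key hX hU
  obtain ⟨dZ, oZ, eZ⟩ := key hZ hU'
  have h1 := FramedMetric.G_lieBracket (mem_lineDom hu) dX dZ oX oZ
  have h2 : dChart u₀ u (mlieBracket 𝓘(ℝ, E3 × ℝ) X Z u) =
      lieBracket ℝ (coordVectorField u₀ X) (coordVectorField u₀ Z)
        (extChartAt 𝓘(ℝ, E3 × ℝ) u₀ u) :=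
    chartD_mlieBracket hu ((hX.smooth u hU).contMDiffAt (hX.isOpen.mem_nhds hU))
      ((hZ.smooth u hU').contMDiffAt (hZ.isOpen.mem_nhds hU'))
  rw [h2, h1, eX, eZ]

/-- A smooth field in the chart at `u₀` gives a section. -/
lemma isLocalSection_fieldOfCoord {D : TangentDistribution (E3 × ℝ) (PC g)} {Xc : E3 × ℝ → E3 × ℝ}
    (hX : ∀ q ∈ u₀.model.lineDom, ContDiffAt ℝ ∞ Xc q)
    (hD : ∀ u' ∈ (extChartAt 𝓘(ℝ, E3 × ℝ) u₀).source, ∀ w : E3 × ℝ,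
      dChart u₀ u' w = Xc (extChartAt 𝓘(ℝ, E3 × ℝ) u₀ u') → w ∈ D u') :
    IsLocalSection D (extChartAt 𝓘(ℝ, E3 × ℝ) u₀).source (fieldOfCoord u₀ Xc) := by
  have h := contMDiffOn_fieldOfCoord (q₀ := u₀) u₀.model.isOpen_lineDom
    (fun q hq => (hX q hq).contDiffWithinAt)
  refine ⟨isOpen_extChartAt_source u₀, h.mono fun u hu => ⟨hu, mem_lineDom hu⟩, fun u hu => ?_⟩
  exact hD u hu _ (chartD_chartDSymm' hu _)

lemma dChart_fieldOfCoord (Xc : E3 × ℝ → E3 × ℝ) (hu : u ∈ (extChartAt 𝓘(ℝ, E3 × ℝ) u₀).source) :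
    dChart u₀ u (fieldOfCoord u₀ Xc u) = Xc (extChartAt 𝓘(ℝ, E3 × ℝ) u₀ u) :=
  chartD_chartDSymm' hu _

end Coordinates

section Distributions

lemma G_of_mem_dSub (hu : u ∈ (extChartAt 𝓘(ℝ, E3 × ℝ) u₀).source) {w : E3 × ℝ} (hw : w ∈ u.dSub) :
    u₀.model.G (extChartAt 𝓘(ℝ, E3 × ℝ) u₀ u).1 (dChart u₀ u w).1
      (u₀.model.xi (extChartAt 𝓘(ℝ, E3 × ℝ) u₀ u)) = 0 := by
  obtain ⟨r, hr⟩ := (mem_dSub_iff hu w).1 hw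
  rw [hr, map_smul, smul_apply, FramedMetric.G_xi_xi (mem_lineDom hu), smul_zero]

lemma G_xi_nabla {N : FramedMetric E3} {q : E3 × ℝ} (hq : q ∈ N.lineDom) (Z : E3 × ℝ) :
    N.G q.1 (N.xi q) (N.nabla q Z) = 0 := by
  rw [N.symm _ hq]
  exact FramedMetric.G_nabla_xi hq Z

/-- `[D, D]` in coordinates. -/
lemma mem_eSub_iff (hu : u ∈ (extChartAt 𝓘(ℝ, E3 × ℝ) u₀).source) (w : E3 × ℝ) :
    w ∈ u.eSub ↔ u₀.model.G (extChartAt 𝓘(ℝ, E3 × ℝ) u₀ u).1 (dChart u₀ u w).1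
      (u₀.model.xi (extChartAt 𝓘(ℝ, E3 × ℝ) u₀ u)) = 0 := by
  have hq := mem_lineDom hu
  constructor
  · let S : Submodule ℝ (E3 × ℝ) := LinearMap.ker
      (((u₀.model.G (extChartAt 𝓘(ℝ, E3 × ℝ) u₀ u).1).flip
        (u₀.model.xi (extChartAt 𝓘(ℝ, E3 × ℝ) u₀ u))) ∘L
          (ContinuousLinearMap.fst ℝ E3 ℝ) ∘L (dChart u₀ u)).toLinearMap
    suffices h : u.eSub ≤ S from fun hw => h hw
    refine sup_le (fun w hw => G_of_mem_dSub hu hw) (Submodule.span_le.2 ?_)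
    rintro _ ⟨U, X, Y, hX, hY, hU, rfl⟩
    -- Both fields have base part a multiple of `xi`, and every covariant derivative of `xi` is
    -- orthogonal to `xi`; so both terms of the bracket formula vanish.
    have h := G_mlieBracket (D := prolongation g) (fun u' hu' w hw => G_of_mem_dSub hu' hw)
      hX hY hu hU hU
    refine h.trans ?_
    obtain ⟨a, ha⟩ := (mem_dSub_iff hu _).1 (hX.mem u hU)
    obtain ⟨b, hb⟩ := (mem_dSub_iff hu _).1 (hY.mem u hU)
    rw [ha, hb]
    simp only [map_smul, smul_apply, G_xi_nabla hq]
    simp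
  · intro hw
    set q := extChartAt 𝓘(ℝ, E3 × ℝ) u₀ u with hqdef
    have hdec := FramedMetric.decompose hq hw
    set a := u₀.model.coeff q.1 (dChart u₀ u w).1
    set b := u₀.model.G q.1 (dChart u₀ u w).1 (u₀.model.rho q) / 4
    -- Local generators of D. The bracket of the vertical field `X2` with `X1` is `(rho, 0)`, and
    -- these three vectors span the orthogonality hyperplane by `decompose`.
    let X1 : ∀ u : PC g, TangentSpace 𝓘(ℝ, E3 × ℝ) u := fieldOfCoord u₀ fun q => (u₀.model.xi q, 0)
    let X2 : ∀ u : PC g, TangentSpace 𝓘(ℝ, E3 × ℝ) u := fieldOfCoord u₀ fun q => ((0 : E3), (1 : ℝ))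
    have h1 : IsLocalSection (prolongation g) (extChartAt 𝓘(ℝ, E3 × ℝ) u₀).source X1 := by
      refine isLocalSection_fieldOfCoord
        (fun q hq => (FramedMetric.contDiffAt_xi hq).prodMk contDiffAt_const) fun u' hu' w hw => ?_
      exact (mem_dSub_iff hu' w).2 ⟨1, by rw [hw, one_smul]⟩
    have h2 : IsLocalSection (prolongation g) (extChartAt 𝓘(ℝ, E3 × ℝ) u₀).source X2 := by
      refine isLocalSection_fieldOfCoord (fun q hq => contDiffAt_const) fun u' hu' w hw => ?_
      exact (mem_dSub_iff hu' w).2 ⟨0, by rw [hw, zero_smul]⟩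
    have e1 : (X1 u : E3 × ℝ) ∈ u.eSub :=
      (le_sup_left : prolongation g u ≤ bracket (prolongation g) u) (h1.mem u hu)
    have e2 : (X2 u : E3 × ℝ) ∈ u.eSub :=
      (le_sup_left : prolongation g u ≤ bracket (prolongation g) u) (h2.mem u hu)
    have e3 : (mlieBracket 𝓘(ℝ, E3 × ℝ) X2 X1 u : E3 × ℝ) ∈ u.eSub :=
      (le_sup_right : _ ≤ bracket (prolongation g) u)
        (Submodule.subset_span ⟨_, X2, X1, h2, h1, hu, rfl⟩)
    have d3 : dChart u₀ u (mlieBracket 𝓘(ℝ, E3 × ℝ) X2 X1 u) = (u₀.model.rho q, 0) := by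
      have h3 : dChart u₀ u (mlieBracket 𝓘(ℝ, E3 × ℝ) X2 X1 u) =
          lieBracket ℝ (coordVectorField u₀ X2) (coordVectorField u₀ X1) q :=
        chartD_mlieBracket hu ((h2.smooth u hu).contMDiffAt (h2.isOpen.mem_nhds hu))
          ((h1.smooth u hu).contMDiffAt (h1.isOpen.mem_nhds hu))
      have f : ∀ Xc : E3 × ℝ → E3 × ℝ, coordVectorField u₀ (fieldOfCoord u₀ Xc) =ᶠ[𝓝 q] Xc := by
        intro Xc
        filter_upwards [coordVectorField_eventually (X := fieldOfCoord u₀ Xc) isOpen_univ hu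
          (mem_univ u) (P := fun _ => True) (fun _ _ => trivial)] with z hz
        obtain ⟨u', g1, -, g3, g4⟩ := hz
        rw [g4, dChart_fieldOfCoord Xc g1, g3]
      rw [h3, Filter.EventuallyEq.lieBracket_vectorField_eq (f _) (f _)]
      unfold lieBracket
      have hd := ((FramedMetric.contDiffAt_xi hq).differentiableAt (by simp)).hasFDerivAt.prodMk
        (hasFDerivAt_const (0 : ℝ) q)
      rw [hd.fderiv, fderiv_fun_const]
      simp [FramedMetric.fderiv_xi_snd hq]
    have lin : ∀ x₁ x₂ x₃ : E3 × ℝ, dChart u₀ u x₁ = (u₀.model.xi q, 0) →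
        dChart u₀ u x₂ = (0, 1) → dChart u₀ u x₃ = (u₀.model.rho q, 0) →
        w = a • x₁ + b • x₃ + (dChart u₀ u w).2 • x₂ := by
      intro x₁ x₂ x₃ f1 f2 f3
      apply chartD_injective hu
      show dChart u₀ u w = dChart u₀ u _
      rw [map_add, map_add, map_smul, map_smul, map_smul, f1, f2, f3]
      refine Prod.ext ?_ ?_
      · simpa using hdec
      · simp
    have hw' := lin (X1 u) (X2 u) _ (dChart_fieldOfCoord _ hu) (dChart_fieldOfCoord _ hu) d3
    rw [hw']
    exact add_mem (add_mem (Submodule.smul_mem _ _ e1) (Submodule.smul_mem _ _ e3))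
      (Submodule.smul_mem _ _ e2)

/-- The Engel kernel in coordinates is spanned by the projectivized geodesic spray. -/
lemma mem_wSub_iff (hu : u ∈ (extChartAt 𝓘(ℝ, E3 × ℝ) u₀).source) (w : E3 × ℝ) :
    w ∈ u.wSub ↔ ∃ r : ℝ, dChart u₀ u w = r • u₀.model.spray (extChartAt 𝓘(ℝ, E3 × ℝ) u₀ u) := by
  have hE : ∀ u' ∈ (extChartAt 𝓘(ℝ, E3 × ℝ) u₀).source, ∀ w : E3 × ℝ,
      w ∈ bracket (prolongation g) u' →
      u₀.model.G (extChartAt 𝓘(ℝ, E3 × ℝ) u₀ u').1 (dChart u₀ u' w).1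
        (u₀.model.xi (extChartAt 𝓘(ℝ, E3 × ℝ) u₀ u')) = 0 :=
    fun u' hu' w hw => (mem_eSub_iff hu' w).1 hw
  have hq := mem_lineDom hu
  set q := extChartAt 𝓘(ℝ, E3 × ℝ) u₀ u with hqdef
  constructor
  · let S : Submodule ℝ (E3 × ℝ) :=
      (Submodule.span ℝ {u₀.model.spray q}).comap (dChart u₀ u).toLinearMap
    suffices h : u.wSub ≤ S by
      intro hw
      obtain ⟨r, hr⟩ := Submodule.mem_span_singleton.1 (h hw)
      exact ⟨r, hr.symm⟩
    refine Submodule.span_le.2 ?_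
    rintro _ ⟨U, X, ⟨hX, hXE⟩, hU, rfl⟩
    -- Two test sections of [D, D]. For a characteristic field with base part `a xi + b rho`,
    -- bracketing with the vertical field gives `b = 0`; bracketing with `(rho, 0)` then forces the
    -- fibre component to be `a slope`.
    let Z1 : ∀ u : PC g, TangentSpace 𝓘(ℝ, E3 × ℝ) u := fieldOfCoord u₀ fun q => (u₀.model.rho q, 0)
    let Z2 : ∀ u : PC g, TangentSpace 𝓘(ℝ, E3 × ℝ) u := fieldOfCoord u₀ fun q => ((0 : E3), (1 : ℝ))
    have h1 : IsLocalSection (bracket (prolongation g)) (extChartAt 𝓘(ℝ, E3 × ℝ) u₀).source Z1 := by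
      refine isLocalSection_fieldOfCoord
        (fun q hq => (FramedMetric.contDiffAt_rho hq).prodMk contDiffAt_const) fun u' hu' w hw => ?_
      refine (mem_eSub_iff hu' w).2 ?_
      rw [hw, u₀.model.symm _ (mem_lineDom hu')]
      exact FramedMetric.G_xi_rho (mem_lineDom hu')
    have h2 : IsLocalSection (bracket (prolongation g)) (extChartAt 𝓘(ℝ, E3 × ℝ) u₀).source Z2 := by
      refine isLocalSection_fieldOfCoord (fun q hq => contDiffAt_const) fun u' hu' w hw => ?_
      refine (mem_eSub_iff hu' w).2 ?_
      rw [hw]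
      simp
    have b1 := G_mlieBracket hE hX h1 hu hU hu
    have b2 := G_mlieBracket hE hX h2 hu hU hu
    have c1 := hE u hu _ (hXE _ _ h1 u ⟨hU, hu⟩)
    have c2 := hE u hu _ (hXE _ _ h2 u ⟨hU, hu⟩)
    have f1 : dChart u₀ u (Z1 u) = (u₀.model.rho q, 0) := dChart_fieldOfCoord _ hu
    have f2 : dChart u₀ u (Z2 u) = (0, 1) := dChart_fieldOfCoord _ hu
    rw [c1, f1] at b1
    rw [c2, f2] at b2
    have hdec := FramedMetric.decompose hq (hE u hu _ (hX.mem u hU))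
    set Xh := dChart u₀ u (X u)
    have eb : u₀.model.G q.1 Xh.1 (u₀.model.rho q) = 0 := by
      rw [FramedMetric.nabla_snd hq] at b2
      simp only [map_zero, zero_apply, sub_zero] at b2
      exact b2.symm
    rw [eb, zero_div, zero_smul, add_zero] at hdec
    set a := u₀.model.coeff q.1 Xh.1
    have hX' : Xh = a • (u₀.model.xi q, (0 : ℝ)) + Xh.2 • ((0 : E3), (1 : ℝ)) := by
      refine Prod.ext ?_ ?_
      · simpa using hdec
      · simp
    have hr1 : u₀.model.G q.1 (u₀.model.rho q) (u₀.model.xi q) = 0 :=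
      (u₀.model.symm _ hq _ _).trans (FramedMetric.G_xi_rho hq)
    have hr2 := FramedMetric.G_rho_rho hq
    have hn1 : u₀.model.G q.1 Xh.1 (u₀.model.nabla q (u₀.model.rho q, 0)) = 0 := by
      rw [hdec, map_smul, smul_apply, G_xi_nabla hq, smul_zero]
    have hn2 : u₀.model.nabla q Xh = a • u₀.model.acc q + Xh.2 • u₀.model.rho q := by
      conv_lhs => rw [hX']
      rw [FramedMetric.nabla_add, FramedMetric.nabla_smul, FramedMetric.nabla_smul,
        FramedMetric.nabla_snd hq]
      rfl
    rw [← hqdef, hn1, hn2, FramedMetric.acc_eq hq] at b1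
    simp only [map_add, map_sub, map_smul, hr1, hr2, smul_eq_mul] at b1
    refine Submodule.mem_span_singleton.2 ⟨a, ?_⟩
    show a • u₀.model.spray q = Xh
    refine Prod.ext ?_ ?_
    · exact hdec.symm
    · show a * u₀.model.slope q = Xh.2
      linarith
  · rintro ⟨r, hr⟩
    let Z : ∀ u : PC g, TangentSpace 𝓘(ℝ, E3 × ℝ) u := fieldOfCoord u₀ u₀.model.spray
    have h1 : IsLocalSection (bracket (prolongation g)) (extChartAt 𝓘(ℝ, E3 × ℝ) u₀).source Z := by
      refine isLocalSection_fieldOfCoord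
        (fun q hq => FramedMetric.contDiffAt_spray hq) fun u' hu' w hw => ?_
      refine (mem_eSub_iff hu' w).2 ?_
      rw [hw]
      exact FramedMetric.G_xi_xi (mem_lineDom hu')
    have hZ : Z u ∈ engelKernel (prolongation g) u := by
      refine Submodule.subset_span ⟨_, Z, ⟨h1, fun U' Y hY u' hu' => ?_⟩, hu, rfl⟩
      refine (mem_eSub_iff hu'.1 _).2 ?_
      have hq' := mem_lineDom hu'.1
      -- Conversely the spray preserves [D, D]. One term of the formula pairs `xi` with a covariant
      -- derivative of `xi`; in the other, the derivative along the spray is a multiple of `xi`, to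
      -- which every section of [D, D] is orthogonal.
      rw [G_mlieBracket hE h1 hY hu'.1 hu'.1 hu'.2]
      have f1 : dChart u₀ u' (Z u') = u₀.model.spray (extChartAt 𝓘(ℝ, E3 × ℝ) u₀ u') :=
        dChart_fieldOfCoord _ hu'.1
      rw [f1, FramedMetric.nabla_spray hq', map_smul, hE u' hu'.1 _ (hY.mem u' hu'.2)]
      simp only [FramedMetric.spray, G_xi_nabla hq']
      simp
    have lin : ∀ z : E3 × ℝ, dChart u₀ u z = u₀.model.spray q → w = r • z := by
      intro z hz
      apply chartD_injective hu
      show dChart u₀ u w = dChart u₀ u _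
      rw [map_smul, hz, hr]
    have hw := lin (Z u) (dChart_fieldOfCoord _ hu)
    rw [hw]
    exact Submodule.smul_mem u.wSub r hZ

end Distributions

end PC

end

/-! ### Lifts of null geodesics to the bundle of null lines. -/

section

variable {M : Type*} [TopologicalSpace M] [ChartedSpace E3 M] [IsManifold 𝓘(ℝ, E3) ∞ M]
  {g : LorentzMetric M} {o : TimeOrientation g}

lemma chartMetric_chartD_field {x₀ x : M} (hx : x ∈ (extChartAt 𝓘(ℝ, E3) x₀).source)
    (X : ∀ x : M, TangentSpace 𝓘(ℝ, E3) x) (v : E3) :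
    chartMetric g x₀ (extChartAt 𝓘(ℝ, E3) x₀ x) (chartD x₀ x v)
      (coordVectorField x₀ X (extChartAt 𝓘(ℝ, E3) x₀ x)) = g.form x v (X x) := by
  unfold coordVectorField
  rw [(extChartAt 𝓘(ℝ, E3) x₀).left_inv hx]
  exact chartMetric_chartD g hx v (X x)

namespace PC

/-- The null line spanned by the velocity of a curve, in coordinates: the scale of the velocity. -/
def scale (u₀ : PC g) (γ : ℝ → M) (r : ℝ) : ℝ :=
  u₀.model.coeff (coordCurve u₀.pt γ r) (deriv (coordCurve u₀.pt γ) r)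

end PC

section Lift

open PC

variable {γ : ℝ → M} {I : Set ℝ} {c : ℝ → PC g} {t : ℝ} {u₀ : PC g}

/-- `c` is the lift of the null geodesic `γ` to the bundle of null lines. -/
def IsLift (hγ : IsNullGeodesic o γ I) (c : ℝ → PC g) : Prop :=
  ∀ (t : ℝ) (ht : t ∈ I), c t = hγ.direction ht

lemma IsLift.pt {hγ : IsNullGeodesic o γ I} (hc : IsLift hγ c) (ht : t ∈ I) : (c t).pt = γ t := by
  rw [hc t ht]; rfl

lemma IsNullGeodesic.num_eq (hγ : IsNullGeodesic o γ I) (u₀ : PC g) (ht : t ∈ I)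
    (hx : γ t ∈ (extChartAt 𝓘(ℝ, E3) u₀.pt).source) :
    u₀.frame.num (γ t) (velocity γ t) = u₀.model.G (coordCurve u₀.pt γ t)
      (deriv (coordCurve u₀.pt γ) t) (u₀.model.Y (coordCurve u₀.pt γ t)) := by
  rw [deriv_coordCurve (hγ.contMDiffAt ht) hx]
  exact (chartMetric_chartD_field hx u₀.frame.Y _).symm

lemma IsNullGeodesic.den_eq (hγ : IsNullGeodesic o γ I) (u₀ : PC g) (ht : t ∈ I)
    (hx : γ t ∈ (extChartAt 𝓘(ℝ, E3) u₀.pt).source) :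
    u₀.frame.den (γ t) (velocity γ t) = 2 * scale u₀ γ t := by
  have h1 := chartMetric_chartD_field (g := g) hx u₀.frame.V (vel γ t)
  have h2 := chartMetric_chartD_field (g := g) hx u₀.frame.T (vel γ t)
  rw [← deriv_coordCurve (hγ.contMDiffAt ht) hx] at h1 h2
  have h3 : 2 * scale u₀ γ t = chartMetric g u₀.pt (extChartAt 𝓘(ℝ, E3) u₀.pt (γ t))
      (deriv (coordCurve u₀.pt γ) t)
      (coordVectorField u₀.pt u₀.frame.V (extChartAt 𝓘(ℝ, E3) u₀.pt (γ t))) -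
      chartMetric g u₀.pt (extChartAt 𝓘(ℝ, E3) u₀.pt (γ t)) (deriv (coordCurve u₀.pt γ) t)
      (coordVectorField u₀.pt u₀.frame.T (extChartAt 𝓘(ℝ, E3) u₀.pt (γ t))) :=
    mul_div_cancel₀ _ two_ne_zero
  rw [h3, h1, h2]
  rfl

variable {hγ : IsNullGeodesic o γ I}

lemma IsLift.mem_source_iff (hc : IsLift hγ c) (ht : t ∈ I) :
    c t ∈ (extChartAt 𝓘(ℝ, E3 × ℝ) u₀).source ↔
      γ t ∈ (extChartAt 𝓘(ℝ, E3) u₀.pt).source ∧ γ t ∈ u₀.frame.dom ∧ scale u₀ γ t ≠ 0 := by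
  rw [extChartAt_source_iff, hc t ht]
  refine and_congr_right fun hx => and_congr_right fun _ => ?_
  refine (u₀.frame.den_of _ _).trans ?_
  have hx' : γ t ∈ (extChartAt 𝓘(ℝ, E3) u₀.pt).source := hx
  rw [hγ.den_eq u₀ ht hx']
  simp

lemma IsLift.extChartAt_eq (hc : IsLift hγ c) (ht : t ∈ I)
    (hx : γ t ∈ (extChartAt 𝓘(ℝ, E3) u₀.pt).source) :
    extChartAt 𝓘(ℝ, E3 × ℝ) u₀ (c t) = (coordCurve u₀.pt γ t,
      u₀.model.G (coordCurve u₀.pt γ t) (deriv (coordCurve u₀.pt γ) t)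
        (u₀.model.Y (coordCurve u₀.pt γ t)) / (2 * scale u₀ γ t)) := by
  rw [extChartAt_apply, hc t ht]
  refine Prod.ext rfl ?_
  show u₀.frame.coord (PC.of g _ _ _ _) = _
  rw [u₀.frame.coord_of, hγ.num_eq u₀ ht hx, hγ.den_eq u₀ ht hx]

lemma IsLift.mem_dom (hc : IsLift hγ c) (ht : t ∈ I)
    (hu : c t ∈ (extChartAt 𝓘(ℝ, E3 × ℝ) u₀).source) : coordCurve u₀.pt γ t ∈ u₀.model.dom := by
  obtain ⟨hx, h2, h3⟩ := hc.mem_source_iff ht |>.1 hu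
  have := mem_lineDom hu
  rw [hc.extChartAt_eq ht hx] at this
  exact this

/-- The velocity of a null geodesic in the chart at `u₀`. -/
lemma IsLift.deriv_coordCurve_eq (hc : IsLift hγ c) (ht : t ∈ I)
    (hu : c t ∈ (extChartAt 𝓘(ℝ, E3 × ℝ) u₀).source) :
    deriv (coordCurve u₀.pt γ) t =
      scale u₀ γ t • u₀.model.xi (extChartAt 𝓘(ℝ, E3 × ℝ) u₀ (c t)) := by
  obtain ⟨hx, h2, h3⟩ := hc.mem_source_iff ht |>.1 hu
  have hq := mem_lineDom hu
  have e := hc.extChartAt_eq ht hx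
  rw [e] at hq ⊢
  refine FramedMetric.eq_smul_xi_of_null hq ?_ h3 ?_
  · show chartMetric g u₀.pt (extChartAt 𝓘(ℝ, E3) u₀.pt (γ t)) _ _ = 0
    rw [deriv_coordCurve (hγ.contMDiffAt ht) hx, chartMetric_chartD g hx]
    exact (hγ.futureNullAt ht).null
  · show _ = 2 * scale u₀ γ t * (_ / (2 * scale u₀ γ t))
    field_simp

lemma contDiffAt_scale (hγ : IsNullGeodesic o γ I) (ht : t ∈ I)
    (hx : γ t ∈ (extChartAt 𝓘(ℝ, E3) u₀.pt).source) (hF : γ t ∈ u₀.frame.dom) :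
    ContDiffAt ℝ ∞ (scale u₀ γ) t ∧ ContDiffAt ℝ ∞ (fun r => u₀.model.G (coordCurve u₀.pt γ r)
      (deriv (coordCurve u₀.pt γ) r) (u₀.model.Y (coordCurve u₀.pt γ r))) t := by
  have hy := contDiffAt_coordCurve (hγ.contMDiffAt ht) hx
  have hd : coordCurve u₀.pt γ t ∈ u₀.model.dom :=
    ⟨(extChartAt 𝓘(ℝ, E3) u₀.pt).map_source hx, by
      show (extChartAt 𝓘(ℝ, E3) u₀.pt).symm (extChartAt 𝓘(ℝ, E3) u₀.pt (γ t)) ∈ _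
      rw [(extChartAt 𝓘(ℝ, E3) u₀.pt).left_inv hx]; exact hF⟩
  have key : ∀ {F : Type} [NormedAddCommGroup F] [NormedSpace ℝ F] {f : E3 → F},
      ContDiffOn ℝ ∞ f u₀.model.dom → ContDiffAt ℝ ∞ (fun r => f (coordCurve u₀.pt γ r)) t :=
    fun hf => ((hf _ hd).contDiffAt (u₀.model.isOpen_dom.mem_nhds hd)).comp t hy
  have hG := (key u₀.model.smooth_G).clm_apply (contDiffAt_deriv hy)
  exact ⟨((hG.clm_apply (key u₀.model.smooth_V)).sub (hG.clm_apply (key u₀.model.smooth_T))).div_const 2,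
    hG.clm_apply (key u₀.model.smooth_Y)⟩

lemma IsLift.eventually_mem (hc : IsLift hγ c) (ht : t ∈ I)
    (hu : c t ∈ (extChartAt 𝓘(ℝ, E3 × ℝ) u₀).source) :
    ∀ᶠ r in 𝓝 t, r ∈ I ∧ c r ∈ (extChartAt 𝓘(ℝ, E3 × ℝ) u₀).source := by
  obtain ⟨hx, h2, h3⟩ := hc.mem_source_iff ht |>.1 hu
  filter_upwards [hγ.isOpen.mem_nhds ht, eventually_mem_chart (hγ.contMDiffAt ht) hx,
    (hγ.contMDiffAt ht).continuousAt.eventually (u₀.frame.isOpen_dom.mem_nhds h2),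
    (contDiffAt_scale hγ ht hx h2).1.continuousAt.eventually_ne h3] with r a1 a2 a3 a4
  exact ⟨a1, (hc.mem_source_iff a1).2 ⟨a2, a3, a4⟩⟩

/-- The lift of a null geodesic is smooth. -/
lemma IsLift.contMDiffAt (hc : IsLift hγ c) (ht : t ∈ I) :
    ContMDiffAt 𝓘(ℝ, ℝ) 𝓘(ℝ, E3 × ℝ) ∞ c t := by
  have hu : c t ∈ (extChartAt 𝓘(ℝ, E3 × ℝ) (c t)).source := mem_extChartAt_source _
  obtain ⟨hx, h2, h3⟩ := hc.mem_source_iff ht |>.1 hu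
  obtain ⟨k1, k2⟩ := contDiffAt_scale hγ ht hx h2
  refine contMDiffAt_of_coord_curve (q₀ := c t) (y := fun r => (coordCurve (c t).pt γ r,
      (c t).model.G (coordCurve (c t).pt γ r) (deriv (coordCurve (c t).pt γ) r)
        ((c t).model.Y (coordCurve (c t).pt γ r)) / (2 * scale (c t) γ r)))
    ((contDiffAt_coordCurve (hγ.contMDiffAt ht) hx).prodMk
      (k2.div (contDiffAt_const.mul k1) (mul_ne_zero two_ne_zero h3))) ?_ ?_
  · have := (extChartAt 𝓘(ℝ, E3 × ℝ) (c t)).map_source hu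
    rwa [hc.extChartAt_eq ht hx] at this
  · filter_upwards [hc.eventually_mem ht hu] with r hr
    rw [← hc.extChartAt_eq hr.1 (hc.mem_source_iff hr.1 |>.1 hr.2).1]
    exact ((extChartAt 𝓘(ℝ, E3 × ℝ) (c t)).left_inv hr.2).symm

/-- The lift of a null geodesic is tangent to the spray. -/
lemma IsLift.hasDerivAt (hc : IsLift hγ c) (ht : t ∈ I)
    (hu : c t ∈ (extChartAt 𝓘(ℝ, E3 × ℝ) u₀).source) :
    HasDerivAt (fun r => extChartAt 𝓘(ℝ, E3 × ℝ) u₀ (c r))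
      (scale u₀ γ t • u₀.model.spray (extChartAt 𝓘(ℝ, E3 × ℝ) u₀ (c t))) t ∧
    HasDerivAt (scale u₀ γ) (-(scale u₀ γ t ^ 2 *
      u₀.model.nonaffinity (extChartAt 𝓘(ℝ, E3 × ℝ) u₀ (c t)))) t := by
  obtain ⟨hx, h2, h3⟩ := hc.mem_source_iff ht |>.1 hu
  obtain ⟨k1, k2⟩ := contDiffAt_scale hγ ht hx h2
  have ev : ∀ᶠ r in 𝓝 t, extChartAt 𝓘(ℝ, E3 × ℝ) u₀ (c r) = (coordCurve u₀.pt γ r,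
      u₀.model.G (coordCurve u₀.pt γ r) (deriv (coordCurve u₀.pt γ) r)
        (u₀.model.Y (coordCurve u₀.pt γ r)) / (2 * scale u₀ γ r)) := by
    filter_upwards [hc.eventually_mem ht hu] with r hr
    exact hc.extChartAt_eq hr.1 (hc.mem_source_iff hr.1 |>.1 hr.2).1
  have key := FramedMetric.hasDerivAt_lift (N := u₀.model) (y := coordCurve u₀.pt γ)
    (h := scale u₀ γ) (hc.mem_dom ht hu)
    (contDiffAt_coordCurve (hγ.contMDiffAt ht) hx) k1
    (k2.div (contDiffAt_const.mul k1) (mul_ne_zero two_ne_zero h3)) h3 (by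
      filter_upwards [hc.eventually_mem ht hu, ev] with r hr er
      refine (hc.deriv_coordCurve_eq hr.1 hr.2).trans ?_
      rw [er]
      rfl) (hγ.geodOp_eq_zero ht hx)
  have ev' : (fun r => extChartAt 𝓘(ℝ, E3 × ℝ) u₀ (c r)) =ᶠ[𝓝 t] fun r => (coordCurve u₀.pt γ r,
      u₀.model.G (coordCurve u₀.pt γ r) (deriv (coordCurve u₀.pt γ) r)
        (u₀.model.Y (coordCurve u₀.pt γ r)) / (2 * scale u₀ γ r)) := ev
  rw [ev.self_of_nhds]
  exact ⟨key.1.congr_of_eventuallyEq ev', key.2⟩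

lemma IsLift.dChart_vel (hc : IsLift hγ c) (ht : t ∈ I)
    (hu : c t ∈ (extChartAt 𝓘(ℝ, E3 × ℝ) u₀).source) :
    dChart u₀ (c t) (vel c t) =
      scale u₀ γ t • u₀.model.spray (extChartAt 𝓘(ℝ, E3 × ℝ) u₀ (c t)) :=
  (hasDerivAt_coord_curve ((hc.contMDiffAt ht).mdifferentiableAt (by simp)) hu).unique
    (hc.hasDerivAt ht hu).1

/-- The velocity of the lift of a null geodesic spans the Engel kernel. -/
lemma IsLift.wSub_eq_span (hc : IsLift hγ c) (ht : t ∈ I) :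
    (c t).wSub = Submodule.span ℝ {(vel c t : E3 × ℝ)} := by
  have hu : c t ∈ (extChartAt 𝓘(ℝ, E3 × ℝ) (c t)).source := mem_extChartAt_source _
  have h3 := (hc.mem_source_iff ht |>.1 hu).2.2
  ext w
  rw [mem_wSub_iff hu, Submodule.mem_span_singleton]
  have hv := hc.dChart_vel ht hu
  constructor
  · rintro ⟨r, hr⟩
    refine ⟨r / scale (c t) γ t, chartD_injective hu ?_⟩
    show dChart (c t) (c t) _ = dChart (c t) (c t) _
    rw [map_smul, hv, hr, smul_smul, div_mul_cancel₀ _ h3]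
  · rintro ⟨r, rfl⟩
    exact ⟨r * scale (c t) γ t, by rw [map_smul, hv, smul_smul]⟩

end Lift

end

/-! ### The null geodesic tangent to a null line, and the leaves of the Engel kernel. -/

section

variable {M : Type*} [TopologicalSpace M] [ChartedSpace E3 M] [IsManifold 𝓘(ℝ, E3) ∞ M]
  {g : LorentzMetric M} {o : TimeOrientation g} {γ γ₁ γ₂ : ℝ → M} {I I₁ I₂ : Set ℝ}
  {s t t₁ t₂ : ℝ}

open PC

section Directions

lemma velocity_mem_lineSub (hγ : IsNullGeodesic o γ I) (ht : t ∈ I) (w : E3) :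
    w ∈ (hγ.direction ht).lineSub ↔ ∃ r : ℝ, w = r • (vel γ t : E3) :=
  mem_lineSub_of (γ t) (vel γ t) _ _ w

lemma direction_eq (h₁ : IsNullGeodesic o γ₁ I₁) (h₂ : IsNullGeodesic o γ₂ I₂) (ht₁ : t₁ ∈ I₁)
    (ht₂ : t₂ ∈ I₂) (h : h₁.direction ht₁ = h₂.direction ht₂) :
    γ₁ t₁ = γ₂ t₂ ∧ ∃ k : ℝ, k ≠ 0 ∧ (vel γ₁ t₁ : E3) = k • vel γ₂ t₂ := by
  refine ⟨congrArg PC.pt h, ?_⟩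
  have h3 : (vel γ₁ t₁ : E3) ∈ (h₂.direction ht₂).lineSub := by
    rw [← h, velocity_mem_lineSub]
    exact ⟨1, (one_smul ℝ _).symm⟩
  obtain ⟨k, hk⟩ := (velocity_mem_lineSub h₂ ht₂ _).1 h3
  refine ⟨k, ?_, hk⟩
  rintro rfl
  rw [zero_smul] at hk
  exact (h₁.futureNullAt ht₁).ne_zero hk

lemma of_eq_of {x₁ x₂ : M} {v₁ v₂ : E3} (hx : x₁ = x₂) {k : ℝ} (hv : v₁ = k • v₂)
    (h₁ : v₁ ≠ 0) (h₂ : v₂ ≠ 0) (n₁ : g.form x₁ v₁ v₁ = 0) (n₂ : g.form x₂ v₂ v₂ = 0) :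
    PC.of g x₁ v₁ h₁ n₁ = PC.of g x₂ v₂ h₂ n₂ := by
  subst hx
  exact PC.of_congr _ _ _ _ k hv.symm

lemma direction_eq_of (h₁ : IsNullGeodesic o γ₁ I₁) (h₂ : IsNullGeodesic o γ₂ I₂) (ht₁ : t₁ ∈ I₁)
    (ht₂ : t₂ ∈ I₂) (h : γ₁ t₁ = γ₂ t₂) {k : ℝ} (hk : (vel γ₁ t₁ : E3) = k • vel γ₂ t₂) :
    h₁.direction ht₁ = h₂.direction ht₂ :=
  of_eq_of h hk _ _ _ _

variable [T2Space M]

/-- The maximal null geodesic with a given future null initial vector. -/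
lemma exists_geodesic_direction {x : M} {v : E3} (hv : FutureNullAt o x v) :
    ∃ (γ : ℝ → M) (I : Set ℝ) (hγ : IsMaximalNullGeodesic o γ I) (t : ℝ) (ht : t ∈ I),
      hγ.direction ht = PC.of g x v hv.ne_zero hv.null ∧ γ t = x ∧ (vel γ t : E3) = v := by
  obtain ⟨γ, I, hγ, ht, hx, hv'⟩ := exists_isMaximalNullGeodesic o hv 0
  exact ⟨γ, I, hγ, 0, ht, of_eq_of hx (k := 1) (by rw [one_smul]; exact hv') _ _ _ _, hx, hv'⟩

lemma neg_one_neg_eq (v : E3) : v = (-1 : ℝ) • -v := by simp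

-- A null line has two opposite rays, and one of them is future directed; hence null lines and rays
-- of future null vectors carry the same information.
omit [T2Space M] in
variable (o) in
lemma exists_futureNull (u : PC g) : ∃ (v : E3) (hv : FutureNullAt o u.pt v),
    u = PC.of g u.pt v hv.ne_zero hv.null := by
  obtain ⟨x, v, hv, hn, rfl⟩ := u.exists_of
  rcases futureNullAt_or_neg (o := o) hv hn with h | h
  · exact ⟨v, h, rfl⟩
  · exact ⟨-(v : E3), h, of_eq_of rfl (k := -1) (neg_one_neg_eq v) hv _ hn _⟩

variable (o) in
lemma exists_maximal_direction (u : PC g) :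
    ∃ (γ : ℝ → M) (I : Set ℝ) (hγ : IsMaximalNullGeodesic o γ I) (t : ℝ) (ht : t ∈ I),
      hγ.direction ht = u := by
  obtain ⟨v, hv, h⟩ := exists_futureNull o u
  obtain ⟨γ, I, hγ, t, ht, hd, -, -⟩ := exists_geodesic_direction hv
  exact ⟨γ, I, hγ, t, ht, hd.trans h.symm⟩

variable (o) in
/-- The null geodesic tangent to a null line. -/
def tangentGeodesic (u : PC g) : NullGeodesic o where
  carrier := (exists_maximal_direction o u).choose '' (exists_maximal_direction o u).choose_spec.choose
  isNull := ⟨_, _, (exists_maximal_direction o u).choose_spec.choose_spec.choose, rfl⟩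

/-- Frees `tangentGeodesic` from the choice in its definition: maximal geodesics through the same
null line are affine reparametrisations of each other. -/
lemma tangentGeodesic_direction (hγ : IsMaximalNullGeodesic o γ I) (ht : t ∈ I) :
    (tangentGeodesic o (hγ.direction ht)).carrier = γ '' I := by
  set u := hγ.direction ht
  obtain ⟨t', ht', h⟩ := (exists_maximal_direction o u).choose_spec.choose_spec.choose_spec
  obtain ⟨e, k, hk, ev⟩ := direction_eq _ _ _ _ h
  exact (exists_maximal_direction o u).choose_spec.choose_spec.choose.image_eq hγ ht' ht e hk ev

lemma tangentGeodesic_eq_iff (u : PC g) (A : NullGeodesic o) : tangentGeodesic o u = A ↔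
    ∃ (γ : ℝ → M) (I : Set ℝ) (hγ : IsMaximalNullGeodesic o γ I) (t : ℝ) (ht : t ∈ I),
      hγ.direction ht = u ∧ γ '' I = A.carrier := by
  constructor
  · rintro rfl
    obtain ⟨γ, I, hγ, t, ht, rfl⟩ := exists_maximal_direction o u
    exact ⟨γ, I, hγ, t, ht, rfl, (tangentGeodesic_direction hγ ht).symm⟩
  · rintro ⟨γ, I, hγ, t, ht, rfl, h⟩
    exact NullGeodesic.ext ((tangentGeodesic_direction hγ ht).trans h)

end Directions

section Leaves

/-- The lift of a null geodesic. -/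
def IsNullGeodesic.lift (hγ : IsNullGeodesic o γ I) (r : ℝ) : PC g := by
  classical
  exact if hr : r ∈ I then hγ.direction hr else hγ.direction hγ.isConnected.nonempty.choose_spec

lemma IsNullGeodesic.lift_apply (hγ : IsNullGeodesic o γ I) (ht : t ∈ I) :
    hγ.lift t = hγ.direction ht := dif_pos ht

lemma IsNullGeodesic.isLift_lift (hγ : IsNullGeodesic o γ I) : IsLift hγ hγ.lift :=
  fun _ ht => hγ.lift_apply ht

/-- Two null lines tangent to the same null geodesic are in the same leaf. -/
lemma joinedAlong_direction (hγ : IsNullGeodesic o γ I) (hs : s ∈ I) (ht : t ∈ I) :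
    JoinedAlong (engelKernel (prolongation g)) (hγ.direction hs) (hγ.direction ht) := by
  -- `JoinedAlong` wants a curve defined on all of ℝ, while `I` may be bounded. The smooth
  -- transition stays between `s` and `t`, and it may stand still because the zero vector is tangent
  -- to the kernel.
  let φ : ℝ → ℝ := fun r => s + (t - s) * Real.smoothTransition r
  have cφ : ContDiff ℝ ∞ φ := contDiff_const.add (contDiff_const.mul Real.smoothTransition.contDiff)
  have hφ : ∀ r, φ r ∈ I := by
    intro r
    refine hγ.isConnected.isPreconnected.ordConnected.uIcc_subset hs ht ?_
    have h0 := Real.smoothTransition.nonneg r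
    have h1 := Real.smoothTransition.le_one r
    rw [← segment_eq_uIcc]
    refine ⟨1 - Real.smoothTransition r, Real.smoothTransition r, by linarith, h0, by ring, ?_⟩
    simp only [smul_eq_mul, φ]
    ring
  have hL := hγ.isLift_lift
  refine ⟨fun r => hγ.lift (φ r), fun r => ?_, fun r => ?_, ?_, ?_⟩
  · exact (hL.contMDiffAt (hφ r)).comp r cφ.contDiffAt.contMDiffAt
  · have h1 : (engelKernel (prolongation g) (hγ.lift (φ r)) : Submodule ℝ (E3 × ℝ)) =
        Submodule.span ℝ {(vel hγ.lift (φ r) : E3 × ℝ)} := hL.wSub_eq_span (hφ r)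
    have h2 : (vel (fun r => hγ.lift (φ r)) r : E3 × ℝ) = deriv φ r • vel hγ.lift (φ r) := by
      have d1 := ((hL.contMDiffAt (hφ r)).mdifferentiableAt (by simp)).hasMFDerivAt
      have d2 : HasMFDerivAt 𝓘(ℝ, ℝ) 𝓘(ℝ, ℝ) φ r (fderiv ℝ φ r) :=
        ((cφ.differentiable (by simp)) r).hasFDerivAt.hasMFDerivAt
      have d3 := (d1.comp r d2).mfderiv
      have d4 : (vel (fun r => hγ.lift (φ r)) r : E3 × ℝ) =
          (mfderiv 𝓘(ℝ, ℝ) 𝓘(ℝ, E3 × ℝ) hγ.lift (φ r) : ℝ →L[ℝ] E3 × ℝ) (fderiv ℝ φ r 1) :=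
        congrArg (fun L : ℝ →L[ℝ] E3 × ℝ => L 1) d3
      rw [d4]
      have d5 : fderiv ℝ φ r 1 = deriv φ r • (1 : ℝ) := by simp
      rw [d5]
      exact ContinuousLinearMap.map_smul
        (mfderiv 𝓘(ℝ, ℝ) 𝓘(ℝ, E3 × ℝ) hγ.lift (φ r) : ℝ →L[ℝ] E3 × ℝ) (deriv φ r) 1
    show (vel (fun r => hγ.lift (φ r)) r : E3 × ℝ) ∈
      (engelKernel (prolongation g) (hγ.lift (φ r)) : Submodule ℝ (E3 × ℝ))
    rw [h1, h2]
    exact Submodule.smul_mem _ _ (Submodule.mem_span_singleton_self _)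
  · simp only [φ, Real.smoothTransition.zero, mul_zero, add_zero]
    exact hγ.lift_apply hs
  · have : φ 1 = t := by simp [φ]
    show hγ.lift (φ 1) = _
    rw [this]
    exact hγ.lift_apply ht

/-- Solutions of a scaled equation are reparametrisations of each other. -/
lemma exists_reparam {h k : ℝ → ℝ} {t₀ a : ℝ} (ch : ContDiffAt ℝ ∞ h t₀) (ck : ContDiffAt ℝ ∞ k a)
    (hk : k a ≠ 0) : ∃ θ : ℝ → ℝ, θ t₀ = a ∧
      ∀ᶠ t in 𝓝 t₀, HasDerivAt θ (h t / k (θ t)) t := by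
  -- The time is added as a coordinate to make the equation autonomous.
  let f : ℝ × ℝ → ℝ × ℝ := fun p => (1, h p.1 / k p.2)
  have hf : ContDiffAt ℝ 1 f (t₀, a) := by
    have h1 : ContDiffAt ℝ ∞ (fun p : ℝ × ℝ => h p.1) (t₀, a) := ch.comp (t₀, a) contDiffAt_fst
    have h2 : ContDiffAt ℝ ∞ (fun p : ℝ × ℝ => k p.2) (t₀, a) := ck.comp (t₀, a) contDiffAt_snd
    exact (contDiffAt_const.prodMk (h1.div h2 hk)).of_le (by norm_cast)
  obtain ⟨α, h0, ε, hε, hα⟩ := hf.exists_forall_mem_closedBall_exists_eq_forall_mem_Ioo_hasDerivAt₀ t₀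
  have h1 : ∀ t ∈ Ioo (t₀ - ε) (t₀ + ε), (α t).1 = t := by
    intro t ht
    have hd : ∀ t ∈ Ioo (t₀ - ε) (t₀ + ε), HasDerivAt (fun t => (α t).1 - t) 0 t := by
      intro t ht
      have h2 : HasDerivAt (fun t => (α t).1) 1 t := (ContinuousLinearMap.fst ℝ ℝ ℝ).hasFDerivAt.comp_hasDerivAt t (hα t ht)
      exact (h2.sub (hasDerivAt_id t)).congr_deriv (sub_self 1)
    have := isOpen_Ioo.is_const_of_deriv_eq_zero isPreconnected_Ioo
      (fun r hr => (hd r hr).differentiableAt.differentiableWithinAt) (fun r hr => (hd r hr).deriv)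
      ht (show t₀ ∈ Ioo (t₀ - ε) (t₀ + ε) from ⟨by linarith, by linarith⟩)
    simp only [h0, sub_self] at this
    linarith
  refine ⟨fun t => (α t).2, by simp only [h0], ?_⟩
  filter_upwards [isOpen_Ioo.mem_nhds (show t₀ ∈ Ioo (t₀ - ε) (t₀ + ε) from
    ⟨by linarith, by linarith⟩)] with t ht
  have h2 : HasDerivAt (fun t => (α t).2) (h (α t).1 / k (α t).2) t :=
    (ContinuousLinearMap.snd ℝ ℝ ℝ).hasFDerivAt.comp_hasDerivAt t (hα t ht)
  rwa [h1 t ht] at h2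

variable [T2Space M]

/-- The tangent geodesic is constant along curves tangent to the Engel kernel. -/
lemma tangentGeodesic_eventually {c : ℝ → PC g} (hc : ContMDiff 𝓘(ℝ, ℝ) 𝓘(ℝ, E3 × ℝ) ∞ c)
    (hW : ∀ t, (vel c t : E3 × ℝ) ∈ (c t).wSub) (t₀ : ℝ) :
    ∀ᶠ t in 𝓝 t₀, tangentGeodesic o (c t) = tangentGeodesic o (c t₀) := by
  obtain ⟨γ, I, hγ, a, ha, hd⟩ := exists_maximal_direction o (c t₀)
  set u₀ := c t₀ with hu₀
  have hL := hγ.isLift_lift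
  set c₂ := hγ.lift
  have e2 : c₂ a = u₀ := (hγ.lift_apply ha).trans hd
  have m1 : c t₀ ∈ (extChartAt 𝓘(ℝ, E3 × ℝ) u₀).source := mem_extChartAt_source _
  have m2 : c₂ a ∈ (extChartAt 𝓘(ℝ, E3 × ℝ) u₀).source := by rw [e2]; exact mem_extChartAt_source _
  set q := fun t => extChartAt 𝓘(ℝ, E3 × ℝ) u₀ (c t) with hqdef
  have evm : ∀ᶠ t in 𝓝 t₀, c t ∈ (extChartAt 𝓘(ℝ, E3 × ℝ) u₀).source :=
    hc.continuous.continuousAt.eventually ((isOpen_extChartAt_source u₀).mem_nhds m1)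
  have cq : ContDiffAt ℝ ∞ q t₀ := contDiffAt_coord_curve (hc t₀) m1
  -- The speed of `c` relative to the spray. The hypothesis gives only some multiple at each
  -- parameter; as `coeff` of `xi` is 1, this formula recovers that multiple and shows that it is
  -- smooth.
  let h : ℝ → ℝ := fun t => u₀.model.coeff (q t).1 (deriv q t).1
  have hql : q t₀ ∈ u₀.model.lineDom := mem_lineDom m1
  have ch : ContDiffAt ℝ ∞ h t₀ := by
    have key : ∀ {F : Type} [NormedAddCommGroup F] [NormedSpace ℝ F] {f : E3 → F},
        ContDiffOn ℝ ∞ f u₀.model.dom → ContDiffAt ℝ ∞ (fun r => f (q r).1) t₀ :=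
      fun hf => (FramedMetric.contDiffAt_comp_fst hql hf).comp t₀ cq
    have hG := (key u₀.model.smooth_G).clm_apply (contDiffAt_deriv cq).fst
    exact ((hG.clm_apply (key u₀.model.smooth_V)).sub
      (hG.clm_apply (key u₀.model.smooth_T))).div_const 2
  have dq : ∀ᶠ t in 𝓝 t₀, HasDerivAt q (h t • u₀.model.spray (q t)) t := by
    filter_upwards [evm] with t ht
    have d1 := hasDerivAt_coord_curve ((hc t).mdifferentiableAt (by simp)) ht
    obtain ⟨r, hr⟩ := (mem_wSub_iff ht _).1 (hW t)
    have hr' : chartD u₀ (c t) (vel c t) = r • u₀.model.spray (q t) := hr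
    rw [hr'] at d1
    have : h t = r := by
      show u₀.model.coeff (q t).1 (deriv q t).1 = r
      have d2 : deriv q t = r • u₀.model.spray (q t) := d1.deriv
      rw [d2]
      show u₀.model.coeff (q t).1 (r • u₀.model.xi (q t)) = r
      rw [FramedMetric.coeff_smul, FramedMetric.coeff_xi (mem_lineDom ht), mul_one]
    rw [this]
    exact d1
  obtain ⟨hx, hF, hs⟩ := hL.mem_source_iff ha |>.1 m2
  -- The lift of `γ` runs along the spray with its own speed `scale`. With `θ' = h / scale θ`, the
  -- curve `c₂ ∘ θ` satisfies the same equation as `c`, so the two coincide near `t₀`.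
  obtain ⟨θ, hθ, dθ⟩ := exists_reparam ch (contDiffAt_scale hγ.toIsNullGeodesic ha hx hF).1 hs
  have cθ : ContinuousAt θ t₀ := dθ.self_of_nhds.continuousAt
  have evθ : ∀ᶠ t in 𝓝 t₀, θ t ∈ I ∧ c₂ (θ t) ∈ (extChartAt 𝓘(ℝ, E3 × ℝ) u₀).source := by
    have := hL.eventually_mem ha m2
    rw [← hθ] at this
    exact cθ.eventually this
  have dq2 : ∀ᶠ t in 𝓝 t₀, HasDerivAt (fun t => extChartAt 𝓘(ℝ, E3 × ℝ) u₀ (c₂ (θ t)))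
      (h t • u₀.model.spray (extChartAt 𝓘(ℝ, E3 × ℝ) u₀ (c₂ (θ t)))) t := by
    filter_upwards [dθ, evθ] with t h1 h2
    have h3 := (hL.hasDerivAt h2.1 h2.2).1.scomp t h1
    refine h3.congr_deriv ?_
    rw [smul_smul, div_mul_cancel₀ _ (hL.mem_source_iff h2.1 |>.1 h2.2).2.2]
  have huniq : q =ᶠ[𝓝 t₀] fun t => extChartAt 𝓘(ℝ, E3 × ℝ) u₀ (c₂ (θ t)) := by
    refine ode_unique_scaled ((FramedMetric.contDiffAt_spray hql).of_le (by norm_cast))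
      ch.continuousAt dq dq2 ?_
    show extChartAt 𝓘(ℝ, E3 × ℝ) u₀ (c t₀) = extChartAt 𝓘(ℝ, E3 × ℝ) u₀ (c₂ (θ t₀))
    rw [hθ, e2]
  filter_upwards [huniq, evθ, evm] with t h1 h2 h3
  have h4 : c t = hγ.direction h2.1 :=
    ((extChartAt 𝓘(ℝ, E3 × ℝ) u₀).injOn h3 h2.2 h1).trans (hγ.lift_apply h2.1)
  apply NullGeodesic.ext
  have e3 := tangentGeodesic_direction hγ ha
  rw [hd] at e3
  rw [e3, h4]
  exact tangentGeodesic_direction hγ h2.1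

lemma tangentGeodesic_of_joinedAlong {u v : PC g}
    (h : JoinedAlong (engelKernel (prolongation g)) u v) :
    tangentGeodesic o u = tangentGeodesic o v := by
  obtain ⟨c, hc, hW, rfl, rfl⟩ := h
  have h1 : IsLocallyConstant (fun t => tangentGeodesic o (c t)) :=
    (IsLocallyConstant.iff_eventually_eq _).2 fun t => tangentGeodesic_eventually hc hW t
  exact h1.apply_eq_of_preconnectedSpace 0 1

end Leaves

end

/-! ### Null geodesics with the same image. -/

section

variable {M : Type*} [TopologicalSpace M] [ChartedSpace E3 M] [IsManifold 𝓘(ℝ, E3) ∞ M]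
  {g : LorentzMetric M} {o : TimeOrientation g} {γ γ₁ γ₂ : ℝ → M} {I I₁ I₂ : Set ℝ}
  {s t t₁ t₂ : ℝ}

open PC

section SameImage

/-- An uncountable subset of the plane accumulates at one of its points. -/
lemma exists_accumulation {P : Set (ℝ × ℝ)} (hP : ¬ P.Countable) :
    ∃ p ∈ P, (𝓝[≠] p ⊓ Filter.principal P).NeBot := by
  by_contra! h
  -- Without such a point `P` would be a discrete subspace of the plane, and a discrete separable
  -- space is countable.
  have hd : DiscreteTopology P := discreteTopology_subtype_iff.2 h
  exact hP (TopologicalSpace.separableSpace_iff_countable.1 inferInstance)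

lemma not_countable_of_isOpen {I : Set ℝ} (hI : IsOpen I) (hne : I.Nonempty) : ¬ I.Countable := by
  intro h
  obtain ⟨x, hx, hx'⟩ := (h.dense_compl ℝ).inter_open_nonempty I hI hne
  exact hx' hx

/-- Null geodesics with the same image are somewhere tangent. -/
lemma exists_parallel (h₁ : IsNullGeodesic o γ₁ I₁) (h₂ : IsNullGeodesic o γ₂ I₂)
    (h : γ₁ '' I₁ ⊆ γ₂ '' I₂) : ∃ (s₁ : ℝ) (hs₁ : s₁ ∈ I₁) (s₂ : ℝ) (hs₂ : s₂ ∈ I₂),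
      h₁.direction hs₁ = h₂.direction hs₂ := by
  -- The parameter on the second curve is chosen pointwise, with no continuity: the second curve may
  -- pass through a point several times.
  have hex : ∀ t, ∃ s, t ∈ I₁ → s ∈ I₂ ∧ γ₂ s = γ₁ t := by
    intro t
    by_cases ht : t ∈ I₁
    · obtain ⟨s, hs, e⟩ := h ⟨t, ht, rfl⟩
      exact ⟨s, fun _ => ⟨hs, e⟩⟩
    · exact ⟨0, fun h => absurd h ht⟩
  choose σ hσ using hex
  let P : Set (ℝ × ℝ) := (fun t => (t, σ t)) '' I₁
  have hP : ¬ P.Countable := by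
    intro hc
    refine not_countable_of_isOpen h₁.isOpen h₁.isConnected.nonempty ?_
    have : I₁ = Prod.fst '' P := by
      ext t
      simp [P]
    rw [this]
    exact hc.image _
  -- The graph of `σ` projects onto an interval, so it is uncountable and accumulates at one of its
  -- own points.
  obtain ⟨p, ⟨s₁, hs₁, rfl⟩, hp⟩ := exists_accumulation hP
  obtain ⟨hs₂, e⟩ := hσ s₁ hs₁
  set s₂ := σ s₁
  set x := γ₁ s₁ with hx
  have m1 : γ₁ s₁ ∈ (extChartAt 𝓘(ℝ, E3) x).source := mem_extChartAt_source _
  have m2 : γ₂ s₂ ∈ (extChartAt 𝓘(ℝ, E3) x).source := by rw [e]; exact m1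
  set a : E3 := deriv (coordCurve x γ₁) s₁ with ha
  set b : E3 := deriv (coordCurve x γ₂) s₂ with hb
  have d1 : HasFDerivAt (fun p : ℝ × ℝ => coordCurve x γ₁ p.1)
      ((ContinuousLinearMap.fst ℝ ℝ ℝ).smulRight a) (s₁, s₂) := by
    have := (((contDiffAt_coordCurve (h₁.contMDiffAt hs₁) m1).differentiableAt
      (by simp)).hasDerivAt.hasFDerivAt.comp (s₁, s₂)
      (ContinuousLinearMap.fst ℝ ℝ ℝ).hasFDerivAt)
    refine this.congr_fderiv ?_
    ext p <;> simp [ha]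
  have d2 : HasFDerivAt (fun p : ℝ × ℝ => coordCurve x γ₂ p.2)
      ((ContinuousLinearMap.snd ℝ ℝ ℝ).smulRight b) (s₁, s₂) := by
    have := (((contDiffAt_coordCurve (h₂.contMDiffAt hs₂) m2).differentiableAt
      (by simp)).hasDerivAt.hasFDerivAt.comp (s₁, s₂)
      (ContinuousLinearMap.snd ℝ ℝ ℝ).hasFDerivAt)
    refine this.congr_fderiv ?_
    ext p <;> simp [hb]
  set L : ℝ × ℝ →L[ℝ] E3 := (ContinuousLinearMap.fst ℝ ℝ ℝ).smulRight a -
    (ContinuousLinearMap.snd ℝ ℝ ℝ).smulRight b with hL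
  have d3 : HasFDerivAt (fun p : ℝ × ℝ => coordCurve x γ₁ p.1 - coordCurve x γ₂ p.2) L (s₁, s₂) :=
    d1.sub d2
  have ea : a = chartD x (γ₁ s₁) (vel γ₁ s₁) := deriv_coordCurve (h₁.contMDiffAt hs₁) m1
  have eb : b = chartD x (γ₁ s₁) (vel γ₂ s₂) := by
    rw [hb, deriv_coordCurve (h₂.contMDiffAt hs₂) m2, e]
  have hb0 : b ≠ 0 := by
    rw [eb, Ne, chartD_eq_zero_iff m1]
    exact (h₂.futureNullAt hs₂).ne_zero
  -- `L` is the differential of the difference of the two curves. If it were injective, the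
  -- difference would have no zero in a punctured neighbourhood, against the accumulation of
  -- coincidences.
  have hker : LinearMap.ker L.toLinearMap ≠ ⊥ := by
    intro hk
    obtain ⟨C, -, hC⟩ := LinearMap.exists_antilipschitzWith L.toLinearMap hk
    have h3 := d3.eventually_ne (c := 0) ⟨C, hC⟩
    have h4 : ∀ᶠ z in 𝓝[≠] (s₁, s₂) ⊓ Filter.principal P, False := by
      have h5 : ∀ᶠ z in 𝓝[≠] (s₁, s₂) ⊓ Filter.principal P, z ∈ P :=
        Filter.mem_inf_of_right (Filter.mem_principal_self P)
      filter_upwards [h5, Filter.mem_inf_of_left h3] with z hz hz'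
      obtain ⟨t, ht, rfl⟩ := hz
      apply hz'
      show extChartAt 𝓘(ℝ, E3) x (γ₁ t) - extChartAt 𝓘(ℝ, E3) x (γ₂ (σ t)) = 0
      rw [(hσ t ht).2, sub_self]
    exact hp.ne (Filter.eventually_false_iff_eq_bot.1 h4)
  obtain ⟨⟨δ, τ⟩, hδ, hne⟩ := Submodule.exists_mem_ne_zero_of_ne_bot hker
  have h5 : δ • a - τ • b = 0 := by
    have : L (δ, τ) = 0 := hδ
    simpa [hL] using this
  -- The kernel relation expresses the first velocity through the second as soon as `δ ≠ 0`, and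
  -- this holds because the second velocity does not vanish.
  have hδ0 : δ ≠ 0 := by
    rintro rfl
    rw [zero_smul, zero_sub, neg_eq_zero, smul_eq_zero] at h5
    rcases h5 with rfl | h5
    · exact hne rfl
    · exact hb0 h5
  refine ⟨s₁, hs₁, s₂, hs₂, direction_eq_of h₁ h₂ hs₁ hs₂ e.symm (k := δ⁻¹ * τ) ?_⟩
  apply chartD_injective m1
  have h6 : a = (δ⁻¹ * τ) • b := by
    rw [mul_smul, ← sub_eq_zero.1 h5, smul_smul, inv_mul_cancel₀ hδ0, one_smul]
  rw [map_smul, ← eb, ← ea]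
  exact h6

variable [T2Space M]

/-- Equality of null geodesics is only equality of point sets. `exists_parallel` supplies a null
line tangent to both, and each of `u`, `v` is joined to it along its own geodesic. -/
lemma leaf_eq_of_tangentGeodesic_eq {u v : PC g} (h : tangentGeodesic o u = tangentGeodesic o v) :
    (Quot.mk _ u : LeafSpace (engelKernel (prolongation g))) = Quot.mk _ v := by
  obtain ⟨γ₁, I₁, h₁, t₁, ht₁, rfl⟩ := exists_maximal_direction o u
  obtain ⟨γ₂, I₂, h₂, t₂, ht₂, rfl⟩ := exists_maximal_direction o v
  have h3 : γ₁ '' I₁ = γ₂ '' I₂ := by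
    rw [← tangentGeodesic_direction h₁ ht₁, ← tangentGeodesic_direction h₂ ht₂, h]
  obtain ⟨s₁, hs₁, s₂, hs₂, e⟩ := exists_parallel h₁.toIsNullGeodesic h₂.toIsNullGeodesic h3.subset
  have j1 := Quot.sound (joinedAlong_direction h₁.toIsNullGeodesic ht₁ hs₁)
  have j2 := Quot.sound (joinedAlong_direction h₂.toIsNullGeodesic hs₂ ht₂)
  rw [← e] at j2
  exact j1.trans j2

end SameImage

/-! ### The homeomorphism between the leaf space and the space of null geodesics. -/

section Topology

lemma continuousAt_bundle_iff {X : Type*} [TopologicalSpace X] {f : X → TangentBundle 𝓘(ℝ, E3) M}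
    {x₀ : X} : ContinuousAt f x₀ ↔ ContinuousAt (fun x => (f x).proj) x₀ ∧
      ContinuousAt (fun x => (chartD (f x₀).proj (f x).proj (f x).2 : E3)) x₀ := by
  rw [FiberBundle.continuousAt_totalSpace E3]
  refine and_congr_right fun h => ?_
  have : (fun x => ((trivializationAt E3 (TangentSpace 𝓘(ℝ, E3)) (f x₀).proj) (f x)).2) =ᶠ[𝓝 x₀]
      fun x => (chartD (f x₀).proj (f x).proj (f x).2 : E3) := by
    filter_upwards [h.eventually (extChartAt_source_mem_nhds (I := 𝓘(ℝ, E3)) (f x₀).proj)] with x hx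
    exact (chartD_eq_trivialization hx _).symm
  exact continuousAt_congr this

lemma continuousAt_chart_field {X : Type*} [TopologicalSpace X] {f : X → M} {x : X}
    (hf : ContinuousAt f x) {Z : ∀ x : M, TangentSpace 𝓘(ℝ, E3) x} {U : Set M} (hU : IsOpen U)
    (hZ : SmoothFieldOn Z U) (hx : f x ∈ U) :
    ContinuousAt (fun z => coordVectorField (f x) Z (extChartAt 𝓘(ℝ, E3) (f x) (f z))) x := by
  have h1 := contDiffOn_coordVectorField hU hZ (f x)
  have hm : extChartAt 𝓘(ℝ, E3) (f x) (f x) ∈ {y | y ∈ (extChartAt 𝓘(ℝ, E3) (f x)).target ∧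
      (extChartAt 𝓘(ℝ, E3) (f x)).symm y ∈ U} :=
    ⟨mem_extChartAt_target _, by rw [extChartAt_to_inv]; exact hx⟩
  have h2 := (h1.continuousOn _ hm).continuousAt ((isOpen_extChartAt_symm_preimage hU).mem_nhds hm)
  have h3 : ContinuousAt (fun z => extChartAt 𝓘(ℝ, E3) (f x) (f z)) x :=
    (continuousAt_extChartAt (I := 𝓘(ℝ, E3)) (f x)).comp hf
  exact ContinuousAt.comp (f := fun z => extChartAt 𝓘(ℝ, E3) (f x) (f z)) h2 h3

lemma continuousAt_form {X : Type*} [TopologicalSpace X] {f : X → M} {v : X → E3} {x : X}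
    (hf : ContinuousAt f x) (hv : ContinuousAt (fun z => (chartD (f x) (f z) (v z) : E3)) x)
    {Z : ∀ x : M, TangentSpace 𝓘(ℝ, E3) x} {U : Set M} (hU : IsOpen U) (hZ : SmoothFieldOn Z U)
    (hx : f x ∈ U) : ContinuousAt (fun z => g.form (f z) (v z) (Z (f z))) x := by
  have h1 := continuousAt_chart_field hf hU hZ hx
  have h2 : ContinuousAt (fun z => chartMetric g (f x) (extChartAt 𝓘(ℝ, E3) (f x) (f z))) x := by
    have h3 : ContinuousAt (fun z => extChartAt 𝓘(ℝ, E3) (f x) (f z)) x :=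
      (continuousAt_extChartAt (I := 𝓘(ℝ, E3)) (f x)).comp hf
    exact ContinuousAt.comp (f := fun z => extChartAt 𝓘(ℝ, E3) (f x) (f z))
      (contDiffAt_chartMetric g (f x) (mem_extChartAt_target (f x))).continuousAt h3
  refine ((h2.clm_apply hv).clm_apply h1).congr ?_
  filter_upwards [hf.eventually (extChartAt_source_mem_nhds (I := 𝓘(ℝ, E3)) (f x))] with z hz
  exact chartMetric_chartD_field hz Z (v z)

/-- A map into the bundle of null lines given by a continuous family of null vectors. -/
lemma continuousAt_of {X : Type*} [TopologicalSpace X] {f : X → M} {v : X → E3} {x : X}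
    (h0 : ∀ z, v z ≠ 0) (hn : ∀ z, g.form (f z) (v z) (v z) = 0)
    (hf : ContinuousAt f x) (hv : ContinuousAt (fun z => (chartD (f x) (f z) (v z) : E3)) x) :
    ContinuousAt (fun z => PC.of g (f z) (v z) (h0 z) (hn z)) x := by
  set u₀ := PC.of g (f x) (v x) (h0 x) (hn x) with hu₀
  have hm : u₀ ∈ (extChartAt 𝓘(ℝ, E3 × ℝ) u₀).source := mem_extChartAt_source _
  obtain ⟨m1, m2, m3⟩ := extChartAt_source_iff.1 hm
  rw [Ne] at m3
  have m3' : u₀.frame.den (f x) (v x) ≠ 0 := (u₀.frame.den_of (h0 x) (hn x)).1 m3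
  have cnum : ContinuousAt (fun z => u₀.frame.num (f z) (v z)) x :=
    continuousAt_form hf hv u₀.frame.isOpen_dom u₀.frame.smooth_Y m2
  have cden : ContinuousAt (fun z => u₀.frame.den (f z) (v z)) x :=
    (continuousAt_form hf hv u₀.frame.isOpen_dom u₀.frame.smooth_V m2).sub
      (continuousAt_form hf hv u₀.frame.isOpen_dom u₀.frame.smooth_T m2)
  have ev : ∀ᶠ z in 𝓝 x, PC.of g (f z) (v z) (h0 z) (hn z) ∈
      (extChartAt 𝓘(ℝ, E3 × ℝ) u₀).source := by
    filter_upwards [hf.eventually ((isOpen_extChartAt_source (I := 𝓘(ℝ, E3)) (f x)).mem_nhds m1),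
      hf.eventually (u₀.frame.isOpen_dom.mem_nhds m2), cden.eventually_ne m3'] with z z1 z2 z3
    exact extChartAt_source_iff.2 ⟨z1, z2, (u₀.frame.den_of _ _).2 z3⟩
  have cc : ContinuousAt (fun z => extChartAt 𝓘(ℝ, E3 × ℝ) u₀
      (PC.of g (f z) (v z) (h0 z) (hn z))) x := by
    have e : (fun z => extChartAt 𝓘(ℝ, E3 × ℝ) u₀ (PC.of g (f z) (v z) (h0 z) (hn z))) =
        fun z => (extChartAt 𝓘(ℝ, E3) (f x) (f z),
          u₀.frame.num (f z) (v z) / u₀.frame.den (f z) (v z)) := by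
      funext z
      exact Prod.ext rfl (u₀.frame.coord_of (h0 z) (hn z))
    rw [e]
    exact ContinuousAt.prodMk ((continuousAt_extChartAt (I := 𝓘(ℝ, E3)) (f x)).comp hf)
      (cnum.div cden m3')
  have cs : ContinuousAt (extChartAt 𝓘(ℝ, E3 × ℝ) u₀).symm (extChartAt 𝓘(ℝ, E3 × ℝ) u₀ u₀) :=
    continuousAt_extChartAt_symm u₀
  refine (ContinuousAt.comp (f := fun z => extChartAt 𝓘(ℝ, E3 × ℝ) u₀
    (PC.of g (f z) (v z) (h0 z) (hn z))) cs cc).congr ?_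
  filter_upwards [ev] with z hz
  exact (extChartAt 𝓘(ℝ, E3 × ℝ) u₀).left_inv hz

variable [T2Space M]

lemma TangentPair.exists_direction (P : TangentPair o) :
    ∃ hv : FutureNullAt o P.vec.proj P.vec.2, tangentGeodesic o
      (PC.of g P.vec.proj P.vec.2 hv.ne_zero hv.null) = P.curve := by
  obtain ⟨⟨x, v⟩, A, γ, I, t, hγ, hA, ht, hv⟩ := P
  have hx : x = γ t := congrArg TotalSpace.proj hv.symm
  subst hx
  have hv' : v = velocity γ t := by
    simpa using hv.symm
  subst hv'
  refine ⟨hγ.toIsNullGeodesic.futureNullAt ht, (tangentGeodesic_eq_iff _ _).2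
    ⟨γ, I, hγ, t, ht, rfl, hA⟩⟩

/-- The null line of a tangent pair depends continuously on it. -/
lemma continuous_leaf_curve {X : Type*} [TopologicalSpace X] {ψ : NullGeodesic o → X}
    (h : Continuous fun u : PC g => ψ (tangentGeodesic o u)) : Continuous ψ := by
  -- In the coinduced topology it is enough to test `ψ` on tangent pairs. There it factors through
  -- the null line `f P` spanned by the vector of the pair, which varies continuously.
  refine continuous_coinduced_dom.2 ?_
  let _ : TopologicalSpace (TangentPair o) :=
    TopologicalSpace.induced (TangentPair.vec (o := o)) inferInstance
  have hvec : Continuous (TangentPair.vec (o := o)) := continuous_induced_dom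
  let f : TangentPair o → PC g := fun P => PC.of g P.vec.proj P.vec.2
    P.exists_direction.choose.ne_zero P.exists_direction.choose.null
  have hf : Continuous f := by
    refine continuous_iff_continuousAt.2 fun P => ?_
    obtain ⟨h1, h2⟩ := continuousAt_bundle_iff.1 (hvec.continuousAt (x := P))
    exact continuousAt_of _ _ h1 h2
  have e : ψ ∘ TangentPair.curve = fun P => ψ (tangentGeodesic o (f P)) := by
    funext P
    exact congrArg ψ P.exists_direction.choose_spec.symm
  rw [e]
  exact h.comp hf

/-- The null geodesic tangent to a null line depends continuously on it. -/
lemma continuous_tangentGeodesic : Continuous (tangentGeodesic o) := by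
  refine continuous_iff_continuousAt.2 fun u₀ => ?_
  let _ : TopologicalSpace (TangentPair o) :=
    TopologicalSpace.induced (TangentPair.vec (o := o)) inferInstance
  have hcurve : Continuous (TangentPair.curve (o := o)) := continuous_coinduced_rng
  have hm : u₀ ∈ (extChartAt 𝓘(ℝ, E3 × ℝ) u₀).source := mem_extChartAt_source _
  obtain ⟨m1, m2, m3⟩ := extChartAt_source_iff.1 hm
  have hnull : ∀ {u : PC g}, u ∈ (extChartAt 𝓘(ℝ, E3 × ℝ) u₀).source →
      ∀ ε : ℝ, g.form u.pt (ε • (u₀.frame.vec u.pt (u₀.frame.coord u) : E3))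
        (ε • (u₀.frame.vec u.pt (u₀.frame.coord u) : E3)) = 0 := by
    intro u hu ε
    have key : ∀ v : E3, g.form u.pt v v = 0 → g.form u.pt (ε • v) (ε • v) = 0 := by
      intro v hv
      rw [map_smul, map_smul, smul_apply, hv, smul_zero, smul_zero]
    exact key _ (u₀.frame.vec_null (extChartAt_source_iff.1 hu).2.1 (u₀.frame.coord u))
  -- A sign that makes the frame vector future directed at `u₀`; by continuity the same sign works
  -- nearby.
  obtain ⟨ε, hε, hfut⟩ : ∃ ε : ℝ, ε ≠ 0 ∧ FutureNullAt o u₀.pt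
      (ε • (u₀.frame.vec u₀.pt (u₀.frame.coord u₀) : E3)) := by
    have h1 := hnull hm 1
    rw [one_smul] at h1
    rcases futureNullAt_or_neg (o := o) (u₀.frame.vec_ne_zero m2 (u₀.frame.coord u₀)) h1 with h | h
    · exact ⟨1, one_ne_zero, by rwa [one_smul]⟩
    · exact ⟨-1, by norm_num, by rwa [neg_one_smul]⟩
  have cpt : ContinuousAt (PC.pt : PC g → M) u₀ := (contMDiff_pt g u₀).continuousAt
  have cvec : ContinuousAt (fun u : PC g => (chartD u₀.pt u.pt
      (ε • (u₀.frame.vec u.pt (u₀.frame.coord u) : E3)) : E3)) u₀ := by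
    have h1 : ContinuousAt (fun u => ε • u₀.model.xi (extChartAt 𝓘(ℝ, E3 × ℝ) u₀ u)) u₀ :=
      (ContinuousAt.comp (f := extChartAt 𝓘(ℝ, E3 × ℝ) u₀)
        (FramedMetric.contDiffAt_xi (mem_lineDom hm)).continuousAt
        (continuousAt_extChartAt u₀)).const_smul ε
    refine h1.congr ?_
    filter_upwards [extChartAt_source_mem_nhds (I := 𝓘(ℝ, E3 × ℝ)) u₀] with u hu
    have key : ∀ v X : E3, chartD u₀.pt u.pt v = X → ε • X = chartD u₀.pt u.pt (ε • v) := by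
      rintro v _ rfl
      rw [map_smul]
    exact key _ _ (chartD_vec u₀.frame (pt_mem hu) (u₀.frame.coord u))
  have cfut : ∀ᶠ u in 𝓝 u₀, g.form u.pt (ε • (u₀.frame.vec u.pt (u₀.frame.coord u) : E3))
      (o.field u.pt) < 0 :=
    (continuousAt_form cpt cvec isOpen_univ o.smooth (mem_univ _)).eventually
      (isOpen_Iio.mem_nhds hfut.future)
  have hex : ∀ᶠ u in 𝓝 u₀, ∃ P : TangentPair o, P.curve = tangentGeodesic o u ∧
      P.vec = ⟨u.pt, ε • (u₀.frame.vec u.pt (u₀.frame.coord u))⟩ := by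
    filter_upwards [extChartAt_source_mem_nhds (I := 𝓘(ℝ, E3 × ℝ)) u₀, cfut] with u hu hu'
    have hu2 := extChartAt_source_iff.1 hu
    have hF : FutureNullAt o u.pt (ε • (u₀.frame.vec u.pt (u₀.frame.coord u) : E3)) :=
      futureNullAt_iff.2 ⟨smul_ne_zero hε (u₀.frame.vec_ne_zero hu2.2.1 _), hnull hu ε, hu'⟩
    obtain ⟨γ, I, hγ, t, ht, hd, e1, e2⟩ := exists_geodesic_direction hF
    have hdu : hγ.direction ht = u := by
      rw [hd]
      have h3 : u = u₀.frame.lineAt u.pt hu2.2.1 (u₀.frame.coord u) := by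
        obtain ⟨x, v, hv, hn, rfl⟩ := u.exists_of
        rw [u₀.frame.coord_of]
        exact (u₀.frame.lineAt_coord hu2.2.1 hv hn ((u₀.frame.den_of hv hn).1 hu2.2.2)).symm
      conv_rhs => rw [h3]
      exact of_eq_of rfl (k := ε) rfl _ _ _ _
    refine ⟨⟨_, tangentGeodesic o u, γ, I, t, hγ, ?_, ht, ?_⟩, rfl, rfl⟩
    · rw [← hdu]
      exact (tangentGeodesic_direction hγ ht).symm
    · have key : ∀ (x : M) (v : E3), γ t = x → (vel γ t : E3) = v →
          (⟨γ t, velocity γ t⟩ : TangentBundle 𝓘(ℝ, E3) M) = ⟨x, v⟩ := by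
        rintro _ _ rfl rfl
        rfl
      exact key _ _ e1 e2
  have hne : Nonempty (TangentPair o) := ⟨hex.self_of_nhds.choose⟩
  classical
  -- A local section assigning to a null line a tangent pair over it. Its vector part is the
  -- explicit continuous expression, which suffices since tangent pairs carry the induced topology;
  -- the default value occurs only away from `u₀`.
  let σ : PC g → TangentPair o := fun u => if h : ∃ P : TangentPair o,
    P.curve = tangentGeodesic o u ∧ P.vec = ⟨u.pt, ε • (u₀.frame.vec u.pt (u₀.frame.coord u))⟩
      then h.choose else hne.some
  have hσ : ∀ᶠ u in 𝓝 u₀, (σ u).curve = tangentGeodesic o u ∧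
      (σ u).vec = ⟨u.pt, ε • (u₀.frame.vec u.pt (u₀.frame.coord u))⟩ := by
    filter_upwards [hex] with u hu
    simp only [σ, dif_pos hu]
    exact hu.choose_spec
  have cσ : ContinuousAt σ u₀ := by
    refine (Topology.IsInducing.continuousAt_iff (g := TangentPair.vec (o := o)) ⟨rfl⟩).2 ?_
    have h1 : ContinuousAt (fun u : PC g => (⟨u.pt, ε • (u₀.frame.vec u.pt (u₀.frame.coord u))⟩ :
        TangentBundle 𝓘(ℝ, E3) M)) u₀ := continuousAt_bundle_iff.2 ⟨cpt, cvec⟩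
    refine h1.congr ?_
    filter_upwards [hσ] with u hu using hu.2.symm
  refine (hcurve.continuousAt.comp cσ).congr ?_
  filter_upwards [hσ] with u hu using hu.1

/-- The bijection from the leaf space of the Engel kernel to the space of null geodesics. -/
def leafEquiv (o : TimeOrientation g) :
    LeafSpace (engelKernel (prolongation g)) ≃ NullGeodesic o :=
  Equiv.ofBijective
    (Quot.lift (tangentGeodesic o) fun _ _ h => tangentGeodesic_of_joinedAlong h) <| by
      constructor
      · rintro ⟨u⟩ ⟨v⟩ h
        exact leaf_eq_of_tangentGeodesic_eq h
      · intro A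
        obtain ⟨γ, I, hγ, hA⟩ := A.isNull
        obtain ⟨t, ht⟩ := hγ.isConnected.nonempty
        exact ⟨Quot.mk _ (hγ.direction ht), (tangentGeodesic_eq_iff _ _).2 ⟨γ, I, hγ, t, ht, rfl, hA⟩⟩

/-- The leaf space of the Engel kernel is the space of null geodesics. -/
def leafHomeomorph (o : TimeOrientation g) :
    LeafSpace (engelKernel (prolongation g)) ≃ₜ NullGeodesic o where
  toEquiv := leafEquiv o
  continuous_toFun := continuous_quot_lift _ continuous_tangentGeodesic
  continuous_invFun := by
    refine continuous_leaf_curve ?_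
    refine continuous_quot_mk.congr fun u => ?_
    exact ((leafEquiv o).symm_apply_apply (Quot.mk _ u)).symm

end Topology

end

/-! ### Uniqueness of Jacobi fields and nonconjugacy of nearby points. -/

section SecondOrder

variable {E : Type*} [NormedAddCommGroup E] [NormedSpace ℝ E]

/-- A solution of a second order linear equation that vanishes at the ends of a short interval
has vanishing initial velocity. -/
lemma velocity_eq_zero_of_short {J K D : ℝ → E} {a b C : ℝ} (hab : a < b) (h1 : b - a ≤ 1)
    (hC0 : 0 ≤ C) (hC : 4 * C * (b - a) < 1)
    (hJ : ∀ s ∈ Icc a b, HasDerivAt J (K s) s) (hK : ∀ s ∈ Icc a b, HasDerivAt K (D s) s)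
    (hD : ∀ s ∈ Icc a b, ‖D s‖ ≤ C * (‖J s‖ + ‖K s‖)) (ha : J a = 0) (hb : J b = 0) : K a = 0 := by
  have hL : 0 < b - a := sub_pos.2 hab
  have maa : a ∈ Icc a b := ⟨le_rfl, hab.le⟩
  have mbb : b ∈ Icc a b := ⟨hab.le, le_rfl⟩
  -- All estimates are in terms of the maximum `m` of `‖K‖`: since `J a = 0` and the interval has
  -- length at most 1, `‖J‖ ≤ m`, and so `‖D‖ ≤ 2 C m`.
  obtain ⟨τ, hτ, hmax⟩ := isCompact_Icc.exists_isMaxOn ⟨a, maa⟩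
    (fun s hs => (hK s hs).continuousAt.norm.continuousWithinAt : ContinuousOn (fun s => ‖K s‖) (Icc a b))
  set m := ‖K τ‖ with hm
  have hKm : ∀ s ∈ Icc a b, ‖K s‖ ≤ m := fun s hs => hmax hs
  have hm0 : 0 ≤ m := norm_nonneg _
  have bJ : ∀ s ∈ Icc a b, ‖J s‖ ≤ m := by
    intro s hs
    have := norm_image_sub_le_of_norm_deriv_le_segment' (fun x hx => (hJ x hx).hasDerivWithinAt)
      (fun x hx => hKm x (Ico_subset_Icc_self hx)) s hs
    rw [ha, sub_zero] at this
    refine this.trans (mul_le_of_le_one_right hm0 ?_)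
    linarith [hs.2]
  have bD : ∀ s ∈ Icc a b, ‖D s‖ ≤ 2 * C * m := by
    intro s hs
    refine (hD s hs).trans ?_
    have := mul_le_mul_of_nonneg_left (add_le_add (bJ s hs) (hKm s hs)) hC0
    linarith
  have hc0 : 0 ≤ 2 * C * m := by positivity
  have bK : ∀ s ∈ Icc a b, ‖K s - K a‖ ≤ 2 * C * m * (b - a) := by
    intro s hs
    have := norm_image_sub_le_of_norm_deriv_le_segment' (fun x hx => (hK x hx).hasDerivWithinAt)
      (fun x hx => bD x (Ico_subset_Icc_self hx)) s hs
    refine this.trans (mul_le_mul_of_nonneg_left ?_ hc0)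
    linarith [hs.2]
  -- Comparing `J` with its linear part at `a` and evaluating at `b`, where `J` vanishes, bounds the
  -- initial velocity.
  have bKa : ‖K a‖ ≤ 2 * C * m * (b - a) := by
    have h2 : ∀ s ∈ Icc a b, HasDerivAt (fun s => J s - (s - a) • K a) (K s - K a) s := by
      intro s hs
      have := (hJ s hs).sub (((hasDerivAt_id s).sub_const a).smul_const (K a))
      rw [one_smul] at this
      exact this
    have := norm_image_sub_le_of_norm_deriv_le_segment' (fun x hx => (h2 x hx).hasDerivWithinAt)
      (fun x hx => bK x (Ico_subset_Icc_self hx)) b mbb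
    simp only [ha, hb, sub_self, zero_smul, sub_zero, zero_sub, norm_neg, norm_smul,
      Real.norm_eq_abs, abs_of_pos hL] at this
    rw [mul_comm (b - a)] at this
    exact le_of_mul_le_mul_right this hL
  -- The variation of `K` and the bound on `K a` contribute `2 C (b - a) m` each. The total factor
  -- is below 1, so `m = 0`.
  have hle : m ≤ 4 * C * (b - a) * m := by
    have h3 : m ≤ ‖K τ - K a‖ + ‖K a‖ := by
      have := norm_add_le (K τ - K a) (K a)
      rwa [sub_add_cancel] at this
    linarith [bK τ hτ]
  have hz : m = 0 := by
    by_contra hne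
    have hp : 0 < m := lt_of_le_of_ne hm0 (Ne.symm hne)
    have := mul_lt_mul_of_pos_right hC hp
    linarith
  exact norm_le_zero_iff.1 ((hKm a maa).trans hz.le)

variable {Γ : E → E →L[ℝ] E →L[ℝ] E} {y J : ℝ → E} {t : ℝ}

/-- The acceleration in the equation `jacobiOp Γ y J = 0`. -/
def jacobiAcc (Γ : E → E →L[ℝ] E →L[ℝ] E) (y : ℝ → E) (t : ℝ) : E × E →L[ℝ] E :=
  -((((fderiv ℝ Γ (y t)).flip (deriv y t)).flip (deriv y t)).comp (ContinuousLinearMap.fst ℝ E E))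
    - ((2 : ℝ) • Γ (y t) (deriv y t)).comp (ContinuousLinearMap.snd ℝ E E)

lemma jacobiOp_eq_zero_iff : jacobiOp Γ y J t = 0 ↔
    deriv (deriv J) t = jacobiAcc Γ y t (J t, deriv J t) := by
  unfold jacobiOp jacobiAcc
  rw [add_assoc, add_eq_zero_iff_eq_neg]
  simp [sub_eq_add_neg, add_comm]

lemma continuousAt_jacobiAcc (hΓ : ContDiffAt ℝ ∞ Γ (y t)) (hy : ContDiffAt ℝ ∞ y t) :
    ContinuousAt (jacobiAcc Γ y) t := by
  have h1 : ContinuousAt (fun s => fderiv ℝ Γ (y s)) t :=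
    ContinuousAt.comp (f := y) (contDiffAt_fderiv hΓ).continuousAt hy.continuousAt
  have h2 : ContinuousAt (deriv y) t := (contDiffAt_deriv hy).continuousAt
  have h3 : ContinuousAt (fun s => Γ (y s)) t :=
    ContinuousAt.comp (f := y) hΓ.continuousAt hy.continuousAt
  have h4 : ContinuousAt (fun s => (fderiv ℝ Γ (y s)).flip (deriv y s)) t :=
    ((ContinuousLinearMap.flipₗᵢ ℝ E E (E →L[ℝ] E)).continuous.continuousAt.comp h1).clm_apply h2
  have h5 : ContinuousAt (fun s => ((fderiv ℝ Γ (y s)).flip (deriv y s)).flip (deriv y s)) t :=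
    ((ContinuousLinearMap.flipₗᵢ ℝ E E E).continuous.continuousAt.comp h4).clm_apply h2
  exact (h5.clm_comp continuousAt_const).neg.sub
    (((h3.clm_apply h2).const_smul (2 : ℝ)).clm_comp continuousAt_const)

lemma jacobi_eventually_eq_zero (hΓ : ContDiffAt ℝ ∞ Γ (y t)) (hy : ContDiffAt ℝ ∞ y t)
    (hJ : ContDiffAt ℝ ∞ J t) (h : ∀ᶠ s in 𝓝 t, jacobiOp Γ y J s = 0) (h0 : J t = 0)
    (h1 : deriv J t = 0) : ∀ᶠ s in 𝓝 t, J s = 0 := by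
  have key : ∀ᶠ s in 𝓝 t, (J s, deriv J s) = 0 := by
    refine linear_ode_eq_zero
      (L := fun s => (ContinuousLinearMap.snd ℝ E E).prod (jacobiAcc Γ y s)) ?_ ?_ (by simp [h0, h1])
    · exact (ContinuousLinearMap.prodₗᵢ (𝕜 := ℝ) (E := E × E) (F := E) (G := E) ℝ).continuous.continuousAt.comp
        (continuousAt_const.prodMk (continuousAt_jacobiAcc hΓ hy))
    · filter_upwards [h, eventually_differentiableAt hJ,
        eventually_differentiableAt (contDiffAt_deriv hJ)] with s hs d1 d2
      have := d1.hasDerivAt.prodMk d2.hasDerivAt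
      rw [jacobiOp_eq_zero_iff.1 hs] at this
      exact this
  exact key.mono fun s hs => congrArg Prod.fst hs

end SecondOrder

section Jacobi

variable {M : Type*} [TopologicalSpace M] [ChartedSpace E3 M] [IsManifold 𝓘(ℝ, E3) ∞ M]
  {g : LorentzMetric M} {γ : ℝ → M} {I : Set ℝ} {t : ℝ} {x₀ : M}
  {J : ∀ t, TangentSpace 𝓘(ℝ, E3) (γ t)}

lemma IsJacobiField.jacobiOp_eq_zero (hJ : IsJacobiField g γ I J) (hγ : IsGeodesic g γ I) (ht : t ∈ I)
    (hx : γ t ∈ (extChartAt 𝓘(ℝ, E3) x₀).source) :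
    jacobiOp (chartGamma g x₀) (coordCurve x₀ γ) (coordField x₀ γ J) t = 0 := by
  obtain ⟨h1, h2⟩ := hJ x₀ t ht (by rwa [extChartAt_source] at hx)
  rw [← jacobi_eq_jacobiOp (hγ.contMDiffAt ht) hx h1 (hγ.geodOp_eq_zero ht hx)]
  exact h2

/-- A Jacobi field that vanishes near a point vanishes. -/
lemma IsJacobiField.eq_zero (hJ : IsJacobiField g γ I J) (hγ : IsGeodesic g γ I) (ht : t ∈ I)
    (h : ∀ᶠ s in 𝓝 t, J s = 0) : ∀ s ∈ I, J s = 0 := by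
  -- The set of parameters near which `J` vanishes is open. At a limit point `J` and its derivative
  -- vanish by continuity, and linear uniqueness makes `J` vanish nearby.
  have key : I ⊆ {s | ∀ᶠ r in 𝓝 s, J r = 0} := by
    refine hγ.isConnected.isPreconnected.subset_of_closure_inter_subset
      (isOpen_setOfPred_eventually_nhds (p := fun s => J s = 0)) ⟨t, ht, h⟩ ?_
    rintro s ⟨hs, hsI⟩
    have hx : γ s ∈ (extChartAt 𝓘(ℝ, E3) (γ s)).source := mem_extChartAt_source _
    obtain ⟨h1, -⟩ := hJ (γ s) s hsI (mem_chart_source _ _)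
    have z : ∀ r, (∀ᶠ r' in 𝓝 r, J r' = 0) → coordField (γ s) γ J r = 0 ∧
        deriv (coordField (γ s) γ J) r = 0 := by
      intro r hr
      have : coordField (γ s) γ J =ᶠ[𝓝 r] fun _ => 0 := by
        filter_upwards [hr] with r' hr'
        unfold coordField
        rw [hr', map_zero]
        rfl
      exact ⟨this.self_of_nhds, by rw [this.deriv_eq]; simp⟩
    have hfr : ∃ᶠ r in 𝓝 s, coordField (γ s) γ J r = 0 ∧ deriv (coordField (γ s) γ J) r = 0 :=
      (mem_closure_iff_frequently.1 hs).mono z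
    have lim : ∀ {f : ℝ → E3}, ContinuousAt f s → (∃ᶠ r in 𝓝 s, f r = 0) → f s = 0 := by
      intro f hf hfr
      by_contra hne
      exact hfr (hf.eventually_ne hne)
    have := jacobi_eventually_eq_zero (contDiffAt_chartGamma g (γ s)
      ((extChartAt 𝓘(ℝ, E3) (γ s)).map_source hx)) (contDiffAt_coordCurve (hγ.contMDiffAt hsI) hx) h1
      (by
        filter_upwards [hγ.isOpen.mem_nhds hsI, eventually_mem_chart (hγ.contMDiffAt hsI) hx]
          with r hr hr' using hJ.jacobiOp_eq_zero hγ hr hr')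
      (lim h1.continuousAt (hfr.mono fun r hr => hr.1))
      (lim (contDiffAt_deriv h1).continuousAt (hfr.mono fun r hr => hr.2))
    filter_upwards [this, eventually_mem_chart (hγ.contMDiffAt hsI) hx] with r hr hr'
    exact (chartD_eq_zero_iff hr' (J r)).1 hr
  exact fun s hs => (key hs).self_of_nhds

/-- Close points are not conjugate. -/
lemma IsGeodesic.exists_not_conjugate (hγ : IsGeodesic g γ I) (ht : t ∈ I) :
    ∃ b ∈ I, ¬ Conjugate g γ I t b := by
  have hx : γ t ∈ (extChartAt 𝓘(ℝ, E3) (γ t)).source := mem_extChartAt_source _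
  have hΓ := contDiffAt_chartGamma g (γ t) ((extChartAt 𝓘(ℝ, E3) (γ t)).map_source hx)
  have hy := contDiffAt_coordCurve (hγ.contMDiffAt ht) hx
  set Γ := chartGamma g (γ t)
  set y := coordCurve (γ t) γ
  set C := ‖jacobiAcc Γ y t‖ + 1 with hCdef
  have hC : 0 ≤ C := by positivity
  have hb : ∀ᶠ s in 𝓝 t, ‖jacobiAcc Γ y s‖ < C :=
    (continuousAt_jacobiAcc hΓ hy).norm.eventually_lt continuousAt_const (by simp [hCdef])
  obtain ⟨ε, hε, hball⟩ := Metric.eventually_nhds_iff.1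
    (hb.and ((hγ.isOpen.eventually_mem ht).and (eventually_mem_chart (hγ.contMDiffAt ht) hx)))
  -- The three bounds keep the interval inside the neighbourhood where the coefficient bound and the
  -- chart are available, make its length at most 1, and give `4 C δ < 1`.
  set δ := min (ε / 2) (min 1 (1 / (8 * (C + 1)))) with hδ
  have hδ0 : 0 < δ := by positivity
  have hδε : δ < ε := lt_of_le_of_lt (min_le_left _ _) (half_lt_self hε)
  have hsub : ∀ s ∈ Icc t (t + δ), ‖jacobiAcc Γ y s‖ < C ∧ s ∈ I ∧
      γ s ∈ (extChartAt 𝓘(ℝ, E3) (γ t)).source := by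
    intro s hs
    refine hball ?_
    rw [Real.dist_eq, abs_of_nonneg (by linarith [hs.1])]
    linarith [hs.2]
  refine ⟨t + δ, (hsub _ ⟨by linarith, le_rfl⟩).2.1, ?_⟩
  rintro ⟨J, hJ, ⟨s, hs, hne⟩, h0, h1⟩
  have cJ : ∀ s ∈ Icc t (t + δ), ContDiffAt ℝ ∞ (coordField (γ t) γ J) s := fun s hs =>
    (hJ (γ t) s (hsub s hs).2.1 (by have := (hsub s hs).2.2; rwa [extChartAt_source] at this)).1
  have z : ∀ r, J r = 0 → coordField (γ t) γ J r = 0 := by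
    intro r hr
    unfold coordField
    rw [hr, map_zero]
    rfl
  have mt : t ∈ Icc t (t + δ) := ⟨le_rfl, by linarith⟩
  have hv : deriv (coordField (γ t) γ J) t = 0 := by
    refine velocity_eq_zero_of_short (b := t + δ) (C := C) (by linarith) ?_ hC ?_
      (fun s hs => ((cJ s hs).differentiableAt (by simp)).hasDerivAt)
      (fun s hs => ((contDiffAt_deriv (cJ s hs)).differentiableAt (by simp)).hasDerivAt) ?_
      (z _ h0) (z _ h1)
    · rw [add_sub_cancel_left]
      exact (min_le_right _ _).trans (min_le_left _ _)
    · rw [add_sub_cancel_left]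
      have h3 : δ ≤ 1 / (8 * (C + 1)) := (min_le_right _ _).trans (min_le_right _ _)
      rw [le_div_iff₀ (by positivity)] at h3
      nlinarith
    · intro s hs
      have h3 := hJ.jacobiOp_eq_zero hγ (hsub s hs).2.1 (hsub s hs).2.2
      rw [jacobiOp_eq_zero_iff.1 h3]
      refine ((jacobiAcc Γ y s).le_opNorm _).trans ?_
      refine mul_le_mul (hsub s hs).1.le ?_ (norm_nonneg _) hC
      rw [Prod.norm_mk]
      exact max_le_add_of_nonneg (norm_nonneg _) (norm_nonneg _)
  refine hne (hJ.eq_zero hγ ht ?_ s hs)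
  have := jacobi_eventually_eq_zero hΓ hy (cJ t mt)
    (by
      filter_upwards [hγ.isOpen.mem_nhds ht, eventually_mem_chart (hγ.contMDiffAt ht) hx]
        with r hr hr' using hJ.jacobiOp_eq_zero hγ hr hr') (z _ h0) hv
  filter_upwards [this, eventually_mem_chart (hγ.contMDiffAt ht) hx] with r hr hr'
  exact (chartD_eq_zero_iff hr' (J r)).1 hr

end Jacobi

/-! ### The linearised spray equation and its relation to Jacobi fields. -/

namespace FramedMetric

variable {E : Type*} [NormedAddCommGroup E] [NormedSpace ℝ E] [CompleteSpace E]
  {N : FramedMetric E} {q Z : ℝ → E × ℝ} {h μ : ℝ → ℝ} {t : ℝ}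

/-- `Z` is a solution of the linearised equation of the spray along the integral curve `q` up to
reparametrisation. -/
structure IsSprayField (N : FramedMetric E) (q Z : ℝ → E × ℝ) (h μ : ℝ → ℝ) (t : ℝ) : Prop where
  mem : q t ∈ N.lineDom
  field_smooth : ∀ᶠ s in 𝓝 t, ContDiffAt ℝ ∞ Z s
  scale_smooth : ∀ᶠ s in 𝓝 t, ContDiffAt ℝ ∞ h s
  rate_smooth : ∀ᶠ s in 𝓝 t, ContDiffAt ℝ ∞ μ s
  curve : ∀ᶠ s in 𝓝 t, HasDerivAt q (h s • N.spray (q s)) s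
  scale : ∀ᶠ s in 𝓝 t, HasDerivAt h (-(h s ^ 2 * N.nonaffinity (q s))) s
  field : ∀ᶠ s in 𝓝 t, HasDerivAt Z (h s • fderiv ℝ N.spray (q s) (Z s) + μ s • N.spray (q s)) s

lemma fderiv_spray_fst {q : E × ℝ} (hq : q ∈ N.lineDom) (w : E × ℝ) :
    (fderiv ℝ N.spray q w).1 = fderiv ℝ N.xi q w := by
  have h1 := ((contDiffAt_xi hq).differentiableAt (by simp)).hasFDerivAt.prodMk
    ((contDiffAt_slope hq).differentiableAt (by simp)).hasFDerivAt
  have h2 : HasFDerivAt N.spray _ q := h1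
  rw [h2.fderiv]
  rfl

/-- The derivative of `nabla_spray`. -/
lemma fderiv_nabla_spray {q : E × ℝ} (hq : q ∈ N.lineDom) (w : E × ℝ) :
    fderiv ℝ (fderiv ℝ N.xi) q w (N.spray q) + fderiv ℝ N.xi q (fderiv ℝ N.spray q w) +
      (fderiv ℝ N.Γ q.1 w.1 (N.xi q) (N.xi q) + N.Γ q.1 (fderiv ℝ N.xi q w) (N.xi q) +
        N.Γ q.1 (N.xi q) (fderiv ℝ N.xi q w)) =
      fderiv ℝ N.nonaffinity q w • N.xi q + N.nonaffinity q • fderiv ℝ N.xi q w := by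
  have hxi := ((contDiffAt_xi hq).differentiableAt (by simp)).hasFDerivAt
  have hdxi := ((contDiffAt_fderiv (contDiffAt_xi hq)).differentiableAt (by simp)).hasFDerivAt
  have hsp := ((contDiffAt_spray hq).differentiableAt (by simp)).hasFDerivAt
  have hν := ((contDiffAt_nonaffinity hq).differentiableAt (by simp)).hasFDerivAt
  have hΓ : HasFDerivAt N.Γ (fderiv ℝ N.Γ q.1) q.1 :=
    (((contDiffOn_christoffelCLM N.isOpen_dom N.smooth_G N.invertible).contDiffAt
      (N.isOpen_dom.mem_nhds hq)).differentiableAt (by simp)).hasFDerivAt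
  have l := (hdxi.clm_apply hsp).add (((hΓ.comp q hasFDerivAt_fst).clm_apply hxi).clm_apply hxi)
  have r := hν.smul hxi
  have e : (fun q => fderiv ℝ N.xi q (N.spray q) + N.Γ q.1 (N.xi q) (N.xi q)) =ᶠ[𝓝 q]
      fun q => N.nonaffinity q • N.xi q := by
    filter_upwards [N.isOpen_lineDom.mem_nhds hq] with z hz using nabla_spray hz
  have key := congrArg (fun L : E × ℝ →L[ℝ] E => L w) ((l.congr_of_eventuallyEq e.symm).unique r)
  simp only [add_apply, ContinuousLinearMap.comp_apply, ContinuousLinearMap.flip_apply,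
    ContinuousLinearMap.coe_fst', smul_apply, ContinuousLinearMap.smulRight_apply,
    Function.comp_apply] at key
  rw [add_comm (N.Γ q.1 (N.xi q) _), add_comm (fderiv ℝ N.xi q _)] at key
  rw [← sub_eq_zero] at key ⊢
  rw [← key]
  abel

namespace IsSprayField

variable (H : N.IsSprayField q Z h μ t)
include H

omit [CompleteSpace E] in
lemma eventually : ∀ᶠ s in 𝓝 t, N.IsSprayField q Z h μ s := by
  have hq : ContinuousAt q t := H.curve.self_of_nhds.continuousAt
  filter_upwards [hq.eventually (N.isOpen_lineDom.mem_nhds H.mem),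
    H.curve.eventually_nhds, H.scale.eventually_nhds, H.field.eventually_nhds,
    H.field_smooth.eventually_nhds, H.scale_smooth.eventually_nhds,
    H.rate_smooth.eventually_nhds] with s a1 a2 a3 a4 a5 a6 a7
  exact ⟨a1, a5, a6, a7, a2, a3, a4⟩

omit [CompleteSpace E] in
lemma hasDerivAt_fst : HasDerivAt (fun s => (q s).1) (h t • N.xi (q t)) t :=
  (ContinuousLinearMap.fst ℝ E ℝ).hasFDerivAt.comp_hasDerivAt t H.curve.self_of_nhds

lemma hasDerivAt_field_fst :
    HasDerivAt (fun s => (Z s).1) (h t • fderiv ℝ N.xi (q t) (Z t) + μ t • N.xi (q t)) t := by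
  have := (ContinuousLinearMap.fst ℝ E ℝ).hasFDerivAt.comp_hasDerivAt t H.field.self_of_nhds
  rw [map_add, map_smul, map_smul] at this
  rw [← fderiv_spray_fst H.mem]
  exact this

/-- A field that is vertical near `t` vanishes there. -/
lemma eq_zero_of_vertical (hh : h t ≠ 0) (hz : ∀ᶠ s in 𝓝 t, (Z s).1 = 0) : Z t = 0 := by
  have hz0 := hz.self_of_nhds
  have h1 : h t • fderiv ℝ N.xi (q t) (Z t) + μ t • N.xi (q t) = 0 := by
    rw [← H.hasDerivAt_field_fst.deriv]
    have : (fun s => (Z s).1) =ᶠ[𝓝 t] fun _ => 0 := hz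
    rw [this.deriv_eq]
    simp
  -- For a vertical `Z` the equation of the base part becomes `h Z.2 rho + μ xi = 0`; pairing with
  -- `rho` leaves `4 h Z.2 = 0`.
  have h2 : Z t = (Z t).2 • ((0 : E), (1 : ℝ)) := Prod.ext (by simp [hz0]) (by simp)
  rw [h2, map_smul, fderiv_xi_snd H.mem] at h1
  have h3 := congrArg (fun w => N.G (q t).1 w (N.rho (q t))) h1
  simp only [map_add, map_smul, add_apply, smul_apply, smul_eq_mul, G_rho_rho H.mem, G_xi_rho H.mem,
    map_zero, zero_apply] at h3
  have h4 : (Z t).2 = 0 := by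
    have : h t * ((Z t).2 * 4) = 0 := by linarith
    simpa [hh] using this
  rw [h2, h4, zero_smul]

omit [CompleteSpace E] in
/-- The base component of a spray field is orthogonal to its null line at a constant rate. -/
lemma G_covariant_eq_zero :
    N.G (q t).1 ((h t • fderiv ℝ N.xi (q t) (Z t) + μ t • N.xi (q t)) +
      N.Γ (q t).1 (h t • N.xi (q t)) (Z t).1) (N.xi (q t)) = 0 := by
  have hs : N.Γ (q t).1 (N.xi (q t)) (Z t).1 = N.Γ (q t).1 (Z t).1 (N.xi (q t)) := by
    exact christoffel_symm N.isOpen_dom (N.smooth_G.differentiableOn (by simp)) N.symm N.invertible H.mem _ _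
  -- By symmetry of `Γ`, the covariant derivative of the base part of `Z` along the curve equals `h
  -- ∇_Z xi + μ xi`, and both terms are orthogonal to `xi`.
  have : (h t • fderiv ℝ N.xi (q t) (Z t) + μ t • N.xi (q t)) +
      N.Γ (q t).1 (h t • N.xi (q t)) (Z t).1 = h t • N.nabla (q t) (Z t) + μ t • N.xi (q t) := by
    rw [map_smul, smul_apply, hs]
    unfold nabla
    module
  rw [this, map_add, map_smul, map_smul, add_apply, smul_apply, smul_apply, G_nabla_xi H.mem,
    G_xi_xi H.mem]
  simp

/-- The base component of a spray field is a Jacobi field up to multiples of the velocity. -/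
lemma jacobiOp_fst : jacobiOp N.Γ (fun s => (q s).1) (fun s => (Z s).1) t =
    (h t ^ 2 * fderiv ℝ N.nonaffinity (q t) (Z t) + 2 * h t * μ t * N.nonaffinity (q t) +
      deriv μ t) • N.xi (q t) := by
  have hs : N.Γ (q t).1 (fderiv ℝ N.xi (q t) (Z t)) (N.xi (q t)) =
      N.Γ (q t).1 (N.xi (q t)) (fderiv ℝ N.xi (q t) (Z t)) := by
    exact christoffel_symm N.isOpen_dom (N.smooth_G.differentiableOn (by simp)) N.symm N.invertible H.mem _ _
  have hy : deriv (fun s => (q s).1) t = h t • N.xi (q t) := H.hasDerivAt_fst.deriv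
  have hJ : deriv (fun s => (Z s).1) =ᶠ[𝓝 t]
      fun s => h s • fderiv ℝ N.xi (q s) (Z s) + μ s • N.xi (q s) :=
    H.eventually.mono fun s hs => hs.hasDerivAt_field_fst.deriv
  have hxi := ((contDiffAt_xi H.mem).differentiableAt (by simp)).hasFDerivAt
  have hdxi := ((contDiffAt_fderiv (contDiffAt_xi H.mem)).differentiableAt (by simp)).hasFDerivAt
  have dq := H.curve.self_of_nhds
  have dZ := H.field.self_of_nhds
  have dμ := (H.rate_smooth.self_of_nhds.differentiableAt (by simp)).hasDerivAt
  have d1 := hdxi.comp_hasDerivAt t dq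
  have d2 := (H.scale.self_of_nhds.smul (d1.clm_apply dZ)).add (dμ.smul (hxi.comp_hasDerivAt t dq))
  have d3 : deriv (deriv fun s => (Z s).1) t = _ := hJ.deriv_eq.trans d2.deriv
  have hsymm : fderiv ℝ (fderiv ℝ N.xi) (q t) (N.spray (q t)) (Z t) =
      fderiv ℝ (fderiv ℝ N.xi) (q t) (Z t) (N.spray (q t)) :=
    ((contDiffAt_xi H.mem).isSymmSndFDerivAt (by simp; norm_cast)) _ _
  have k := fderiv_nabla_spray H.mem (Z t)
  have k2 : fderiv ℝ N.xi (q t) (N.spray (q t)) + N.Γ (q t).1 (N.xi (q t)) (N.xi (q t)) =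
      N.nonaffinity (q t) • N.xi (q t) := nabla_spray H.mem
  unfold jacobiOp
  rw [d3, hJ.self_of_nhds, hy]
  simp only [Function.comp_apply, map_smul, map_add, smul_apply, hsymm]
  rw [hs] at k
  -- The contribution of `Z` itself is `h²` times the identity `nabla_spray` differentiated along
  -- `Z`; the admixture `μ` of the spray contributes that identity with factor `2 h μ`, and the
  -- derivative of `μ` supplies the last term.
  linear_combination (norm := module) (h t ^ 2) • k + (2 * h t * μ t) • k2

end IsSprayField

end FramedMetric

/-! ### The differential of p, its kernel, and the gauge fixed by the time orientation. -/

section Submersion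

variable {M : Type*} [TopologicalSpace M] [ChartedSpace E3 M] [IsManifold 𝓘(ℝ, E3) ∞ M] [T2Space M]
  {g : LorentzMetric M} {o : TimeOrientation g} [ChartedSpace E3 (NullGeodesic o)]
  [IsManifold 𝓘(ℝ, E3) ∞ (NullGeodesic o)] {p : PC g → NullGeodesic o} {A : NullGeodesic o}
  {u₀ u : PC g} {γ : ℝ → M} {I : Set ℝ} {s t : ℝ}

open PC

omit [IsManifold 𝓘(ℝ, E3) ∞ (NullGeodesic o)] in
/-- `p` is a submersion that sends a null line to the null geodesic tangent to it. -/
structure IsTangentSubmersion (p : PC g → NullGeodesic o) : Prop where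
  apply : ∀ u, p u = tangentGeodesic o u
  submersion : IsSmoothSubmersion p

/-- The map `p` in charts. -/
def projCoord (p : PC g → NullGeodesic o) (A : NullGeodesic o) (u₀ : PC g) (q : E3 × ℝ) : E3 :=
  extChartAt 𝓘(ℝ, E3) A (p ((extChartAt 𝓘(ℝ, E3 × ℝ) u₀).symm q))

namespace IsTangentSubmersion

omit [IsManifold 𝓘(ℝ, E3) ∞ (NullGeodesic o)] in
lemma apply_direction (hp : IsTangentSubmersion p) (hγ : IsMaximalNullGeodesic o γ I) (ht : t ∈ I)
    (hA : γ '' I = A.carrier) : p (hγ.direction ht) = A := by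
  rw [hp.apply]
  exact NullGeodesic.ext ((tangentGeodesic_direction hγ ht).trans hA)

lemma contDiffAt_projCoord (hp : IsTangentSubmersion p)
    (hu : u ∈ (extChartAt 𝓘(ℝ, E3 × ℝ) u₀).source) (hA : p u ∈ (extChartAt 𝓘(ℝ, E3) A).source) :
    ContDiffAt ℝ ∞ (projCoord p A u₀) (extChartAt 𝓘(ℝ, E3 × ℝ) u₀ u) :=
  contDiffAt_coord_map (hp.submersion.1 u) hu hA

lemma fderiv_projCoord (hp : IsTangentSubmersion p)
    (hu : u ∈ (extChartAt 𝓘(ℝ, E3 × ℝ) u₀).source) (hA : p u ∈ (extChartAt 𝓘(ℝ, E3) A).source)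
    (w : E3 × ℝ) :
    fderiv ℝ (projCoord p A u₀) (extChartAt 𝓘(ℝ, E3 × ℝ) u₀ u) (dChart u₀ u w) =
      chartD A (p u) (mfd p u w) :=
  (fderiv_coord_map ((hp.submersion.1 u).mdifferentiableAt (by simp)) hu hA w).2

lemma fderiv_projCoord_self (hp : IsTangentSubmersion p)
    (hu : u ∈ (extChartAt 𝓘(ℝ, E3 × ℝ) u₀).source) (hA : p u = A) (w : E3 × ℝ) :
    fderiv ℝ (projCoord p A u₀) (extChartAt 𝓘(ℝ, E3 × ℝ) u₀ u) (dChart u₀ u w) = mfd p u w := by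
  subst hA
  rw [hp.fderiv_projCoord hu (mem_extChartAt_source _), chartD_self]

/-- The spray is tangent, up to a nonzero factor, to the lift of a null geodesic, and p is constant
on that lift. -/
lemma fderiv_projCoord_spray (hp : IsTangentSubmersion p)
    (hu : u ∈ (extChartAt 𝓘(ℝ, E3 × ℝ) u₀).source) (hA : p u ∈ (extChartAt 𝓘(ℝ, E3) A).source) :
    fderiv ℝ (projCoord p A u₀) (extChartAt 𝓘(ℝ, E3 × ℝ) u₀ u)
      (u₀.model.spray (extChartAt 𝓘(ℝ, E3 × ℝ) u₀ u)) = 0 := by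
  obtain ⟨γ, I, hγ, t, ht, hd⟩ := exists_maximal_direction o u
  have hL := hγ.isLift_lift
  have hc : hγ.lift t = u := (hγ.lift_apply ht).trans hd
  have hu' : hγ.lift t ∈ (extChartAt 𝓘(ℝ, E3 × ℝ) u₀).source := by rwa [hc]
  have h1 := (hL.hasDerivAt ht hu').1
  rw [hc] at h1
  have h2 := ((hp.contDiffAt_projCoord hu hA).differentiableAt (by simp)).hasFDerivAt
  rw [← hc] at h2
  have h3 := h2.comp_hasDerivAt t h1
  have h4 : (projCoord p A u₀ ∘ fun r => extChartAt 𝓘(ℝ, E3 × ℝ) u₀ (hγ.lift r)) =ᶠ[𝓝 t]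
      fun _ => extChartAt 𝓘(ℝ, E3) A (p u) := by
    filter_upwards [hL.eventually_mem ht hu'] with r hr
    show extChartAt 𝓘(ℝ, E3) A (p ((extChartAt 𝓘(ℝ, E3 × ℝ) u₀).symm _)) = _
    rw [(extChartAt 𝓘(ℝ, E3 × ℝ) u₀).left_inv hr.2, hγ.lift_apply hr.1, ← hd, hp.apply, hp.apply]
    congr 1
    exact NullGeodesic.ext ((tangentGeodesic_direction hγ hr.1).trans
      (tangentGeodesic_direction hγ ht).symm)
  have h5 := h3.unique ((hasDerivAt_const t _).congr_of_eventuallyEq h4)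
  rw [map_smul, hc] at h5
  exact (smul_eq_zero.1 h5).resolve_left (hL.mem_source_iff ht |>.1 hu').2.2

omit [IsManifold 𝓘(ℝ, E3) ∞ (NullGeodesic o)] in
lemma mfd_surjective (hp : IsTangentSubmersion p) (u : PC g) :
    Function.Surjective (mfd p u : E3 × ℝ →L[ℝ] E3) := hp.submersion.2 u

/-- The kernel of the differential of `p` is the Engel kernel. -/
lemma mfd_eq_zero_iff (hp : IsTangentSubmersion p)
    (hu : u ∈ (extChartAt 𝓘(ℝ, E3 × ℝ) u₀).source) (w : E3 × ℝ) : (mfd p u w : E3) = 0 ↔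
      ∃ r : ℝ, dChart u₀ u w = r • u₀.model.spray (extChartAt 𝓘(ℝ, E3 × ℝ) u₀ u) := by
  have hA : p u ∈ (extChartAt 𝓘(ℝ, E3) (p u)).source := mem_extChartAt_source _
  have hsp := hp.fderiv_projCoord_spray hu hA
  have hne : u₀.model.spray (extChartAt 𝓘(ℝ, E3 × ℝ) u₀ u) ≠ 0 := fun h =>
    FramedMetric.xi_ne_zero (mem_lineDom hu) (congrArg Prod.fst h)
  constructor
  · intro h
    set v₀ := chartDSymm u₀ (extChartAt 𝓘(ℝ, E3 × ℝ) u₀ u)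
      (u₀.model.spray (extChartAt 𝓘(ℝ, E3 × ℝ) u₀ u)) with hv₀
    have e₀ : dChart u₀ u v₀ = u₀.model.spray (extChartAt 𝓘(ℝ, E3 × ℝ) u₀ u) :=
      chartD_chartDSymm' hu _
    have k₀ : (mfd p u v₀ : E3) = 0 := by
      rw [← hp.fderiv_projCoord_self hu rfl, e₀, hsp]
    have h0 : v₀ ≠ 0 := by
      intro h0
      rw [h0, map_zero] at e₀
      exact hne e₀.symm
    let L : E3 × ℝ →ₗ[ℝ] E3 := (mfd p u : E3 × ℝ →L[ℝ] E3).toLinearMap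
    -- A surjection from dimension 4 to dimension 3 has a one-dimensional kernel, so the nonzero
    -- spray vector spans it.
    have hr : LinearMap.range L = ⊤ := LinearMap.range_eq_top.2 (hp.mfd_surjective u)
    have hdim := L.finrank_range_add_finrank_ker
    rw [hr, finrank_top, Module.finrank_prod] at hdim
    simp only [finrank_euclideanSpace, Fintype.card_fin, Module.finrank_self] at hdim
    have h1 : Module.finrank ℝ (LinearMap.ker L) = 1 := by omega
    obtain ⟨r, hr⟩ := (finrank_eq_one_iff_of_nonzero' (⟨v₀, k₀⟩ : LinearMap.ker L)
      (fun h => h0 (congrArg Subtype.val h))).1 h1 ⟨w, h⟩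
    refine ⟨r, ?_⟩
    have : r • v₀ = w := congrArg Subtype.val hr
    rw [← this, map_smul, e₀]
  · rintro ⟨r, hr⟩
    rw [← hp.fderiv_projCoord_self hu rfl, hr, map_smul, hsp, smul_zero]

end IsTangentSubmersion

variable (o) in
/-- The pairing of the base component of a vector with the time orientation, in coordinates. -/
def gauge (u₀ : PC g) (q : E3 × ℝ) : E3 × ℝ →L[ℝ] ℝ :=
  ((u₀.model.G q.1).flip (coordVectorField u₀.pt o.field q.1)).comp (ContinuousLinearMap.fst ℝ E3 ℝ)

omit [T2Space M] [ChartedSpace E3 (NullGeodesic o)] [IsManifold 𝓘(ℝ, E3) ∞ (NullGeodesic o)] in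
lemma gauge_dChart (hu : u ∈ (extChartAt 𝓘(ℝ, E3 × ℝ) u₀).source) (w : E3 × ℝ) :
    gauge o u₀ (extChartAt 𝓘(ℝ, E3 × ℝ) u₀ u) (dChart u₀ u w) =
      g.form u.pt (mfd (PC.pt : PC g → M) u w) (o.field u.pt) := by
  rw [← chartMetric_chartD_field (pt_mem hu), chartD_mfd_pt hu]
  rfl

-- The base part of the spray is a nonzero null vector and cannot be orthogonal to the timelike
-- field. Hence the kernel of the gauge is complementary to the kernel of the differential of p.
omit [T2Space M] [ChartedSpace E3 (NullGeodesic o)] [IsManifold 𝓘(ℝ, E3) ∞ (NullGeodesic o)] in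
lemma gauge_spray_ne_zero (hu : u ∈ (extChartAt 𝓘(ℝ, E3 × ℝ) u₀).source) :
    gauge o u₀ (extChartAt 𝓘(ℝ, E3 × ℝ) u₀ u) (u₀.model.spray (extChartAt 𝓘(ℝ, E3 × ℝ) u₀ u)) ≠ 0 := by
  set v := chartDSymm u₀ (extChartAt 𝓘(ℝ, E3 × ℝ) u₀ u)
      (u₀.model.spray (extChartAt 𝓘(ℝ, E3 × ℝ) u₀ u)) with hv
  have e : dChart u₀ u v = u₀.model.spray (extChartAt 𝓘(ℝ, E3 × ℝ) u₀ u) :=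
    chartD_chartDSymm' hu _
  have e1 : chartD u₀.pt u.pt (mfd (PC.pt : PC g → M) u v) =
      u₀.model.xi (extChartAt 𝓘(ℝ, E3 × ℝ) u₀ u) := by
    rw [chartD_mfd_pt hu, e]
    rfl
  rw [← e, gauge_dChart hu]
  intro h
  have h0 : g.form u.pt (mfd (PC.pt : PC g → M) u v) (mfd (PC.pt : PC g → M) u v) = 0 := by
    rw [← chartMetric_chartD g (pt_mem hu), e1]
    exact FramedMetric.G_xi_xi (mem_lineDom hu)
  have h1 := lorentz_ne_zero (o.timelike u.pt) h0 h
  rw [h1, map_zero] at e1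
  exact FramedMetric.xi_ne_zero (mem_lineDom hu) e1.symm

omit [T2Space M] [ChartedSpace E3 (NullGeodesic o)] [IsManifold 𝓘(ℝ, E3) ∞ (NullGeodesic o)] in
lemma contDiffAt_gauge (hu : u ∈ (extChartAt 𝓘(ℝ, E3 × ℝ) u₀).source) :
    ContDiffAt ℝ ∞ (gauge o u₀) (extChartAt 𝓘(ℝ, E3 × ℝ) u₀ u) := by
  have hq := mem_lineDom hu
  have h1 : ContDiffAt ℝ ∞ (coordVectorField u₀.pt o.field) (extChartAt 𝓘(ℝ, E3 × ℝ) u₀ u).1 := by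
    refine (contDiffOn_coordVectorField isOpen_univ o.smooth u₀.pt _
      ⟨hq.1, mem_univ _⟩).contDiffAt ?_
    filter_upwards [(isOpen_extChartAt_target (I := 𝓘(ℝ, E3)) u₀.pt).mem_nhds hq.1]
      with y hy using ⟨hy, mem_univ _⟩
  have h2 := ((ContinuousLinearMap.flipₗᵢ ℝ E3 E3 ℝ).contDiff.contDiffAt.comp _
    (FramedMetric.contDiffAt_comp_fst hq u₀.model.smooth_G)).clm_apply
      (h1.comp _ contDiffAt_fst)
  exact h2.clm_comp contDiffAt_const

/-- The differential of `p`, completed by the gauge to an isomorphism, in coordinates. -/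
def gaugedDeriv (p : PC g → NullGeodesic o) (A : NullGeodesic o) (u₀ : PC g) (q : E3 × ℝ) :
    E3 × ℝ →L[ℝ] E3 × ℝ :=
  (fderiv ℝ (projCoord p A u₀) q).prod (gauge o u₀ q)

namespace IsTangentSubmersion

lemma eq_zero_of_gauge (hp : IsTangentSubmersion p) {w : E3 × ℝ} (h : (mfd p u w : E3) = 0)
    (h' : g.form u.pt (mfd (PC.pt : PC g → M) u w) (o.field u.pt) = 0) : w = 0 := by
  have hu : u ∈ (extChartAt 𝓘(ℝ, E3 × ℝ) u).source := mem_extChartAt_source _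
  obtain ⟨r, hr⟩ := (hp.mfd_eq_zero_iff hu w).1 h
  rw [← gauge_dChart hu, hr, map_smul, smul_eq_mul] at h'
  rw [(mul_eq_zero.1 h').resolve_right (gauge_spray_ne_zero hu), zero_smul] at hr
  exact chartD_injective hu (hr.trans (map_zero _).symm)

lemma gaugedDeriv_dChart (hp : IsTangentSubmersion p)
    (hu : u ∈ (extChartAt 𝓘(ℝ, E3 × ℝ) u₀).source) (hA : p u = A) (w : E3 × ℝ) :
    gaugedDeriv p A u₀ (extChartAt 𝓘(ℝ, E3 × ℝ) u₀ u) (dChart u₀ u w) =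
      ((mfd p u w : E3), g.form u.pt (mfd (PC.pt : PC g → M) u w) (o.field u.pt)) :=
  Prod.ext (hp.fderiv_projCoord_self hu hA w) (gauge_dChart hu w)

lemma gaugedDeriv_injective (hp : IsTangentSubmersion p)
    (hu : u ∈ (extChartAt 𝓘(ℝ, E3 × ℝ) u₀).source) (hA : p u = A) :
    Function.Injective (gaugedDeriv p A u₀ (extChartAt 𝓘(ℝ, E3 × ℝ) u₀ u)) := by
  rw [injective_iff_map_eq_zero]
  intro w hw
  have e : dChart u₀ u (chartDSymm u₀ (extChartAt 𝓘(ℝ, E3 × ℝ) u₀ u) w) = w :=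
    chartD_chartDSymm' hu w
  rw [← e, hp.gaugedDeriv_dChart hu hA] at hw
  rw [← e, hp.eq_zero_of_gauge (congrArg Prod.fst hw) (congrArg Prod.snd hw), map_zero]

lemma gaugedDeriv_isInvertible (hp : IsTangentSubmersion p)
    (hu : u ∈ (extChartAt 𝓘(ℝ, E3 × ℝ) u₀).source) (hA : p u = A) :
    (gaugedDeriv p A u₀ (extChartAt 𝓘(ℝ, E3 × ℝ) u₀ u)).IsInvertible :=
  ⟨(LinearEquiv.ofInjectiveEndo (gaugedDeriv p A u₀ (extChartAt 𝓘(ℝ, E3 × ℝ) u₀ u)).toLinearMap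
    (hp.gaugedDeriv_injective hu hA)).toContinuousLinearEquiv, by ext <;> rfl⟩

lemma contDiffAt_gaugedDeriv (hp : IsTangentSubmersion p)
    (hu : u ∈ (extChartAt 𝓘(ℝ, E3 × ℝ) u₀).source) (hA : p u = A) :
    ContDiffAt ℝ ∞ (gaugedDeriv p A u₀) (extChartAt 𝓘(ℝ, E3 × ℝ) u₀ u) := by
  have hA' : p u ∈ (extChartAt 𝓘(ℝ, E3) A).source := by rw [hA]; exact mem_extChartAt_source _
  exact (ContinuousLinearMap.prodₗᵢ (𝕜 := ℝ) (E := E3 × ℝ) (F := E3) (G := ℝ) ℝ).contDiff.contDiffAt.comp _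
    ((contDiffAt_fderiv (hp.contDiffAt_projCoord hu hA')).prodMk (contDiffAt_gauge hu))

/-- A tangent vector of the space of null geodesics lifts to a unique vector in the gauge. -/
lemma exists_gauged (hp : IsTangentSubmersion p) (u : PC g) (ζ : E3) : ∃ Z : E3 × ℝ,
    (mfd p u Z : E3) = ζ ∧ g.form u.pt (mfd (PC.pt : PC g → M) u Z) (o.field u.pt) = 0 := by
  have hu : u ∈ (extChartAt 𝓘(ℝ, E3 × ℝ) u).source := mem_extChartAt_source _
  have hs := (hp.gaugedDeriv_isInvertible hu rfl).surjective
  obtain ⟨w, hw⟩ := hs (ζ, 0)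
  have e : dChart u u (chartDSymm u (extChartAt 𝓘(ℝ, E3 × ℝ) u u) w) = w :=
    chartD_chartDSymm' hu w
  rw [← e, hp.gaugedDeriv_dChart hu rfl] at hw
  exact ⟨_, congrArg Prod.fst hw, congrArg Prod.snd hw⟩

end IsTangentSubmersion

end Submersion

lemma FramedMetric.contDiffAt_coeff_comp {E : Type*} [NormedAddCommGroup E] [NormedSpace ℝ E]
    {N : FramedMetric E} {q : ℝ → E × ℝ} {w : ℝ → E} {s : ℝ} (hd : q s ∈ N.lineDom)
    (hq : ContDiffAt ℝ ∞ q s) (hw : ContDiffAt ℝ ∞ w s) :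
    ContDiffAt ℝ ∞ (fun s => N.coeff (q s).1 (w s)) s := by
  have hG := ((contDiffAt_comp_fst hd N.smooth_G).comp s hq).clm_apply hw
  exact ((hG.clm_apply ((contDiffAt_comp_fst hd N.smooth_V).comp s hq)).sub
    (hG.clm_apply ((contDiffAt_comp_fst hd N.smooth_T).comp s hq))).div_const 2

/-- A field `Z` along an integral curve of `h X` that is sent to a constant by the differential
of a first integral `φ` of `X` solves the linearised equation modulo the kernel. -/
lemma fderiv_linearised_eq_zero {F F' : Type*} [NormedAddCommGroup F] [NormedSpace ℝ F]
    [NormedAddCommGroup F'] [NormedSpace ℝ F'] {φ : F → F'} {X : F → F} {q Z : ℝ → F} {h : ℝ → ℝ}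
    {ζ : F'} {s : ℝ} (hφ : ContDiffAt ℝ ∞ φ (q s)) (cZ : ContDiffAt ℝ ∞ Z s) (dq : HasDerivAt q (h s • X (q s)) s)
    (hζ : (fun r => fderiv ℝ φ (q r) (Z r)) =ᶠ[𝓝 s] fun _ => ζ)
    (hX : fderiv ℝ (fderiv ℝ φ) (q s) (Z s) (X (q s)) + fderiv ℝ φ (q s) (fderiv ℝ X (q s) (Z s)) = 0) :
    fderiv ℝ φ (q s) (deriv Z s - h s • fderiv ℝ X (q s) (Z s)) = 0 := by
  have h1 := ((contDiffAt_fderiv hφ).differentiableAt (by simp)).hasFDerivAt.comp_hasDerivAt s dq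
  have h3 := (h1.clm_apply (cZ.differentiableAt (by simp)).hasDerivAt).unique
    ((hasDerivAt_const s ζ).congr_of_eventuallyEq hζ)
  have h5 : fderiv ℝ (fderiv ℝ φ) (q s) (X (q s)) (Z s) =
      fderiv ℝ (fderiv ℝ φ) (q s) (Z s) (X (q s)) :=
    (hφ.isSymmSndFDerivAt (by simp; norm_cast)) _ _
  rw [map_smul, smul_apply, h5, Function.comp_apply] at h3
  simp only [map_sub, map_smul]
  linear_combination (norm := module) h3 - (h s) • hX

/-! ### Gauged lifts of tangent vectors solve the linearised spray equation. -/

section Submersion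

variable {M : Type*} [TopologicalSpace M] [ChartedSpace E3 M] [IsManifold 𝓘(ℝ, E3) ∞ M] [T2Space M]
  {g : LorentzMetric M} {o : TimeOrientation g} [ChartedSpace E3 (NullGeodesic o)]
  [IsManifold 𝓘(ℝ, E3) ∞ (NullGeodesic o)] {p : PC g → NullGeodesic o} {A : NullGeodesic o}
  {u₀ u : PC g} {γ : ℝ → M} {I : Set ℝ} {c : ℝ → PC g} {ζ : E3} {s t : ℝ}

open PC

namespace IsTangentSubmersion

lemma eq_smul_spray (hp : IsTangentSubmersion p)
    (hu : u ∈ (extChartAt 𝓘(ℝ, E3 × ℝ) u₀).source) (hA : p u = A) {w : E3 × ℝ}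
    (h : fderiv ℝ (projCoord p A u₀) (extChartAt 𝓘(ℝ, E3 × ℝ) u₀ u) w = 0) :
    w = u₀.model.coeff (extChartAt 𝓘(ℝ, E3 × ℝ) u₀ u).1 w.1 •
      u₀.model.spray (extChartAt 𝓘(ℝ, E3 × ℝ) u₀ u) := by
  have e : dChart u₀ u (chartDSymm u₀ (extChartAt 𝓘(ℝ, E3 × ℝ) u₀ u) w) = w :=
    chartD_chartDSymm' hu w
  rw [← e, hp.fderiv_projCoord_self hu hA] at h
  obtain ⟨r, hr⟩ := (hp.mfd_eq_zero_iff hu _).1 h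
  rw [e] at hr
  rw [hr]
  congr 1
  show r = u₀.model.coeff _ (r • u₀.model.xi _)
  rw [FramedMetric.coeff_smul, FramedMetric.coeff_xi (mem_lineDom hu), mul_one]

/-- The derivative in the direction `w` of the identity that the differential of p kills the spray.
-/
lemma fderiv_fderiv_projCoord (hp : IsTangentSubmersion p)
    (hu : u ∈ (extChartAt 𝓘(ℝ, E3 × ℝ) u₀).source) (hA : p u = A) (w : E3 × ℝ) :
    fderiv ℝ (fderiv ℝ (projCoord p A u₀)) (extChartAt 𝓘(ℝ, E3 × ℝ) u₀ u) w
        (u₀.model.spray (extChartAt 𝓘(ℝ, E3 × ℝ) u₀ u)) +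
      fderiv ℝ (projCoord p A u₀) (extChartAt 𝓘(ℝ, E3 × ℝ) u₀ u)
        (fderiv ℝ u₀.model.spray (extChartAt 𝓘(ℝ, E3 × ℝ) u₀ u) w) = 0 := by
  have hA' : p u ∈ (extChartAt 𝓘(ℝ, E3) A).source := by rw [hA]; exact mem_extChartAt_source _
  have hy := (extChartAt 𝓘(ℝ, E3 × ℝ) u₀).map_source hu
  have h1 := ((contDiffAt_fderiv (hp.contDiffAt_projCoord hu hA')).differentiableAt
    (by simp)).hasFDerivAt
  have h2 := ((FramedMetric.contDiffAt_spray (mem_lineDom hu)).differentiableAt (by simp)).hasFDerivAt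
  have hc : ContinuousAt (fun z => p ((extChartAt 𝓘(ℝ, E3 × ℝ) u₀).symm z))
      (extChartAt 𝓘(ℝ, E3 × ℝ) u₀ u) :=
    hp.submersion.1.continuous.continuousAt.comp (contMDiffAt_extChartAt_symm hy).continuousAt
  have h3 : (fun z => fderiv ℝ (projCoord p A u₀) z (u₀.model.spray z)) =ᶠ[𝓝
      (extChartAt 𝓘(ℝ, E3 × ℝ) u₀ u)] fun _ => 0 := by
    have hn : (extChartAt 𝓘(ℝ, E3) A).source ∈
        𝓝 (p ((extChartAt 𝓘(ℝ, E3 × ℝ) u₀).symm (extChartAt 𝓘(ℝ, E3 × ℝ) u₀ u))) := by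
      rw [(extChartAt 𝓘(ℝ, E3 × ℝ) u₀).left_inv hu]
      exact (isOpen_extChartAt_source A).mem_nhds hA'
    filter_upwards [(isOpen_extChartAt_target u₀).mem_nhds hy, hc.eventually hn] with z hz hz'
    have := hp.fderiv_projCoord_spray ((extChartAt 𝓘(ℝ, E3 × ℝ) u₀).map_target hz) hz'
    rwa [(extChartAt 𝓘(ℝ, E3 × ℝ) u₀).right_inv hz] at this
  have h4 := (h1.clm_apply h2).unique ((hasFDerivAt_const (0 : E3) _).congr_of_eventuallyEq h3)
  have h5 := congrArg (fun L : E3 × ℝ →L[ℝ] E3 => L w) h4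
  simp only [add_apply, ContinuousLinearMap.comp_apply, ContinuousLinearMap.flip_apply,
    zero_apply] at h5
  rw [add_comm]
  exact h5

/-- The gauged lift of a tangent vector of the space of null geodesics along a curve. -/
def gaugedField (hp : IsTangentSubmersion p) (c : ℝ → PC g) (ζ : E3) (t : ℝ) : E3 × ℝ :=
  (hp.exists_gauged (c t) ζ).choose

lemma mfd_gaugedField (hp : IsTangentSubmersion p) (c : ℝ → PC g) (ζ : E3) (t : ℝ) :
    (mfd p (c t) (hp.gaugedField c ζ t) : E3) = ζ := (hp.exists_gauged (c t) ζ).choose_spec.1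

lemma form_gaugedField (hp : IsTangentSubmersion p) (c : ℝ → PC g) (ζ : E3) (t : ℝ) :
    g.form (c t).pt (mfd (PC.pt : PC g → M) (c t) (hp.gaugedField c ζ t)) (o.field (c t).pt) = 0 :=
  (hp.exists_gauged (c t) ζ).choose_spec.2

/-- The gauged lift is chosen separately at each parameter. Uniqueness identifies it with the
inverse of a smooth family of isomorphisms applied to a constant vector, whence its smoothness. -/
lemma dChart_gaugedField (hp : IsTangentSubmersion p)
    (hu : c t ∈ (extChartAt 𝓘(ℝ, E3 × ℝ) u₀).source) (hA : p (c t) = A) :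
    dChart u₀ (c t) (hp.gaugedField c ζ t) =
      (gaugedDeriv p A u₀ (extChartAt 𝓘(ℝ, E3 × ℝ) u₀ (c t))).inverse (ζ, 0) := by
  have h := hp.gaugedDeriv_dChart hu hA (hp.gaugedField c ζ t)
  rw [hp.mfd_gaugedField, hp.form_gaugedField] at h
  rw [← h, (hp.gaugedDeriv_isInvertible hu hA).inverse_apply_self]

/-- The gauged lift solves the linearised equation of the spray. -/
lemma isSprayField (hp : IsTangentSubmersion p) {hγ : IsNullGeodesic o γ I} (hc : IsLift hγ c)
    (hA : ∀ s ∈ I, p (c s) = A) (ht : t ∈ I) (hu : c t ∈ (extChartAt 𝓘(ℝ, E3 × ℝ) u₀).source) :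
    ∃ μ : ℝ → ℝ, u₀.model.IsSprayField (fun s => extChartAt 𝓘(ℝ, E3 × ℝ) u₀ (c s))
      (fun s => dChart u₀ (c s) (hp.gaugedField c ζ s)) (scale u₀ γ) μ t := by
  set q := fun s => extChartAt 𝓘(ℝ, E3 × ℝ) u₀ (c s) with hq
  set Z := fun s => dChart u₀ (c s) (hp.gaugedField c ζ s) with hZ
  have ev := hc.eventually_mem ht hu
  have cq : ∀ s ∈ I, c s ∈ (extChartAt 𝓘(ℝ, E3 × ℝ) u₀).source → ContDiffAt ℝ ∞ q s :=
    fun s hs hs' => contDiffAt_coord_curve (hc.contMDiffAt hs) hs'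
  have cZ : ∀ s ∈ I, c s ∈ (extChartAt 𝓘(ℝ, E3 × ℝ) u₀).source → ContDiffAt ℝ ∞ Z s := by
    intro s hs hs'
    have h1 : ContDiffAt ℝ ∞ (fun r => (gaugedDeriv p A u₀ (q r)).inverse ((ζ, 0) : E3 × ℝ)) s := by
      refine ContDiffAt.clm_apply ?_ contDiffAt_const
      exact ((hp.gaugedDeriv_isInvertible hs' (hA s hs)).contDiffAt_map_inverse).comp s
        ((hp.contDiffAt_gaugedDeriv hs' (hA s hs)).comp s (cq s hs hs'))
    refine h1.congr_of_eventuallyEq ?_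
    filter_upwards [hc.eventually_mem hs hs'] with r hr
    exact hp.dChart_gaugedField hr.2 (hA r hr.1)
  have cs : ∀ s ∈ I, c s ∈ (extChartAt 𝓘(ℝ, E3 × ℝ) u₀).source → ContDiffAt ℝ ∞ (scale u₀ γ) s := by
    intro s hs hs'
    obtain ⟨h1, h2, -⟩ := (hc.mem_source_iff hs).1 hs'
    exact (contDiffAt_scale hγ hs h1 h2).1
  -- The defect in the linearised equation. It lies in the kernel of the differential of p, because
  -- p sends the field to the constant `ζ`; so it is a multiple of the spray, and `coeff` exhibits
  -- the factor `μ` as a smooth function.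
  set w := fun s => deriv Z s - scale u₀ γ s • fderiv ℝ u₀.model.spray (q s) (Z s) with hw
  set μ := fun s => u₀.model.coeff (q s).1 (w s).1 with hμ
  have cμ : ∀ s ∈ I, c s ∈ (extChartAt 𝓘(ℝ, E3 × ℝ) u₀).source → ContDiffAt ℝ ∞ μ s := by
    intro s hs hs'
    have hd := mem_lineDom hs'
    have hqs := cq s hs hs'
    have cw : ContDiffAt ℝ ∞ (fun s => (w s).1) s :=
      contDiffAt_fst.comp s ((contDiffAt_deriv (cZ s hs hs')).sub ((cs s hs hs').smul
        (((contDiffAt_fderiv (FramedMetric.contDiffAt_spray hd)).comp s hqs).clm_apply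
          (cZ s hs hs'))))
    exact FramedMetric.contDiffAt_coeff_comp hd hqs cw
  have dZ : ∀ s ∈ I, c s ∈ (extChartAt 𝓘(ℝ, E3 × ℝ) u₀).source → HasDerivAt Z
      (scale u₀ γ s • fderiv ℝ u₀.model.spray (q s) (Z s) + μ s • u₀.model.spray (q s)) s := by
    intro s hs hs'
    have hA' : p (c s) ∈ (extChartAt 𝓘(ℝ, E3) A).source := by
      rw [hA s hs]; exact mem_extChartAt_source _
    have hφ := hp.contDiffAt_projCoord hs' hA'
    have h2 : (fun r => fderiv ℝ (projCoord p A u₀) (q r) (Z r)) =ᶠ[𝓝 s] fun _ => ζ := by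
      filter_upwards [hc.eventually_mem hs hs'] with r hr
      exact (hp.fderiv_projCoord_self hr.2 (hA r hr.1) _).trans (hp.mfd_gaugedField c ζ r)
    have h6 : fderiv ℝ (projCoord p A u₀) (q s) (w s) = 0 :=
      fderiv_linearised_eq_zero hφ (cZ s hs hs') (hc.hasDerivAt hs hs').1 h2
        (hp.fderiv_fderiv_projCoord hs' (hA s hs) (Z s))
    have h7 := hp.eq_smul_spray hs' (hA s hs) h6
    have h8 : deriv Z s = scale u₀ γ s • fderiv ℝ u₀.model.spray (q s) (Z s) +
        μ s • u₀.model.spray (q s) := by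
      rw [add_comm]
      exact sub_eq_iff_eq_add.1 h7
    rw [← h8]
    exact ((cZ s hs hs').differentiableAt (by simp)).hasDerivAt
  exact ⟨μ, mem_lineDom hu, ev.mono fun s hs => cZ s hs.1 hs.2, ev.mono fun s hs => cs s hs.1 hs.2,
    ev.mono fun s hs => cμ s hs.1 hs.2, ev.mono fun s hs => (hc.hasDerivAt hs.1 hs.2).1,
    ev.mono fun s hs => (hc.hasDerivAt hs.1 hs.2).2, ev.mono fun s hs => dZ s hs.1 hs.2⟩

end IsTangentSubmersion

end Submersion

/-! ### Correction of a field by a multiple of the velocity to a Jacobi field. -/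

section Primitive

variable {β : ℝ → ℝ} {I : Set ℝ} {a : ℝ}

/-- A smooth function on an open interval has a smooth primitive. -/
lemma exists_primitive (hI : IsOpen I) (hc : I.OrdConnected) (hβ : ContDiffOn ℝ ∞ β I) (ha : a ∈ I) :
    ∃ F : ℝ → ℝ, ContDiffOn ℝ ∞ F I ∧ (∀ t ∈ I, HasDerivAt F (β t) t) ∧ F a = 0 := by
  have hF : ∀ t ∈ I, HasDerivAt (fun t => ∫ x in a..t, β x) (β t) t := by
    intro t ht
    refine intervalIntegral.integral_hasDerivAt_right
      (hβ.continuousOn.mono (hc.uIcc_subset ha ht)).intervalIntegrable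
      (hβ.continuousOn.stronglyMeasurableAtFilter hI t ht)
      (hβ.continuousOn.continuousAt (hI.mem_nhds ht))
  refine ⟨fun t => ∫ x in a..t, β x, ?_, hF, intervalIntegral.integral_same⟩
  rw [contDiffOn_infty_iff_deriv_of_isOpen hI]
  exact ⟨fun t ht => (hF t ht).differentiableAt.differentiableWithinAt,
    hβ.congr fun t ht => (hF t ht).deriv⟩

/-- A smooth function on an open interval has a second primitive with prescribed zeros. -/
lemma exists_second_primitive (hI : IsOpen I) (hc : I.OrdConnected) (hβ : ContDiffOn ℝ ∞ β I)
    (ha : a ∈ I) (b : ℝ) : ∃ H : ℝ → ℝ, ContDiffOn ℝ ∞ H I ∧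
      (∀ t ∈ I, deriv (deriv H) t = β t) ∧ H a = 0 ∧ H b = 0 := by
  obtain ⟨F, cF, dF, -⟩ := exists_primitive hI hc hβ ha
  obtain ⟨H, cH, dH, hHa⟩ := exists_primitive hI hc cF ha
  -- Subtracting a multiple of `t - a` leaves the second derivative and the zero at `a` unchanged
  -- and creates the zero at `b`. For `b = a` the quotient is 0 by convention and the two conditions
  -- coincide.
  have d1 : ∀ t ∈ I, HasDerivAt (fun t => H t - (t - a) * (H b / (b - a))) (F t - H b / (b - a)) t := by
    intro t ht
    have := (dH t ht).sub (((hasDerivAt_id t).sub_const a).mul_const (H b / (b - a)))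
    rw [one_mul] at this
    exact this
  refine ⟨fun t => H t - (t - a) * (H b / (b - a)), ?_, ?_, ?_, ?_⟩
  · exact cH.sub ((contDiffOn_id.sub contDiffOn_const).mul contDiffOn_const)
  · intro t ht
    have e : deriv (fun t => H t - (t - a) * (H b / (b - a))) =ᶠ[𝓝 t] fun t => F t - H b / (b - a) := by
      filter_upwards [hI.mem_nhds ht] with s hs using (d1 s hs).deriv
    rw [e.deriv_eq, ((dF t ht).sub_const _).deriv]
  · simp [hHa]
  · rcases eq_or_ne b a with rfl | h
    · simp [hHa]
    · field_simp [sub_ne_zero.2 h]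
      simp

end Primitive

section JacobiGauge

variable {M : Type*} [TopologicalSpace M] [ChartedSpace E3 M] [IsManifold 𝓘(ℝ, E3) ∞ M]
  {g : LorentzMetric M} {γ : ℝ → M} {I : Set ℝ} {a : ℝ}

lemma isJacobiField_of_chart (hγ : IsGeodesic g γ I) {J : ∀ t, TangentSpace 𝓘(ℝ, E3) (γ t)}
    (h : ∀ t ∈ I, ∃ x₀, γ t ∈ (extChartAt 𝓘(ℝ, E3) x₀).source ∧
      ContDiffAt ℝ ∞ (coordField x₀ γ J) t ∧
      jacobiOp (chartGamma g x₀) (coordCurve x₀ γ) (coordField x₀ γ J) t = 0) :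
    IsJacobiField g γ I J := by
  intro x₁ t ht hx₁
  rw [← extChartAt_source 𝓘(ℝ, E3)] at hx₁
  obtain ⟨x₀, h0, hJ, h1⟩ := h t ht
  have hJ₁ := contDiffAt_coordField_chart (hγ.contMDiffAt ht) h0 hx₁ hJ
  refine ⟨hJ₁, ?_⟩
  refine (jacobi_eq_jacobiOp (hγ.contMDiffAt ht) hx₁ hJ₁ (hγ.geodOp_eq_zero ht hx₁)).trans ?_
  rw [jacobiOp_chart (hγ.contMDiffAt ht) h0 hx₁ hJ (hγ.geodOp_eq_zero ht h0), h1, map_zero]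

/-- The field along a curve given by vectors of the model space. -/
abbrev alongCurve (γ : ℝ → M) (J : ℝ → E3) : ∀ t, TangentSpace 𝓘(ℝ, E3) (γ t) := J

/-- A field that is a Jacobi field modulo the velocity becomes one after subtracting a multiple of
the velocity that vanishes at two given points. -/
lemma exists_isJacobiField_sub (hγ : IsGeodesic g γ I) (hv : ∀ t ∈ I, (vel γ t : E3) ≠ 0) {J : ℝ → E3}
    (h : ∀ t ∈ I, ∃ (x₀ : M) (β : ℝ → ℝ), γ t ∈ (extChartAt 𝓘(ℝ, E3) x₀).source ∧
      ContDiffAt ℝ ∞ β t ∧ ∀ᶠ s in 𝓝 t, ContDiffAt ℝ ∞ (coordField x₀ γ (alongCurve γ J)) s ∧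
        jacobiOp (chartGamma g x₀) (coordCurve x₀ γ) (coordField x₀ γ (alongCurve γ J)) s =
          β s • deriv (coordCurve x₀ γ) s) (ha : a ∈ I) (b : ℝ) :
    ∃ H : ℝ → ℝ, H a = 0 ∧ H b = 0 ∧
      IsJacobiField g γ I (alongCurve γ fun s => J s - H s • (vel γ s : E3)) := by
  have : Nonempty M := ⟨γ a⟩
  choose! x β₀ hx cβ hJ using h
  have rate : ∀ t ∈ I, ∀ x₁, γ t ∈ (extChartAt 𝓘(ℝ, E3) x₁).source → ∀ {x₀ : M} {r : ℝ},
      γ t ∈ (extChartAt 𝓘(ℝ, E3) x₀).source → ContDiffAt ℝ ∞ (coordField x₀ γ (alongCurve γ J)) t →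
      jacobiOp (chartGamma g x₀) (coordCurve x₀ γ) (coordField x₀ γ (alongCurve γ J)) t =
          r • deriv (coordCurve x₀ γ) t →
      jacobiOp (chartGamma g x₁) (coordCurve x₁ γ) (coordField x₁ γ (alongCurve γ J)) t =
          r • chartD x₁ (γ t) (vel γ t) := by
    intro t ht x₁ h1 x₀ r h0 cJ e
    rw [jacobiOp_chart (hγ.contMDiffAt ht) h0 h1 cJ (hγ.geodOp_eq_zero ht h0), e, map_smul,
      deriv_coordCurve (hγ.contMDiffAt ht) h0]
    congr 1
    exact fderiv_transition h0 h1 _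
  set β : ℝ → ℝ := fun t => β₀ t t with hβ
  -- The functions `β₀ t` belong to different charts. Both the Jacobi operator and the velocity
  -- transform by the differential of the change of charts, and the velocity is nonzero; so the
  -- factor does not depend on the chart and the local functions glue.
  have hev : ∀ t ∈ I, β =ᶠ[𝓝 t] β₀ t := by
    intro t ht
    filter_upwards [hJ t ht, hγ.isOpen.mem_nhds ht, eventually_mem_chart (hγ.contMDiffAt ht) (hx t ht)]
      with s hs hsI hsx
    have e1 := rate s hsI (x s) (hx s hsI) hsx hs.1 hs.2
    have e2 := rate s hsI (x s) (hx s hsI) (hx s hsI) (hJ s hsI).self_of_nhds.1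
      (hJ s hsI).self_of_nhds.2
    have hne : chartD (x s) (γ s) (vel γ s : E3) ≠ 0 := fun h0 =>
      hv s hsI ((chartD_eq_zero_iff (hx s hsI) _).1 h0)
    exact smul_left_injective ℝ hne (e2.symm.trans e1)
  have cβ' : ContDiffOn ℝ ∞ β I := fun t ht =>
    ((cβ t ht).congr_of_eventuallyEq (hev t ht)).contDiffWithinAt
  -- Subtracting `H γ'` changes the factor `β` into `β - H''`, which vanishes for a second primitive
  -- of `β`.
  obtain ⟨H, cH, hH, hHa, hHb⟩ := exists_second_primitive hγ.isOpen
    hγ.isConnected.isPreconnected.ordConnected cβ' ha b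
  refine ⟨H, hHa, hHb, isJacobiField_of_chart hγ fun t ht => ⟨x t, hx t ht, ?_⟩⟩
  have hγt := hγ.contMDiffAt ht
  have hy := contDiffAt_coordCurve hγt (hx t ht)
  have cHt := (cH t ht).contDiffAt (hγ.isOpen.mem_nhds ht)
  have hK : coordField (x t) γ (alongCurve γ fun s => J s - H s • (vel γ s : E3)) =ᶠ[𝓝 t]
      fun s => coordField (x t) γ (alongCurve γ J) s - H s • deriv (coordCurve (x t) γ) s := by
    filter_upwards [hγ.isOpen.mem_nhds ht, eventually_mem_chart hγt (hx t ht)] with s hsI hsx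
    rw [deriv_coordCurve (hγ.contMDiffAt hsI) hsx]
    show chartD (x t) (γ s) (J s - H s • (vel γ s : E3)) = chartD (x t) (γ s) (J s) - _
    rw [map_sub, map_smul]
  have cJ := (hJ t ht).self_of_nhds.1
  refine ⟨(cJ.sub (cHt.smul (contDiffAt_deriv hy))).congr_of_eventuallyEq hK, ?_⟩
  have hxt := (extChartAt 𝓘(ℝ, E3) (x t)).map_source (hx t ht)
  rw [jacobiOp_congr Filter.EventuallyEq.rfl hK, jacobiOp_sub_smul_velocity hy cJ cHt
    ((contDiffAt_chartGamma g (x t) hxt).differentiableAt (by simp))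
    (fun u v => chartGamma_symm g (x t) hxt u v)
    (by
      filter_upwards [hγ.isOpen.mem_nhds ht, eventually_mem_chart hγt (hx t ht)] with s hsI hsx
        using hγ.geodOp_eq_zero hsI hsx), (hJ t ht).self_of_nhds.2, hH t ht, sub_self]

end JacobiGauge

/-! ### Variation fields, tangent spaces of skies, and the image of [D, D]. -/

section Submersion

variable {M : Type*} [TopologicalSpace M] [ChartedSpace E3 M] [IsManifold 𝓘(ℝ, E3) ∞ M] [T2Space M]
  {g : LorentzMetric M} {o : TimeOrientation g} [ChartedSpace E3 (NullGeodesic o)]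
  [IsManifold 𝓘(ℝ, E3) ∞ (NullGeodesic o)] {p : PC g → NullGeodesic o} {A : NullGeodesic o}
  {u₀ u v : PC g} {γ : ℝ → M} {I : Set ℝ} {c : ℝ → PC g} {ζ : E3} {a b s t : ℝ}

open PC

/-- The image of `[D, D] u` under the differential of `p`. -/
def pushE (p : PC g → NullGeodesic o) (u : PC g) : Submodule ℝ E3 :=
  u.eSub.map (mfd p u : E3 × ℝ →L[ℝ] E3).toLinearMap

/-- The tangent space of the sky of the base point of `u`. -/
def skyAt (p : PC g → NullGeodesic o) (u : PC g) : Submodule ℝ E3 :=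
  (LinearMap.ker (mfd (PC.pt : PC g → M) u : E3 × ℝ →L[ℝ] E3).toLinearMap).map
    (mfd p u : E3 × ℝ →L[ℝ] E3).toLinearMap

omit [T2Space M] [IsManifold 𝓘(ℝ, E3) ∞ (NullGeodesic o)] in
lemma mem_skyAt_iff : ζ ∈ skyAt p u ↔
    ∃ w : E3 × ℝ, (mfd (PC.pt : PC g → M) u w : E3) = 0 ∧ (mfd p u w : E3) = ζ := Iff.rfl

omit [T2Space M] [IsManifold 𝓘(ℝ, E3) ∞ (NullGeodesic o)] in
lemma skyAt_le_pushE (p : PC g → NullGeodesic o) (u : PC g) : skyAt p u ≤ pushE p u := by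
  rintro ζ hζ
  obtain ⟨w, hw, rfl⟩ := mem_skyAt_iff.1 hζ
  have hu : u ∈ (extChartAt 𝓘(ℝ, E3 × ℝ) u).source := mem_extChartAt_source _
  refine ⟨w, (mem_eSub_iff hu w).2 ?_, rfl⟩
  rw [← chartD_mfd_pt hu, hw, map_zero, map_zero]
  rfl

namespace IsTangentSubmersion

/-- The variation field in `M` defined by a tangent vector of the space of null geodesics. -/
def variation (hp : IsTangentSubmersion p) (c : ℝ → PC g) (ζ : E3) (s : ℝ) : E3 :=
  mfd (PC.pt : PC g → M) (c s) (hp.gaugedField c ζ s)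

lemma chartD_variation (hp : IsTangentSubmersion p) {hγ : IsNullGeodesic o γ I} (hc : IsLift hγ c)
    (ht : t ∈ I) (hu : c t ∈ (extChartAt 𝓘(ℝ, E3 × ℝ) u₀).source) :
    chartD u₀.pt (γ t) (hp.variation c ζ t) = (dChart u₀ (c t) (hp.gaugedField c ζ t)).1 := by
  rw [← hc.pt ht]
  exact chartD_mfd_pt hu _

/-- A vector tangent to the sky has a vertical preimage. It satisfies the gauge condition trivially,
so it is the gauged lift. -/
lemma variation_eq_zero_of_mem_skyAt (hp : IsTangentSubmersion p) (h : ζ ∈ skyAt p (c t)) :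
    hp.variation c ζ t = 0 := by
  obtain ⟨w, hw, hwζ⟩ := mem_skyAt_iff.1 h
  have e : w - hp.gaugedField c ζ t = 0 := by
    refine hp.eq_zero_of_gauge (u := c t) ?_ ?_
    · rw [map_sub, hwζ, hp.mfd_gaugedField, sub_self]
    · have key : ∀ {x : M} {w X : E3}, g.form x w X = 0 → g.form x (0 - w) X = 0 := by
        intro x w X h
        rw [zero_sub, map_neg, neg_apply, h, neg_zero]
      rw [map_sub, hw]
      exact key (hp.form_gaugedField c ζ t)
  unfold variation
  rw [← sub_eq_zero.1 e, hw]

/-- A tangent vector of two skies through a null geodesic gives a Jacobi field vanishing at the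
corresponding points. -/
lemma conjugate (hp : IsTangentSubmersion p) {hγ : IsNullGeodesic o γ I} (hc : IsLift hγ c)
    (hA : ∀ s ∈ I, p (c s) = A) (ha : a ∈ I) (h0 : ζ ≠ 0)
    (hζa : ζ ∈ skyAt p (c a)) (hζb : ζ ∈ skyAt p (c b)) : Conjugate g γ I a b := by
  have hloc : ∀ t ∈ I, ∃ (x₀ : M) (β : ℝ → ℝ), γ t ∈ (extChartAt 𝓘(ℝ, E3) x₀).source ∧
      ContDiffAt ℝ ∞ β t ∧ ∀ᶠ s in 𝓝 t,
        ContDiffAt ℝ ∞ (coordField x₀ γ (alongCurve γ (hp.variation c ζ))) s ∧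
        jacobiOp (chartGamma g x₀) (coordCurve x₀ γ)
          (coordField x₀ γ (alongCurve γ (hp.variation c ζ))) s = β s • deriv (coordCurve x₀ γ) s := by
    intro t ht
    set u₀ := c t with hu₀
    have hu : c t ∈ (extChartAt 𝓘(ℝ, E3 × ℝ) u₀).source := mem_extChartAt_source _
    obtain ⟨hx, h2, h3⟩ := (hc.mem_source_iff ht).1 hu
    obtain ⟨μ, H⟩ := hp.isSprayField (ζ := ζ) hc hA ht hu
    -- The factor of `xi` from `jacobiOp_fst`, divided by `scale` because the velocity is `scale`
    -- times `xi`.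
    refine ⟨u₀.pt, fun s => (scale u₀ γ s ^ 2 * fderiv ℝ u₀.model.nonaffinity
      (extChartAt 𝓘(ℝ, E3 × ℝ) u₀ (c s)) (dChart u₀ (c s) (hp.gaugedField c ζ s)) +
      2 * scale u₀ γ s * μ s * u₀.model.nonaffinity (extChartAt 𝓘(ℝ, E3 × ℝ) u₀ (c s)) +
      deriv μ s) / scale u₀ γ s, hx, ?_, ?_⟩
    · have cq : ContDiffAt ℝ ∞ (fun s => extChartAt 𝓘(ℝ, E3 × ℝ) u₀ (c s)) t :=
        contDiffAt_coord_curve (hc.contMDiffAt ht) hu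
      have cs := H.scale_smooth.self_of_nhds
      have cμ := H.rate_smooth.self_of_nhds
      have cν := FramedMetric.contDiffAt_nonaffinity (mem_lineDom hu)
      have cν1 := cν.comp t cq
      have cν2 := ((contDiffAt_fderiv cν).comp t cq).clm_apply H.field_smooth.self_of_nhds
      exact ((((cs.pow 2).mul cν2).add (((contDiffAt_const.mul cs).mul cμ).mul cν1)).add
        (contDiffAt_deriv cμ)).div cs h3
    · have hmem := hc.eventually_mem ht hu
      have hJ : ∀ s ∈ I, c s ∈ (extChartAt 𝓘(ℝ, E3 × ℝ) u₀).source →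
          coordField u₀.pt γ (alongCurve γ (hp.variation c ζ)) =ᶠ[𝓝 s]
            fun s => (dChart u₀ (c s) (hp.gaugedField c ζ s)).1 := by
        intro s hs hs'
        filter_upwards [hc.eventually_mem hs hs'] with r hr using hp.chartD_variation hc hr.1 hr.2
      filter_upwards [hmem, H.eventually] with s hs Hs
      have hs3 := ((hc.mem_source_iff hs.1).1 hs.2).2.2
      refine ⟨(contDiffAt_fst.comp s Hs.field_smooth.self_of_nhds).congr_of_eventuallyEq
        (hJ s hs.1 hs.2), ?_⟩
      rw [jacobiOp_congr (z := fun s => (extChartAt 𝓘(ℝ, E3 × ℝ) u₀ (c s)).1) ?_ (hJ s hs.1 hs.2)]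
      · refine Hs.jacobiOp_fst.trans ?_
        rw [hc.deriv_coordCurve_eq hs.1 hs.2, smul_smul, div_mul_cancel₀ _ hs3]
      · filter_upwards [hc.eventually_mem hs.1 hs.2] with r hr
        rw [hc.extChartAt_eq hr.1 ((hc.mem_source_iff hr.1).1 hr.2).1]
  obtain ⟨H, hHa, hHb, hK⟩ := exists_isJacobiField_sub hγ.toIsGeodesic
    (fun t ht => (hγ.futureNullAt ht).ne_zero) hloc ha b
  have zero : ∀ {t}, H t = 0 → ζ ∈ skyAt p (c t) →
      hp.variation c ζ t - H t • (vel γ t : E3) = 0 := by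
    intro t h1 h2
    rw [hp.variation_eq_zero_of_mem_skyAt h2, h1, zero_smul, sub_zero]
  refine ⟨_, hK, ?_, zero hHa hζa, zero hHb hζb⟩
  by_contra hall
  push Not at hall
  -- The corrected field must not be trivial. If it were, the variation would be `H γ'`; the gauge
  -- condition then gives `H = 0`, so the lift is vertical near `a`, hence zero there, and `ζ = 0`.
  have hJ0 : ∀ s ∈ I, hp.variation c ζ s = 0 := by
    intro s hs
    have e1 : hp.variation c ζ s = H s • (vel γ s : E3) := sub_eq_zero.1 (hall s hs)
    have e2 : g.form (γ s) (hp.variation c ζ s) (o.field (γ s)) = 0 := by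
      rw [← hc.pt hs]
      exact hp.form_gaugedField c ζ s
    have key : ∀ {x : M} {v X : E3} {r : ℝ}, g.form x (r • v) X = 0 → r * g.form x v X = 0 := by
      intro x v X r h
      rwa [map_smul, smul_apply, smul_eq_mul] at h
    rw [e1] at e2
    have e3 : H s = 0 := (mul_eq_zero.1 (key e2)).resolve_right (hγ.futureNullAt hs).future.ne
    rw [e1, e3, zero_smul]
  have hu : c a ∈ (extChartAt 𝓘(ℝ, E3 × ℝ) (c a)).source := mem_extChartAt_source _
  obtain ⟨μ, H'⟩ := hp.isSprayField (ζ := ζ) hc hA ha hu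
  have hz : dChart (c a) (c a) (hp.gaugedField c ζ a) = 0 := by
    refine H'.eq_zero_of_vertical ((hc.mem_source_iff ha).1 hu).2.2 ?_
    filter_upwards [hc.eventually_mem ha hu] with r hr
    rw [← hp.chartD_variation hc hr.1 hr.2, hJ0 r hr.1, map_zero]
  rw [dChart, chartD_self] at hz
  have := hp.mfd_gaugedField c ζ a
  rw [hz, map_zero] at this
  exact h0 this.symm

/-- The pairing of a variation field with the velocity is constant. -/
lemma form_variation_const (hp : IsTangentSubmersion p) {hγ : IsNullGeodesic o γ I} (hc : IsLift hγ c)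
    (hA : ∀ s ∈ I, p (c s) = A) (hs : s ∈ I) (ht : t ∈ I) :
    g.form (γ t) (hp.variation c ζ t) (vel γ t) = g.form (γ s) (hp.variation c ζ s) (vel γ s) := by
  have hd : ∀ r ∈ I, HasDerivAt (fun s => g.form (γ s) (hp.variation c ζ s) (vel γ s)) 0 r := by
    intro r hr
    have hu : c r ∈ (extChartAt 𝓘(ℝ, E3 × ℝ) (c r)).source := mem_extChartAt_source _
    obtain ⟨hx, h2, h3⟩ := (hc.mem_source_iff hr).1 hu
    obtain ⟨μ, H⟩ := hp.isSprayField (ζ := ζ) hc hA hr hu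
    have hv := hγ.hasDerivAt_velocity hr hx
    have hJ : (fun s => chartD (c r).pt (γ s) (hp.variation c ζ s)) =ᶠ[𝓝 r]
        fun s => (dChart (c r) (c s) (hp.gaugedField c ζ s)).1 := by
      filter_upwards [hc.eventually_mem hr hu] with s hs using hp.chartD_variation hc hs.1 hs.2
    -- The velocity is parallel, so only the covariant derivative of the variation field
    -- contributes, and that is orthogonal to `xi` by `G_covariant_eq_zero`.
    have key := hasDerivAt_form (g := g) (hγ.contMDiffAt hr) hx
      (H.hasDerivAt_field_fst.congr_of_eventuallyEq hJ) hv
    have e1 : chartD (c r).pt (γ r) (vel γ r) = scale (c r) γ r •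
        (c r).model.xi (extChartAt 𝓘(ℝ, E3 × ℝ) (c r) (c r)) := by
      rw [← deriv_coordCurve (hγ.contMDiffAt hr) hx, hc.deriv_coordCurve_eq hr hu]
    have e2 : coordCurve (c r).pt γ r = (extChartAt 𝓘(ℝ, E3 × ℝ) (c r) (c r)).1 := by
      rw [hc.extChartAt_eq hr hx]
    have hG := H.G_covariant_eq_zero
    rw [hp.chartD_variation hc hr hu, deriv_coordCurve (hγ.contMDiffAt hr) hx, neg_add_cancel, map_zero, add_zero,
      e1, e2, map_smul] at key
    have hz : (c r).model.G (extChartAt 𝓘(ℝ, E3 × ℝ) (c r) (c r)).1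
        ((scale (c r) γ r • fderiv ℝ (c r).model.xi (extChartAt 𝓘(ℝ, E3 × ℝ) (c r) (c r))
          (dChart (c r) (c r) (hp.gaugedField c ζ r)) + μ r • (c r).model.xi
            (extChartAt 𝓘(ℝ, E3 × ℝ) (c r) (c r))) +
          (c r).model.Γ (extChartAt 𝓘(ℝ, E3 × ℝ) (c r) (c r)).1
          (scale (c r) γ r • (c r).model.xi (extChartAt 𝓘(ℝ, E3 × ℝ) (c r) (c r)))
            (dChart (c r) (c r) (hp.gaugedField c ζ r)).1)
          ((c r).model.xi (extChartAt 𝓘(ℝ, E3 × ℝ) (c r) (c r))) = 0 := hG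
    convert key using 1
    rw [smul_eq_mul]
    exact (mul_eq_zero_of_right _ hz).symm
  exact hγ.isOpen.is_const_of_deriv_eq_zero hγ.isConnected.isPreconnected
    (fun r hr => (hd r hr).differentiableAt.differentiableWithinAt)
    (fun r hr => (hd r hr).deriv) ht hs

/-- The kernel of the differential of p is contained in [D, D], so whether `ζ` comes from [D, D] can
be decided on any preimage, in particular on the gauged one. -/
lemma mem_pushE_iff (hp : IsTangentSubmersion p) {hγ : IsNullGeodesic o γ I} (hc : IsLift hγ c)
    (ht : t ∈ I) : ζ ∈ pushE p (c t) ↔ g.form (γ t) (hp.variation c ζ t) (vel γ t) = 0 := by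
  have hu : c t ∈ (extChartAt 𝓘(ℝ, E3 × ℝ) (c t)).source := mem_extChartAt_source _
  obtain ⟨hx, -, h3⟩ := (hc.mem_source_iff ht).1 hu
  have e1 : chartD (c t).pt (γ t) (vel γ t) = scale (c t) γ t •
      (c t).model.xi (extChartAt 𝓘(ℝ, E3 × ℝ) (c t) (c t)) := by
    rw [← deriv_coordCurve (hγ.contMDiffAt ht) hx, hc.deriv_coordCurve_eq ht hu]
  have e2 : extChartAt 𝓘(ℝ, E3) (c t).pt (γ t) = (extChartAt 𝓘(ℝ, E3 × ℝ) (c t) (c t)).1 := by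
    rw [hc.extChartAt_eq ht hx]
    rfl
  have key : g.form (γ t) (hp.variation c ζ t) (vel γ t) = 0 ↔
      hp.gaugedField c ζ t ∈ (c t).eSub := by
    rw [mem_eSub_iff hu, ← chartMetric_chartD g hx, hp.chartD_variation hc ht hu, e1, e2, map_smul,
      smul_eq_mul, mul_eq_zero, or_iff_right h3]
    rfl
  rw [key]
  constructor
  · rintro ⟨w, hw, hwζ⟩
    have hwζ' : (mfd p (c t) w : E3) = ζ := hwζ
    have hw' : w ∈ (c t).eSub := hw
    have h0 : (mfd p (c t) (hp.gaugedField c ζ t - w) : E3) = 0 := by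
      rw [map_sub, hwζ', hp.mfd_gaugedField, sub_self]
    obtain ⟨r, hr⟩ := (hp.mfd_eq_zero_iff hu _).1 h0
    have h1 : hp.gaugedField c ζ t - w ∈ (c t).eSub := by
      rw [mem_eSub_iff hu, hr]
      show (c t).model.G _ (r • (c t).model.xi _) _ = 0
      rw [map_smul, smul_apply, FramedMetric.G_xi_xi (mem_lineDom hu), smul_zero]
    have := add_mem h1 hw'
    rwa [sub_add_cancel] at this
  · exact fun h => ⟨_, h, hp.mfd_gaugedField c ζ t⟩

lemma pushE_lift (hp : IsTangentSubmersion p) {hγ : IsNullGeodesic o γ I} (hc : IsLift hγ c)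
    (hA : ∀ s ∈ I, p (c s) = A) (hs : s ∈ I) (ht : t ∈ I) : pushE p (c s) = pushE p (c t) := by
  ext ζ
  rw [hp.mem_pushE_iff hc hs, hp.mem_pushE_iff hc ht, hp.form_variation_const hc hA hs ht]

omit [IsManifold 𝓘(ℝ, E3) ∞ (NullGeodesic o)] in
lemma apply_lift (hp : IsTangentSubmersion p) (hγ : IsMaximalNullGeodesic o γ I)
    (hA : γ '' I = A.carrier) : ∀ s ∈ I, p (hγ.lift s) = A := fun s hs => by
  rw [hγ.lift_apply hs]
  exact hp.apply_direction hγ hs hA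

/-- The image of `[D, D]` is well defined on the space of null geodesics. -/
lemma pushE_eq (hp : IsTangentSubmersion p) (h : p u = p v) : pushE p u = pushE p v := by
  obtain ⟨γ₁, I₁, h₁, t₁, ht₁, rfl⟩ := exists_maximal_direction o u
  obtain ⟨γ₂, I₂, h₂, t₂, ht₂, rfl⟩ := exists_maximal_direction o v
  have e1 : γ₁ '' I₁ = (p (h₁.direction ht₁)).carrier := by
    rw [hp.apply]; exact (tangentGeodesic_direction h₁ ht₁).symm
  have e2 : γ₂ '' I₂ = (p (h₁.direction ht₁)).carrier := by
    rw [h, hp.apply]; exact (tangentGeodesic_direction h₂ ht₂).symm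
  -- The two geodesics share only their point set; constancy along each lift is combined at a null
  -- line common to both lifts.
  obtain ⟨s₁, hs₁, s₂, hs₂, e⟩ := exists_parallel h₁.toIsNullGeodesic h₂.toIsNullGeodesic
    (e1.trans e2.symm).subset
  have k1 := hp.pushE_lift h₁.isLift_lift (hp.apply_lift h₁ e1) ht₁ hs₁
  have k2 := hp.pushE_lift h₂.isLift_lift (hp.apply_lift h₂ e2) hs₂ ht₂
  rw [h₁.lift_apply ht₁, h₁.lift_apply hs₁] at k1
  rw [h₂.lift_apply ht₂, h₂.lift_apply hs₂] at k2
  rw [k1, e, k2]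

/-- The vertical vector is not a multiple of the spray, whose base part is nonzero; so the
differential of p does not kill it. -/
lemma skyAt_ne_bot (hp : IsTangentSubmersion p) (u : PC g) : skyAt p u ≠ ⊥ := by
  have hu : u ∈ (extChartAt 𝓘(ℝ, E3 × ℝ) u).source := mem_extChartAt_source _
  have e : dChart u u ((0, 1) : E3 × ℝ) = (0, 1) := chartD_self u _
  have h1 : (mfd p u ((0, 1) : E3 × ℝ) : E3) ∈ skyAt p u := by
    refine mem_skyAt_iff.2 ⟨(0, 1), ?_, rfl⟩
    rw [← chartD_eq_zero_iff (pt_mem hu), chartD_mfd_pt hu, e]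
  intro h
  rw [h, Submodule.mem_bot, hp.mfd_eq_zero_iff hu, e] at h1
  obtain ⟨r, hr⟩ := h1
  have hr1 : (0 : E3) = r • u.model.xi (extChartAt 𝓘(ℝ, E3 × ℝ) u u) := congrArg Prod.fst hr
  have hr2 : r = 0 := (smul_eq_zero.1 hr1.symm).resolve_right
    (FramedMetric.xi_ne_zero (mem_lineDom hu))
  rw [hr2, zero_smul] at hr
  exact one_ne_zero (congrArg Prod.snd hr)

/-- Since [D, D] contains the kernel of the differential of p, a full image would make [D, D] the
whole tangent space; but `G(·, xi)` is not zero, as `coeff` of `xi` is 1. -/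
lemma finrank_pushE_le (hp : IsTangentSubmersion p) (u : PC g) : Module.finrank ℝ (pushE p u) ≤ 2 := by
  have hu : u ∈ (extChartAt 𝓘(ℝ, E3 × ℝ) u).source := mem_extChartAt_source _
  have hq := mem_lineDom hu
  have hlt : pushE p u < ⊤ := by
    rw [lt_top_iff_ne_top]
    intro htop
    have hE : u.eSub = ⊤ := by
      rw [eq_top_iff]
      intro w _
      have : (mfd p u w : E3) ∈ pushE p u := by rw [htop]; trivial
      obtain ⟨e, he, hew⟩ := this
      have hew' : (mfd p u e : E3) = mfd p u w := hew
      have h0 : (mfd p u (w - e) : E3) = 0 := by rw [map_sub, hew', sub_self]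
      obtain ⟨r, hr⟩ := (hp.mfd_eq_zero_iff hu _).1 h0
      have h1 : w - e ∈ u.eSub := by
        rw [mem_eSub_iff hu, hr]
        show u.model.G _ (r • u.model.xi _) _ = 0
        rw [map_smul, smul_apply, FramedMetric.G_xi_xi hq, smul_zero]
      have := add_mem h1 (show e ∈ u.eSub from he)
      rwa [sub_add_cancel] at this
    have hall : ∀ w : E3, u.model.G (extChartAt 𝓘(ℝ, E3 × ℝ) u u).1 w
        (u.model.xi (extChartAt 𝓘(ℝ, E3 × ℝ) u u)) = 0 := by
      intro w
      have h1 : ((w, 0) : E3 × ℝ) ∈ u.eSub := by rw [hE]; trivial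
      rw [mem_eSub_iff hu, dChart, chartD_self] at h1
      exact h1
    have h1 := FramedMetric.coeff_xi hq
    unfold FramedMetric.coeff at h1
    rw [u.model.symm _ hq, u.model.symm _ hq _ (u.model.T _), hall, hall] at h1
    norm_num at h1
  have := Submodule.finrank_lt_finrank_of_lt hlt
  rw [finrank_top] at this
  simp only [finrank_euclideanSpace, Fintype.card_fin] at this
  omega

/-- Two skies that are transverse along a null geodesic span the image of `[D, D]`. -/
lemma sup_skyAt (hp : IsTangentSubmersion p) (h : p u = p v)
    (hd : Disjoint (skyAt p u) (skyAt p v)) : skyAt p u ⊔ skyAt p v = pushE p u := by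
  have hle : skyAt p u ⊔ skyAt p v ≤ pushE p u :=
    sup_le (skyAt_le_pushE p u) (by rw [hp.pushE_eq h]; exact skyAt_le_pushE p v)
  refine Submodule.eq_of_le_of_finrank_le hle ?_
  -- Two disjoint nonzero subspaces have a sum of dimension at least 2, which is the most that the
  -- image of [D, D] can have.
  have h1 := Submodule.finrank_sup_add_finrank_inf_eq (skyAt p u) (skyAt p v)
  rw [hd.eq_bot, finrank_bot, add_zero] at h1
  have h2 := Submodule.one_le_finrank_iff.2 (hp.skyAt_ne_bot u)
  have h3 := Submodule.one_le_finrank_iff.2 (hp.skyAt_ne_bot v)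
  have h4 := hp.finrank_pushE_le u
  omega

end IsTangentSubmersion

end Submersion

/-! ### Existence and uniqueness of the canonical contact structure. -/

section Contact

variable {M : Type*} [TopologicalSpace M] [ChartedSpace E3 M] [IsManifold 𝓘(ℝ, E3) ∞ M] [T2Space M]
  {g : LorentzMetric M} {o : TimeOrientation g} [ChartedSpace E3 (NullGeodesic o)]
  {p : PC g → NullGeodesic o} {A : NullGeodesic o} {u v : PC g} {γ : ℝ → M} {I : Set ℝ} {a b : ℝ}

-- Removes the transport along `p u = A` in `skyTangent`, so that tangent spaces of different skies
-- can be compared inside the model space.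
omit [T2Space M] in
lemma skyTangent_eq (h : p u = A) : (skyTangent p A u h : Submodule ℝ E3) = skyAt p u := by
  subst h
  rfl

open Classical in
/-- The distribution on the space of null geodesics spanned by the image of `[D, D]`. -/
def canonicalContact (p : PC g → NullGeodesic o) : TangentDistribution E3 (NullGeodesic o) :=
  fun A => if h : ∃ u, p u = A then pushE p h.choose else ⊥

variable [IsManifold 𝓘(ℝ, E3) ∞ (NullGeodesic o)]

-- Every null geodesic carries a nonconjugate pair, and the sum over that one pair already
-- determines the distribution there.
omit [T2Space M] [IsManifold 𝓘(ℝ, E3) ∞ (NullGeodesic o)] in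
lemma IsCanonicalContactStructure.eq
    {H H' : TangentDistribution E3 (NullGeodesic o)} (h : IsCanonicalContactStructure p H)
    (h' : IsCanonicalContactStructure p H') : H' = H := by
  funext A
  obtain ⟨γ, I, a, b, hγ, hA, ha, hb, hab⟩ := h.exists_nonconjugate A
  obtain ⟨_, _, -, e⟩ := h.eq_sum A γ I hγ a b ha hb hA hab
  obtain ⟨_, _, -, e'⟩ := h'.eq_sum A γ I hγ a b ha hb hA hab
  exact e'.trans e.symm

namespace IsTangentSubmersion

lemma canonicalContact_eq (hp : IsTangentSubmersion p) (h : p u = A) :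
    (canonicalContact p A : Submodule ℝ E3) = pushE p u := by
  have hex : ∃ u, p u = A := ⟨u, h⟩
  have e : (canonicalContact p A : Submodule ℝ E3) = pushE p hex.choose := dif_pos hex
  rw [e]
  -- The definition picks some null line over `A`; the image of [D, D] is the same for all of them.
  exact hp.pushE_eq (hex.choose_spec.trans h.symm)

lemma disjoint_skyAt (hp : IsTangentSubmersion p) (hγ : IsMaximalNullGeodesic o γ I) (ha : a ∈ I)
    (hb : b ∈ I) (hA : γ '' I = A.carrier) (h : ¬ Conjugate g γ I a b) :
    Disjoint (skyAt p (hγ.direction ha)) (skyAt p (hγ.direction hb)) := by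
  rw [Submodule.disjoint_def]
  intro ζ h1 h2
  by_contra h0
  rw [← hγ.lift_apply ha] at h1
  rw [← hγ.lift_apply hb] at h2
  exact h (hp.conjugate hγ.isLift_lift (hp.apply_lift hγ hA) ha h0 h1 h2)

lemma isCanonicalContactStructure (hp : IsTangentSubmersion p) :
    IsCanonicalContactStructure p (canonicalContact p) := by
  refine ⟨fun A => ?_, fun A γ I hγ a b ha hb hA hab => ?_⟩
  · obtain ⟨γ, I, hγ, hA⟩ := A.isNull
    obtain ⟨a, ha⟩ := hγ.isConnected.nonempty
    obtain ⟨b, hb, hab⟩ := hγ.toIsGeodesic.exists_not_conjugate ha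
    exact ⟨γ, I, a, b, hγ, hA, ha, hb, hab⟩
  · have hu := hp.apply_direction hγ ha hA
    have hv := hp.apply_direction hγ hb hA
    have hd := hp.disjoint_skyAt hγ ha hb hA hab
    have e1 := skyTangent_eq hu
    have e2 := skyTangent_eq hv
    refine ⟨hu, hv, ?_, ?_⟩
    · exact (congrArg₂ (fun S T : Submodule ℝ E3 => Disjoint S T) e1 e2).mpr hd
    · exact (hp.canonicalContact_eq hu).trans ((hp.sup_skyAt (hu.trans hv.symm) hd).symm.trans
        (congrArg₂ (fun S T : Submodule ℝ E3 => S ⊔ T) e1.symm e2.symm))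

end IsTangentSubmersion

end Contact

end LorentzEngel

end

theorem theorem4p6 {M : Type*} [TopologicalSpace M] [ChartedSpace E3 M]
    [IsManifold 𝓘(ℝ, E3) ∞ M] [T2Space M] [ConnectedSpace M]
    (g : LorentzMetric M) (o : TimeOrientation g) :
    (∀ (γ : ℝ → M) (I : Set ℝ) (hγ : IsNullGeodesic o γ I) (c : ℝ → PC g),
      (∀ (t : ℝ) (ht : t ∈ I), c t = hγ.direction ht) →
      ∀ t ∈ I, MDifferentiableAt 𝓘(ℝ, ℝ) 𝓘(ℝ, E3 × ℝ) c t ∧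
        engelKernel (prolongation g) (c t) =
          Submodule.span ℝ {mfderiv 𝓘(ℝ, ℝ) 𝓘(ℝ, E3 × ℝ) c t (1 : ℝ)}) ∧
    ∃ Φ : LeafSpace (engelKernel (prolongation g)) ≃ₜ NullGeodesic o,
      (∀ (u : PC g) (A : NullGeodesic o), Φ (Quot.mk _ u) = A ↔
        ∃ (γ : ℝ → M) (I : Set ℝ) (hγ : IsMaximalNullGeodesic o γ I) (t : ℝ) (ht : t ∈ I),
          hγ.direction ht = u ∧ γ '' I = A.carrier) ∧
      ∀ [ChartedSpace E3 (NullGeodesic o)] [IsManifold 𝓘(ℝ, E3) ∞ (NullGeodesic o)]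
        (p : PC g → NullGeodesic o), (∀ u, p u = Φ (Quot.mk _ u)) → IsSmoothSubmersion p →
        ∃ H : TangentDistribution E3 (NullGeodesic o),
          IsCanonicalContactStructure p H ∧
          (∀ H' : TangentDistribution E3 (NullGeodesic o), IsCanonicalContactStructure p H' → H' = H) ∧
          ∀ u : PC g, H (p u) = (bracket (prolongation g) u).map
            (mfderiv 𝓘(ℝ, E3 × ℝ) 𝓘(ℝ, E3) p u).toLinearMap := by
  refine ⟨fun γ I hγ c hc t ht => ?_, leafHomeomorph o, tangentGeodesic_eq_iff, ?_⟩
  · have hL : IsLift hγ c := hc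
    exact ⟨(hL.contMDiffAt ht).mdifferentiableAt (by simp), hL.wSub_eq_span ht⟩
  · intro _ _ p hp hs
    have h : IsTangentSubmersion p := ⟨hp, hs⟩
    exact ⟨canonicalContact p, h.isCanonicalContactStructure,
      fun H' h' => h.isCanonicalContactStructure.eq h', fun u => h.canonicalContact_eq rfl⟩
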